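/- Let $p$ be a prime and $\mathbb F$ an algebraically closed field of characteristic $p$. All groups are finite. **Notation.** $\mathrm{IBr}(H)$ is the set of isomorphism classes of simple $\mathbb FH$-modules. For $H\le K$ and $\zeta\in\mathrm{IBr}(H)$, $\mathrm{IBr}(K\mid\zeta)$ is the set of classes of simple $\mathbb FK$-modules whose restriction to $H$ has a submodule in the class $\zeta$. For a $p$-subgroup $Q\le H$, $\mathrm{IBr}_Q(N_H(Q))$ is the set of classes of simple $\mathbb FN_H(Q)$-modules that are projective as $\mathbb F(N_H(Q)/Q)$-modules. $\mathrm{Alp}(H)$ is the set of $H$-conjugacy classes of pairs $(Q,\psi)$, where $Q\le H$ is a $p$-subgroup and $\psi\in\mathrm{IBr}_Q(N_H(Q))$. For $\nu\in\mathrm{IBr}(Z(H))$, $\mathrm{Alp}(H\mid\nu)$ is the set of classes of those $(Q,\psi)$ with $\psi\in\mathrm{IBr}(N_H(Q)\mid\nu)$. $\mathrm{Aut}(H)$ acts on $\mathrm{IBr}(H)$, on $\mathrm{Alp}(H)$ and on the pairs $(Y,\psi)$ with $Y\le H$, $\psi\in\mathrm{IBr}(Y)$, by transport of structure. A normalized projective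 representation of a group $A$ is a map $\mathcal P\colon A\to\mathrm{GL}_d(\mathbb F)$ with $\mathcal P(1)=1$ and $\mathcal P(a)\mathcal P(b)=\alpha(a,b)\mathcal P(ab)$ for some $\alpha\colon A\times A\to\mathbb F^\times$, its cocycle. **Cohomological condition.** Let $Z=Z(H)\le Y\le H$, $\chi\in\mathrm{IBr}(H)$, $\psi\in\mathrm{IBr}(Y)$. The pair $(\chi,\psi)$ satisfies the cohomological condition if there are normalized projective representations $\mathcal P$ of $\mathrm{Aut}(H)_\chi$ and $\mathcal Q$ of $\mathrm{Aut}(H)_{Y,\psi}$ such that, identifying $H/Z$ with the group of inner automorphisms of $H$: the restriction of $\mathcal P$ to $H/Z$ is $\mathcal L\circ s$, where $\mathcal L$ is a linear representation of $H$ affording $\chi$ and $s\colon H/Z\to H$ is a section of the quotient map with $s(1)=1$; the restriction of $\mathcal Q$ to $Y/Z$ is $\mathcal M\circ t$, where $\mathcal M$ is a linear representation of $Y$ affording $\psi$ and $t\colon Y/Z\to Y$ is the restriction of $s$; and $\mathcal P$, $\mathcal Q$ have the same cocycle on $\mathrm{Aut}(H)_{Y,\psi,\chi}$. **Conditions (iAw)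 and ($\widehat{\mathrm{iAw}}$).** $H$ satisfies (iAw) if there is an $\mathrm{Aut}(H)$-equivariant bijection $\Omega\colon\mathrm{IBr}(H)\to\mathrm{Alp}(H)$ such that $\Omega(\mathrm{IBr}(H\mid\nu))=\mathrm{Alp}(H\mid\nu)$ for all $\nu\in\mathrm{IBr}(Z(H))$ and such that, for all $\chi\in\mathrm{IBr}(H)$ and $(Q,\psi)\in\Omega(\chi)$, the pair $(\chi,\psi)\in\mathrm{IBr}(H)\times\mathrm{IBr}(N_H(Q))$ satisfies the cohomological condition. A universal covering of a perfect group $S$ is a surjective homomorphism $\widehat S\to S$ with $\widehat S$ perfect and with central kernel isomorphic to the Schur multiplier $\mathrm H^2(S,\mathbb C^\times)$; for $S$ of prime order put $\widehat S=S$. A group $S$ that is perfect or abelian simple satisfies ($\widehat{\mathrm{iAw}}$) if $\widehat S$ satisfies (iAw). **Theorem.** Let $G$ be a finite group and $X\unlhd G$ with $[G,Z(X)]=1$. Assume that $X/Z(X)\cong S^n$ with $n\ge 1$ and $S$ a finite simple group (possibly abelian) satisfying ($\widehat{\mathrm{iAw}}$). Then there is a bijection $$\Omega\colon\mathrm{IBr}(X)\to\mathrm{Alp}(X)$$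 that is equivariant for the conjugation action of $G$, satisfies $\Omega(\mathrm{IBr}(X\mid\nu))=\mathrm{Alp}(X\mid\nu)$ for every $\nu\in\mathrm{IBr}(Z(X))$, and is such that for all $\chi\in\mathrm{IBr}(X)$ and all $(Q,\psi)\in\Omega(\chi)$ $$|\mathrm{IBr}(G\mid\chi)|=|\mathrm{IBr}(N_G(Q)\mid\psi)|.$$ -/

import Mathlib

open scoped MonoidAlgebra

namespace AWC

universe u v w

/-! ### Isomorphism classes of irreducible representations -/

section Irreducible

variable {F : Type u} [Field F]

variable (F) in
/-- An irreducible linear representation of `H` on some space `F ^ dim`. -/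
structure IrrRep (H : Type v) [Group H] where
  dim : ℕ
  rep : Representation F H (Fin dim → F)
  irreducible : rep.IsIrreducible

variable (F) in
/-- Isomorphism of irreducible representations. -/
instance IrrRep.setoid (H : Type v) [Group H] : Setoid (IrrRep F H) where
  r ρ σ := Nonempty (ρ.rep.Equiv σ.rep)
  iseqv :=
    { refl := fun ρ => ⟨.refl ρ.rep⟩
      symm := fun ⟨e⟩ => ⟨e.symm⟩
      trans := fun ⟨e⟩ ⟨f⟩ => ⟨e.trans f⟩ }

variable (F) in
/-- `IBr(H)`: the isomorphism classes of irreducible representations of the (finite) group `H`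
over `F`, i.e. of simple `F[H]`-modules. A simple module of a finite group is
finite-dimensional, so each one is isomorphic to a representation on some `F ^ n`. -/
def IBr (H : Type v) [Group H] : Type (max u v) := Quotient (IrrRep.setoid F H)

variable {H : Type v} [Group H] {K : Type v} [Group K] {L : Type v} [Group L]

/-- The class in `IBr(H)` afforded by an irreducible representation. -/
def IrrRep.cls (ρ : IrrRep F H) : IBr F H := Quotient.mk (IrrRep.setoid F H) ρ

theorem isIrreducible_comp {H : Type v} [Group H] {K : Type w} [Group K] {n : ℕ}
    (f : K →* H) (hf : Function.Surjective f) (ρ : Representation F H (Fin n → F))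
    (hρ : ρ.IsIrreducible) :
    Representation.IsIrreducible (MonoidHom.comp ρ f : Representation F K (Fin n → F)) := by
  let e : Subrepresentation ρ ≃o
      Subrepresentation (MonoidHom.comp ρ f : Representation F K (Fin n → F)) :=
    { toFun := fun W => ⟨W.toSubmodule, fun g v hv => W.apply_mem_toSubmodule (f g) hv⟩
      invFun := fun W => ⟨W.toSubmodule, fun g v hv => by
        obtain ⟨k, rfl⟩ := hf g
        exact W.apply_mem_toSubmodule k hv⟩
      left_inv := fun W => rfl
      right_inv := fun W => rfl
      map_rel_iff' := Iff.rfl }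
  exact (OrderIso.isSimpleOrder_iff e).mp hρ

/-- Transport of a representation along `τ : H ≃* K`: the representation `ρ ∘ τ⁻¹` of `K`. -/
def IrrRep.map (τ : H ≃* K) (ρ : IrrRep F H) : IrrRep F K where
  dim := ρ.dim
  rep := MonoidHom.comp ρ.rep τ.symm.toMonoidHom
  irreducible := isIrreducible_comp _ τ.symm.surjective _ ρ.irreducible

/-- Transport of classes along `τ : H ≃* K`: the class of `ρ` goes to that of `ρ ∘ τ⁻¹`. -/
def IBr.map (τ : H ≃* K) : IBr F H → IBr F K :=
  Quotient.map (IrrRep.map τ) (fun _ _ ⟨e⟩ =>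
    ⟨.mk e.toLinearEquiv (fun k => e.isIntertwining' (τ.symm k))⟩)

theorem IBr.map_refl (χ : IBr F H) : IBr.map (MulEquiv.refl H) χ = χ := by
  induction χ using Quotient.inductionOn
  rfl

theorem IBr.map_map (τ : H ≃* K) (σ : K ≃* L) (χ : IBr F H) :
    IBr.map σ (IBr.map τ χ) = IBr.map (τ.trans σ) χ := by
  induction χ using Quotient.inductionOn
  rfl

/-- The action of `Aut(H)` on `IBr(H)`, given by `τ • [ρ] = [ρ ∘ τ⁻¹]`. -/
instance IBr.mulAction : MulAction (MulAut H) (IBr F H) where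
  smul τ χ := IBr.map τ χ
  one_smul χ := IBr.map_refl χ
  mul_smul τ σ χ := (IBr.map_map σ τ χ).symm

/-- For a homomorphism `f : H →* K` (in practice an inclusion of a subgroup) and `ζ ∈ IBr(H)`:
the set `IBr(K | ζ)` of the classes of those irreducible representations of `K` whose restriction
to `H` has a subrepresentation in the class `ζ`. -/
def IBr.over (f : H →* K) (ζ : IBr F H) : Set (IBr F K) :=
  {φ | ∃ (ρ : IrrRep F K) (σ : IrrRep F H), ρ.cls = φ ∧ σ.cls = ζ ∧
    ∃ i : Representation.IntertwiningMap σ.rep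
        (MonoidHom.comp ρ.rep f : Representation F H (Fin ρ.dim → F)),
      Function.Injective i}

end Irreducible

/-! ### Pairs of a subgroup and an irreducible representation of it -/

section Pairs

variable (F : Type u) [Field F] (G : Type v) [Group G]

/-- Pairs `(Y, ψ)` with `Y` a subgroup of `G` and `ψ ∈ IBr(Y)`. -/
structure SubPair where
  Y : Subgroup G
  ψ : IBr F Y

variable {F G}

theorem SubPair.ext_map {a b : SubPair F G} (h : a.Y = b.Y)
    (h' : IBr.map (MulEquiv.subgroupCongr h) a.ψ = b.ψ) : a = b := by
  obtain ⟨Y, ψ⟩ := a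
  obtain ⟨Y', ψ'⟩ := b
  obtain rfl : Y = Y' := h
  have : ψ = ψ' := (IBr.map_refl ψ).symm.trans h'
  rw [this]

/-- The action of `Aut(G)` on pairs, `τ • (Y, [ρ]) = (τ(Y), [ρ ∘ τ⁻¹])`. -/
instance SubPair.mulAction : MulAction (MulAut G) (SubPair F G) where
  smul τ a := ⟨a.Y.map τ.toMonoidHom, IBr.map (MulEquiv.subgroupMap τ a.Y) a.ψ⟩
  one_smul a := by
    refine SubPair.ext_map (Subgroup.map_id a.Y) ?_
    refine (IBr.map_map _ _ a.ψ).trans ?_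
    exact IBr.map_refl a.ψ
  mul_smul τ σ a := by
    refine SubPair.ext_map (Subgroup.map_map a.Y τ.toMonoidHom σ.toMonoidHom).symm ?_
    refine (IBr.map_map _ _ a.ψ).trans ?_
    refine Eq.trans ?_ (IBr.map_map _ _ a.ψ).symm
    rfl

end Pairs

/-! ### Weights -/

section Weights

variable {F : Type u} [Field F] {G : Type v} [Group G]

/-- The subset `IBr_Q(N_G(Q))` of `IBr(N_G(Q))`: the classes inflated from those irreducible
representations `σ` of `N_G(Q)/Q` that are projective as `F[N_G(Q)/Q]`-modules. -/
def IsWeightChar (Q : Subgroup G) (ψ : IBr F (Subgroup.normalizer (Q : Set G))) : Prop :=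
  ∃ (n : ℕ)
    (σ : Representation F
      (Subgroup.normalizer (Q : Set G) ⧸ Q.subgroupOf (Subgroup.normalizer (Q : Set G)))
      (Fin n → F))
    (hσ : σ.IsIrreducible),
    Module.Projective
      F[Subgroup.normalizer (Q : Set G) ⧸ Q.subgroupOf (Subgroup.normalizer (Q : Set G))]
      σ.asModule ∧
    ψ = IrrRep.cls
      { dim := n
        rep := MonoidHom.comp σ (QuotientGroup.mk' _)
        irreducible := isIrreducible_comp _ (QuotientGroup.mk'_surjective _) σ hσ }

/-- The isomorphism `N_G(Q) ≃* N_G(τ(Q))` induced by an automorphism `τ` of `G`. -/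
def normalizerMap (τ : MulAut G) (Q : Subgroup G) :
    Subgroup.normalizer (Q : Set G) ≃*
      Subgroup.normalizer ((Q.map τ.toMonoidHom : Subgroup G) : Set G) :=
  (MulEquiv.subgroupMap τ (Subgroup.normalizer (Q : Set G))).trans
    (MulEquiv.subgroupCongr (Subgroup.map_equiv_normalizer_eq Q τ))

theorem projective_transport {A : Type v} [Group A] {B : Type v} [Group B] (e : A ≃* B) {n : ℕ}
    (σ : Representation F A (Fin n → F)) (h : Module.Projective F[A] σ.asModule) :
    Module.Projective F[B]
      (Representation.asModule
        (MonoidHom.comp σ e.symm.toMonoidHom : Representation F B (Fin n → F))) := by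
  let σ' : Representation F B (Fin n → F) := MonoidHom.comp σ e.symm.toMonoidHom
  change Module.Projective F[B] σ'.asModule
  let E : F[A] ≃ₐ[F] F[B] := MonoidAlgebra.domCongr F F e
  have hE : (σ'.asAlgebraHom.comp E.toAlgHom) = σ.asAlgebraHom := by
    refine MonoidAlgebra.algHom_ext (fun a => ?_) (Subsingleton.elim _ _)
    change σ'.asAlgebraHom (E (MonoidAlgebra.single a 1)) = _
    rw [MonoidAlgebra.domCongr_single, Representation.asAlgebraHom_single,
      Representation.asAlgebraHom_single]
    change (1 : F) • σ (e.symm (e a)) = _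
    rw [e.symm_apply_apply]
  let _ : RingHomInvPair (E.toRingEquiv : F[A] →+* F[B]) (E.toRingEquiv.symm : F[B] →+* F[A]) :=
    RingHomInvPair.of_ringEquiv E.toRingEquiv
  let _ : RingHomInvPair (E.toRingEquiv.symm : F[B] →+* F[A]) (E.toRingEquiv : F[A] →+* F[B]) :=
    RingHomInvPair.of_ringEquiv E.toRingEquiv.symm
  let φ : σ.asModule ≃ₛₗ[(E.toRingEquiv : F[A] →+* F[B])] σ'.asModule :=
    { toFun := fun x => x
      invFun := fun x => x
      map_add' := fun _ _ => rfl
      map_smul' := fun r x => (congrArg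
        (fun f : F[A] →ₐ[F] Module.End F (Fin n → F) => f r x) hE).symm
      left_inv := fun _ => rfl
      right_inv := fun _ => rfl }
  exact Module.Projective.of_equiv φ

theorem IsWeightChar.map (τ : MulAut G) {Q : Subgroup G}
    {ψ : IBr F (Subgroup.normalizer (Q : Set G))} (h : IsWeightChar Q ψ) :
    IsWeightChar (Q.map τ.toMonoidHom) (IBr.map (normalizerMap τ Q) ψ) := by
  obtain ⟨n, σ, hσ, hproj, rfl⟩ := h
  have hmap : (Q.subgroupOf (Subgroup.normalizer (Q : Set G))).map
      (normalizerMap τ Q).toMonoidHom = (Q.map τ.toMonoidHom).subgroupOf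
        (Subgroup.normalizer ((Q.map τ.toMonoidHom : Subgroup G) : Set G)) := by
    ext x
    constructor
    · rintro ⟨y, hy, rfl⟩
      exact ⟨y, hy, rfl⟩
    · rintro ⟨y, hy, hyx⟩
      refine ⟨⟨y, Subgroup.le_normalizer hy⟩, hy, Subtype.ext hyx⟩
  let e := QuotientGroup.congr _ _ (normalizerMap τ Q) hmap
  exact ⟨n, MonoidHom.comp σ e.symm.toMonoidHom,
    isIrreducible_comp _ e.symm.surjective σ hσ, projective_transport e σ hproj, rfl⟩

variable (p : ℕ)

variable (F G) in
/-- Pairs `(Q, ψ)` with `Q` a `p`-subgroup of `G` and `ψ ∈ IBr_Q(N_G(Q))`. -/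
structure Weight where
  Q : Subgroup G
  isPGroup : IsPGroup p Q
  ψ : IBr F (Subgroup.normalizer (Q : Set G))
  isWeightChar : IsWeightChar Q ψ

variable {p}

theorem Weight.ext_map {a b : Weight F G p} (h : a.Q = b.Q)
    (h' : IBr.map (MulEquiv.subgroupCongr
      (congrArg (fun R : Subgroup G => Subgroup.normalizer (R : Set G)) h)) a.ψ = b.ψ) :
    a = b := by
  obtain ⟨Q, hQ, ψ, hψ⟩ := a
  obtain ⟨Q', hQ', ψ', hψ'⟩ := b
  obtain rfl : Q = Q' := h
  have : ψ = ψ' := (IBr.map_refl ψ).symm.trans h'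
  subst this
  rfl

/-- The action of `Aut(G)` on pairs `(Q, ψ)`, `τ • (Q, [ρ]) = (τ(Q), [ρ ∘ τ⁻¹])`. -/
instance Weight.mulAction : MulAction (MulAut G) (Weight F G p) where
  smul τ a := ⟨a.Q.map τ.toMonoidHom, a.isPGroup.map τ.toMonoidHom,
    IBr.map (normalizerMap τ a.Q) a.ψ, a.isWeightChar.map τ⟩
  one_smul a := by
    refine Weight.ext_map (Subgroup.map_id a.Q) ?_
    refine (IBr.map_map _ _ a.ψ).trans ?_
    exact IBr.map_refl a.ψ
  mul_smul τ σ a := by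
    refine Weight.ext_map (Subgroup.map_map a.Q τ.toMonoidHom σ.toMonoidHom).symm ?_
    refine (IBr.map_map _ _ a.ψ).trans ?_
    refine Eq.trans ?_ (IBr.map_map _ _ a.ψ).symm
    rfl

variable (p)

variable (F G) in
/-- `G`-conjugacy of pairs `(Q, ψ)`. -/
instance Weight.conjSetoid : Setoid (Weight F G p) where
  r a b := ∃ g : G, MulAut.conj g • a = b
  iseqv :=
    { refl := fun a => ⟨1, by rw [map_one, one_smul]⟩
      symm := fun {a b} ⟨g, h⟩ => ⟨g⁻¹, by rw [← h, map_inv, inv_smul_smul]⟩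
      trans := fun {a b c} ⟨g, h⟩ ⟨k, h'⟩ => ⟨k * g, by rw [map_mul, mul_smul, h, h']⟩ }

variable (F G) in
/-- `Alp(G)`: the `G`-conjugacy classes of pairs `(Q, ψ)`. -/
def Alp : Type (max u v) := Quotient (Weight.conjSetoid F G p)

variable {p}

/-- The conjugacy class of a pair `(Q, ψ)`. -/
def Weight.cls (a : Weight F G p) : Alp F G p := Quotient.mk (Weight.conjSetoid F G p) a

/-- The action of `Aut(G)` on `Alp(G)`. -/
instance Alp.mulAction : MulAction (MulAut G) (Alp F G p) where
  smul τ := Quotient.map (fun a : Weight F G p => τ • a) (fun a b ⟨g, h⟩ => ⟨τ g, by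
    have key : MulAut.conj (τ g) * τ = τ * MulAut.conj g := by ext x; simp
    rw [← h, ← mul_smul, key, mul_smul]⟩)
  one_smul a := by
    induction a using Quotient.inductionOn with
    | h a => exact congrArg Weight.cls (one_smul _ a)
  mul_smul τ σ a := by
    induction a using Quotient.inductionOn with
    | h a => exact congrArg Weight.cls (mul_smul τ σ a)

/-- `Alp(G | ν)` for `ν ∈ IBr(Z(G))`: the classes of the pairs `(Q, ψ)` with
`ψ ∈ IBr(N_G(Q) | ν)`. -/
def Alp.over (ν : IBr F (Subgroup.center G)) : Set (Alp F G p) :=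
  {α | ∃ a : Weight F G p, a.cls = α ∧
    a.ψ ∈ IBr.over (Subgroup.inclusion (Subgroup.center_le_normalizer (a.Q : Set G))) ν}

end Weights

/-! ### Projective representations and the cohomological condition -/

section Cohomological

variable (F : Type u) [Field F]

/-- A normalized projective representation of `A` on `V`, with its cocycle (the cocycle identity
is a consequence of associativity). -/
structure ProjRep (A : Type v) [Group A] (V : Type w) [AddCommGroup V] [Module F V] where
  toFun : A → LinearMap.GeneralLinearGroup F V
  cocycle : A → A → Fˣ
  map_one : toFun 1 = 1
  map_mul : ∀ a b : A, ((toFun a * toFun b : LinearMap.GeneralLinearGroup F V) : V →ₗ[F] V) =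
    (cocycle a b : F) • (toFun (a * b) : V →ₗ[F] V)

/-- A normalized section of the quotient map `X → X / Z(X)`. -/
structure CentralSection (X : Type v) [Group X] where
  toFun : X ⧸ Subgroup.center X → X
  map_one : toFun 1 = 1
  mk_toFun : ∀ a, (toFun a : X ⧸ Subgroup.center X) = a

theorem CentralSection.toFun_mem {X : Type v} [Group X] (s : CentralSection X) {Y : Subgroup X}
    (hY : Subgroup.center X ≤ Y) (y : Y) : s.toFun ((y : X) : X ⧸ Subgroup.center X) ∈ Y := by
  have h := QuotientGroup.eq.mp (s.mk_toFun ((y : X) : X ⧸ Subgroup.center X)).symm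
  have h' := Y.mul_mem y.2 (hY h)
  rwa [mul_inv_cancel_left] at h'

variable {F} {X : Type v} [Group X]

/-- The cohomological condition on a pair `(χ, ψ) ∈ IBr(X) × IBr(Y)`, for `Z(X) ≤ Y ≤ X`.
There are projective representations `P` of `Aut(X)_χ` and `P'` of `Aut(X)_{Y,ψ}` such that,
when `X / Z(X)` is identified with the group of inner automorphisms of `X`,
* `P` restricts to `ρ ∘ s` on `X / Z(X)`, with `ρ` affording `χ` and `s` a normalized section;
* `P'` restricts to `ρ' ∘ t` on `Y / Z(X)`, with `ρ'` affording `ψ` and `t` the restriction of `s`;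
* `P` and `P'` have the same cocycle on `Aut(X)_{Y,ψ,χ}`. -/
def CohomologicalCondition (Y : Subgroup X) (hY : Subgroup.center X ≤ Y)
    (χ : IBr F X) (ψ : IBr F Y) : Prop :=
  ∃ (s : CentralSection X) (ρ : IrrRep F X) (ρ' : IrrRep F Y)
    (P : ProjRep F (MulAction.stabilizer (MulAut X) χ) (Fin ρ.dim → F))
    (P' : ProjRep F (MulAction.stabilizer (MulAut X) (⟨Y, ψ⟩ : SubPair F X)) (Fin ρ'.dim → F)),
    ρ.cls = χ ∧ ρ'.cls = ψ ∧
    (∀ (a : MulAction.stabilizer (MulAut X) χ) (x : X), (a : MulAut X) = MulAut.conj x →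
      (P.toFun a : (Fin ρ.dim → F) →ₗ[F] (Fin ρ.dim → F)) =
        ρ.rep (s.toFun (x : X ⧸ Subgroup.center X))) ∧
    (∀ (a : MulAction.stabilizer (MulAut X) (⟨Y, ψ⟩ : SubPair F X)) (y : Y),
      (a : MulAut X) = MulAut.conj (y : X) →
      (P'.toFun a : (Fin ρ'.dim → F) →ₗ[F] (Fin ρ'.dim → F)) =
        ρ'.rep ⟨s.toFun ((y : X) : X ⧸ Subgroup.center X), s.toFun_mem hY y⟩) ∧
    (∀ (a b : MulAut X)
      (ha : a ∈ MulAction.stabilizer (MulAut X) χ)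
      (hb : b ∈ MulAction.stabilizer (MulAut X) χ)
      (ha' : a ∈ MulAction.stabilizer (MulAut X) (⟨Y, ψ⟩ : SubPair F X))
      (hb' : b ∈ MulAction.stabilizer (MulAut X) (⟨Y, ψ⟩ : SubPair F X)),
      P.cocycle ⟨a, ha⟩ ⟨b, hb⟩ = P'.cocycle ⟨a, ha'⟩ ⟨b, hb'⟩)

end Cohomological

/-! ### Schur multipliers and universal coverings -/

section Schur

/-- The group `Z²(G, A)` of 2-cocycles of `G` with values in `A`, with trivial action. -/
def twoCocycles (G : Type v) [Group G] (A : Type w) [CommGroup A] : Subgroup (G → G → A) where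
  carrier := {α | ∀ g h k : G, α g h * α (g * h) k = α h k * α g (h * k)}
  one_mem' := fun g h k => rfl
  mul_mem' := fun {α β} hα hβ g h k => by
    have := congrArg₂ (· * ·) (hα g h k) (hβ g h k)
    simpa only [Pi.mul_apply, mul_mul_mul_comm] using this
  inv_mem' := fun {α} hα g h k => by
    have := congrArg (·⁻¹) (hα g h k)
    simpa only [Pi.inv_apply, mul_inv] using this

/-- The homomorphism `∂ : A ^ G → Z²(G, A)`, `(∂f)(g, h) = f(g) f(h) f(gh)⁻¹`. -/
def coboundary (G : Type v) [Group G] (A : Type w) [CommGroup A] : (G → A) →* twoCocycles G A where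
  toFun f := ⟨fun g h => f g * f h * (f (g * h))⁻¹, fun g h k => by
    have h₁ : f g * f h * (f (g * h))⁻¹ * (f (g * h) * f k * (f (g * h * k))⁻¹) =
        f g * f h * f k * (f (g * h * k))⁻¹ := by
      simp only [mul_assoc, inv_mul_cancel_left]
    have h₂ : f h * f k * (f (h * k))⁻¹ * (f g * f (h * k) * (f (g * (h * k)))⁻¹) =
        f g * f h * f k * (f (g * (h * k)))⁻¹ := by
      rw [mul_comm (f g) (f (h * k)), mul_comm (f g * f h) (f k), mul_comm (f g) (f h)]
      simp only [mul_assoc, inv_mul_cancel_left, mul_left_comm (f k)]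
    exact h₁.trans ((by rw [mul_assoc g h k]) : _ = _) |>.trans h₂.symm⟩
  map_one' := by
    ext g h
    simp
  map_mul' f f' := by
    ext g h
    simp only [Pi.mul_apply, mul_inv, Subgroup.coe_mul]
    rw [mul_mul_mul_comm (f g), mul_mul_mul_comm (f g * f h)]

/-- The Schur multiplier `H²(G, ℂˣ) = Z²(G, ℂˣ) / ∂((ℂˣ) ^ G)`. -/
abbrev SchurMultiplier (G : Type v) [Group G] : Type v :=
  twoCocycles G ℂˣ ⧸ (coboundary G ℂˣ).range

/-- `π : E →* S` is a universal covering of the perfect group `S`: it is surjective, `E` is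
perfect, and the kernel of `π` is central and isomorphic to the Schur multiplier of `S`. -/
structure IsUniversalCovering {E : Type v} [Group E] {S : Type w} [Group S] (π : E →* S) :
    Prop where
  surjective : Function.Surjective π
  perfect : Group.IsPerfect E
  ker_le_center : π.ker ≤ Subgroup.center E
  ker_equiv : Nonempty (π.ker ≃* SchurMultiplier S)

end Schur

/-! ### The inductive condition -/

section Inductive

variable (F : Type u) [Field F] (p : ℕ)

/-- The condition (iAw) for a finite group `X`. -/
def SatisfiesIAw (X : Type v) [Group X] : Prop :=
  ∃ Ω : IBr F X ≃ Alp F X p,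
    (∀ (τ : MulAut X) (χ : IBr F X), Ω (τ • χ) = τ • Ω χ) ∧
    (∀ ν : IBr F (Subgroup.center X),
      Ω '' IBr.over (Subgroup.center X).subtype ν = Alp.over ν) ∧
    ∀ (χ : IBr F X) (a : Weight F X p), a.cls = Ω χ →
      CohomologicalCondition (Subgroup.normalizer (a.Q : Set X))
        (Subgroup.center_le_normalizer _) χ a.ψ

/-- The condition that the universal covering of the finite group `S` satisfies (iAw), for `S`
perfect or abelian simple. A cyclic group of prime order has trivial Schur multiplier and is its
own universal covering. -/
def SatisfiesIAwHat (S : Type v) [Group S] : Prop :=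
  (IsSimpleGroup S ∧ IsMulCommutative S ∧ SatisfiesIAw F p S) ∨
  (Group.IsPerfect S ∧ ∃ (E : Type v) (_ : Group E) (_ : Finite E) (π : E →* S),
    IsUniversalCovering π ∧ SatisfiesIAw F p E)

end Inductive

/-- For `X ≤ G` and `Q ≤ X`, the inclusion of `N_X(Q)` into `N_G(Q)`. -/
def normalizerInclusion {G : Type v} [Group G] (X : Subgroup G) (Q : Subgroup X) :
    Subgroup.normalizer (Q : Set X) →*
      Subgroup.normalizer ((Q.map X.subtype : Subgroup G) : Set G) :=
  (X.subtype.comp (Subgroup.normalizer (Q : Set X)).subtype).codRestrict _ (fun y =>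
    Subgroup.le_normalizer_map X.subtype (Subgroup.mem_map_of_mem X.subtype y.2))

end AWC

/-!
# Reduction of counting modular representations above a central power of a simple group

The proof distinguishes whether the simple group `S` is abelian.

If `S` is abelian, then `X` is nilpotent of class at most two. Commutators of `p`-elements of `X`
are then central `p`-elements, which lie in the first component `Q` of every weight; so the
subgroup of all `p`-elements normalizes `Q`, and being a normal `p`-subgroup of `N_X(Q)` it is
contained in `Q` (`exists_weight_eq`). Hence the weights are the pairs `(O_p(X), ψ)` with `ψ ∈
IBr(X)` arbitrary, and `χ ↦ (O_p(X), χ)` is the bijection. Since `O_p(X)` is normal in `G`, the two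
sets to be counted are the same.

If `S` is perfect, let `E` be its universal covering. Perfect central extensions of `S` have a
kernel of size at most that of the Schur multiplier (`card_ker_le_card_schurMultiplier`), so that
every homomorphism from `E` lifts along central extensions. It follows that `X` is a central
product of `Z(X)` and of `n` images of `E`, and that the automorphisms of `X` permute these images
and lift to `E` (`nonempty_cover`).

*The bijection.* An irreducible representation of a central product is determined by the action of
the central subgroup and by its irreducible constituents on the factors, of which it is the tensor
product, by Burnside's theorem. Weights decompose in the same way (`exists_wType`): the first
component `Q` of a weight of `X` contains all normal `p`-subgroups of its normalizer, hence it is a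
product of subgroups `R i` of the factors, and its normalizer is the central product of the
normalizers of the `R i`. By Higman's criterion (`projective_iff_exists_sum_eq_one`) an irreducible
representation of `N_X(Q)` defines a weight if and only if `Q` contains all `p`-elements that act
by scalars and the identity is a trace over the projective image (`isWeightChar_iff`). Both
conditions are compatible with tensor products. So the bijection `Ω` given for `E`, applied to each
factor, induces a bijection for `X` that is equivariant for `Aut(X)` (`exists_equiv_corr`).

*The counting.* Let `χ` correspond to `(Q, ψ)`. For the cohomological condition over `E`, the
scalars by which the projective representations fail to intertwine define homomorphisms from the
perfect group `E` and so are trivial. Thus every automorphism of `E` between two weights comes with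
intertwining maps `g`, `g'` for the global and for the local representations, such that the pairs
`(g, g')` are closed under composition and multiply the two representations by the same scalar over
inner automorphisms (`nonempty_matching`). Kronecker products of these maps, twisted by the
permutation of the factors, lift the stabilizer of the weight in `G` to a group `D` that acts
linearly on both tensor products, with the same scalars over `N_X(Q)` (`liftGroup`, `Lift.inner`).
The hypothesis `[G, Z(X)] = 1` ensures that these lifts intertwine also the action of `Z(X)`.
Finally, the Clifford correspondence (`CliffordDatum.encard_over`) identifies `IBr(G | χ)` and
`IBr(N_G(Q) | ψ)` with one and the same set of irreducible representations of `D`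
(`encard_over_eq`). It is used in the form `M ↦ Hom_X(V, M)`, which avoids choosing a cocycle.
-/

namespace AWC

universe u v w

/-! ### Irreducible representations and the group algebra -/

section Basic

variable {F : Type*} [Field F] {G : Type*} [Group G]
variable {V : Type*} [AddCommGroup V] [Module F V] {W : Type*} [AddCommGroup W] [Module F W]
variable {ρ : Representation F G V} {σ : Representation F G W}

theorem isIrreducible_iff :
    ρ.IsIrreducible ↔ Nontrivial V ∧
      ∀ U : Submodule F V, (∀ g, ∀ v ∈ U, ρ g v ∈ U) → U = ⊥ ∨ U = ⊤ := by
  constructor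
  · intro h
    refine ⟨?_, fun U hU => ?_⟩
    · by_contra hV
      rw [not_nontrivial_iff_subsingleton] at hV
      obtain ⟨a, b, hab⟩ := h.toNontrivial
      exact hab (Subrepresentation.toSubmodule_injective (Subsingleton.elim _ _))
    · rcases h.eq_bot_or_eq_top (⟨U, fun g v hv => hU g v hv⟩ : Subrepresentation ρ) with h' | h'
      · exact Or.inl (congrArg Subrepresentation.toSubmodule h')
      · exact Or.inr (congrArg Subrepresentation.toSubmodule h')
  · rintro ⟨hV, h⟩
    refine { exists_pair_ne := ⟨⊥, ⊤, fun hbt => ?_⟩, eq_bot_or_eq_top := fun U => ?_ }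
    · exact bot_ne_top (α := Submodule F V) (congrArg Subrepresentation.toSubmodule hbt)
    · rcases h U.toSubmodule (fun g v hv => U.apply_mem_toSubmodule g hv) with h' | h'
      · exact Or.inl (Subrepresentation.toSubmodule_injective h')
      · exact Or.inr (Subrepresentation.toSubmodule_injective h')

/-- The restriction (or inflation) of a representation along a homomorphism. -/
abbrev resRep {H : Type*} [Group H] (ρ : Representation F G V) (f : H →* G) :
    Representation F H V :=
  MonoidHom.comp ρ f

theorem isIrreducible_resRep {H : Type*} [Group H] (f : H →* G) (hf : Function.Surjective f)
    {ρ : Representation F G V} (hρ : ρ.IsIrreducible) : (resRep ρ f).IsIrreducible := by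
  rw [isIrreducible_iff] at hρ ⊢
  refine ⟨hρ.1, fun U hU => hρ.2 U fun g v hv => ?_⟩
  obtain ⟨k, rfl⟩ := hf g
  exact hU k v hv

theorem nontrivial_of_irreducible (h : ρ.IsIrreducible) : Nontrivial V :=
  (isIrreducible_iff.mp h).1

theorem injective_of_isIntertwiningMap (hρ : ρ.IsIrreducible) {f : V →ₗ[F] W}
    (hf : ρ.IsIntertwiningMap σ f) (h0 : f ≠ 0) : Function.Injective f := by
  rw [← LinearMap.ker_eq_bot]
  refine ((isIrreducible_iff.mp hρ).2 (LinearMap.ker f) fun g v hv => ?_).resolve_right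
    fun h => h0 (LinearMap.ker_eq_top.mp h)
  rw [LinearMap.mem_ker] at hv ⊢
  rw [hf.isIntertwining, hv, map_zero]

theorem surjective_of_isIntertwiningMap (hσ : σ.IsIrreducible) {f : V →ₗ[F] W}
    (hf : ρ.IsIntertwiningMap σ f) (h0 : f ≠ 0) : Function.Surjective f := by
  rw [← LinearMap.range_eq_top]
  refine ((isIrreducible_iff.mp hσ).2 (LinearMap.range f) ?_).resolve_left
    fun h => h0 (LinearMap.range_eq_bot.mp h)
  rintro g _ ⟨v, rfl⟩
  exact ⟨ρ g v, hf.isIntertwining g v⟩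

/-- A bijective linear intertwining map as an equivalence of representations. -/
noncomputable def equivOfBijective (f : V →ₗ[F] W) (hf : ρ.IsIntertwiningMap σ f)
    (hb : Function.Bijective f) : ρ.Equiv σ :=
  .mk (LinearEquiv.ofBijective f hb) fun g => LinearMap.ext fun v => hf.isIntertwining g v

theorem isIntertwiningMap_equiv (e : ρ.Equiv σ) :
    ρ.IsIntertwiningMap σ e.toLinearEquiv.toLinearMap :=
  ⟨fun g v => LinearMap.congr_fun (e.isIntertwining' g) v⟩

/-- Schur's lemma: a nonzero intertwining map between irreducible representations is an
isomorphism. -/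
theorem nonempty_equiv_of_isIntertwiningMap (hρ : ρ.IsIrreducible) (hσ : σ.IsIrreducible)
    {f : V →ₗ[F] W} (hf : ρ.IsIntertwiningMap σ f) (h0 : f ≠ 0) : Nonempty (ρ.Equiv σ) :=
  ⟨equivOfBijective f hf ⟨injective_of_isIntertwiningMap hρ hf h0,
    surjective_of_isIntertwiningMap hσ hf h0⟩⟩

theorem isIrreducible_of_equiv (e : ρ.Equiv σ) (h : ρ.IsIrreducible) : σ.IsIrreducible := by
  rw [isIrreducible_iff] at h ⊢
  have := h.1
  refine ⟨e.toLinearEquiv.symm.toEquiv.nontrivial, fun U hU => ?_⟩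
  have key := h.2 (U.comap e.toLinearEquiv.toLinearMap) fun g v hv => by
    have := hU g _ hv
    rw [Submodule.mem_comap]
    rwa [(isIntertwiningMap_equiv e).isIntertwining]
  have hs : (U.comap e.toLinearEquiv.toLinearMap).map e.toLinearEquiv.toLinearMap = U :=
    Submodule.map_comap_eq_of_surjective e.toLinearEquiv.surjective U
  rcases key with key | key
  · left
    rw [← hs, key, Submodule.map_bot]
  · right
    rw [← hs, key, Submodule.map_top, LinearMap.range_eq_top]
    exact e.toLinearEquiv.surjective

theorem asAlgebraHom_map {f : V →ₗ[F] W} (hf : ρ.IsIntertwiningMap σ f) (r : F[G]) (v : V) :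
    f (ρ.asAlgebraHom r v) = σ.asAlgebraHom r (f v) := by
  induction r using MonoidAlgebra.induction_linear with
  | zero => simp
  | add x y hx hy => simp [hx, hy]
  | single g a => simp [hf.isIntertwining]

section Closed

variable [IsAlgClosed F] [FiniteDimensional F V]

theorem exists_smul_of_isIntertwiningMap (hρ : ρ.IsIrreducible) {f : V →ₗ[F] V}
    (hf : ρ.IsIntertwiningMap ρ f) : ∃ c : F, f = c • 1 := by
  obtain ⟨c, hc⟩ := (Representation.IsIrreducible.algebraMap_intertwiningMap_bijective_of_isAlgClosed
    (ρ := ρ)).2 (f.intertwiningMap_of_isIntertwiningMap ρ ρ hf.isIntertwining)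
  refine ⟨c, ?_⟩
  have := congrArg (fun x : ρ.IntertwiningMap ρ => x.toLinearMap) hc
  exact this.symm

/-- Burnside's theorem: the group algebra acts on an irreducible representation through the whole
endomorphism algebra. -/
theorem asAlgebraHom_surjective (hρ : ρ.IsIrreducible) :
    Function.Surjective ρ.asAlgebraHom := by
  intro a
  have hs : IsSimpleModule F[G] ρ.asModule :=
    (Representation.irreducible_iff_isSimpleModule_asModule ρ).mp hρ
  have : FiniteDimensional F ρ.asModule := inferInstanceAs (FiniteDimensional F V)
  let a' : ρ.asModule →ₗ[F] ρ.asModule := a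
  let f : Module.End (Module.End F[G] ρ.asModule) ρ.asModule :=
    { toFun := a'
      map_add' := a'.map_add
      map_smul' := fun φ v => by
        obtain ⟨c, rfl⟩ := (IsSimpleModule.algebraMap_end_bijective_of_isAlgClosed
          (A := F[G]) (V := ρ.asModule) F).2 φ
        exact a'.map_smul c v }
  classical
  let b := Module.finBasis F ρ.asModule
  obtain ⟨r, hr⟩ := jacobson_density f (Finset.univ.image b)
  refine ⟨r, b.ext fun i => ?_⟩
  exact (hr (b i) (by simp)).symm

end Closed

/-- If every element of the group algebra that kills the irreducible representation `σ` kills `ρ`,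
then the action on `ρ` factors through the endomorphism algebra of `σ`. -/
theorem exists_algHom_end [IsAlgClosed F] [FiniteDimensional F W] (hσ : σ.IsIrreducible)
    {U : Type*} [AddCommGroup U] [Module F U] {τ : Representation F G U}
    (h : ∀ r, σ.asAlgebraHom r = 0 → τ.asAlgebraHom r = 0) :
    ∃ α : Module.End F W →ₐ[F] Module.End F U, ∀ r, α (σ.asAlgebraHom r) = τ.asAlgebraHom r := by
  have hsurj := asAlgebraHom_surjective hσ
  obtain ⟨s, hs⟩ := LinearMap.exists_rightInverse_of_surjective σ.asAlgebraHom.toLinearMap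
    (LinearMap.range_eq_top.mpr hsurj)
  have hs' : ∀ a, σ.asAlgebraHom (s a) = a := fun a => LinearMap.congr_fun hs a
  have key : ∀ r, τ.asAlgebraHom (s (σ.asAlgebraHom r)) = τ.asAlgebraHom r := fun r => by
    rw [← sub_eq_zero, ← map_sub]
    refine h _ ?_
    rw [map_sub, hs', sub_self]
  refine ⟨AlgHom.ofLinearMap (τ.asAlgebraHom.toLinearMap ∘ₗ s) ?_ fun a b => ?_, key⟩
  · have := key 1
    rwa [map_one σ.asAlgebraHom, map_one τ.asAlgebraHom] at this
  · obtain ⟨x, rfl⟩ := hsurj a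
    obtain ⟨y, rfl⟩ := hsurj b
    have := key (x * y)
    rw [map_mul σ.asAlgebraHom, map_mul τ.asAlgebraHom, ← key x, ← key y] at this
    exact this

section Separation

theorem sum_smulRight_coord {n : ℕ} (b : Module.Basis (Fin n) F V) (a : Module.End F V) :
    ∑ i, (b.coord i).smulRight (a (b i)) = a := by
  refine b.ext fun j => ?_
  rw [LinearMap.sum_apply, Finset.sum_eq_single j]
  · simp
  · intro i _ hij
    simp [Finsupp.single_eq_of_ne hij]
  · simp

variable [IsAlgClosed F] [FiniteDimensional F W]

/-- Two irreducible representations with nested annihilators in the group algebra are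
isomorphic. -/
theorem nonempty_equiv_of_annihilator_le (hρ : ρ.IsIrreducible) (hσ : σ.IsIrreducible)
    (h : ∀ r, σ.asAlgebraHom r = 0 → ρ.asAlgebraHom r = 0) : Nonempty (σ.Equiv ρ) := by
  obtain ⟨α, hα⟩ := exists_algHom_end hσ h
  have hV := nontrivial_of_irreducible hρ
  let b := Module.finBasis F W
  by_contra hne
  have h0 : ∀ (i : Fin _) (w : W), α ((b.coord i).smulRight w) = 0 := by
    intro i
    by_contra hex
    push Not at hex
    obtain ⟨w, hw⟩ := hex
    obtain ⟨v, hv⟩ := DFunLike.ne_iff.mp hw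
    -- `w ↦ α (w ⊗ φ) v` intertwines the two actions
    let f : W →ₗ[F] V := LinearMap.applyₗ v ∘ₗ α.toLinearMap ∘ₗ
      LinearMap.smulRightₗ (b.coord i)
    have hf : σ.IsIntertwiningMap ρ f := ⟨fun g w => by
      have h1 : (b.coord i).smulRight (σ g w) = σ g * (b.coord i).smulRight w := by
        ext x
        simp
      have h2 := hα (MonoidAlgebra.single g 1)
      rw [Representation.asAlgebraHom_single_one, Representation.asAlgebraHom_single_one] at h2
      change α ((b.coord i).smulRight (σ g w)) v = ρ g (α ((b.coord i).smulRight w) v)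
      rw [h1, map_mul, h2]
      rfl⟩
    exact hne (nonempty_equiv_of_isIntertwiningMap hσ hρ hf
      (fun hf0 => hv (LinearMap.congr_fun hf0 w)))
  have h1 : (1 : Module.End F V) = 0 := by
    rw [← map_one α, ← sum_smulRight_coord b 1, map_sum]
    exact Finset.sum_eq_zero fun i _ => h0 i _
  exact one_ne_zero h1

variable [FiniteDimensional F V]

/-- For non-isomorphic irreducible `ρ`, `σ`, the annihilator of `σ` in the group algebra acts on
`ρ` through every endomorphism. -/
theorem exists_asAlgebraHom_eq_of_not_equiv (hρ : ρ.IsIrreducible) (hσ : σ.IsIrreducible)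
    (h : IsEmpty (σ.Equiv ρ)) (a : Module.End F V) :
    ∃ r, ρ.asAlgebraHom r = a ∧ σ.asAlgebraHom r = 0 := by
  have hex : ∃ r, σ.asAlgebraHom r = 0 ∧ ρ.asAlgebraHom r ≠ 0 := by
    by_contra hc
    push Not at hc
    exact h.elim (nonempty_equiv_of_annihilator_le hρ hσ hc).some
  obtain ⟨r, hr, hr'⟩ := hex
  obtain ⟨v, hv⟩ := DFunLike.ne_iff.mp hr'
  obtain ⟨φ, hφ⟩ := Module.Projective.exists_dual_eq_one F hv
  let b := Module.finBasis F V
  -- `(w ⊗ φ) * ρ(r) * (v ⊗ ψ) = w ⊗ ψ`, and every endomorphism is a sum of such tensors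
  choose x hx using fun i => asAlgebraHom_surjective hρ (φ.smulRight (a (b i)))
  choose y hy using fun i => asAlgebraHom_surjective hρ ((b.coord i).smulRight v)
  refine ⟨∑ i, x i * r * y i, ?_, ?_⟩
  · rw [map_sum]
    conv_rhs => rw [← sum_smulRight_coord b a]
    refine Finset.sum_congr rfl fun i _ => ?_
    rw [map_mul, map_mul, hx, hy]
    ext w
    simp [hφ]
  · rw [map_sum]
    exact Finset.sum_eq_zero fun i _ => by rw [map_mul, map_mul, hr, mul_zero, zero_mul]

/-- The group algebra separates an irreducible representation from finitely many irreducible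
representations not isomorphic to it. -/
theorem exists_asAlgebraHom_eq_of_forall_not_equiv (hρ : ρ.IsIrreducible) {ι : Type*}
    (τ : ι → Representation F G V) (hτ : ∀ i, (τ i).IsIrreducible) (s : Finset ι)
    (h : ∀ i ∈ s, IsEmpty ((τ i).Equiv ρ)) (a : Module.End F V) :
    ∃ r, ρ.asAlgebraHom r = a ∧ ∀ i ∈ s, (τ i).asAlgebraHom r = 0 := by
  classical
  induction s using Finset.induction_on generalizing a with
  | empty =>
    obtain ⟨r, hr⟩ := asAlgebraHom_surjective hρ a
    exact ⟨r, hr, by simp⟩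
  | insert i s hi ih =>
    obtain ⟨r, hr, hr'⟩ := ih (fun j hj => h j (Finset.mem_insert_of_mem hj)) a
    obtain ⟨t, ht, ht'⟩ := exists_asAlgebraHom_eq_of_not_equiv hρ (hτ i)
      (h i (Finset.mem_insert_self i s)) 1
    refine ⟨t * r, by rw [map_mul, ht, hr, one_mul], fun j hj => ?_⟩
    rcases Finset.mem_insert.mp hj with rfl | hj
    · rw [map_mul, ht', zero_mul]
    · rw [map_mul, hr' j hj, mul_zero]

end Separation
end Basic

/-! ### Invariant subspaces and quotients -/

section SubQuotient

variable {F : Type*} [Field F] {G : Type*} [Group G] {M : Type*} [AddCommGroup M] [Module F M]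

/-- The restriction of a representation to an invariant subspace. -/
def subRep (ρ : Representation F G M) (N : Submodule F M) (h : ∀ g, ∀ v ∈ N, ρ g v ∈ N) :
    Representation F G N :=
  ρ.subrepresentation N h

/-- The smallest invariant subspace containing the images of a set of linear maps into a
representation. -/
def invariantSpan (ρ : Representation F G M) {V : Type*} [AddCommGroup V] [Module F V]
    (U : Set (V →ₗ[F] M)) : Submodule F M :=
  Submodule.span F {m | ∃ g, ∃ u ∈ U, ∃ v, ρ g (u v) = m}

variable (ρ : Representation F G M) {V : Type*} [AddCommGroup V] [Module F V]
  {U : Set (V →ₗ[F] M)}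

theorem apply_mem_invariantSpan (g : G) {u : V →ₗ[F] M} (hu : u ∈ U) (v : V) :
    ρ g (u v) ∈ invariantSpan ρ U :=
  Submodule.subset_span ⟨g, u, hu, v, rfl⟩

theorem mem_invariantSpan {u : V →ₗ[F] M} (hu : u ∈ U) (v : V) : u v ∈ invariantSpan ρ U := by
  have := apply_mem_invariantSpan ρ 1 hu v
  rwa [map_one] at this

theorem invariantSpan_invariant (g : G) (m : M) (hm : m ∈ invariantSpan ρ U) :
    ρ g m ∈ invariantSpan ρ U := by
  have h : invariantSpan ρ U ≤ (invariantSpan ρ U).comap (ρ g) := by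
    rw [invariantSpan, Submodule.span_le, ← invariantSpan]
    rintro _ ⟨g', u, hu, v, rfl⟩
    change ρ g (ρ g' (u v)) ∈ invariantSpan ρ U
    rw [← Module.End.mul_apply, ← map_mul]
    exact apply_mem_invariantSpan ρ _ hu v
  exact h hm

theorem invariantSpan_le {N : Submodule F M} (hN : ∀ g, ∀ m ∈ N, ρ g m ∈ N)
    (h : ∀ u ∈ U, ∀ v, u v ∈ N) : invariantSpan ρ U ≤ N := by
  refine Submodule.span_le.mpr ?_
  rintro _ ⟨g, u, hu, v, rfl⟩
  exact hN g _ (h u hu v)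

/-- Every nonzero finite-dimensional representation has an irreducible quotient. -/
theorem exists_irreducible_quotient {F : Type*} [Field F] {G : Type*} [Group G] {M : Type u}
    [AddCommGroup M] [Module F M] (ρ : Representation F G M) [FiniteDimensional F M]
    [Nontrivial M] :
    ∃ (N : Type u) (_ : AddCommGroup N) (_ : Module F N) (_ : FiniteDimensional F N)
      (σ : Representation F G N) (π : M →ₗ[F] N), σ.IsIrreducible ∧ ρ.IsIntertwiningMap σ π ∧
      Function.Surjective π := by
  induction hn : Module.finrank F M using Nat.strong_induction_on generalizing M with
  | _ n ih =>
    by_cases hirr : ρ.IsIrreducible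
    · exact ⟨M, _, _, inferInstance, ρ, LinearMap.id, hirr, ⟨fun _ _ => rfl⟩,
        Function.surjective_id⟩
    · rw [isIrreducible_iff] at hirr
      push Not at hirr
      obtain ⟨U, hU, hbot, htop⟩ := hirr inferInstance
      have : Nontrivial (M ⧸ U) := Submodule.Quotient.nontrivial_iff.mpr htop
      have hlt : Module.finrank F (M ⧸ U) < n := by
        have h1 := Submodule.finrank_quotient_add_finrank U
        have h2 : 0 < Module.finrank F U := by
          have := (Submodule.nontrivial_iff_ne_bot (p := U)).mpr hbot
          exact Module.finrank_pos
        omega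
      obtain ⟨N, i1, i2, i3, σ, π, hσ, hπ, hs⟩ := ih _ hlt
        (ρ.quotient U fun g v hv => hU g v hv) rfl
      refine ⟨N, i1, i2, i3, σ, π ∘ₗ U.mkQ, hσ, ⟨fun g v => ?_⟩,
        hs.comp (Submodule.mkQ_surjective U)⟩
      exact hπ.isIntertwining g (U.mkQ v)

end SubQuotient

/-! ### The functor `Hom_X(V, M)` of Clifford theory -/

section Clifford

variable {F : Type*} [Field F] {X G D : Type*} [Group X] [Group G] [Group D]
variable {V : Type*} [AddCommGroup V] [Module F V]

/-- The setting of Clifford theory for an irreducible representation `ρ` of `X` on `V` and a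
homomorphism `j : X →* G` with normal image. The group `D` maps to `G` by `q` and acts on `V` by
`γ`, compatibly with the action of `X`; so `γ` stands for a projective representation, extending
`ρ`, of the stabilizer of `ρ` in `G`, and `D` for a covering group on which it becomes linear. -/
structure CliffordDatum (ρ : Representation F X V) (j : X →* G) (D : Type*) [Group D] where
  c : G → MulAut X
  j_c : ∀ g x, j (c g x) = g * j x * g⁻¹
  q : D →* G
  γ : Representation F D V
  γ_ρ : ∀ d x v, γ d (ρ x v) = ρ (c (q d) x) (γ d v)
  stab : ∀ g, Nonempty (ρ.Equiv (MonoidHom.comp ρ (c g⁻¹).toMonoidHom : Representation F X V)) →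
    ∃ d x, g = q d * j x

variable {ρ : Representation F X V} {j : X →* G} (𝒟 : CliffordDatum ρ j D)
variable {M : Type*} [AddCommGroup M] [Module F M] {N : Type*} [AddCommGroup N] [Module F N]

/-- The space `Hom_X(V, M)`. -/
def homSpace (ρ : Representation F X V) (j : X →* G) (W : Representation F G M) :
    Submodule F (V →ₗ[F] M) where
  carrier := {f | ∀ x v, f (ρ x v) = W (j x) (f v)}
  add_mem' := fun {f g} hf hg x v => by simp [hf x v, hg x v]
  zero_mem' := fun x v => by simp
  smul_mem' := fun a f hf x v => by simp [hf x v]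

theorem mem_homSpace_iff {W : Representation F G M} {f : V →ₗ[F] M} :
    f ∈ homSpace ρ j W ↔
      ρ.IsIntertwiningMap (resRep W j) f :=
  ⟨fun h => ⟨h⟩, fun h => h.isIntertwining⟩

theorem CliffordDatum.linHom_mem (W : Representation F G M) (d : D) (f : V →ₗ[F] M)
    (hf : f ∈ homSpace ρ j W) :
    (Representation.linHom 𝒟.γ (resRep W 𝒟.q)) d f ∈
      homSpace ρ j W := by
  intro x v
  change W (𝒟.q d) (f (𝒟.γ d⁻¹ (ρ x v))) = W (j x) (W (𝒟.q d) (f (𝒟.γ d⁻¹ v)))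
  rw [𝒟.γ_ρ, hf, 𝒟.j_c, map_inv, inv_inv, ← Module.End.mul_apply, ← map_mul,
    ← Module.End.mul_apply, ← map_mul]
  congr 2
  group

/-- The action of `D` on `Hom_X(V, M)`, given by `d • f = d ∘ f ∘ d⁻¹`. -/
def CliffordDatum.homRep (W : Representation F G M) : Representation F D (homSpace ρ j W) :=
  subRep (Representation.linHom 𝒟.γ (resRep W 𝒟.q)) _
    (𝒟.linHom_mem W)

theorem CliffordDatum.homRep_apply (W : Representation F G M) (d : D) (f : homSpace ρ j W)
    (v : V) : (𝒟.homRep W d f : V →ₗ[F] M) v = W (𝒟.q d) ((f : V →ₗ[F] M) (𝒟.γ d⁻¹ v)) := rfl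

/-- `g ∘ f` intertwines the conjugate of `ρ` by `g` with the restriction to `X`. -/
theorem CliffordDatum.isIntertwiningMap_conj {W : Representation F G M} {f : V →ₗ[F] M}
    (hf : f ∈ homSpace ρ j W) (g : G) :
    Representation.IsIntertwiningMap
      (MonoidHom.comp ρ (𝒟.c g⁻¹).toMonoidHom : Representation F X V)
      (resRep W j) (W g ∘ₗ f) := by
  refine ⟨fun x v => ?_⟩
  change W g (f (ρ (𝒟.c g⁻¹ x) v)) = W (j x) (W g (f v))
  rw [hf, 𝒟.j_c, ← Module.End.mul_apply, ← map_mul, ← Module.End.mul_apply, ← map_mul]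
  congr 2
  group

variable [IsAlgClosed F] [FiniteDimensional F V] [Finite G]

/-- The `G`-submodule generated by the images of a `D`-invariant space `U` of `X`-homomorphisms
`V → M` admits no further `X`-homomorphism from `V`. An element of the group algebra of `X` acting
on `V` as a projection to a line and killing the conjugates of `V` by elements outside the
stabilizer detects the elements of `U`. -/
theorem CliffordDatum.mem_of_forall_mem_invariantSpan (hρ : ρ.IsIrreducible)
    {W : Representation F G M} {U : Submodule F (V →ₗ[F] M)} (hU : U ≤ homSpace ρ j W)
    (hD : ∀ d, ∀ f ∈ U,
      (Representation.linHom 𝒟.γ (resRep W 𝒟.q)) d f ∈ U)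
    {f : V →ₗ[F] M} (hf : f ∈ homSpace ρ j W)
    (hfU : ∀ v, f v ∈ invariantSpan W (U : Set (V →ₗ[F] M))) : f ∈ U := by
  classical
  have := Fintype.ofFinite G
  have := nontrivial_of_irreducible hρ
  obtain ⟨v₁, hv₁⟩ := exists_ne (0 : V)
  obtain ⟨φ, hφ⟩ := Module.Projective.exists_dual_eq_one F hv₁
  obtain ⟨r, hr, hr'⟩ := exists_asAlgebraHom_eq_of_forall_not_equiv hρ
    (fun g : G => (MonoidHom.comp ρ (𝒟.c g⁻¹).toMonoidHom : Representation F X V))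
    (fun g => isIrreducible_resRep _ (𝒟.c g⁻¹).surjective hρ)
    (Finset.univ.filter fun g => ¬ ∃ d x, g = 𝒟.q d * j x)
    (fun g hg => ⟨fun e => (Finset.mem_filter.mp hg).2 (𝒟.stab g ⟨e.symm⟩)⟩)
    (φ.smulRight v₁)
  let R := (resRep W j).asAlgebraHom r
  have key : invariantSpan W (U : Set (V →ₗ[F] M)) ≤
      (U.map (LinearMap.applyₗ v₁)).comap R := by
    refine Submodule.span_le.mpr ?_
    rintro _ ⟨g, u, hu, v, rfl⟩
    by_cases hg : ∃ d x, g = 𝒟.q d * j x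
    · obtain ⟨d, x, rfl⟩ := hg
      have hdu := hD d u hu
      set u' := (Representation.linHom 𝒟.γ (resRep W 𝒟.q)) d u
      have h1 : W (𝒟.q d * j x) (u v) = u' (𝒟.γ d (ρ x v)) := by
        change _ = W (𝒟.q d) (u (𝒟.γ d⁻¹ (𝒟.γ d (ρ x v))))
        rw [← Module.End.mul_apply (𝒟.γ d⁻¹), ← map_mul, inv_mul_cancel, map_one, map_mul]
        change W _ (W _ _) = W _ (u (ρ x v))
        rw [hU hu x v]
      refine ⟨φ (𝒟.γ d (ρ x v)) • u', U.smul_mem _ hdu, ?_⟩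
      change _ = (resRep W j).asAlgebraHom r (W _ (u v))
      rw [h1, ← asAlgebraHom_map (mem_homSpace_iff.mp (hU hdu)), hr]
      simp
    · have h0 := hr' g (Finset.mem_filter.mpr ⟨Finset.mem_univ g, hg⟩)
      have := asAlgebraHom_map (𝒟.isIntertwiningMap_conj (hU hu) g) r v
      rw [h0] at this
      change R (W g (u v)) ∈ U.map (LinearMap.applyₗ v₁)
      have h2 : R (W g (u v)) = 0 := by
        rw [LinearMap.comp_apply] at this
        rw [← LinearMap.comp_apply (W g) u]
        exact this.symm.trans (by simp)
      rw [h2]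
      exact Submodule.zero_mem _
  obtain ⟨u, hu, huv⟩ := key (hfU v₁)
  have h1 : R (f v₁) = f v₁ := by
    change (resRep W j).asAlgebraHom r (f v₁) = _
    rw [← asAlgebraHom_map (mem_homSpace_iff.mp hf), hr]
    simp [hφ]
  rw [h1] at huv
  have h2 : f - u = 0 := by
    by_contra h0
    have := injective_of_isIntertwiningMap hρ
      (mem_homSpace_iff.mp ((homSpace ρ j W).sub_mem hf (hU hu))) h0
    refine hv₁ (this ?_)
    rw [map_zero, LinearMap.sub_apply, ← huv]
    exact sub_self _
  rw [sub_eq_zero.mp h2]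
  exact hu

/-- `Hom_X(V, M)` is an irreducible representation of `D` if `M` is irreducible over `G`. -/
theorem CliffordDatum.homRep_irreducible (hρ : ρ.IsIrreducible) {W : Representation F G M}
    (hW : W.IsIrreducible) (h : homSpace ρ j W ≠ ⊥) : (𝒟.homRep W).IsIrreducible := by
  rw [isIrreducible_iff]
  refine ⟨(Submodule.nontrivial_iff_ne_bot).mpr h, fun U hU => or_iff_not_imp_left.mpr fun hbot => ?_⟩
  rw [eq_top_iff]
  rintro ⟨f, hf⟩ -
  let U' := U.map (homSpace ρ j W).subtype
  have hU' : U' ≤ homSpace ρ j W := by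
    rintro _ ⟨u, -, rfl⟩
    exact u.2
  have hspan : invariantSpan W (U' : Set (V →ₗ[F] M)) = ⊤ := by
    refine ((isIrreducible_iff.mp hW).2 _ (invariantSpan_invariant W)).resolve_left fun h0 => hbot ?_
    rw [eq_bot_iff]
    intro u hu
    rw [Submodule.mem_bot]
    refine Subtype.ext (LinearMap.ext fun v => ?_)
    have := mem_invariantSpan W (U := (U' : Set (V →ₗ[F] M))) ⟨u, hu, rfl⟩ v
    rw [h0] at this
    exact this
  obtain ⟨u, hu, huf⟩ := 𝒟.mem_of_forall_mem_invariantSpan hρ hU'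
    (by
      rintro d _ ⟨u, hu, rfl⟩
      exact ⟨𝒟.homRep W d u, hU d u hu, rfl⟩) hf (fun v => by rw [hspan]; trivial)
  have : u = ⟨f, hf⟩ := Subtype.ext huf
  rwa [← this]

omit [IsAlgClosed F] [FiniteDimensional F V] [Finite G] in
theorem CliffordDatum.nonempty_homRep_equiv {W : Representation F G M} {W' : Representation F G N}
    (e : W.Equiv W') : Nonempty ((𝒟.homRep W).Equiv (𝒟.homRep W')) := by
  have he := isIntertwiningMap_equiv e
  have he' := isIntertwiningMap_equiv e.symm
  let E : homSpace ρ j W ≃ₗ[F] homSpace ρ j W' :=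
    { toFun := fun f => ⟨e.toLinearEquiv.toLinearMap ∘ₗ f.1, fun x v => by
        rw [LinearMap.comp_apply, f.2, he.isIntertwining]; rfl⟩
      invFun := fun f => ⟨e.symm.toLinearEquiv.toLinearMap ∘ₗ f.1, fun x v => by
        rw [LinearMap.comp_apply, f.2, he'.isIntertwining]; rfl⟩
      map_add' := fun f g => Subtype.ext (LinearMap.ext fun v => map_add e.toLinearEquiv _ _)
      map_smul' := fun a f => Subtype.ext (LinearMap.ext fun v => map_smul e.toLinearEquiv _ _)
      left_inv := fun f => Subtype.ext (LinearMap.ext fun v => e.toLinearEquiv.symm_apply_apply _)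
      right_inv := fun f => Subtype.ext (LinearMap.ext fun v => e.toLinearEquiv.apply_symm_apply _) }
  refine ⟨.mk E fun d => LinearMap.ext fun f => Subtype.ext (LinearMap.ext fun v => ?_)⟩
  exact he.isIntertwining (𝒟.q d) _

/-- The `D`-representation `Hom_X(V, M)`, if nonzero, determines the irreducible `M`: the submodule
of `M × N` generated by the graph of an isomorphism `Hom_X(V, M) ≃ Hom_X(V, N)` is the graph of an
isomorphism. -/
theorem CliffordDatum.nonempty_equiv_of_homRep_equiv (hρ : ρ.IsIrreducible)
    {W : Representation F G M} {W' : Representation F G N} (hW : W.IsIrreducible)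
    (hW' : W'.IsIrreducible) (h : homSpace ρ j W ≠ ⊥) (e : (𝒟.homRep W).Equiv (𝒟.homRep W')) :
    Nonempty (W.Equiv W') := by
  have he := isIntertwiningMap_equiv e
  let φ := e.toLinearEquiv
  let Γ : homSpace ρ j W →ₗ[F] (V →ₗ[F] M × N) :=
    { toFun := fun f => f.1.prod (φ f).1
      map_add' := fun f g => by ext v <;> simp
      map_smul' := fun a f => by ext v <;> simp }
  let U := LinearMap.range Γ
  have hU : U ≤ homSpace ρ j (W.prod W') := by
    rintro _ ⟨f, rfl⟩ x v
    change (f.1 (ρ x v), (φ f).1 (ρ x v)) = (W (j x) (f.1 v), W' (j x) ((φ f).1 v))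
    rw [f.2, (φ f).2]
  have hD : ∀ d, ∀ f ∈ U,
      (Representation.linHom 𝒟.γ (resRep (W.prod W') 𝒟.q)) d f ∈ U := by
    rintro d _ ⟨f, rfl⟩
    refine ⟨𝒟.homRep W d f, LinearMap.ext fun v => Prod.ext rfl ?_⟩
    exact LinearMap.congr_fun (congrArg Subtype.val (he.isIntertwining d f)) v
  let P := invariantSpan (W.prod W') (U : Set (V →ₗ[F] M × N))
  have hP : ∀ g, ∀ m ∈ P, (W.prod W') g m ∈ P := invariantSpan_invariant _
  have key : ∀ f, f ∈ homSpace ρ j (W.prod W') → (∀ v, f v ∈ P) → f ∈ U := fun f hf hfP =>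
    𝒟.mem_of_forall_mem_invariantSpan hρ hU hD hf hfP
  obtain ⟨f₀, hf₀, hf₀'⟩ := (Submodule.ne_bot_iff _).mp h
  obtain ⟨v₀, hv₀⟩ := DFunLike.ne_iff.mp hf₀'
  have hφ0 : φ ⟨f₀, hf₀⟩ ≠ 0 := by
    rw [Ne, LinearEquiv.map_eq_zero_iff]
    exact fun h0 => hf₀' (congrArg Subtype.val h0)
  obtain ⟨v₁, hv₁⟩ := DFunLike.ne_iff.mp (fun h0 => hφ0 (Subtype.ext h0) : (φ ⟨f₀, hf₀⟩).1 ≠ 0)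
  -- the intersections of `P` with the two factors vanish
  have hP₁ : ∀ m, (m, (0 : N)) ∈ P → m = 0 := by
    let A : Submodule F M := P.comap (LinearMap.inl F M N)
    have hA : ∀ g, ∀ m ∈ A, W g m ∈ A := fun g m hm => by
      have := hP g _ hm
      change (W g m, (0 : N)) ∈ P
      change (W g m, W' g 0) ∈ P at this
      rwa [map_zero] at this
    rcases (isIrreducible_iff.mp hW).2 A hA with h0 | h0
    · intro m hm
      have : m ∈ A := hm
      rwa [h0] at this
    · exfalso
      obtain ⟨f, hf⟩ := key (LinearMap.inl F M N ∘ₗ f₀) (fun x v => by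
        change (f₀ (ρ x v), (0 : N)) = (W (j x) (f₀ v), W' (j x) 0)
        rw [hf₀, map_zero]) (fun v => by
          have : f₀ v ∈ A := by rw [h0]; trivial
          exact this)
      have h1 : f = ⟨f₀, hf₀⟩ := Subtype.ext (LinearMap.ext fun v =>
        congrArg Prod.fst (LinearMap.congr_fun hf v))
      apply hφ0
      rw [← h1]
      exact Subtype.ext (LinearMap.ext fun v => congrArg Prod.snd (LinearMap.congr_fun hf v))
  have hP₂ : ∀ m, ((0 : M), m) ∈ P → m = 0 := by
    let A : Submodule F N := P.comap (LinearMap.inr F M N)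
    have hA : ∀ g, ∀ m ∈ A, W' g m ∈ A := fun g m hm => by
      have := hP g _ hm
      change ((0 : M), W' g m) ∈ P
      change (W g 0, W' g m) ∈ P at this
      rwa [map_zero] at this
    rcases (isIrreducible_iff.mp hW').2 A hA with h0 | h0
    · intro m hm
      have : m ∈ A := hm
      rwa [h0] at this
    · exfalso
      obtain ⟨f, hf⟩ := key (LinearMap.inr F M N ∘ₗ (φ ⟨f₀, hf₀⟩).1) (fun x v => by
        change ((0 : M), (φ ⟨f₀, hf₀⟩).1 (ρ x v)) = (W (j x) 0, W' (j x) ((φ ⟨f₀, hf₀⟩).1 v))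
        rw [(φ ⟨f₀, hf₀⟩).2, map_zero]) (fun v => by
          have : (φ ⟨f₀, hf₀⟩).1 v ∈ A := by rw [h0]; trivial
          exact this)
      have h1 : f = 0 := Subtype.ext (LinearMap.ext fun v =>
        congrArg Prod.fst (LinearMap.congr_fun hf v))
      apply hv₁
      have h2 := congrArg Prod.snd (LinearMap.congr_fun hf v₁)
      rw [h1] at h2
      refine h2.symm.trans ?_
      change (φ 0).1 v₁ = 0
      rw [map_zero]
      rfl
  have hmem : ∀ v, (f₀ v, (φ ⟨f₀, hf₀⟩).1 v) ∈ P := fun v =>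
    mem_invariantSpan (W.prod W') (U := (U : Set (V →ₗ[F] M × N))) ⟨⟨f₀, hf₀⟩, rfl⟩ v
  let π₁ : P →ₗ[F] M := LinearMap.fst F M N ∘ₗ P.subtype
  let π₂ : P →ₗ[F] N := LinearMap.snd F M N ∘ₗ P.subtype
  have h₁ : (subRep (W.prod W') P hP).IsIntertwiningMap W π₁ := ⟨fun g v => rfl⟩
  have h₂ : (subRep (W.prod W') P hP).IsIntertwiningMap W' π₂ := ⟨fun g v => rfl⟩
  have b₁ : Function.Bijective π₁ := by
    constructor
    · rw [← LinearMap.ker_eq_bot, LinearMap.ker_eq_bot']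
      rintro ⟨⟨a, b⟩, hab⟩ h0
      obtain rfl : a = 0 := h0
      obtain rfl : b = 0 := hP₂ b hab
      rfl
    · exact surjective_of_isIntertwiningMap hW h₁ fun h0 => hv₀
        (LinearMap.congr_fun h0 ⟨_, hmem v₀⟩)
  have b₂ : Function.Bijective π₂ := by
    constructor
    · rw [← LinearMap.ker_eq_bot, LinearMap.ker_eq_bot']
      rintro ⟨⟨a, b⟩, hab⟩ h0
      obtain rfl : b = 0 := h0
      obtain rfl : a = 0 := hP₁ a hab
      rfl
    · exact surjective_of_isIntertwiningMap hW' h₂ fun h0 => hv₁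
        (LinearMap.congr_fun h0 ⟨_, hmem v₁⟩)
  exact ⟨(equivOfBijective π₁ h₁ b₁).symm.trans (equivOfBijective π₂ h₂ b₂)⟩

omit [IsAlgClosed F] [FiniteDimensional F V] [Finite G] in
/-- If `d` lies over the image of `X` and acts on `V` as `c • ρ x`, then it acts on `Hom_X(V, M)` as
`c⁻¹`. -/
theorem CliffordDatum.homRep_eq_smul [Nontrivial V] (W : Representation F G M) {d : D} {x : X}
    {c : F} (hd : 𝒟.q d = j x) (hc : 𝒟.γ d = c • ρ x) : 𝒟.homRep W d = c⁻¹ • 1 := by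
  have h1 : 𝒟.γ d * 𝒟.γ d⁻¹ = 1 := by rw [← map_mul, mul_inv_cancel, map_one]
  have hc0 : c ≠ 0 := by
    rintro rfl
    rw [hc, zero_smul, zero_mul] at h1
    exact zero_ne_one h1
  refine LinearMap.ext fun f => Subtype.ext (LinearMap.ext fun v => ?_)
  rw [𝒟.homRep_apply, hd, ← f.2]
  have h2 : ρ x (𝒟.γ d⁻¹ v) = c⁻¹ • v := by
    have h3 := LinearMap.congr_fun h1 v
    rw [hc, smul_mul_assoc] at h3
    change c • ρ x (𝒟.γ d⁻¹ v) = v at h3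
    rw [← h3, smul_smul, inv_mul_cancel₀ hc0, one_smul, h3]
  rw [h2, map_smul]
  rfl

end Clifford

/-! ### Isomorphism classes of irreducible representations -/

section OfRep

variable {F : Type*} [Field F] {G : Type*} [Group G] {V : Type*} [AddCommGroup V] [Module F V]
  [FiniteDimensional F V]

/-- The transport of a finite-dimensional irreducible representation to a space `F ^ n`, along a
basis. -/
noncomputable def IrrRep.ofRep (ρ : Representation F G V) (h : ρ.IsIrreducible) : IrrRep F G :=
  let e := (Module.finBasis F V).equivFun
  let σ : Representation F G (Fin (Module.finrank F V) → F) :=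
    { toFun := fun g => e.toLinearMap ∘ₗ ρ g ∘ₗ e.symm.toLinearMap
      map_one' := by ext; simp
      map_mul' := fun g h => LinearMap.ext fun v => by simp }
  { dim := Module.finrank F V
    rep := σ
    irreducible := isIrreducible_of_equiv (ρ := ρ) (.mk e fun g => LinearMap.ext fun v => by
      change e (ρ g v) = e (ρ g (e.symm (e v)))
      rw [e.symm_apply_apply]) h }

theorem IrrRep.nonempty_equiv_ofRep (ρ : Representation F G V) (h : ρ.IsIrreducible) :
    Nonempty (ρ.Equiv (IrrRep.ofRep ρ h).rep) :=
  ⟨.mk (Module.finBasis F V).equivFun fun g => LinearMap.ext fun v => by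
    change _ = (Module.finBasis F V).equivFun
      (ρ g ((Module.finBasis F V).equivFun.symm ((Module.finBasis F V).equivFun v)))
    rw [LinearEquiv.symm_apply_apply]
    rfl⟩

theorem IrrRep.cls_eq_iff {ρ σ : IrrRep F G} : ρ.cls = σ.cls ↔ Nonempty (ρ.rep.Equiv σ.rep) :=
  Quotient.eq (r := IrrRep.setoid F G)

theorem IBr.exists_rep (χ : IBr F G) : ∃ ρ : IrrRep F G, ρ.cls = χ :=
  Quotient.exists_rep χ

end OfRep

/-- A relation between the elements of two sets that is bijective in both directions yields equality
of cardinals. It replaces a bijection between sets of isomorphism classes that is given in terms of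
representatives. -/
theorem Set.encard_eq_of_rel {α : Type*} {β : Type*} {A : Set α} {B : Set β} (R : α → β → Prop)
    (hA : ∀ a ∈ A, ∃ b ∈ B, R a b) (hB : ∀ b ∈ B, ∃ a ∈ A, R a b)
    (hl : ∀ a ∈ A, ∀ a' ∈ A, ∀ b, R a b → R a' b → a = a')
    (hr : ∀ a, ∀ b ∈ B, ∀ b' ∈ B, R a b → R a b' → b = b') : A.encard = B.encard := by
  choose f hf hfR using hA
  refine Set.encard_congr (Equiv.ofBijective (fun a : A => ⟨f a.1 a.2, hf a.1 a.2⟩) ⟨?_, ?_⟩)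
  · rintro ⟨a, ha⟩ ⟨a', ha'⟩ h
    have h' : f a ha = f a' ha' := congrArg Subtype.val h
    exact Subtype.ext (hl a ha a' ha' _ (hfR a ha) (h' ▸ hfR a' ha'))
  · rintro ⟨b, hb⟩
    obtain ⟨a, ha, hab⟩ := hB b hb
    exact ⟨⟨a, ha⟩, Subtype.ext (hr a _ (hf a ha) b hb (hfR a ha) hab)⟩

/-! ### Surjectivity in the Clifford correspondence -/

section Clifford

variable {F : Type*} [Field F] {X G D : Type*} [Group X] [Group G] [Group D]
variable {V : Type*} [AddCommGroup V] [Module F V]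
variable {ρ : Representation F X V} {j : X →* G} (𝒟 : CliffordDatum ρ j D)

variable (F G V) in
/-- The action of `G` on functions `G → V` by right translation. -/
def translationRep : Representation F G (G → V) where
  toFun g :=
    { toFun := fun h a => h (a * g)
      map_add' := fun _ _ => rfl
      map_smul' := fun _ _ => rfl }
  map_one' := by ext; simp
  map_mul' g g' := LinearMap.ext fun h => funext fun a => congrArg h (mul_assoc a g g').symm

/-- An element of `D` over `j x` acts on `V` as a multiple of `ρ x`, by Schur's lemma. -/
theorem CliffordDatum.exists_eq_smul [IsAlgClosed F] [FiniteDimensional F V]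
    (hρ : ρ.IsIrreducible) (hj : Function.Injective j) {d : D} {x : X} (h : 𝒟.q d = j x) :
    ∃ c : F, c ≠ 0 ∧ 𝒟.γ d = c • ρ x := by
  have hc : ∀ y, 𝒟.c (𝒟.q d) y = x * y * x⁻¹ := fun y => hj (by rw [𝒟.j_c, h]; simp)
  obtain ⟨c, hc'⟩ := exists_smul_of_isIntertwiningMap hρ (f := ρ x⁻¹ ∘ₗ 𝒟.γ d) ⟨fun y v => by
    rw [LinearMap.comp_apply, 𝒟.γ_ρ, hc, ← Module.End.mul_apply, ← map_mul, LinearMap.comp_apply,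
      ← Module.End.mul_apply (ρ y), ← map_mul]
    congr 2
    group⟩
  have h2 : 𝒟.γ d = c • ρ x := by
    have : ρ x * (ρ x⁻¹ * 𝒟.γ d) = 𝒟.γ d := by
      rw [← mul_assoc, ← map_mul, mul_inv_cancel, map_one, one_mul]
    rw [← this]
    change ρ x * (ρ x⁻¹ ∘ₗ 𝒟.γ d) = _
    rw [hc', mul_smul_comm, mul_one]
  refine ⟨c, ?_, h2⟩
  rintro rfl
  have := nontrivial_of_irreducible hρ
  have h1 : 𝒟.γ d * 𝒟.γ d⁻¹ = 1 := by rw [← map_mul, mul_inv_cancel, map_one]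
  rw [h2, zero_smul, zero_mul] at h1
  exact zero_ne_one h1

section Coind

variable {Y : Type*} [AddCommGroup Y] [Module F Y] (U : Representation F D Y)

open Classical in
/-- The function on `G` supported on the stabilizer of `ρ` with `j x * q d ↦ ℓ (d y) • x d v`. -/
noncomputable def CliffordDatum.coindFun (ℓ : Y →ₗ[F] F) (y : Y) (v : V) (g : G) : V :=
  if h : ∃ p : X × D, g = j p.1 * 𝒟.q p.2 then
    ℓ (U h.choose.2 y) • ρ h.choose.1 (𝒟.γ h.choose.2 v)
  else 0

theorem CliffordDatum.coindFun_of_not {ℓ : Y →ₗ[F] F} {y : Y} {v : V} {g : G}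
    (h : ¬ ∃ (x : X) (d : D), g = j x * 𝒟.q d) : 𝒟.coindFun U ℓ y v g = 0 := by
  rw [coindFun, dif_neg]
  rintro ⟨p, hp⟩
  exact h ⟨p.1, p.2, hp⟩

theorem CliffordDatum.j_mul_q (d : D) (x : X) : 𝒟.q d * j x = j (𝒟.c (𝒟.q d) x) * 𝒟.q d := by
  rw [𝒟.j_c]
  group

variable {U} [IsAlgClosed F] [FiniteDimensional F V]

/-- The value of `coindFun` does not depend on the chosen decomposition of an element of the
stabilizer: two decompositions differ by an element of `D` over the image of `X`, and the scalars by
which it acts through `U` and `γ` cancel. -/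
theorem CliffordDatum.coindFun_apply (hρ : ρ.IsIrreducible) (hj : Function.Injective j)
    (hU : ∀ (d : D) (x : X) (c : F), 𝒟.q d = j x → 𝒟.γ d = c • ρ x → U d = c⁻¹ • 1)
    (ℓ : Y →ₗ[F] F) (y : Y) (v : V) (x : X) (d : D) :
    𝒟.coindFun U ℓ y v (j x * 𝒟.q d) = ℓ (U d y) • ρ x (𝒟.γ d v) := by
  have h : ∃ p : X × D, j x * 𝒟.q d = j p.1 * 𝒟.q p.2 := ⟨(x, d), rfl⟩
  rw [coindFun, dif_pos h]
  have hp := h.choose_spec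
  generalize h.choose = p at hp
  obtain ⟨x', d'⟩ := p
  change j x * 𝒟.q d = j x' * 𝒟.q d' at hp
  change ℓ (U d' y) • ρ x' (𝒟.γ d' v) = _
  have hq : 𝒟.q (d' * d⁻¹) = j (x'⁻¹ * x) := by
    rw [map_mul, map_mul, map_inv, map_inv, eq_inv_mul_iff_mul_eq, ← mul_assoc, ← hp]
    group
  obtain ⟨c, hc0, hc⟩ := 𝒟.exists_eq_smul hρ hj hq
  have hU' := hU _ _ c hq hc
  have e1 : U d' = c⁻¹ • U d := by
    rw [← inv_mul_cancel_right d' d, map_mul, hU', smul_mul_assoc, one_mul]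
  have e2 : 𝒟.γ d' = c • (ρ (x'⁻¹ * x) * 𝒟.γ d) := by
    rw [← inv_mul_cancel_right d' d, map_mul, hc, smul_mul_assoc]
  rw [e1, e2, LinearMap.smul_apply, LinearMap.smul_apply, map_smul, map_smul, smul_eq_mul, smul_smul,
    mul_right_comm, inv_mul_cancel₀ hc0, one_mul, Module.End.mul_apply, ← Module.End.mul_apply (ρ x'),
    ← map_mul, mul_inv_cancel_left]

variable [Finite G]

/-- Every irreducible representation of `D` on which the preimage of `X` acts by the inverse of the
scalars `γ d * ρ(d)⁻¹` arises as `Hom_X(V, M)` for an irreducible representation `M` of `G`. -/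
theorem CliffordDatum.exists_homRep_equiv (hρ : ρ.IsIrreducible) (hj : Function.Injective j)
    (hirr : U.IsIrreducible)
    (hU : ∀ (d : D) (x : X) (c : F), 𝒟.q d = j x → 𝒟.γ d = c • ρ x → U d = c⁻¹ • 1) :
    ∃ W : IrrRep F G, homSpace ρ j W.rep ≠ ⊥ ∧ Nonempty ((𝒟.homRep W.rep).Equiv U) := by
  have hY := nontrivial_of_irreducible hirr
  have hV := nontrivial_of_irreducible hρ
  obtain ⟨y₀, hy₀⟩ := exists_ne (0 : Y)
  obtain ⟨v₀, hv₀⟩ := exists_ne (0 : V)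
  obtain ⟨ℓ, hℓ⟩ := Module.Projective.exists_dual_eq_one F hy₀
  have hap := 𝒟.coindFun_apply (U := U) hρ hj hU ℓ
  have hex : ∀ g, (∃ (x : X) (d : D), g = j x * 𝒟.q d) ∨
      ((¬ ∃ (x : X) (d : D), g = j x * 𝒟.q d) ∧ ∀ y v, 𝒟.coindFun U ℓ y v g = 0) := fun g =>
    or_iff_not_imp_left.mpr fun h => ⟨h, fun y v => 𝒟.coindFun_of_not U h⟩
  let Θ (y : Y) : V →ₗ[F] (G → V) :=
    { toFun := 𝒟.coindFun U ℓ y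
      map_add' := fun v w => funext fun g => by
        rcases hex g with ⟨x, d, rfl⟩ | ⟨-, h⟩
        · simp [hap]
        · simp [h]
      map_smul' := fun a v => funext fun g => by
        rcases hex g with ⟨x, d, rfl⟩ | ⟨-, h⟩
        · simp only [hap, map_smul, RingHom.id_apply, Pi.smul_apply]
          rw [smul_comm]
        · simp [h] }
  -- `P` is a quotient of the representation induced from the stabilizer; any irreducible quotient
  -- `M` of `P` comes with a nonzero map from `U` to `Hom_X(V, M)`.
  let I := translationRep F G V
  let P := invariantSpan I (Set.range Θ)
  have hΘP : ∀ y v, Θ y v ∈ P := fun y v => mem_invariantSpan I (Set.mem_range_self y) v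
  have hΘ0 : Θ y₀ v₀ ≠ 0 := by
    intro h
    have h1 := congrFun h (j 1 * 𝒟.q 1)
    change 𝒟.coindFun U ℓ y₀ v₀ _ = 0 at h1
    rw [hap] at h1
    simp [hℓ, hv₀] at h1
  have : Nontrivial P := ⟨⟨⟨_, hΘP y₀ v₀⟩, 0, fun h => hΘ0 (congrArg Subtype.val h)⟩⟩
  have : FiniteDimensional F (G → V) := inferInstance
  obtain ⟨M, i1, i2, i3, σ, π, hσ, hπ, hs⟩ :=
    exists_irreducible_quotient (subRep I P (invariantSpan_invariant I))
  let π' : Y → V →ₗ[F] M := fun y => π ∘ₗ (Θ y).codRestrict P (hΘP y)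
  have hΘx : ∀ y x v, Θ y (ρ x v) = I (j x) (Θ y v) := fun y x v => funext fun g => by
    change 𝒟.coindFun U ℓ y _ g = 𝒟.coindFun U ℓ y v (g * j x)
    rcases hex g with ⟨x', d, rfl⟩ | ⟨hg', h⟩
    · rw [mul_assoc, 𝒟.j_mul_q, ← mul_assoc, ← map_mul, hap, hap, 𝒟.γ_ρ, map_mul,
        Module.End.mul_apply]
    · rw [h, 𝒟.coindFun_of_not]
      rintro ⟨x', d, hg⟩
      refine hg' ⟨x' * 𝒟.c (𝒟.q d) x⁻¹, d, ?_⟩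
      rw [map_mul, mul_assoc, ← 𝒟.j_mul_q, ← mul_assoc, ← hg, map_inv, mul_inv_cancel_right]
  have hΘd : ∀ y d v, Θ (U d y) v = I (𝒟.q d) (Θ y (𝒟.γ d⁻¹ v)) := fun y d v => funext fun g => by
    change 𝒟.coindFun U ℓ _ v g = 𝒟.coindFun U ℓ y (𝒟.γ d⁻¹ v) (g * 𝒟.q d)
    rcases hex g with ⟨x', d', rfl⟩ | ⟨hg', h⟩
    · rw [mul_assoc, ← map_mul, hap, hap, map_mul, map_mul, Module.End.mul_apply,
        Module.End.mul_apply, ← Module.End.mul_apply (𝒟.γ d), ← map_mul 𝒟.γ, mul_inv_cancel, map_one]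
      rfl
    · rw [h, 𝒟.coindFun_of_not]
      rintro ⟨x', d', hg⟩
      exact hg' ⟨x', d' * d⁻¹, by rw [map_mul, ← mul_assoc, ← hg, map_inv, mul_inv_cancel_right]⟩
  have hπ'mem : ∀ y, π' y ∈ homSpace ρ j σ := fun y x v => by
    have h1 : (Θ y).codRestrict P (hΘP y) (ρ x v) =
        subRep I P (invariantSpan_invariant I) (j x) ((Θ y).codRestrict P (hΘP y) v) :=
      Subtype.ext (hΘx y x v)
    change π _ = σ (j x) (π _)
    rw [h1, hπ.isIntertwining]
  let E : Y →ₗ[F] homSpace ρ j σ :=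
    { toFun := fun y => ⟨π' y, hπ'mem y⟩
      map_add' := fun y z => Subtype.ext (LinearMap.ext fun v => by
        change π _ = π _ + π _
        rw [← map_add]
        congr 1
        refine Subtype.ext (funext fun g => ?_)
        change 𝒟.coindFun U ℓ _ v g = 𝒟.coindFun U ℓ y v g + 𝒟.coindFun U ℓ z v g
        rcases hex g with ⟨x, d, rfl⟩ | ⟨-, h⟩
        · simp [hap, add_smul]
        · simp [h])
      map_smul' := fun a y => Subtype.ext (LinearMap.ext fun v => by
        change π _ = a • π _
        rw [← map_smul]
        congr 1
        refine Subtype.ext (funext fun g => ?_)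
        change 𝒟.coindFun U ℓ _ v g = a • 𝒟.coindFun U ℓ y v g
        rcases hex g with ⟨x, d, rfl⟩ | ⟨-, h⟩
        · simp [hap, mul_smul]
        · simp [h]) }
  have hE : U.IsIntertwiningMap (𝒟.homRep σ) E := ⟨fun d y => Subtype.ext (LinearMap.ext fun v => by
    have h1 : (Θ (U d y)).codRestrict P (hΘP _) v = subRep I P (invariantSpan_invariant I) (𝒟.q d)
        ((Θ y).codRestrict P (hΘP y) (𝒟.γ d⁻¹ v)) := Subtype.ext (hΘd y d v)
    change π _ = σ (𝒟.q d) (π _)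
    rw [h1, hπ.isIntertwining])⟩
  -- the images of the maps `Θ y` generate, so that not all of them vanish in the quotient
  have hE0 : E ≠ 0 := by
    intro h0
    have hker : P ≤ (LinearMap.ker π).map P.subtype := by
      refine invariantSpan_le I (fun g m hm => ?_) ?_
      · obtain ⟨m', hm', rfl⟩ := hm
        refine ⟨subRep I P (invariantSpan_invariant I) g m', ?_, rfl⟩
        rw [SetLike.mem_coe, LinearMap.mem_ker] at hm' ⊢
        rw [hπ.isIntertwining, hm', map_zero]
      · rintro _ ⟨y, rfl⟩ v
        refine ⟨⟨Θ y v, hΘP y v⟩, ?_, rfl⟩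
        exact LinearMap.congr_fun (congrArg Subtype.val (LinearMap.congr_fun h0 y)) v
    have := nontrivial_of_irreducible hσ
    obtain ⟨m, hm⟩ := exists_ne (0 : M)
    obtain ⟨m', rfl⟩ := hs m
    obtain ⟨m'', h1, h2⟩ := hker m'.2
    obtain rfl : m'' = m' := Subtype.ext h2
    exact hm h1
  have hbot : homSpace ρ j σ ≠ ⊥ := by
    intro h0
    exact hE0 (LinearMap.ext fun y => Subtype.ext ((Submodule.eq_bot_iff _).mp h0 _ (E y).2))
  obtain ⟨e⟩ := nonempty_equiv_of_isIntertwiningMap hirr (𝒟.homRep_irreducible hρ hσ hbot) hE hE0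
  obtain ⟨e'⟩ := IrrRep.nonempty_equiv_ofRep σ hσ
  obtain ⟨e''⟩ := 𝒟.nonempty_homRep_equiv e'
  refine ⟨IrrRep.ofRep σ hσ, fun h0 => ?_, ⟨(e.trans e'').symm⟩⟩
  obtain ⟨f, hf, hf0⟩ := (Submodule.ne_bot_iff _).mp hbot
  have h2 : e''.toLinearEquiv ⟨f, hf⟩ = 0 :=
    Subtype.ext ((Submodule.eq_bot_iff _).mp h0 _ (e''.toLinearEquiv ⟨f, hf⟩).2)
  rw [LinearEquiv.map_eq_zero_iff] at h2
  exact hf0 (congrArg Subtype.val h2)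

end Coind
end Clifford

/-! ### The Clifford correspondence -/

section Count

variable {F : Type u} [Field F] {X G : Type v} [Group X] [Group G]
  {D : Type*} [Group D] {V : Type*} [AddCommGroup V] [Module F V]
  {ρ : Representation F X V} {j : X →* G} (𝒟 : CliffordDatum ρ j D)

theorem mem_over_iff (hρ : ρ.IsIrreducible) {χ : IrrRep F X} (e : ρ.Equiv χ.rep) (W : IrrRep F G) :
    W.cls ∈ IBr.over j χ.cls ↔ homSpace ρ j W.rep ≠ ⊥ := by
  have := nontrivial_of_irreducible hρ
  constructor
  · rintro ⟨W', χ', hW, hχ, i, hi⟩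
    obtain ⟨e₁⟩ := IrrRep.cls_eq_iff.mp hW
    obtain ⟨e₂⟩ := IrrRep.cls_eq_iff.mp hχ.symm
    let f : V →ₗ[F] _ := e₁.toLinearEquiv.toLinearMap ∘ₗ i.toLinearMap ∘ₗ
      (e.trans e₂).toLinearEquiv.toLinearMap
    refine (Submodule.ne_bot_iff _).mpr ⟨f, fun x v => ?_, fun h0 => ?_⟩
    · change e₁.toLinearEquiv (i ((e.trans e₂).toLinearEquiv _)) = _
      have h1 := (isIntertwiningMap_equiv (e.trans e₂)).isIntertwining x v
      have h2 := (isIntertwiningMap_equiv e₁).isIntertwining (j x)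
      rw [LinearEquiv.coe_coe] at h1
      rw [h1, i.isIntertwining]
      exact h2 _
    · obtain ⟨v, hv⟩ := exists_ne (0 : V)
      have hinj : Function.Injective f :=
        e₁.toLinearEquiv.injective.comp (hi.comp (e.trans e₂).toLinearEquiv.injective)
      exact hv (hinj (by rw [h0]; rfl))
  · intro h
    obtain ⟨f, hf, hf0⟩ := (Submodule.ne_bot_iff _).mp h
    have hinj := injective_of_isIntertwiningMap hρ (mem_homSpace_iff.mp hf) hf0
    refine ⟨W, χ, rfl, rfl, ⟨f ∘ₗ e.symm.toLinearEquiv.toLinearMap, fun x => ?_⟩,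
      hinj.comp e.symm.toLinearEquiv.injective⟩
    refine LinearMap.ext fun v => ?_
    have h1 := (isIntertwiningMap_equiv e.symm).isIntertwining x v
    change f (e.symm.toLinearEquiv.toLinearMap _) = _
    rw [h1, hf]
    rfl

variable [IsAlgClosed F] [FiniteDimensional F V] [Finite G]

/-- The Clifford correspondence: the irreducible representations of `G` over that of `X` correspond
to the irreducible representations of `D` on which the preimage of `X` acts by given scalars. -/
theorem CliffordDatum.encard_over (hρ : ρ.IsIrreducible) (hj : Function.Injective j)
    {χ : IrrRep F X} (e : ρ.Equiv χ.rep) :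
    (IBr.over j χ.cls).encard = {φ : IBr F D | ∃ U : IrrRep F D, U.cls = φ ∧
      ∀ (d : D) (c : F), (∃ x, 𝒟.q d = j x ∧ 𝒟.γ d = c • ρ x) → U.rep d = c⁻¹ • 1}.encard := by
  have := nontrivial_of_irreducible hρ
  refine Set.encard_eq_of_rel (fun φ ψ => ∃ (W : IrrRep F G) (U : IrrRep F D),
    W.cls = φ ∧ U.cls = ψ ∧ Nonempty ((𝒟.homRep W.rep).Equiv U.rep)) ?_ ?_ ?_ ?_
  · intro φ hφ
    obtain ⟨W, rfl⟩ := φ.exists_rep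
    have hW := 𝒟.homRep_irreducible hρ W.irreducible ((mem_over_iff hρ e W).mp hφ)
    obtain ⟨e'⟩ := IrrRep.nonempty_equiv_ofRep _ hW
    refine ⟨_, ⟨IrrRep.ofRep _ hW, rfl, ?_⟩, W, _, rfl, rfl, ⟨e'⟩⟩
    rintro d c ⟨x, hd, hc⟩
    have h1 := 𝒟.homRep_eq_smul W.rep hd hc
    refine LinearMap.ext fun v => ?_
    obtain ⟨f, rfl⟩ := e'.toLinearEquiv.surjective v
    have h2 := (isIntertwiningMap_equiv e').isIntertwining d f
    rw [h1] at h2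
    refine h2.symm.trans ?_
    change e'.toLinearEquiv (c⁻¹ • f) = c⁻¹ • e'.toLinearEquiv f
    rw [map_smul]
  · rintro _ ⟨U, rfl, hU⟩
    obtain ⟨W, hW, hWU⟩ := 𝒟.exists_homRep_equiv hρ hj U.irreducible
      (fun d x c hd hc => hU d c ⟨x, hd, hc⟩)
    exact ⟨W.cls, (mem_over_iff hρ e W).mpr hW, W, U, rfl, rfl, hWU⟩
  · rintro φ hφ φ' hφ' ψ ⟨W, U, rfl, rfl, ⟨e₁⟩⟩ ⟨W', U', rfl, hU, ⟨e₂⟩⟩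
    obtain ⟨e₃⟩ := IrrRep.cls_eq_iff.mp hU
    exact IrrRep.cls_eq_iff.mpr (𝒟.nonempty_equiv_of_homRep_equiv hρ W.irreducible W'.irreducible
      ((mem_over_iff hρ e W).mp hφ) (e₁.trans (e₃.symm.trans e₂.symm)))
  · rintro φ ψ hψ ψ' hψ' ⟨W, U, rfl, rfl, ⟨e₁⟩⟩ ⟨W', U', hW, rfl, ⟨e₂⟩⟩
    obtain ⟨e₃⟩ := IrrRep.cls_eq_iff.mp hW
    obtain ⟨e₄⟩ := 𝒟.nonempty_homRep_equiv e₃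
    exact IrrRep.cls_eq_iff.mpr ⟨e₁.symm.trans (e₄.symm.trans e₂)⟩

end Count

/-! ### Irreducible subrepresentations -/

section Sub

theorem exists_irreducible_sub {F : Type*} [Field F] {G : Type*} [Group G] {M : Type*}
    [AddCommGroup M] [Module F M] (ρ : Representation F G M) [FiniteDimensional F M]
    [Nontrivial M] :
    ∃ (σ : IrrRep F G) (i : (Fin σ.dim → F) →ₗ[F] M), σ.rep.IsIntertwiningMap ρ i ∧ i ≠ 0 := by
  induction hn : Module.finrank F M using Nat.strong_induction_on generalizing M with
  | _ n ih =>
    by_cases hirr : ρ.IsIrreducible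
    · obtain ⟨e⟩ := IrrRep.nonempty_equiv_ofRep ρ hirr
      refine ⟨IrrRep.ofRep ρ hirr, e.symm.toLinearEquiv.toLinearMap, isIntertwiningMap_equiv e.symm,
        fun h => ?_⟩
      obtain ⟨m, hm⟩ := exists_ne (0 : M)
      obtain ⟨v, rfl⟩ := e.symm.toLinearEquiv.surjective m
      exact hm (LinearMap.congr_fun h v)
    · rw [isIrreducible_iff] at hirr
      push Not at hirr
      obtain ⟨U, hU, hbot, htop⟩ := hirr inferInstance
      have := (Submodule.nontrivial_iff_ne_bot (p := U)).mpr hbot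
      have hlt : Module.finrank F U < n := hn ▸ Submodule.finrank_lt htop
      obtain ⟨σ, i, hi, hi0⟩ := ih _ hlt (subRep ρ U hU) rfl
      refine ⟨σ, U.subtype ∘ₗ i, ⟨fun g v => ?_⟩, fun h => hi0 ?_⟩
      · rw [LinearMap.comp_apply, hi.isIntertwining]
        rfl
      · exact LinearMap.ext fun v => Subtype.ext (LinearMap.congr_fun h v)

/-- Burnside's theorem, for the linear span of the image of the group. -/
theorem span_range_eq_top {F : Type*} [Field F] [IsAlgClosed F] {G : Type*} [Group G] {V : Type*}
    [AddCommGroup V] [Module F V] [FiniteDimensional F V] {ρ : Representation F G V}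
    (hρ : ρ.IsIrreducible) : Submodule.span F (Set.range ρ) = ⊤ := by
  rw [eq_top_iff]
  intro a _
  obtain ⟨r, rfl⟩ := asAlgebraHom_surjective hρ a
  induction r using MonoidAlgebra.induction_linear with
  | zero => simp
  | add x y hx hy => rw [map_add]; exact Submodule.add_mem _ (hx trivial) (hy trivial)
  | single g a =>
    rw [Representation.asAlgebraHom_single]
    exact Submodule.smul_mem _ _ (Submodule.subset_span ⟨g, rfl⟩)

end Sub

/-! ### Kronecker products and outer tensor products -/

section Kronecker

variable {F : Type*} [Field F] {ι : Type*} [Fintype ι] [DecidableEq ι] {d : ι → ℕ}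

variable (F d) in
/-- The tensor product of the spaces `F ^ (d i)`, as the space of functions on the set of
multi-indices. -/
abbrev TensorSpace : Type _ := (∀ i, Fin (d i)) → F

/-- The Kronecker product of the linear maps `g i (σ i) : F ^ (d i) → F ^ (d (σ i))`, as a linear
endomorphism of the tensor product of the `F ^ (d i)` that permutes the factors by `σ`. The maps
`g i j` with `j ≠ σ i` play no role; indexing by all pairs avoids types that depend on `σ`. -/
def kron (σ : Equiv.Perm ι) (g : ∀ i j, (Fin (d i) → F) →ₗ[F] (Fin (d j) → F)) :
    TensorSpace F d →ₗ[F] TensorSpace F d where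
  toFun t f := ∑ f', (∏ i, g i (σ i) (Pi.single (f' i) 1) (f (σ i))) * t f'
  map_add' s t := by
    ext f
    simp [mul_add, Finset.sum_add_distrib]
  map_smul' a t := by
    ext f
    simp only [Pi.smul_apply, smul_eq_mul, RingHom.id_apply, Finset.mul_sum]
    exact Finset.sum_congr rfl fun _ _ => mul_left_comm _ _ _

theorem kron_apply (σ : Equiv.Perm ι) (g : ∀ i j, (Fin (d i) → F) →ₗ[F] (Fin (d j) → F))
    (t : TensorSpace F d) (f) :
    kron σ g t f = ∑ f', (∏ i, g i (σ i) (Pi.single (f' i) 1) (f (σ i))) * t f' := rfl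

theorem kron_single (σ : Equiv.Perm ι) (g : ∀ i j, (Fin (d i) → F) →ₗ[F] (Fin (d j) → F))
    (f' f) : kron σ g (Pi.single f' 1) f = ∏ i, g i (σ i) (Pi.single (f' i) 1) (f (σ i)) := by
  rw [kron_apply, Finset.sum_eq_single f']
  · simp
  · intro b _ hb
    simp [Pi.single_eq_of_ne hb]
  · simp

omit [DecidableEq ι] in
theorem tensorSpace_hom_ext {M : Type*} [AddCommGroup M] [Module F M]
    {a b : TensorSpace F d →ₗ[F] M}
    (h : ∀ f, a (Pi.single f 1) = b (Pi.single f 1)) : a = b := by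
  classical
  exact (Pi.basisFun F (∀ i, Fin (d i))).ext fun f => by simpa using h f

theorem sum_apply_single {m n : ℕ} (g : (Fin m → F) →ₗ[F] (Fin n → F)) (x : Fin m → F) :
    g x = ∑ k, x k • g (Pi.single k 1) := by
  conv_lhs => rw [← (Pi.basisFun F (Fin m)).sum_repr x, map_sum]
  simp

/-- Kronecker products compose like elements of a wreath product: the component at `i` of the
composition is the component of the second map at `σ i` after that of the first at `i`. -/
theorem kron_comp (σ σ' : Equiv.Perm ι) (g h : ∀ i j, (Fin (d i) → F) →ₗ[F] (Fin (d j) → F)) :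
    kron σ' h ∘ₗ kron σ g = kron (σ' * σ) (fun i k => h (σ i) k ∘ₗ g i (σ i)) := by
  refine tensorSpace_hom_ext fun f' => funext fun f => ?_
  rw [LinearMap.comp_apply, kron_apply, kron_single]
  simp only [kron_single]
  change _ = ∏ i, h (σ i) (σ' (σ i)) (g i (σ i) (Pi.single (f' i) 1)) (f (σ' (σ i)))
  have h1 : ∀ i, h (σ i) (σ' (σ i)) (g i (σ i) (Pi.single (f' i) 1)) (f (σ' (σ i))) =
      ∑ k, h (σ i) (σ' (σ i)) (Pi.single k 1) (f (σ' (σ i))) *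
        g i (σ i) (Pi.single (f' i) 1) k := by
    intro i
    rw [sum_apply_single (h (σ i) (σ' (σ i))), Finset.sum_apply]
    exact Finset.sum_congr rfl fun k _ => mul_comm _ _
  rw [Finset.prod_congr rfl fun i _ => h1 i, Finset.prod_univ_sum, Fintype.piFinset_univ]
  -- reindex the multi-indices by `σ`
  refine Fintype.sum_equiv (Equiv.piCongrLeft (fun i => Fin (d i)) σ).symm _ _ fun k => ?_
  rw [Finset.prod_mul_distrib]
  congr 1
  exact (Equiv.prod_comp σ fun i => h i (σ' i) (Pi.single (k i) 1) (f (σ' i))).symm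

theorem kron_congr {σ : Equiv.Perm ι} {g h : ∀ i j, (Fin (d i) → F) →ₗ[F] (Fin (d j) → F)}
    (hgh : ∀ i, g i (σ i) = h i (σ i)) : kron σ g = kron σ h := by
  refine LinearMap.ext fun t => funext fun f => ?_
  simp only [kron_apply, hgh]

/-- The Kronecker product of endomorphisms `a i` of the spaces `F ^ (d i)`. -/
def tensorEnd (a : ∀ i, Module.End F (Fin (d i) → F)) : Module.End F (TensorSpace F d) :=
  kron 1 fun i j => if h : i = j then h ▸ a i else 0

theorem tensorEnd_apply (a : ∀ i, Module.End F (Fin (d i) → F)) (t f) :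
    tensorEnd a t f = ∑ f', (∏ i, a i (Pi.single (f' i) 1) (f i)) * t f' := by
  simp [tensorEnd, kron_apply]
  rfl

theorem kron_one (g : ∀ i j, (Fin (d i) → F) →ₗ[F] (Fin (d j) → F)) :
    kron 1 g = tensorEnd fun i => g i i := by
  refine LinearMap.ext fun t => funext fun f => ?_
  rw [tensorEnd_apply]
  rfl

theorem tensorEnd_single (a : ∀ i, Module.End F (Fin (d i) → F)) (f' f) :
    tensorEnd a (Pi.single f' 1) f = ∏ i, a i (Pi.single (f' i) 1) (f i) := by
  rw [tensorEnd, kron_single]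
  simp
  rfl

theorem tensorEnd_mul (a b : ∀ i, Module.End F (Fin (d i) → F)) :
    tensorEnd (fun i => a i * b i) = tensorEnd a * tensorEnd b := by
  rw [Module.End.mul_eq_comp, tensorEnd, tensorEnd, tensorEnd, kron_comp]
  refine kron_congr fun i => ?_
  change (if h : i = i then h ▸ (a i * b i) else 0) =
    (if h : i = i then h ▸ a i else 0) ∘ₗ (if h : i = i then h ▸ b i else 0)
  simp [Module.End.mul_eq_comp]

theorem tensorEnd_one : tensorEnd (fun i => (1 : Module.End F (Fin (d i) → F))) = 1 := by
  refine tensorSpace_hom_ext fun f' => funext fun f => ?_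
  rw [tensorEnd_single]
  by_cases h : f = f'
  · subst h
    simp
  · obtain ⟨i, hi⟩ := Function.ne_iff.mp h
    rw [Finset.prod_eq_zero (Finset.mem_univ i)]
    · simp [Pi.single_eq_of_ne h]
    · simp [Pi.single_eq_of_ne hi]

theorem tensorEnd_smul (c : ι → F) (a : ∀ i, Module.End F (Fin (d i) → F)) :
    tensorEnd (fun i => c i • a i) = (∏ i, c i) • tensorEnd a := by
  refine LinearMap.ext fun t => funext fun f => ?_
  simp only [tensorEnd_apply, LinearMap.smul_apply, Pi.smul_apply, smul_eq_mul,
    Finset.prod_mul_distrib, Finset.mul_sum, mul_assoc]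

/-- Kronecker products distribute over sums in all factors. -/
theorem tensorEnd_sum {κ : ι → Type*} [∀ i, Fintype (κ i)]
    (a : ∀ i, κ i → Module.End F (Fin (d i) → F)) :
    tensorEnd (fun i => ∑ k, a i k) = ∑ k : ∀ i, κ i, tensorEnd fun i => a i (k i) := by
  refine tensorSpace_hom_ext fun f' => funext fun f => ?_
  rw [tensorEnd_single, LinearMap.sum_apply, Finset.sum_apply]
  simp only [tensorEnd_single, LinearMap.sum_apply, Finset.sum_apply]
  rw [Finset.prod_univ_sum, Fintype.piFinset_univ]

/-- The outer tensor product of representations of the groups `M i`. -/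
def tensorRep {M : ι → Type*} [∀ i, Group (M i)] (ρ : ∀ i, Representation F (M i) (Fin (d i) → F)) :
    Representation F (∀ i, M i) (TensorSpace F d) where
  toFun e := tensorEnd fun i => ρ i (e i)
  map_one' := by
    simp only [Pi.one_apply, map_one]
    exact tensorEnd_one
  map_mul' e e' := by
    simp only [Pi.mul_apply, map_mul]
    exact tensorEnd_mul _ _

theorem tensorRep_apply {M : ι → Type*} [∀ i, Group (M i)]
    (ρ : ∀ i, Representation F (M i) (Fin (d i) → F)) (e : ∀ i, M i) :
    tensorRep ρ e = tensorEnd fun i => ρ i (e i) := rfl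

variable [IsAlgClosed F] {M : ι → Type*} [∀ i, Group (M i)]
  {ρ : ∀ i, Representation F (M i) (Fin (d i) → F)}

/-- A subspace invariant under an outer tensor product of irreducible representations is invariant
under all Kronecker products. -/
theorem tensorEnd_mem [∀ i, Finite (M i)] (hρ : ∀ i, (ρ i).IsIrreducible)
    {U : Submodule F (TensorSpace F d)}
    (hU : ∀ e, ∀ t ∈ U, tensorRep ρ e t ∈ U) (a : ∀ i, Module.End F (Fin (d i) → F)) {t}
    (ht : t ∈ U) : tensorEnd a t ∈ U := by
  have := fun i => Fintype.ofFinite (M i)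
  have h : ∀ i, ∃ c : M i → F, ∑ m, c m • ρ i m = a i := fun i => by
    rw [← Submodule.mem_span_range_iff_exists_fun, span_range_eq_top (hρ i)]
    trivial
  choose c hc using h
  have h1 : tensorEnd a = ∑ e : ∀ i, M i, (∏ i, c i (e i)) • tensorRep ρ e := by
    rw [← funext hc, tensorEnd_sum]
    exact Finset.sum_congr rfl fun e _ => tensorEnd_smul _ _
  rw [h1, LinearMap.sum_apply]
  exact U.sum_mem fun e _ => U.smul_mem _ (hU e t ht)

theorem tensorRep_irreducible [∀ i, Finite (M i)] (hρ : ∀ i, (ρ i).IsIrreducible) :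
    (tensorRep ρ).IsIrreducible := by
  rw [isIrreducible_iff]
  have hn := fun i => nontrivial_of_irreducible (hρ i)
  have hne : ∀ i, Nonempty (Fin (d i)) := fun i => by
    by_contra h
    rw [not_nonempty_iff] at h
    exact not_subsingleton (Fin (d i) → F) inferInstance
  refine ⟨inferInstance, fun U hU => or_iff_not_imp_left.mpr fun hbot => ?_⟩
  obtain ⟨t, ht, ht0⟩ := (Submodule.ne_bot_iff _).mp hbot
  obtain ⟨f₀, hf₀⟩ := Function.ne_iff.mp ht0
  have key : ∀ f, (Pi.single f 1 : TensorSpace F d) ∈ U := by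
    intro f
    -- the product of the matrix units `E (f i) (f₀ i)` maps `t` to `t f₀ • e_f`
    let E : ∀ i, Module.End F (Fin (d i) → F) := fun i =>
      (LinearMap.proj (R := F) (φ := fun _ : Fin (d i) => F) (f₀ i)).smulRight
        (Pi.single (f i) (1 : F))
    have h1 := tensorEnd_mem hρ hU E ht
    have h2 : tensorEnd E t = t f₀ • Pi.single f 1 := by
      funext f'
      rw [tensorEnd_apply, Finset.sum_eq_single f₀]
      · simp only [E, LinearMap.smulRight_apply, LinearMap.proj_apply, Pi.single_eq_same,
          Pi.smul_apply, smul_eq_mul, one_mul]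
        rw [mul_comm]
        congr 1
        by_cases h : f' = f
        · subst h
          simp
        · obtain ⟨i, hi⟩ := Function.ne_iff.mp h
          rw [Finset.prod_eq_zero (Finset.mem_univ i) (Pi.single_eq_of_ne hi _),
            Pi.single_eq_of_ne h]
      · intro f'' _ hf''
        obtain ⟨i, hi⟩ := Function.ne_iff.mp hf''
        rw [Finset.prod_eq_zero (Finset.mem_univ i), zero_mul]
        simp [E, Pi.single_eq_of_ne hi.symm]
      · simp
    rw [h2] at h1
    exact (U.smul_mem_iff hf₀).mp h1
  rw [eq_top_iff]
  intro s _
  rw [← (Pi.basisFun F (∀ i, Fin (d i))).sum_repr s]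
  exact U.sum_mem fun f _ => U.smul_mem _ (by simpa using key f)

end Kronecker

/-! ### Irreducible representations of direct products -/

section Factor

variable {F : Type*} [Field F] [IsAlgClosed F] {ι : Type*} [Fintype ι] [DecidableEq ι] {d : ι → ℕ}
  {M : ι → Type*} [∀ i, Group (M i)] {ρ : ∀ i, Representation F (M i) (Fin (d i) → F)}
  {V : Type*} [AddCommGroup V] [Module F V] {σ : Representation F (∀ i, M i) V}

omit [IsAlgClosed F] in
theorem commute_asAlgebraHom {G : Type*} [Group G] {τ : Representation F G V} {a : Module.End F V}
    (h : ∀ g, Commute (τ g) a) (r : F[G]) : Commute (τ.asAlgebraHom r) a := by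
  induction r using MonoidAlgebra.induction_linear with
  | zero => simp
  | add x y hx hy => rw [map_add]; exact hx.add_left hy
  | single m c =>
    rw [Representation.asAlgebraHom_single]
    exact (h m).smul_left c

omit [IsAlgClosed F] [Fintype ι] in
/-- The `i`-th factor acts on an irreducible representation of a product through any irreducible
constituent of its restriction to that factor. -/
theorem asAlgebraHom_mulSingle_eq_zero (hσ : σ.IsIrreducible) {i : ι} {W : Type*} [AddCommGroup W]
    [Module F W] {τ : Representation F (M i) W} {f : W →ₗ[F] V}
    (hf : τ.IsIntertwiningMap (resRep σ (MonoidHom.mulSingle M i)) f) (hf0 : f ≠ 0)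
    {r : F[M i]} (hr : τ.asAlgebraHom r = 0) :
    (resRep σ (MonoidHom.mulSingle M i)).asAlgebraHom r = 0 := by
  let U : Submodule F V :=
    { carrier := {v | ∀ r, τ.asAlgebraHom r = 0 →
        (resRep σ (MonoidHom.mulSingle M i)).asAlgebraHom r v = 0}
      add_mem' := fun {v w} hv hw r hr => by rw [map_add, hv r hr, hw r hr, add_zero]
      zero_mem' := fun r _ => map_zero _
      smul_mem' := fun a v hv r hr => by rw [map_smul, hv r hr, smul_zero] }
  have hU : ∀ e, ∀ v ∈ U, σ e v ∈ U := by
    intro e v hv r hr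
    have he : e = Function.update e i 1 * Pi.mulSingle i (e i) := by
      funext j
      by_cases h : j = i
      · subst h; simp
      · simp [h]
    -- the part of `e` away from `i` commutes with `r`, the other part is absorbed into `r`
    have h1 : Commute ((resRep σ (MonoidHom.mulSingle M i)).asAlgebraHom r)
        (σ (Function.update e i 1)) := by
      refine commute_asAlgebraHom (τ := resRep σ (MonoidHom.mulSingle M i)) (fun m => ?_) r
      change Commute (σ (Pi.mulSingle i m)) _
      refine Commute.map ?_ σ
      funext j
      by_cases h : j = i
      · subst h; simp
      · simp [h]
    have h2 := hv (r * MonoidAlgebra.single (e i) 1) (by rw [map_mul, hr, zero_mul])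
    rw [map_mul, Representation.asAlgebraHom_single_one] at h2
    rw [he, map_mul, Module.End.mul_apply, ← Module.End.mul_apply _ (σ (Function.update e i 1)),
      h1.eq, Module.End.mul_apply]
    refine (congrArg _ h2).trans (map_zero _)
  have hU0 : U ≠ ⊥ := by
    obtain ⟨w, hw⟩ := DFunLike.ne_iff.mp hf0
    refine (Submodule.ne_bot_iff _).mpr ⟨f w, fun r hr => ?_, hw⟩
    rw [← asAlgebraHom_map hf, hr, LinearMap.zero_apply, map_zero]
  have hUt := ((isIrreducible_iff.mp hσ).2 U hU).resolve_left hU0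
  refine LinearMap.ext fun v => ?_
  have : v ∈ U := by rw [hUt]; trivial
  exact this r hr

/-- An irreducible representation of a product of groups is the outer tensor product of irreducible
constituents of its restrictions to the factors. -/
theorem nonempty_tensorRep_equiv [∀ i, Finite (M i)] (hσ : σ.IsIrreducible)
    (hρ : ∀ i, (ρ i).IsIrreducible) (f : ∀ i, (Fin (d i) → F) →ₗ[F] V)
    (hf : ∀ i, (ρ i).IsIntertwiningMap (resRep σ (MonoidHom.mulSingle M i)) (f i))
    (hf0 : ∀ i, f i ≠ 0) : Nonempty ((tensorRep ρ).Equiv σ) := by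
  choose α hα using fun i => exists_algHom_end (hρ i)
    (fun r hr => asAlgebraHom_mulSingle_eq_zero hσ (hf i) (hf0 i) (r := r) hr)
  have hcomm : Pairwise fun i j => ∀ (a : Module.End F (Fin (d i) → F))
      (b : Module.End F (Fin (d j) → F)), Commute (α i a) (α j b) := by
    intro i j hij a b
    obtain ⟨r, rfl⟩ := asAlgebraHom_surjective (hρ i) a
    obtain ⟨s, rfl⟩ := asAlgebraHom_surjective (hρ j) b
    rw [hα, hα]
    exact commute_asAlgebraHom (fun x => (commute_asAlgebraHom (fun y =>
      (Pi.mulSingle_commute hij x y).symm.map σ) s).symm) r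
  -- The matrix algebras act on `V` through the images of the group algebras of the factors. These
  -- actions commute and combine to a multilinear map `A` with `A (ρ i (e i))_i = σ e`.
  let A : (∀ i, Module.End F (Fin (d i) → F)) →* Module.End F V :=
    MonoidHom.noncommPiCoprod (fun i => (α i : Module.End F (Fin (d i) → F) →* Module.End F V)) hcomm
  have hA : ∀ (a : ∀ i, Module.End F (Fin (d i) → F)) i x,
      A (Function.update a i x) = A (Function.update a i 1) * α i x := by
    intro a i x
    have h1 : Function.update a i x = Function.update a i 1 * Pi.mulSingle i x := by
      funext j
      by_cases h : j = i
      · subst h; simp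
      · simp [h]
    rw [h1, map_mul]
    congr 1
    exact MonoidHom.noncommPiCoprod_mulSingle (N := fun i => Module.End F (Fin (d i) → F)) _ i x
  let A' : MultilinearMap F (fun i => Module.End F (Fin (d i) → F)) (Module.End F V) :=
    MultilinearMap.mk' A
      (fun a i x y => by rw [hA a i (x + y), hA a i x, hA a i y, map_add, mul_add])
      (fun a i c x => by rw [hA a i (c • x), hA a i x, map_smul, mul_smul_comm])
  have hAσ : ∀ e, A (fun i => ρ i (e i)) = σ e := by
    let B : (∀ i, M i) →* Module.End F V :=
      A.comp (MonoidHom.pi fun i => (ρ i : M i →* _).comp (Pi.evalMonoidHom M i))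
    have hB : B = σ := by
      refine MonoidHom.pi_ext fun i m => ?_
      change A (fun j => ρ j (Pi.mulSingle (M := M) i m j)) = σ (Pi.mulSingle i m)
      have h1 : (fun j => ρ j (Pi.mulSingle (M := M) i m j)) = Pi.mulSingle i (ρ i m) := by
        funext j
        by_cases h : j = i
        · subst h; simp
        · simp [h]
      rw [h1]
      refine (MonoidHom.noncommPiCoprod_mulSingle
        (N := fun i => Module.End F (Fin (d i) → F)) _ i _).trans ?_
      have := hα i (MonoidAlgebra.single m 1)
      rw [Representation.asAlgebraHom_single_one, Representation.asAlgebraHom_single_one] at this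
      exact this
    exact fun e => DFunLike.congr_fun hB e
  -- the matrix units `E i k l` and their images in `End V`
  let E : ∀ i, Fin (d i) → Fin (d i) → Module.End F (Fin (d i) → F) := fun i k l =>
    (LinearMap.proj (R := F) (φ := fun _ : Fin (d i) => F) l).smulRight (Pi.single k (1 : F))
  have hE1 : ∑ f : ∀ i, Fin (d i), A (fun i => E i (f i) (f i)) = 1 := by
    have h1 : (fun i => ∑ k, E i k k) = (1 : ∀ i, Module.End F (Fin (d i) → F)) := by
      funext i
      refine LinearMap.ext fun x => funext fun l => ?_
      simp [E, LinearMap.sum_apply, Finset.sum_apply, Pi.single_apply]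
    rw [← map_one A, ← h1]
    exact (A'.map_sum fun i k => E i k k).symm
  have := nontrivial_of_irreducible hσ
  obtain ⟨f₀, hf₀⟩ : ∃ f : ∀ i, Fin (d i), A (fun i => E i (f i) (f i)) ≠ 0 := by
    by_contra h
    push Not at h
    rw [Finset.sum_eq_zero fun f _ => h f] at hE1
    exact zero_ne_one hE1
  obtain ⟨v₀, hv₀⟩ := DFunLike.ne_iff.mp hf₀
  let Φ : TensorSpace F d →ₗ[F] V :=
    Fintype.linearCombination F fun f => A (fun i => E i (f i) (f₀ i)) v₀
  have hΦ1 : ∀ f, Φ (Pi.single f 1) = A (fun i => E i (f i) (f₀ i)) v₀ := fun f => by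
    simp [Φ, Fintype.linearCombination_apply_single]
  have hΦ : (tensorRep ρ).IsIntertwiningMap σ Φ := by
    refine ⟨fun e t => ?_⟩
    have key : Φ ∘ₗ tensorRep ρ e = σ e ∘ₗ Φ := by
      refine tensorSpace_hom_ext fun f => ?_
      rw [LinearMap.comp_apply, LinearMap.comp_apply, hΦ1, ← hAσ, ← Module.End.mul_apply, ← map_mul]
      have h1 : (fun i => ρ i (e i)) * (fun i => E i (f i) (f₀ i)) =
          fun i => ∑ k, ρ i (e i) (Pi.single (f i) 1) k • E i k (f₀ i) := by
        funext i
        refine LinearMap.ext fun x => funext fun l => ?_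
        simp [E, LinearMap.sum_apply, Finset.sum_apply, Pi.single_apply, mul_comm]
      have h2 : A ((fun i => ρ i (e i)) * (fun i => E i (f i) (f₀ i))) =
          ∑ f' : ∀ i, Fin (d i), (∏ i, ρ i (e i) (Pi.single (f i) 1) (f' i)) •
            A (fun i => E i (f' i) (f₀ i)) := by
        rw [h1]
        refine (A'.map_sum fun i k => ρ i (e i) (Pi.single (f i) 1) k • E i k (f₀ i)).trans ?_
        refine Finset.sum_congr rfl fun f' _ => ?_
        exact A'.map_smul_univ (fun i => ρ i (e i) (Pi.single (f i) 1) (f' i))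
          (fun i => E i (f' i) (f₀ i))
      rw [h2, LinearMap.sum_apply]
      change (∑ f', tensorRep ρ e (Pi.single f 1) f' • A (fun i => E i (f' i) (f₀ i)) v₀) = _
      refine Finset.sum_congr rfl fun f' _ => ?_
      rw [tensorRep_apply, tensorEnd_single]
      rfl
    exact LinearMap.congr_fun key t
  exact nonempty_equiv_of_isIntertwiningMap (tensorRep_irreducible hρ) hσ hΦ
    fun h0 => hv₀ (by rw [← hΦ1, h0]; rfl)

end Factor

/-! ### Extension of representations by central scalars -/

section CentralProduct

variable {F : Type*} [Field F] {N M : Type*} [Group N] [Group M] {V : Type*} [AddCommGroup V]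
  [Module F V] (Θ : N →* M) (Z : Subgroup M)

/-- A representation of `N` extends along `Θ : N →* M` to `M = Z * Θ(N)`, with the central subgroup
`Z` acting by given scalars, if the two prescriptions agree. -/
theorem exists_extension_of_central (hZ : Z ≤ Subgroup.center M)
    (hgen : ∀ m, ∃ z ∈ Z, ∃ e, m = z * Θ e) (τ : Representation F N V) (lam : Z →* F)
    (h : ∀ (e : N) (he : Θ e ∈ Z), τ e = lam ⟨Θ e, he⟩ • 1) :
    ∃ R : Representation F M V, (∀ e, R (Θ e) = τ e) ∧ ∀ z : Z, R z = lam z • 1 := by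
  choose z hz e hze using hgen
  have key : ∀ (m : M) (z' : Z) (e' : N), m = z' * Θ e' →
      lam ⟨z m, hz m⟩ • τ (e m) = lam z' • τ e' := by
    intro m z' e' hm
    have h1 : Θ (e m * e'⁻¹) = (⟨z m, hz m⟩⁻¹ * z' : Z) := by
      rw [map_mul, map_inv, mul_inv_eq_iff_eq_mul]
      push_cast
      rw [mul_assoc, ← hm, eq_inv_mul_iff_mul_eq]
      exact (hze m).symm
    have h2 : Θ (e m * e'⁻¹) ∈ Z := by rw [h1]; exact SetLike.coe_mem _
    have h3 := h _ h2
    have h4 : τ (e m) = τ (e m * e'⁻¹) * τ e' := by rw [← map_mul, inv_mul_cancel_right]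
    have h5 : (⟨Θ (e m * e'⁻¹), h2⟩ : Z) = ⟨z m, hz m⟩⁻¹ * z' := Subtype.ext h1
    rw [h4, h3, h5, smul_mul_assoc, one_mul, smul_smul, ← map_mul, mul_inv_cancel_left]
  refine ⟨{ toFun := fun m => lam ⟨z m, hz m⟩ • τ (e m), map_one' := ?_, map_mul' := ?_ },
    fun e' => ?_, fun z' => ?_⟩
  · rw [key 1 1 1 (by simp)]
    simp
  · intro m m'
    have h1 : m * m' = (⟨z m, hz m⟩ * ⟨z m', hz m'⟩ : Z) * Θ (e m * e m') := by
      conv_lhs => rw [hze m, hze m']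
      push_cast
      rw [map_mul, mul_assoc, mul_assoc, ← mul_assoc (Θ (e m)),
        Subgroup.mem_center_iff.mp (hZ (hz m')) (Θ (e m)), mul_assoc]
    rw [key _ _ _ h1, map_mul, map_mul, smul_mul_smul_comm]
  · exact (key (Θ e') 1 e' (by simp)).trans (by simp)
  · exact (key z' z' 1 (by simp)).trans (by simp)

end CentralProduct

/-! ### `p`-groups in characteristic `p` -/

section PGroup

variable {F : Type*} [Field F] {p : ℕ} [Fact p.Prime] [CharP F p] {V : Type*} [AddCommGroup V]
  [Module F V]

/-- A `p`-group acting on a nonzero vector space of characteristic `p` has a nonzero fixed vector: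
it acts on the finite `𝔽_p`-span of an orbit. -/
theorem exists_fixed_vector {P : Type*} [Group P] [Finite P] (hP : IsPGroup p P)
    (ρ : Representation F P V) [Nontrivial V] : ∃ v ≠ 0, ∀ g, ρ g v = v := by
  obtain ⟨v₀, hv₀⟩ := exists_ne (0 : V)
  let _ : Algebra (ZMod p) F := ZMod.algebra F p
  let _ : Module (ZMod p) V := Module.compHom V (algebraMap (ZMod p) F)
  let S : Submodule (ZMod p) V := Submodule.span (ZMod p) (Set.range fun g => ρ g v₀)
  have hS : ∀ g, ∀ v ∈ S, ρ g v ∈ S := by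
    intro g v hv
    induction hv using Submodule.span_induction with
    | mem x hx =>
      obtain ⟨h, rfl⟩ := hx
      change ρ g (ρ h v₀) ∈ S
      rw [← Module.End.mul_apply, ← map_mul]
      exact Submodule.subset_span ⟨_, rfl⟩
    | zero => rw [map_zero]; exact S.zero_mem
    | add x y _ _ hx hy => rw [map_add]; exact S.add_mem hx hy
    | smul a x _ hx =>
      have : ρ g (a • x) = a • ρ g x := (ρ g).map_smul (algebraMap (ZMod p) F a) x
      rw [this]
      exact S.smul_mem a hx
  let _ : MulAction P S :=
    { smul := fun g s => ⟨ρ g s, hS g s s.2⟩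
      one_smul := fun s => Subtype.ext (by change ρ 1 _ = _; rw [map_one]; rfl)
      mul_smul := fun g h s => Subtype.ext (by change ρ (g * h) _ = ρ g (ρ h _); rw [map_mul]; rfl) }
  have hfg : Module.Finite (ZMod p) S := Module.Finite.span_of_finite _ (Set.finite_range _)
  have hfin : Finite S := Module.finite_of_finite (ZMod p)
  have hv₀S : v₀ ∈ S := Submodule.subset_span ⟨1, by simp⟩
  have hnt : Nontrivial S := ⟨⟨⟨v₀, hv₀S⟩, 0, fun h => hv₀ (congrArg Subtype.val h)⟩⟩
  have hcard : p ∣ Nat.card S := by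
    have := Fintype.ofFinite S
    rw [Nat.card_eq_fintype_card, Module.card_eq_pow_finrank (K := ZMod p), ZMod.card]
    exact dvd_pow_self p (Module.finrank_pos).ne'
  have hfix : (0 : S) ∈ MulAction.fixedPoints P S := fun g => Subtype.ext (map_zero (ρ g))
  obtain ⟨s, hs, hs0⟩ := hP.exists_fixed_point_of_prime_dvd_card_of_fixed_point S hcard hfix
  exact ⟨s, fun h => hs0 (Subtype.ext h.symm), fun g => congrArg Subtype.val (hs g)⟩

/-- A normal `p`-subgroup acts trivially on an irreducible representation in characteristic `p`. -/
theorem eq_one_of_mem_normal_pgroup {N : Type*} [Group N] [Finite N] {ρ : Representation F N V}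
    (hρ : ρ.IsIrreducible) (P : Subgroup N) [P.Normal] (hP : IsPGroup p P) {x : N} (hx : x ∈ P) :
    ρ x = 1 := by
  have := nontrivial_of_irreducible hρ
  obtain ⟨v, hv, hfix⟩ := exists_fixed_vector hP (resRep ρ P.subtype)
  let U : Submodule F V :=
    { carrier := {w | ∀ y ∈ P, ρ y w = w}
      add_mem' := fun {a b} ha hb y hy => by rw [map_add, ha y hy, hb y hy]
      zero_mem' := fun y _ => map_zero _
      smul_mem' := fun c a ha y hy => by rw [map_smul, ha y hy] }
  have hU := ((isIrreducible_iff.mp hρ).2 U fun g w hw y hy => by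
    have h1 := hw (g⁻¹ * y * g) (by simpa using ‹P.Normal›.conj_mem y hy g⁻¹)
    have h2 : y * g = g * (g⁻¹ * y * g) := by group
    rw [← Module.End.mul_apply, ← map_mul, h2, map_mul, Module.End.mul_apply, h1]).resolve_left
      ((Submodule.ne_bot_iff _).mpr ⟨v, fun y hy => hfix ⟨y, hy⟩, hv⟩)
  refine LinearMap.ext fun w => ?_
  have : w ∈ U := by rw [hU]; trivial
  exact this x hx

end PGroup

/-! ### Higman's criterion -/

section Higman

variable {F : Type*} [Field F] {A : Type*} [Group A] [Fintype A] {V : Type*} [AddCommGroup V]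
  [Module F V]

/-- Higman's criterion: a module is projective if and only if its identity map is a trace. -/
theorem projective_iff_exists_sum_eq_one (σ : Representation F A V) :
    Module.Projective F[A] σ.asModule ↔
      ∃ f : Module.End F V, ∑ a, Representation.linHom σ σ a f = 1 := by
  have hsm : ∀ (a : A) (x : σ.asModule), (MonoidAlgebra.single a (1 : F) : F[A]) • x =
      σ.asModuleEquiv.symm (σ a (σ.asModuleEquiv x)) := fun a x => by
    rw [Representation.single_smul, one_smul]; rfl
  constructor
  · intro h
    -- the summation map from the coinduced module `A → V` onto `V` splits
    let τ := translationRep F A V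
    let T : (A → V) →ₗ[F] V := ∑ a, σ a⁻¹ ∘ₗ LinearMap.proj a
    have hT : ∀ φ, T φ = ∑ a, σ a⁻¹ (φ a) := fun φ => by simp [T]
    have hTe : ∀ g φ, T (τ g φ) = σ g (T φ) := by
      intro g φ
      rw [hT, hT, map_sum]
      refine Fintype.sum_equiv (Equiv.mulRight g) _ _ fun a => ?_
      change σ a⁻¹ (φ (a * g)) = σ g (σ (a * g)⁻¹ (φ (a * g)))
      rw [← Module.End.mul_apply, ← map_mul]
      congr 2
      group
    let T' : τ.asModule →ₗ[F[A]] σ.asModule :=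
      MonoidAlgebra.equivariantOfLinearOfComm (R := F) (M := A) (V := τ.asModule)
        (W := σ.asModule) T fun g φ => by
          rw [Representation.single_smul, Representation.single_smul, one_smul, one_smul]
          exact hTe g φ
    have hsurj : Function.Surjective T' := by
      classical
      intro v'
      obtain ⟨v, rfl⟩ : ∃ v : V, σ.asModuleEquiv.symm v = v' := ⟨_, rfl⟩
      refine ⟨τ.asModuleEquiv.symm (Pi.single 1 v : A → V), (hT _).trans ?_⟩
      change _ = v
      change ∑ a, σ a⁻¹ (Pi.single (M := fun _ : A => V) 1 v a) = v
      rw [Finset.sum_eq_single 1]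
      · rw [inv_one, map_one, Pi.single_eq_same]; rfl
      · intro a _ ha
        rw [Pi.single_eq_of_ne ha, map_zero]
      · simp
    obtain ⟨s, hs⟩ := Module.projective_lifting_property T' LinearMap.id hsurj
    let s' : V →ₗ[F] (A → V) := s.restrictScalars F
    refine ⟨LinearMap.proj (1 : A) ∘ₗ s', LinearMap.ext fun v => ?_⟩
    have hsm' : ∀ (a : A) (x : τ.asModule), (MonoidAlgebra.single a (1 : F) : F[A]) • x =
        τ.asModuleEquiv.symm (τ a (τ.asModuleEquiv x)) := fun a x => by
      rw [Representation.single_smul, one_smul]; rfl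
    have hs' : ∀ a v, s' (σ a v) = τ a (s' v) := by
      intro a v
      have := s.map_smul (MonoidAlgebra.single a (1 : F)) (σ.asModuleEquiv.symm v)
      rw [hsm, hsm'] at this
      exact this
    have h1 : T (s' v) = v := congrArg (fun f : σ.asModule →ₗ[F[A]] σ.asModule => f v) hs
    rw [LinearMap.sum_apply]
    refine Eq.trans ?_ h1
    rw [hT]
    refine Fintype.sum_equiv (Equiv.inv A) _ _ fun a => ?_
    change σ a (s' (σ a⁻¹ v) 1) = σ a⁻¹⁻¹ (s' v a⁻¹)
    rw [hs', inv_inv]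
    change σ a (s' v (1 * a⁻¹)) = _
    rw [one_mul]
  · rintro ⟨f, hf⟩
    let L := Finsupp.linearCombination F[A] (id : σ.asModule → σ.asModule)
    have hL : Function.Surjective L := fun x => ⟨Finsupp.single x 1, by simp [L]⟩
    obtain ⟨s, hs⟩ := LinearMap.exists_rightInverse_of_surjective (L.restrictScalars F)
      (LinearMap.range_eq_top.mpr hL)
    let B := σ.asModule →₀ F[A]
    let t : A → σ.asModule →ₗ[F] B := fun a =>
      Algebra.lsmul F F B (MonoidAlgebra.single a (1 : F)) ∘ₗ s ∘ₗ
        σ.asModuleEquiv.symm.toLinearMap ∘ₗ (f * σ a⁻¹) ∘ₗ σ.asModuleEquiv.toLinearMap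
    have ht : ∀ a x, t a x = (MonoidAlgebra.single a (1 : F) : F[A]) •
      s (σ.asModuleEquiv.symm (f (σ a⁻¹ (σ.asModuleEquiv x)))) := fun _ _ => rfl
    -- the average of an `F`-linear splitting
    let s' : σ.asModule →ₗ[F[A]] B := MonoidAlgebra.equivariantOfLinearOfComm (∑ a, t a) (by
      intro g x
      rw [LinearMap.sum_apply, LinearMap.sum_apply, Finset.smul_sum]
      refine Fintype.sum_equiv (Equiv.mulLeft g⁻¹) _ _ fun a => ?_
      rw [ht, ht, smul_smul, MonoidAlgebra.single_mul_single, hsm, one_mul]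
      have h1 : g * (Equiv.mulLeft g⁻¹) a = a := by simp
      have h2 : ((Equiv.mulLeft g⁻¹) a)⁻¹ = a⁻¹ * g := by simp
      rw [h1, h2, map_mul]
      rfl)
    refine Module.projective_def'.mpr ⟨s', LinearMap.ext fun x => ?_⟩
    have h2 : ∀ a, L (t a x) =
        σ.asModuleEquiv.symm (Representation.linHom σ σ a f (σ.asModuleEquiv x)) := fun a => by
      rw [ht, map_smul]
      have h1 := congrArg (fun g : σ.asModule →ₗ[F] σ.asModule =>
        g (σ.asModuleEquiv.symm (f (σ a⁻¹ (σ.asModuleEquiv x))))) hs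
      refine (congrArg _ h1).trans ?_
      rw [hsm]
      rfl
    change L ((∑ a, t a) x) = x
    rw [LinearMap.sum_apply, map_sum, Finset.sum_congr rfl fun a _ => h2 a, ← map_sum,
      ← LinearMap.sum_apply, hf]
    rfl

end Higman

/-! ### Representations whose projective image is of defect zero -/

section DefectZero

variable {F : Type*} [Field F] {N : Type*} [Group N] {V : Type w} [AddCommGroup V] [Module F V]
  {W : Type*} [AddCommGroup W] [Module F W]

/-- The condition that the identity map is a trace for the group of the automorphisms of
`Module.End F V` induced by `ρ`. It depends only on the projective image of `ρ`. -/
def IsDefectZero (ρ : Representation F N V) : Prop :=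
  ∃ f : Module.End F V, ∑ᶠ c ∈ Set.range ⇑(Representation.linHom ρ ρ), c f = 1

/-- `s` is a transversal of the kernel of the projective representation defined by `ρ`. -/
structure IsProjTransversal (ρ : Representation F N V) {T : Type*} (s : T → N) : Prop where
  injective : Function.Injective fun t => Representation.linHom ρ ρ (s t)
  surjective : ∀ x, ∃ t, Representation.linHom ρ ρ (s t) = Representation.linHom ρ ρ x

variable {ρ : Representation F N V} {σ : Representation F N W}

theorem IsProjTransversal.isDefectZero_iff {T : Type*} [Fintype T] {s : T → N}
    (hs : IsProjTransversal ρ s) :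
    IsDefectZero ρ ↔ ∃ f : Module.End F V, ∑ t, Representation.linHom ρ ρ (s t) f = 1 := by
  have h : Set.range ⇑(Representation.linHom ρ ρ) =
      Set.range fun t => Representation.linHom ρ ρ (s t) := by
    ext c
    constructor
    · rintro ⟨x, rfl⟩; exact hs.surjective x
    · rintro ⟨t, rfl⟩; exact ⟨s t, rfl⟩
  refine exists_congr fun f => ?_
  rw [h, finsum_mem_range hs.injective, finsum_eq_sum_of_fintype]

variable (ρ) in
theorem exists_isProjTransversal [Finite N] :
    ∃ (T : Type w) (_ : Fintype T) (s : T → N), IsProjTransversal ρ s := by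
  have := Fintype.ofFinite (Set.range ⇑(Representation.linHom ρ ρ))
  refine ⟨Set.range ⇑(Representation.linHom ρ ρ), this, fun t => t.2.choose, fun t t' h => ?_,
    fun x => ⟨⟨Representation.linHom ρ ρ x, x, rfl⟩,
      (⟨x, rfl⟩ : ∃ y, Representation.linHom ρ ρ y = Representation.linHom ρ ρ x).choose_spec⟩⟩
  exact Subtype.ext (t.2.choose_spec.symm.trans (h.trans t'.2.choose_spec))

theorem IsDefectZero.of_equiv [Finite N] (e : ρ.Equiv σ) (h : IsDefectZero ρ) :
    IsDefectZero σ := by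
  obtain ⟨T, _, s, hs⟩ := exists_isProjTransversal ρ
  let E : Module.End F V ≃ₗ[F] Module.End F W := e.toLinearEquiv.conj
  have hE : ∀ x f, Representation.linHom σ σ x (E f) = E (Representation.linHom ρ ρ x f) := by
    intro x f
    have h1 := fun y v => (isIntertwiningMap_equiv e).isIntertwining y v
    refine LinearMap.ext fun w => ?_
    obtain ⟨v, rfl⟩ := e.toLinearEquiv.surjective w
    change σ x (e.toLinearEquiv (f (e.toLinearEquiv.symm (σ x⁻¹ (e.toLinearEquiv v))))) =
      e.toLinearEquiv (ρ x (f (ρ x⁻¹ (e.toLinearEquiv.symm (e.toLinearEquiv v)))))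
    have h2 : σ x⁻¹ (e.toLinearEquiv v) = e.toLinearEquiv (ρ x⁻¹ v) := (h1 _ _).symm
    rw [h2, LinearEquiv.symm_apply_apply, LinearEquiv.symm_apply_apply]
    exact (h1 _ _).symm
  have hE' : ∀ x y, Representation.linHom σ σ x = Representation.linHom σ σ y ↔
      Representation.linHom ρ ρ x = Representation.linHom ρ ρ y := by
    intro x y
    constructor
    · intro h
      refine LinearMap.ext fun f => E.injective ?_
      rw [← hE, ← hE, h]
    · intro h
      refine LinearMap.ext fun f => ?_
      obtain ⟨f, rfl⟩ := E.surjective f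
      rw [hE, hE, h]
  have hs' : IsProjTransversal σ s :=
    ⟨fun t t' h => hs.injective ((hE' _ _).mp h), fun x =>
      (hs.surjective x).imp fun t ht => (hE' _ _).mpr ht⟩
  obtain ⟨f, hf⟩ := hs.isDefectZero_iff.mp h
  refine hs'.isDefectZero_iff.mpr ⟨E f, ?_⟩
  rw [Finset.sum_congr rfl fun t _ => hE (s t) f, ← map_sum, hf]
  exact e.toLinearEquiv.conj_id

theorem linHom_eq_of_eq_smul {N' : Type*} [Group N'] {ρ' : Representation F N' V} {x : N} {y : N'}
    {c : F} (h : ρ x = c • ρ' y) : Representation.linHom ρ ρ x = Representation.linHom ρ' ρ' y := by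
  have hinv : ρ x * ρ x⁻¹ = 1 := by rw [← map_mul, mul_inv_cancel, map_one]
  have hinv' : ρ' y⁻¹ * ρ' y = 1 := by rw [← map_mul, inv_mul_cancel, map_one]
  refine LinearMap.ext fun f => ?_
  change ρ x * (f * ρ x⁻¹) = ρ' y * (f * ρ' y⁻¹)
  have h1 : ρ' y⁻¹ = c • ρ x⁻¹ := by
    calc ρ' y⁻¹ = ρ' y⁻¹ * (ρ x * ρ x⁻¹) := by rw [hinv, mul_one]
      _ = c • (ρ' y⁻¹ * ρ' y * ρ x⁻¹) := by
        rw [h, smul_mul_assoc, mul_smul_comm, mul_assoc]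
      _ = c • ρ x⁻¹ := by rw [hinv', one_mul]
  rw [h, h1, smul_mul_assoc, mul_smul_comm, mul_smul_comm]

/-- Representations of different groups on the same space with the same projective image are of
defect zero simultaneously. -/
theorem isDefectZero_congr {N' : Type*} [Group N'] {ρ' : Representation F N' V}
    (h : ∀ x, ∃ y, ∃ c : F, ρ x = c • ρ' y) (h' : ∀ y, ∃ x, ∃ c : F, ρ' y = c • ρ x) :
    IsDefectZero ρ ↔ IsDefectZero ρ' := by
  have : Set.range ⇑(Representation.linHom ρ ρ) = Set.range ⇑(Representation.linHom ρ' ρ') := by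
    ext b
    constructor
    · rintro ⟨x, rfl⟩
      obtain ⟨y, c, hy⟩ := h x
      exact ⟨y, (linHom_eq_of_eq_smul hy).symm⟩
    · rintro ⟨y, rfl⟩
      obtain ⟨x, c, hx⟩ := h' y
      exact ⟨x, (linHom_eq_of_eq_smul hx).symm⟩
  rw [IsDefectZero, IsDefectZero, this]

/-- A full trace is a multiple of the trace over the projective image. -/
theorem exists_sum_eq_one_iff {p : ℕ} [Fact p.Prime] [CharP F p] [Fintype N] [Nontrivial V] :
    (∃ f : Module.End F V, ∑ a, Representation.linHom ρ ρ a f = 1) ↔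
      ¬ p ∣ Nat.card (Representation.linHom ρ ρ).ker ∧ IsDefectZero ρ := by
  classical
  obtain ⟨T, _, s, hs⟩ := exists_isProjTransversal ρ
  have h1 : ∀ f, ∑ a, Representation.linHom ρ ρ a f =
      (Nat.card (Representation.linHom ρ ρ).ker : F) •
        ∑ t, Representation.linHom ρ ρ (s t) f := by
    intro f
    rw [Finset.sum_comp (fun c : Module.End F (Module.End F V) => c f)
      (fun a => Representation.linHom ρ ρ a), Finset.smul_sum]
    have himg : (Finset.univ.image fun a => Representation.linHom ρ ρ a) =
        Finset.univ.image fun t => Representation.linHom ρ ρ (s t) := by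
      ext c
      simp only [Finset.mem_image, Finset.mem_univ, true_and]
      constructor
      · rintro ⟨x, rfl⟩; exact hs.surjective x
      · rintro ⟨t, rfl⟩; exact ⟨s t, rfl⟩
    rw [himg, Finset.sum_image fun t _ t' _ h => hs.injective h]
    refine Finset.sum_congr rfl fun t _ => ?_
    rw [MonoidHom.card_fiber_eq_of_mem_range (Representation.linHom ρ ρ) ⟨s t, rfl⟩
      ⟨1, map_one _⟩, ← Fintype.card_subtype, ← Nat.card_eq_fintype_card, Nat.cast_smul_eq_nsmul]
    rfl
  rw [hs.isDefectZero_iff, ← CharP.cast_eq_zero_iff F p]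
  simp only [h1]
  constructor
  · rintro ⟨f, hf⟩
    refine ⟨fun h => ?_, (Nat.card (Representation.linHom ρ ρ).ker : F) • f, ?_⟩
    · rw [h, zero_smul] at hf
      exact zero_ne_one hf
    · simp only [map_smul]
      rw [← Finset.smul_sum, hf]
  · rintro ⟨h, f, hf⟩
    refine ⟨(Nat.card (Representation.linHom ρ ρ).ker : F)⁻¹ • f, ?_⟩
    simp only [map_smul]
    rw [← Finset.smul_sum, hf, smul_smul, mul_inv_cancel₀ h, one_smul]

/-- The kernel of the projective representation defined by an irreducible `ρ` consists of the
elements that act by scalars. -/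
theorem linHom_eq_one_iff [IsAlgClosed F] [FiniteDimensional F V] (hρ : ρ.IsIrreducible) {x : N} :
    Representation.linHom ρ ρ x = 1 ↔ ∃ c : F, ρ x = c • 1 := by
  have hinv : ρ x * ρ x⁻¹ = 1 := by rw [← map_mul, mul_inv_cancel, map_one]
  constructor
  · intro h
    refine exists_smul_of_isIntertwiningMap hρ ⟨fun g v => ?_⟩
    have h1 := congrArg (fun c : Module.End F (Module.End F V) => c (ρ g) (ρ x v)) h
    change ρ x (ρ g (ρ x⁻¹ (ρ x v))) = ρ g (ρ x v) at h1
    rw [← h1, ← Module.End.mul_apply (ρ x⁻¹), ← map_mul, inv_mul_cancel, map_one]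
    rfl
  · rintro ⟨c, hc⟩
    refine LinearMap.ext fun f => ?_
    change ρ x * (f * ρ x⁻¹) = f
    rw [← mul_assoc, hc, smul_mul_assoc, one_mul, ← mul_one f, smul_mul_assoc, mul_assoc, one_mul,
      ← mul_smul_comm, ← smul_one_mul c (ρ x⁻¹), ← hc, hinv]

end DefectZero

/-! ### A criterion for weights -/

section WeightCriterion

variable {F : Type u} [Field F] [IsAlgClosed F] {p : ℕ} [Fact p.Prime] [CharP F p] {G : Type v}
  [Group G] [Finite G]

/-- An irreducible representation of `N_G(Q)` defines a weight if and only if `Q` contains all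
`p`-elements that act by scalars and the projective image is of defect zero. -/
theorem isWeightChar_iff {Q : Subgroup G} (hQ : IsPGroup p Q)
    (ρ : IrrRep F (Subgroup.normalizer (Q : Set G))) :
    IsWeightChar Q ρ.cls ↔
      (∀ x : Subgroup.normalizer (Q : Set G), (∃ k : ℕ, x ^ p ^ k = 1) →
        (∃ c : F, ρ.rep x = c • 1) → (x : G) ∈ Q) ∧ IsDefectZero ρ.rep := by
  have hnormal : (Q.subgroupOf (Subgroup.normalizer (Q : Set G))).Normal :=
    Subgroup.normal_in_normalizer
  have := Fintype.ofFinite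
    (Subgroup.normalizer (Q : Set G) ⧸ Q.subgroupOf (Subgroup.normalizer (Q : Set G)))
  constructor
  · rintro ⟨n, σ, hσ, hproj, hcls⟩
    obtain ⟨e⟩ := IrrRep.cls_eq_iff.mp hcls
    change ρ.rep.Equiv (resRep σ (QuotientGroup.mk' _)) at e
    have := nontrivial_of_irreducible hσ
    obtain ⟨hker, hdz⟩ := (exists_sum_eq_one_iff (p := p)).mp
      ((projective_iff_exists_sum_eq_one σ).mp hproj)
    refine ⟨fun x ⟨k, hk⟩ ⟨c, hc⟩ => ?_, ?_⟩
    · by_contra hx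
      have h1 : σ (x : _ ⧸ _) = c • 1 := by
        refine LinearMap.ext fun v => ?_
        obtain ⟨v, rfl⟩ := e.toLinearEquiv.surjective v
        have h2 := (isIntertwiningMap_equiv e).isIntertwining x v
        refine h2.symm.trans ?_
        rw [hc]
        exact e.toLinearEquiv.map_smul c v
      have h2 : ((x : _ ⧸ _) : Subgroup.normalizer (Q : Set G) ⧸
          Q.subgroupOf (Subgroup.normalizer (Q : Set G))) ∈ (Representation.linHom σ σ).ker :=
        (linHom_eq_one_iff hσ).mpr ⟨c, h1⟩
      let y : (Representation.linHom σ σ).ker := ⟨_, h2⟩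
      have hy : y ^ p ^ k = 1 := Subtype.ext (by
        change (x : Subgroup.normalizer (Q : Set G) ⧸
          Q.subgroupOf (Subgroup.normalizer (Q : Set G))) ^ p ^ k = 1
        rw [← QuotientGroup.mk_pow, hk, QuotientGroup.mk_one])
      obtain ⟨m, _, hm⟩ := (Nat.dvd_prime_pow Fact.out).mp (orderOf_dvd_of_pow_eq_one hy)
      rcases Nat.eq_zero_or_pos m with rfl | hm0
      · rw [pow_zero, orderOf_eq_one_iff] at hm
        have h3 := congrArg Subtype.val hm
        exact hx ((QuotientGroup.eq_one_iff x).mp h3)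
      · exact hker ((dvd_pow_self p hm0.ne').trans (hm ▸ orderOf_dvd_natCard y))
    · refine IsDefectZero.of_equiv e.symm ((isDefectZero_congr (fun x => ?_) fun y => ?_).mp hdz)
      · obtain ⟨y, rfl⟩ := QuotientGroup.mk_surjective x
        exact ⟨y, 1, (one_smul _ _).symm⟩
      · exact ⟨y, 1, (one_smul _ _).symm⟩
  · rintro ⟨h1, h2⟩
    have htriv : ∀ x ∈ Q.subgroupOf (Subgroup.normalizer (Q : Set G)), ρ.rep x = 1 := fun x hx =>
      eq_one_of_mem_normal_pgroup ρ.irreducible (Q.subgroupOf (Subgroup.normalizer (Q : Set G)))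
        (hQ.comap_of_injective _ (Subgroup.subtype_injective _)) hx
    let σ : Representation F (Subgroup.normalizer (Q : Set G) ⧸
        Q.subgroupOf (Subgroup.normalizer (Q : Set G))) (Fin ρ.dim → F) :=
      QuotientGroup.lift _ ρ.rep htriv
    have hσ : σ.IsIrreducible := by
      refine isIrreducible_iff.mpr ⟨nontrivial_of_irreducible ρ.irreducible, fun U hU => ?_⟩
      exact (isIrreducible_iff.mp ρ.irreducible).2 U fun g v hv => hU (g : _ ⧸ _) v hv
    have := nontrivial_of_irreducible hσ
    refine ⟨ρ.dim, σ, hσ, (projective_iff_exists_sum_eq_one σ).mpr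
      ((exists_sum_eq_one_iff (p := p)).mpr ⟨fun hp => ?_, ?_⟩), rfl⟩
    · obtain ⟨⟨a, ha⟩, hap⟩ := exists_prime_orderOf_dvd_card' p hp
      obtain ⟨x, rfl⟩ := QuotientGroup.mk_surjective a
      obtain ⟨c, hc⟩ := (linHom_eq_one_iff hσ).mp ha
      have h3 : x ^ p ∈ Q.subgroupOf (Subgroup.normalizer (Q : Set G)) := by
        rw [← QuotientGroup.eq_one_iff, QuotientGroup.mk_pow]
        exact congrArg Subtype.val (hap ▸ pow_orderOf_eq_one _)
      obtain ⟨k, hk⟩ := hQ ⟨(x ^ p : Subgroup.normalizer (Q : Set G)), h3⟩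
      have h4 : x ^ p ^ (k + 1) = 1 := by
        rw [pow_succ', pow_mul]
        exact Subtype.ext (congrArg (Subtype.val : Q → G) hk)
      have h5 := h1 x ⟨_, h4⟩ ⟨c, hc⟩
      have h6 : (x : Subgroup.normalizer (Q : Set G) ⧸
        Q.subgroupOf (Subgroup.normalizer (Q : Set G))) = 1 := (QuotientGroup.eq_one_iff x).mpr h5
      have h7 := (orderOf_eq_one_iff (x := (⟨_, ha⟩ : (Representation.linHom σ σ).ker))).mpr
        (Subtype.ext h6)
      exact (Fact.out : p.Prime).one_lt.ne' (hap.symm.trans h7)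
    · refine (isDefectZero_congr (fun x => ?_) fun y => ?_).mp h2
      · exact ⟨(x : _ ⧸ _), 1, (one_smul _ _).symm⟩
      · obtain ⟨y, rfl⟩ := QuotientGroup.mk_surjective y
        exact ⟨y, 1, (one_smul _ _).symm⟩

end WeightCriterion

/-! ### Defect zero and tensor products -/

section TensorDefect

variable {F : Type*} [Field F] {ι : Type*} [Fintype ι] [DecidableEq ι] {d : ι → ℕ}

/-- Kronecker products with the identity in all factors but one determine the remaining factor. -/
theorem eq_of_tensorEnd_eq [∀ i, NeZero (d i)] {a b : ∀ i, Module.End F (Fin (d i) → F)} (i : ι)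
    (h : tensorEnd a = tensorEnd b) (ha : ∀ j, j ≠ i → a j = 1) (hb : ∀ j, j ≠ i → b j = 1) :
    a i = b i := by
  have key : ∀ (a : ∀ i, Module.End F (Fin (d i) → F)), (∀ j, j ≠ i → a j = 1) → ∀ k l,
      tensorEnd a (Pi.single (Function.update (fun _ => 0) i k) 1) (Function.update (fun _ => 0) i l)
        = a i (Pi.single k 1) l := by
    intro a ha k l
    rw [tensorEnd_single, Finset.prod_eq_single i]
    · rw [Function.update_self, Function.update_self]
    · intro j _ hj
      rw [ha j hj, Function.update_of_ne hj, Function.update_of_ne hj]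
      simp
    · simp
  refine LinearMap.pi_ext' fun k => LinearMap.ext_ring (funext fun l => ?_)
  change a i (Pi.single k 1) l = b i (Pi.single k 1) l
  rw [← key a ha, ← key b hb, h]

/-- Every endomorphism is a linear combination of Kronecker products of matrix units. -/
theorem sum_smul_tensorEnd (f : Module.End F (TensorSpace F d)) :
    ∑ k : ∀ i, Fin (d i), ∑ l : ∀ i, Fin (d i), f (Pi.single k 1) l • tensorEnd (fun i =>
      (LinearMap.proj (k i) : (Fin (d i) → F) →ₗ[F] F).smulRight (Pi.single (l i) 1)) = f := by
  refine tensorSpace_hom_ext fun k => funext fun l => ?_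
  simp only [LinearMap.sum_apply, Finset.sum_apply, LinearMap.smul_apply, Pi.smul_apply,
    tensorEnd_single, LinearMap.smulRight_apply, LinearMap.proj_apply, smul_eq_mul]
  rw [Finset.sum_eq_single k, Finset.sum_eq_single l]
  · simp
  · intro l' _ hl
    obtain ⟨i, hi⟩ := Function.ne_iff.mp hl
    rw [Finset.prod_eq_zero (Finset.mem_univ i), mul_zero]
    rw [Pi.single_eq_of_ne hi.symm, mul_zero]
  · simp
  · intro k' _ hk
    obtain ⟨i, hi⟩ := Function.ne_iff.mp hk
    refine Finset.sum_eq_zero fun l' _ => ?_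
    rw [Finset.prod_eq_zero (Finset.mem_univ i), mul_zero]
    rw [Pi.single_eq_of_ne hi, zero_mul]
  · simp

variable [IsAlgClosed F] {M : ι → Type*} [∀ i, Group (M i)]
  {ρ : ∀ i, Representation F (M i) (Fin (d i) → F)}

omit [IsAlgClosed F] in
theorem neZero_of_irreducible {n : ℕ} {G : Type*} [Group G] {σ : Representation F G (Fin n → F)}
    (h : σ.IsIrreducible) : NeZero n := by
  have := nontrivial_of_irreducible h
  refine ⟨?_⟩
  rintro rfl
  exact not_subsingleton (Fin 0 → F) inferInstance

/-- An element acting by a scalar on an outer tensor product acts by a scalar on each factor. -/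
theorem exists_smul_of_tensorRep_eq_smul (hρ : ∀ i, (ρ i).IsIrreducible) {m : ∀ i, M i} {c : F}
    (h : tensorRep ρ m = c • 1) (i : ι) : ∃ c : F, ρ i (m i) = c • 1 := by
  have := fun i => neZero_of_irreducible (hρ i)
  refine exists_smul_of_isIntertwiningMap (hρ i) ⟨fun g v => ?_⟩
  have h1 : tensorRep ρ (m * Pi.mulSingle i g * m⁻¹) = tensorRep ρ (Pi.mulSingle i g) := by
    rw [map_mul, map_mul, h, smul_mul_assoc, one_mul, smul_mul_assoc, ← mul_smul_comm,
      ← smul_one_mul c (tensorRep ρ m⁻¹), ← h, ← map_mul, mul_inv_cancel, map_one, mul_one]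
  have h2 := eq_of_tensorEnd_eq i h1
    (fun j hj => by simp [Pi.mulSingle_eq_of_ne hj]) (fun j hj => by simp [Pi.mulSingle_eq_of_ne hj])
  simp only [Pi.mul_apply, Pi.inv_apply, Pi.mulSingle_eq_same] at h2
  rw [← Module.End.mul_apply, ← Module.End.mul_apply, ← map_mul, ← h2, ← map_mul,
    inv_mul_cancel_right]

omit [IsAlgClosed F] in
theorem tensorRep_eq_smul {c : ι → F} {m : ∀ i, M i} (h : ∀ i, ρ i (m i) = c i • 1) :
    tensorRep ρ m = (∏ i, c i) • 1 := by
  rw [tensorRep_apply, funext h, tensorEnd_smul, tensorEnd_one]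

theorem exists_eq_smul_of_linHom_eq {G : Type*} [Group G] {n : ℕ}
    {σ : Representation F G (Fin n → F)} (hσ : σ.IsIrreducible) {x y : G}
    (h : Representation.linHom σ σ x = Representation.linHom σ σ y) : ∃ c : F, σ x = c • σ y := by
  have h1 : Representation.linHom σ σ (x * y⁻¹) = 1 := by
    rw [map_mul, h, ← map_mul, mul_inv_cancel, map_one]
  obtain ⟨c, hc⟩ := (linHom_eq_one_iff hσ).mp h1
  refine ⟨c, ?_⟩
  rw [← inv_mul_cancel_right x y, map_mul, hc, smul_mul_assoc, one_mul]

/-- For an irreducible representation, the existence of a nonzero trace suffices. -/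
theorem IsProjTransversal.isDefectZero_of_ne_zero {G : Type*} [Group G] {n : ℕ}
    {σ : Representation F G (Fin n → F)} (hσ : σ.IsIrreducible) {T : Type*} [Fintype T] {s : T → G}
    (hs : IsProjTransversal σ s) {f : Module.End F (Fin n → F)}
    (hf : ∑ t, Representation.linHom σ σ (s t) f ≠ 0) : IsDefectZero σ := by
  set a := ∑ t, Representation.linHom σ σ (s t) f with ha
  -- left translation permutes the conjugates of `f`
  have hinv : ∀ g, Representation.linHom σ σ g a = a := by
    intro g
    have h1 := fun t => hs.surjective (g * s t)
    choose e he using h1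
    have he' : Function.Injective e := by
      intro t t' htt
      have h2 := (he t).symm.trans ((congrArg _ (congrArg s htt)).trans (he t'))
      rw [map_mul, map_mul] at h2
      have h3 := congrArg (fun x => Representation.linHom σ σ g⁻¹ * x) h2
      simp only [← mul_assoc, ← map_mul, inv_mul_cancel, one_mul] at h3
      exact hs.injective h3
    rw [ha, map_sum]
    refine Fintype.sum_equiv (Equiv.ofBijective e (Finite.injective_iff_bijective.mp he')) _ _
      fun t => ?_
    rw [Equiv.ofBijective_apply, he, map_mul]
    rfl
  obtain ⟨c, hc⟩ := exists_smul_of_isIntertwiningMap hσ (f := a) ⟨fun g v => by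
    have h1 : σ g * (a * σ g⁻¹) = a := hinv g
    have h2 : σ g⁻¹ * σ g = 1 := by rw [← map_mul, inv_mul_cancel, map_one]
    have h3 : a * σ g = σ g * a := by
      conv_lhs => rw [← h1]
      rw [mul_assoc, mul_assoc, h2, mul_one]
    exact LinearMap.congr_fun h3 v⟩
  have hc0 : c ≠ 0 := by
    rintro rfl
    exact hf (hc.trans (zero_smul _ _))
  refine hs.isDefectZero_iff.mpr ⟨c⁻¹ • f, ?_⟩
  simp only [map_smul]
  rw [← Finset.smul_sum, ← ha, hc, smul_smul, inv_mul_cancel₀ hc0, one_smul]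

/-- An outer tensor product is of defect zero if and only if its factors are. -/
theorem isDefectZero_tensorRep_iff [∀ i, Finite (M i)] (hρ : ∀ i, (ρ i).IsIrreducible) :
    IsDefectZero (tensorRep ρ) ↔ ∀ i, IsDefectZero (ρ i) := by
  have hne := fun i => neZero_of_irreducible (hρ i)
  choose T hT s hs using fun i => exists_isProjTransversal (ρ i)
  have hl : ∀ (m : ∀ i, M i) (f : ∀ i, Module.End F (Fin (d i) → F)),
      Representation.linHom (tensorRep ρ) (tensorRep ρ) m (tensorEnd f) =
        tensorEnd fun i => Representation.linHom (ρ i) (ρ i) (m i) (f i) := by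
    intro m f
    change tensorEnd _ * (tensorEnd f * tensorEnd _) = _
    rw [← tensorEnd_mul, ← tensorEnd_mul]
    rfl
  have hs' : IsProjTransversal (tensorRep ρ) (fun (t : ∀ i, T i) i => s i (t i)) := by
    refine ⟨fun t t' h => funext fun i => (hs i).injective ?_, fun x => ?_⟩
    · refine LinearMap.ext fun f => ?_
      have h1 := LinearMap.congr_fun h (tensorEnd (Function.update 1 i f))
      simp only [hl] at h1
      have h2 : ∀ (m : ∀ i, M i) j, j ≠ i → Representation.linHom (ρ j) (ρ j) (m j)
          (Function.update (1 : ∀ i, Module.End F (Fin (d i) → F)) i f j) = 1 := by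
        intro m j hj
        rw [Function.update_of_ne hj]
        change ρ j (m j) * (1 * ρ j (m j)⁻¹) = 1
        rw [one_mul, ← map_mul, mul_inv_cancel, map_one]
      have h3 := eq_of_tensorEnd_eq i h1 (h2 _) (h2 _)
      simpa only [Function.update_self] using h3
    · choose t ht using fun i => (hs i).surjective (x i)
      choose c hc using fun i => exists_eq_smul_of_linHom_eq (hρ i) (ht i)
      refine ⟨t, linHom_eq_of_eq_smul (c := ∏ i, c i) ?_⟩
      rw [tensorRep_apply, funext hc, tensorEnd_smul, tensorRep_apply]
  have hsum : ∀ f : ∀ i, Module.End F (Fin (d i) → F),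
      ∑ t : ∀ i, T i, Representation.linHom (tensorRep ρ) (tensorRep ρ) (fun i => s i (t i))
        (tensorEnd f) = tensorEnd fun i => ∑ t, Representation.linHom (ρ i) (ρ i) (s i t) (f i) := by
    intro f
    rw [tensorEnd_sum]
    exact Finset.sum_congr rfl fun t _ => hl _ _
  constructor
  · intro h
    obtain ⟨f, hf⟩ := hs'.isDefectZero_iff.mp h
    -- some Kronecker product has a nonzero trace
    obtain ⟨f, hf⟩ : ∃ f : ∀ i, Module.End F (Fin (d i) → F), ∑ t : ∀ i, T i,
        Representation.linHom (tensorRep ρ) (tensorRep ρ) (fun i => s i (t i)) (tensorEnd f) ≠ 0 := by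
      by_contra! hcon
      rw [← sum_smul_tensorEnd f] at hf
      obtain ⟨Φ, hΦ⟩ : ∃ Φ : Module.End F (Module.End F (TensorSpace F d)), ∀ x,
          ∑ t : ∀ i, T i, Representation.linHom (tensorRep ρ) (tensorRep ρ)
            (fun i => s i (t i)) x = Φ x :=
        ⟨∑ t : ∀ i, T i, Representation.linHom (tensorRep ρ) (tensorRep ρ) fun i => s i (t i),
          fun x => by rw [LinearMap.sum_apply]⟩
      have h0 : ∀ g, Φ (tensorEnd g) = 0 := fun g => (hΦ _).symm.trans (hcon g)
      rw [hΦ] at hf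
      simp only [map_sum, map_smul, h0, smul_zero, Finset.sum_const_zero] at hf
      have := nontrivial_of_irreducible (tensorRep_irreducible hρ)
      exact zero_ne_one hf
    intro i
    refine (hs i).isDefectZero_of_ne_zero (hρ i) (f := f i) fun h0 => hf ?_
    rw [hsum]
    refine tensorSpace_hom_ext fun f' => funext fun g => ?_
    rw [tensorEnd_single]
    refine Finset.prod_eq_zero (Finset.mem_univ i) ?_
    rw [h0]
    rfl
  · intro h
    choose f hf using fun i => (hs i).isDefectZero_iff.mp (h i)
    refine hs'.isDefectZero_iff.mpr ⟨tensorEnd f, ?_⟩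
    rw [hsum, funext hf, tensorEnd_one]

end TensorDefect

/-! ### Perfect groups and central extensions -/

section PerfectGroups

theorem hom_eq_one_of_isPerfect {E A : Type*} [Group E] [Group.IsPerfect E] [CommGroup A]
    (f : E →* A) (e : E) : f e = 1 :=
  Abelianization.commutator_subset_ker f Group.IsPerfect.mem_commutator

open scoped IsMulCommutative in
/-- Homomorphisms from a perfect group that agree modulo the center are equal. -/
theorem hom_eq_of_mul_inv_mem_center {E G : Type*} [Group E] [Group.IsPerfect E] [Group G]
    {f g : E →* G} (h : ∀ e, f e * (g e)⁻¹ ∈ Subgroup.center G) : f = g := by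
  let δ : E →* Subgroup.center G :=
    { toFun := fun e => ⟨f e * (g e)⁻¹, h e⟩
      map_one' := Subtype.ext (by simp)
      map_mul' := fun a b => Subtype.ext (by
        have h1 := Subgroup.mem_center_iff.mp (h b) (g a)⁻¹
        change f (a * b) * (g (a * b))⁻¹ = f a * (g a)⁻¹ * (f b * (g b)⁻¹)
        rw [mul_assoc (f a), h1, map_mul, map_mul, mul_inv_rev]
        simp only [mul_assoc]) }
  ext e
  exact mul_inv_eq_one.mp (congrArg Subtype.val (hom_eq_one_of_isPerfect δ e))

open scoped IsMulCommutative in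
/-- If `x` commutes with `K` modulo the center, then it commutes with the commutator subgroup
of `K`. -/
theorem commute_of_mem_commutator {K G : Type*} [Group K] [Group G] (f : K →* G) {x : G}
    (h : ∀ k, f k * x * (f k)⁻¹ * x⁻¹ ∈ Subgroup.center G) {k : K} (hk : k ∈ commutator K) :
    Commute (f k) x := by
  let δ : K →* Subgroup.center G :=
    { toFun := fun k => ⟨f k * x * (f k)⁻¹ * x⁻¹, h k⟩
      map_one' := Subtype.ext (by simp)
      map_mul' := fun a b => Subtype.ext (by
        have h1 := Subgroup.mem_center_iff.mp (h b) (f a)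
        change f (a * b) * x * (f (a * b))⁻¹ * x⁻¹ =
          f a * x * (f a)⁻¹ * x⁻¹ * (f b * x * (f b)⁻¹ * x⁻¹)
        have h2 : f (a * b) * x * (f (a * b))⁻¹ * x⁻¹ =
            f a * (f b * x * (f b)⁻¹ * x⁻¹) * (x * (f a)⁻¹ * x⁻¹) := by
          rw [map_mul]; group
        rw [h2, h1, Subgroup.mem_center_iff.mp (h b) (f a * x * (f a)⁻¹ * x⁻¹)]
        simp only [mul_assoc]) }
  have h1 := congrArg Subtype.val (Abelianization.commutator_subset_ker δ hk)
  change f k * x * (f k)⁻¹ * x⁻¹ = 1 at h1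
  rw [mul_inv_eq_one, mul_inv_eq_iff_eq_mul] at h1
  exact h1

theorem mem_center_of_isPerfect {E : Type*} [Group E] [Group.IsPerfect E] {x : E}
    (h : ∀ e, e * x * e⁻¹ * x⁻¹ ∈ Subgroup.center E) : x ∈ Subgroup.center E :=
  Subgroup.mem_center_iff.mpr fun _ =>
    commute_of_mem_commutator (MonoidHom.id E) h Group.IsPerfect.mem_commutator

/-- A preimage of a central element under a central extension of a perfect group is central. -/
theorem mem_center_of_map_mem_center {E G : Type*} [Group E] [Group.IsPerfect E] [Group G]
    {f : E →* G} (hf : f.ker ≤ Subgroup.center E) {x : E} (hx : ∀ e, Commute (f x) (f e)) :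
    x ∈ Subgroup.center E := by
  refine mem_center_of_isPerfect fun e => hf ?_
  rw [MonoidHom.mem_ker, map_mul, map_mul, map_mul, map_inv, map_inv, ← (hx e).eq,
    mul_inv_cancel_right, mul_inv_cancel]

variable {B A : Type*} [Group B] [Group A] (b : B →* A)

open scoped commutatorElement in
/-- A subgroup that covers a group modulo its center contains all commutators. -/
theorem commutator_le_of_forall_exists {K : Subgroup B}
    (h : ∀ x, ∃ k ∈ K, x * k⁻¹ ∈ Subgroup.center B) : commutator B ≤ ⁅K, K⁆ := by
  rw [commutator_def, Subgroup.commutator_le]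
  intro x _ y _
  obtain ⟨k, hk, hkx⟩ := h x
  obtain ⟨l, hl, hly⟩ := h y
  have hx : x = x * k⁻¹ * k := by group
  have hy : y = y * l⁻¹ * l := by group
  have h1 := Subgroup.mem_center_iff.mp hkx
  have h2 := Subgroup.mem_center_iff.mp hly
  generalize x * k⁻¹ = z at *
  generalize y * l⁻¹ = w at *
  have h3 : ⁅x, y⁆ = ⁅k, l⁆ := by
    rw [hx, hy, commutatorElement_def, commutatorElement_def, mul_inv_rev, mul_inv_rev]
    have h1' : ∀ g, g * z⁻¹ = z⁻¹ * g := fun g =>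
      Subgroup.mem_center_iff.mp (inv_mem hkx) g
    have h2' : ∀ g, g * w⁻¹ = w⁻¹ * g := fun g =>
      Subgroup.mem_center_iff.mp (inv_mem hly) g
    calc z * k * (w * l) * (k⁻¹ * z⁻¹) * (l⁻¹ * w⁻¹)
        = z * (k * w * l * k⁻¹) * z⁻¹ * l⁻¹ * w⁻¹ := by group
      _ = (k * w) * l * k⁻¹ * l⁻¹ * w⁻¹ := by rw [← h1 (k * w * l * k⁻¹)]; group
      _ = w * (k * l * k⁻¹ * l⁻¹) * w⁻¹ := by rw [h2 k]; group
      _ = k * l * k⁻¹ * l⁻¹ := by rw [← h2 (k * l * k⁻¹ * l⁻¹)]; group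
  rw [h3]
  exact Subgroup.commutator_mem_commutator hk hl

variable {b}

theorem exists_mem_commutator [Group.IsPerfect A] (hb : Function.Surjective b) (a : A) :
    ∃ k ∈ commutator B, b k = a := by
  have : a ∈ (commutator B).map b := by
    rw [commutator_def, Subgroup.map_commutator, ← MonoidHom.range_eq_map,
      MonoidHom.range_eq_top.mpr hb, ← commutator_def, Group.IsPerfect.commutator_eq_top]
    trivial
  exact this

/-- The commutator subgroup of a central extension of a perfect group is perfect. -/
theorem isPerfect_commutator [Group.IsPerfect A] (hb : Function.Surjective b)
    (hker : b.ker ≤ Subgroup.center B) : Group.IsPerfect (commutator B) := by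
  rw [Subgroup.isPerfect_iff]
  refine le_antisymm (Subgroup.commutator_le_left _ _) ?_
  refine commutator_le_of_forall_exists fun x => ?_
  obtain ⟨k, hk, hkx⟩ := exists_mem_commutator hb (b x)
  exact ⟨k, hk, hker (by rw [MonoidHom.mem_ker, map_mul, map_inv, hkx, mul_inv_cancel])⟩

/-- A perfect group has no proper subgroup covering it modulo the center. -/
theorem eq_top_of_forall_exists [Group.IsPerfect B] {K : Subgroup B}
    (h : ∀ x, ∃ k ∈ K, x * k⁻¹ ∈ Subgroup.center B) : K = ⊤ := by
  refine top_unique ?_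
  rw [← Group.IsPerfect.commutator_eq_top]
  exact (commutator_le_of_forall_exists h).trans (Subgroup.commutator_le_self K)

end PerfectGroups

/-! ### Universal coverings -/

section Schur

/-- The kernel of a perfect finite central extension of `S` is at most as large as the Schur
multiplier: a character of the kernel that turns the cocycle of the extension into a coboundary
extends to the whole group, hence is trivial. -/
theorem card_ker_le_card_schurMultiplier {P : Type*} [Group P] [Finite P] [Group.IsPerfect P]
    {S : Type*} [Group S] [Finite (SchurMultiplier S)] {φ : P →* S} (hφ : Function.Surjective φ)
    (hker : φ.ker ≤ Subgroup.center P) : Nat.card φ.ker ≤ Nat.card (SchurMultiplier S) := by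
  let _ : CommGroup φ.ker :=
    { mul_comm := fun a b => Subtype.ext (Subgroup.mem_center_iff.mp (hker b.2) a) }
  choose s hs using hφ
  have hmem : ∀ g h, s g * s h * (s (g * h))⁻¹ ∈ φ.ker := fun g h => by
    rw [MonoidHom.mem_ker, map_mul, map_mul, map_inv, hs, hs, hs, mul_inv_cancel]
  obtain ⟨γ, hγ⟩ : ∃ γ : S → S → φ.ker, ∀ g h, (γ g h : P) * s (g * h) = s g * s h :=
    ⟨fun g h => ⟨_, hmem g h⟩, fun g h => inv_mul_cancel_right _ _⟩
  have hc : ∀ (z : φ.ker) (x : P), x * z = z * x := fun z => Subgroup.mem_center_iff.mp (hker z.2)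
  have hcoc : ∀ g h k, γ g h * γ (g * h) k = γ h k * γ g (h * k) := by
    intro g h k
    refine Subtype.ext (mul_right_cancel (b := s (g * h * k)) ?_)
    rw [Subgroup.coe_mul, Subgroup.coe_mul, mul_assoc, hγ]
    rw [← mul_assoc, hγ, mul_assoc g h k, mul_assoc (γ h k : P), hγ, ← mul_assoc, ← hc,
      mul_assoc (s g) (γ h k : P), hγ, mul_assoc]
  let Φ : (φ.ker →* ℂˣ) →* twoCocycles S ℂˣ :=
    { toFun := fun lam => ⟨fun g h => lam (γ g h), fun g h k => by
        change lam _ * lam _ = lam _ * lam _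
        rw [← map_mul, ← map_mul, hcoc]⟩
      map_one' := rfl
      map_mul' := fun _ _ => rfl }
  have hinj : Function.Injective ((QuotientGroup.mk' (coboundary S ℂˣ).range).comp Φ) := by
    refine (injective_iff_map_eq_one _).mpr fun lam hlam => ?_
    obtain ⟨f, hf⟩ := (QuotientGroup.eq_one_iff _).mp hlam
    have hf' : ∀ g h, f g * f h * (f (g * h))⁻¹ = lam (γ g h) := fun g h =>
      congrFun (congrFun (congrArg Subtype.val hf) g) h
    have hmem' : ∀ x, x * (s (φ x))⁻¹ ∈ φ.ker := fun x => by
      rw [MonoidHom.mem_ker, map_mul, map_inv, hs, mul_inv_cancel]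
    -- The cocycle `lam ∘ γ` is the coboundary of `f`, so that `κ` is a homomorphism. It agrees with
    -- `lam` on the kernel up to the constant `f 1`.
    let κ : P → ℂˣ := fun x => lam ⟨_, hmem' x⟩ * f (φ x)
    have hκ : ∀ x y, κ (x * y) = κ x * κ y := by
      intro x y
      have h1 : (⟨_, hmem' (x * y)⟩ : φ.ker) =
          ⟨_, hmem' x⟩ * ⟨_, hmem' y⟩ * γ (φ x) (φ y) := by
        refine Subtype.ext (mul_right_cancel (b := s (φ x * φ y)) ?_)
        rw [Subgroup.coe_mul, Subgroup.coe_mul, mul_assoc _ (γ _ _ : P), hγ]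
        change x * y * (s (φ (x * y)))⁻¹ * _ = x * (s (φ x))⁻¹ * (y * (s (φ y))⁻¹) * _
        rw [map_mul, inv_mul_cancel_right, mul_assoc (x * (s (φ x))⁻¹), ← mul_assoc _ (s (φ x)),
          ← hc ⟨_, hmem' y⟩ (s (φ x))]
        change _ = x * (s (φ x))⁻¹ * (s (φ x) * (y * (s (φ y))⁻¹) * s (φ y))
        group
      change lam _ * f (φ (x * y)) = lam _ * f (φ x) * (lam _ * f (φ y))
      rw [h1, map_mul, map_mul, ← hf', map_mul φ, mul_assoc (lam _ * lam _),
        inv_mul_cancel_right, mul_mul_mul_comm]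
    have hκ1 : ∀ x, κ x = 1 := fun x => hom_eq_one_of_isPerfect (MonoidHom.mk' κ hκ) x
    ext z
    have h1 := hκ1 z
    have h2 := hκ1 1
    have hz : φ z = φ 1 := (z.2 : φ z = 1).trans (map_one φ).symm
    have h3 : (⟨_, hmem' z⟩ : φ.ker) = z * ⟨_, hmem' 1⟩ := Subtype.ext (by
      change (z : P) * (s (φ z))⁻¹ = z * (1 * (s (φ 1))⁻¹)
      rw [hz, one_mul])
    change lam _ * f _ = 1 at h1 h2
    rw [h3, hz, map_mul, mul_assoc, h2, mul_one] at h1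
    rw [h1]
    rfl
  have hcard : Nat.card (φ.ker →* ℂˣ) = Nat.card φ.ker :=
    CommGroup.card_monoidHom_of_hasEnoughRootsOfUnity φ.ker ℂ
  rw [← hcard]
  exact Nat.card_le_card_of_injective _ hinj

variable {E : Type*} [Group E] [Finite E] {S : Type*} [Group S] {π : E →* S}

/-- A universal covering has no proper perfect central extensions. -/
theorem IsUniversalCovering.bijective (hπ : IsUniversalCovering π) {B : Type*} [Group B] [Finite B]
    [Group.IsPerfect B] {b : B →* E} (hb : Function.Surjective b)
    (hker : (π.comp b).ker ≤ Subgroup.center B) : Function.Bijective b := by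
  obtain ⟨e⟩ := hπ.ker_equiv
  have : Finite (SchurMultiplier S) := Finite.of_equiv _ e.toEquiv
  have hs : Function.Surjective (π.comp b) := hπ.surjective.comp hb
  have h1 := card_ker_le_card_schurMultiplier hs hker
  rw [← Nat.card_congr e.toEquiv] at h1
  have h2 := Subgroup.card_mul_index (π.comp b).ker
  have h3 := Subgroup.card_mul_index π.ker
  rw [Subgroup.index_ker, MonoidHom.range_eq_top.mpr hs] at h2
  rw [Subgroup.index_ker, MonoidHom.range_eq_top.mpr hπ.surjective] at h3
  refine hb.bijective_of_nat_card_le ?_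
  rw [← h2, ← h3]
  exact Nat.mul_le_mul_right _ h1

/-- A homomorphism from a universal covering lifts along homomorphisms with central kernel:
the perfect core of the fibre product is a perfect central extension, hence isomorphic to the
universal covering. -/
theorem IsUniversalCovering.exists_lift (hπ : IsUniversalCovering π) {Y T : Type*} [Group Y]
    [Finite Y] [Group T] (f : E →* T) (h : Y →* T) (hfh : ∀ e, ∃ y, h y = f e)
    (hcent : ∀ e y, f e = h y → e ∈ π.ker → y ∈ Subgroup.center Y) :
    ∃ g : E →* Y, ∀ e, h (g e) = f e := by
  have := hπ.perfect
  let B : Subgroup (E × Y) := (f.comp (MonoidHom.fst E Y)).eqLocus (h.comp (MonoidHom.snd E Y))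
  let b : B →* E := (MonoidHom.fst E Y).comp B.subtype
  have hb : Function.Surjective b := fun e => by
    obtain ⟨y, hy⟩ := hfh e
    exact ⟨⟨(e, y), hy.symm⟩, rfl⟩
  have hc : ∀ x : B, (π (b x) = 1) → x ∈ Subgroup.center B := by
    rintro ⟨⟨e, y⟩, hey⟩ hx
    refine Subgroup.mem_center_iff.mpr ?_
    rintro ⟨⟨e', y'⟩, _⟩
    refine Subtype.ext (Prod.ext ?_ ?_)
    · exact Subgroup.mem_center_iff.mp (hπ.ker_le_center hx) e'
    · exact Subgroup.mem_center_iff.mp (hcent e y hey hx) y'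
  have hp : Group.IsPerfect (commutator B) := isPerfect_commutator hb fun x hx => hc x (by
    rw [MonoidHom.mem_ker.mp hx, map_one])
  have hbij := hπ.bijective (b := b.comp (commutator B).subtype) (fun e => by
    obtain ⟨k, hk, hke⟩ := exists_mem_commutator hb e
    exact ⟨⟨k, hk⟩, hke⟩) (fun x hx => Subgroup.mem_center_iff.mpr fun y => Subtype.ext
      (Subgroup.mem_center_iff.mp (hc (x : B) hx) y))
  let i := MulEquiv.ofBijective _ hbij
  refine ⟨(MonoidHom.snd E Y).comp (B.subtype.comp
    ((commutator B).subtype.comp i.symm.toMonoidHom)), fun e => ?_⟩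
  have h1 : f (b (i.symm e : B)) = h ((i.symm e : B) : E × Y).2 := (i.symm e : B).2
  have h2 : b (i.symm e : B) = e := i.apply_symm_apply e
  rw [h2] at h1
  exact h1.symm

/-- Two homomorphisms from a universal covering with the same image and central kernels differ by
an automorphism. -/
theorem IsUniversalCovering.exists_mulAut (hπ : IsUniversalCovering π) {T : Type*} [Group T]
    {f h : E →* T} (hh : h.ker ≤ Subgroup.center E)
    (hfh : f.range = h.range) : ∃ α : MulAut E, ∀ e, h (α e) = f e := by
  have := hπ.perfect
  have h1 : ∀ e, ∃ y, h y = f e := fun e => by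
    have : f e ∈ h.range := hfh ▸ ⟨e, rfl⟩
    exact this
  have h2 : ∀ y, ∃ e, f e = h y := fun y => by
    have : h y ∈ f.range := hfh ▸ ⟨y, rfl⟩
    exact this
  obtain ⟨g, hg⟩ := hπ.exists_lift f h h1 (fun e y hey he =>
    mem_center_of_map_mem_center hh fun y' => by
      obtain ⟨e', he'⟩ := h2 y'
      rw [← hey, ← he']
      exact Commute.map (f := f) (Subgroup.mem_center_iff.mp (hπ.ker_le_center he) e').symm)
  have hsurj : Function.Surjective g := by
    refine MonoidHom.range_eq_top.mp (eq_top_of_forall_exists fun y => ?_)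
    obtain ⟨e, he⟩ := h2 y
    refine ⟨g e, ⟨e, rfl⟩, hh ?_⟩
    rw [MonoidHom.mem_ker, map_mul, map_inv, hg, he, mul_inv_cancel]
  exact ⟨MulEquiv.ofBijective g (Finite.injective_iff_bijective.mp
    (Finite.injective_iff_surjective.mpr hsurj)), hg⟩

end Schur

/-! ### Central products -/

section CentralProduct

theorem pi_hom_ext {ι : Type*} [Finite ι] [DecidableEq ι] {M : ι → Type*} [∀ i, Group (M i)]
    {X : Type*} [Group X] {f g : (∀ i, M i) →* X}
    (h : ∀ i m, f (Pi.mulSingle i m) = g (Pi.mulSingle i m)) : f = g := by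
  have := Fintype.ofFinite ι
  refine MonoidHom.noncommPiCoprodEquiv.symm.injective (Subtype.ext (funext fun i => ?_))
  exact MonoidHom.ext (h i)

/-- A group `X` that is the product of a central subgroup `Z` and of pairwise commuting images
of groups `M i`. -/
structure CentralProduct {ι : Type*} [Fintype ι] (M : ι → Type*) [∀ i, Group (M i)] (X : Type*)
    [Group X] where
  θ : ∀ i, M i →* X
  commute : Pairwise fun i j => ∀ x y, Commute (θ i x) (θ j y)
  Z : Subgroup X
  Z_le : Z ≤ Subgroup.center X
  gen : ∀ x, ∃ z ∈ Z, ∃ e, x = z * MonoidHom.noncommPiCoprod θ commute e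

namespace CentralProduct

variable {ι : Type*} [Fintype ι] {M : ι → Type*} [∀ i, Group (M i)] {X : Type*} [Group X]
  (𝒞 : CentralProduct M X)

/-- The homomorphism from the direct product of the groups `M i`. -/
def Θ : (∀ i, M i) →* X := MonoidHom.noncommPiCoprod 𝒞.θ 𝒞.commute

theorem exists_eq (x : X) : ∃ z ∈ 𝒞.Z, ∃ e, x = z * 𝒞.Θ e := 𝒞.gen x

theorem comm_Z {z : X} (hz : z ∈ 𝒞.Z) (x : X) : x * z = z * x :=
  Subgroup.mem_center_iff.mp (𝒞.Z_le hz) x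

variable [DecidableEq ι]

theorem Θ_mulSingle (i : ι) (m : M i) : 𝒞.Θ (Pi.mulSingle i m) = 𝒞.θ i m :=
  MonoidHom.noncommPiCoprod_mulSingle 𝒞.θ i m

theorem Θ_conj {e : ∀ i, M i} {z : X} (hz : z ∈ 𝒞.Z) (i : ι) (m : M i) :
    z * 𝒞.Θ e * 𝒞.θ i m * (z * 𝒞.Θ e)⁻¹ = 𝒞.θ i (e i * m * (e i)⁻¹) := by
  have h1 : e * Pi.mulSingle i m * e⁻¹ = Pi.mulSingle i (e i * m * (e i)⁻¹) := by
    funext j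
    by_cases h : j = i
    · subst h; simp
    · simp [Pi.mulSingle_eq_of_ne h]
  rw [← 𝒞.Θ_mulSingle, ← 𝒞.Θ_mulSingle, ← h1, map_mul, map_mul, map_inv, mul_inv_rev,
    mul_assoc z, mul_assoc z, ← 𝒞.comm_Z hz]
  group

end CentralProduct

/-- A presentation of `X` as a central product of its center and homomorphic images of `E`, such
that the automorphisms of `X` permute these images and lift to `E`. -/
structure Cover (ι : Type*) [Fintype ι] (E X : Type*) [Group E] [Group X] extends
    CentralProduct (fun _ : ι => E) X where
  Z_eq : Z = Subgroup.center X
  mem_center : ∀ e, MonoidHom.noncommPiCoprod θ commute e ∈ Subgroup.center X →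
    ∀ i, e i ∈ Subgroup.center E
  exists_aut : ∀ τ : MulAut X, ∃ (s : Equiv.Perm ι) (α : ι → MulAut E),
    ∀ i e, τ (θ i e) = θ (s i) (α i e)

variable {E : Type*} [Group E] [Finite E] {S : Type*} [Group S] {π : E →* S}

theorem not_forall_commute [Group.IsPerfect S] [Nontrivial S] : ¬ ∀ a b : S, Commute a b := by
  intro h
  have : IsMulCommutative S := ⟨⟨h⟩⟩
  exact not_subsingleton S inferInstance

section

variable {ι : Type*} [DecidableEq ι] {X : Type*} [Group X] (q : X →* (ι → S))

/-- The subgroup of the elements with trivial coordinates away from `i`. -/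
def factor (i : ι) : Subgroup X where
  carrier := {x | ∀ j ≠ i, q x j = 1}
  mul_mem' hx hy j hj := by rw [map_mul, Pi.mul_apply, hx j hj, hy j hj, one_mul]
  one_mem' j _ := by rw [map_one, Pi.one_apply]
  inv_mem' hx j hj := by rw [map_inv, Pi.inv_apply, hx j hj, inv_one]

instance (i : ι) : (factor q i).Normal where
  conj_mem x hx g j hj := by
    rw [map_mul, map_mul, map_inv, Pi.mul_apply, Pi.mul_apply, hx j hj, mul_one, Pi.inv_apply,
      mul_inv_cancel]

variable {q}

theorem mem_ker_of_mem_factor {i : ι} {x : X} (hx : x ∈ factor q i) (h : q x i = 1) :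
    x ∈ q.ker := by
  refine MonoidHom.mem_ker.mpr (funext fun j => ?_)
  by_cases hj : j = i
  · rw [hj, h]; rfl
  · exact hx j hj

variable (hq : Function.Surjective q) (hker : q.ker = Subgroup.center X)

omit [Finite E] in
include hker in
/-- A perfect subgroup of the `i`-th factor that covers `S` is its commutator subgroup. -/
theorem range_eq_commutator_factor [Group.IsPerfect E] {i : ι} {f : E →* X}
    (hf : ∀ e, f e ∈ factor q i) (hs : ∀ s, ∃ e, q (f e) i = s) :
    f.range = ⁅factor q i, factor q i⁆ := by
  let f' : E →* factor q i := f.codRestrict _ hf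
  have h1 : ⁅f'.range, f'.range⁆ = f'.range := by
    rw [MonoidHom.range_eq_map, ← Subgroup.map_commutator, ← commutator_def,
      Group.IsPerfect.commutator_eq_top]
  have h2 : f'.range = commutator (factor q i) := by
    refine le_antisymm ?_ ((commutator_le_of_forall_exists fun x => ?_).trans h1.le)
    · rw [← h1, commutator_def]
      exact Subgroup.commutator_mono le_top le_top
    · obtain ⟨e, he⟩ := hs (q x i)
      refine ⟨f' e, ⟨e, rfl⟩, Subgroup.mem_center_iff.mpr fun y => Subtype.ext ?_⟩
      have h3 : ((x * (f' e)⁻¹ : factor q i) : X) ∈ q.ker := by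
        refine mem_ker_of_mem_factor (x * (f' e)⁻¹ : factor q i).2 ?_
        change q ((x : X) * (f e)⁻¹) i = 1
        rw [map_mul, map_inv, Pi.mul_apply, Pi.inv_apply, he, mul_inv_cancel]
      rw [hker] at h3
      exact Subgroup.mem_center_iff.mp h3 y
  rw [← Subgroup.map_subtype_commutator, ← h2, MonoidHom.map_range]
  rfl

include hker in
theorem commute_of_mem_factor {i j : ι} (hij : i ≠ j) {x y : X}
    (hx : x ∈ ⁅factor q i, factor q i⁆) (hy : y ∈ factor q j) : Commute x y := by
  rw [← Subgroup.map_subtype_commutator] at hx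
  obtain ⟨k, hk, rfl⟩ := hx
  refine commute_of_mem_commutator (factor q i).subtype (fun k => ?_) hk
  rw [← hker, MonoidHom.mem_ker]
  funext l
  simp only [map_mul, map_inv, Pi.mul_apply, Pi.inv_apply, Pi.one_apply]
  by_cases hl : l = i
  · rw [hy l (by rw [hl]; exact hij), mul_one, mul_inv_cancel, inv_one, mul_one]
  · have : q ((factor q i).subtype k) l = 1 := k.2 l hl
    rw [this, one_mul, inv_one, mul_one, mul_inv_cancel]

include hq hker in
/-- The universal covering of `S` maps onto the perfect core of each factor. -/
theorem exists_hom_factor [Finite X] [Group.IsPerfect S] (hπ : IsUniversalCovering π) (i : ι) :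
    ∃ f : E →* X, (∀ e, f e ∈ factor q i) ∧ ∀ e, q (f e) i = π e := by
  let b : factor q i →* S := (Pi.evalMonoidHom (fun _ : ι => S) i).comp (q.comp (factor q i).subtype)
  have hb : Function.Surjective b := fun s => by
    obtain ⟨x, hx⟩ := hq (Pi.mulSingle i s)
    refine ⟨⟨x, fun j hj => ?_⟩, ?_⟩
    · rw [hx, Pi.mulSingle_eq_of_ne hj]
    · change q x i = s
      rw [hx, Pi.mulSingle_eq_same]
  obtain ⟨g, hg⟩ := hπ.exists_lift π (b.comp (commutator (factor q i)).subtype)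
    (fun e => by
      obtain ⟨k, hk, hke⟩ := exists_mem_commutator hb (π e)
      exact ⟨⟨k, hk⟩, hke⟩)
    (fun e y hey he => Subgroup.mem_center_iff.mpr fun y' => Subtype.ext (Subtype.ext (by
      have h1 : ((y : factor q i) : X) ∈ q.ker :=
        mem_ker_of_mem_factor (y : factor q i).2 (hey.symm.trans he)
      rw [hker] at h1
      exact Subgroup.mem_center_iff.mp h1 _)))
  exact ⟨(factor q i).subtype.comp ((commutator (factor q i)).subtype.comp g),
    fun e => (g e : factor q i).2, hg⟩

omit [Finite E] in
include hq hker in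
/-- An automorphism of `X` maps the perfect core of each factor into a factor. -/
theorem exists_factor_of_aut [Finite ι] [IsSimpleGroup S] [Group.IsPerfect S]
    (hπ : IsUniversalCovering π) {i : ι} {f : E →* X} (hf : ∀ e, f e ∈ factor q i)
    (hfπ : ∀ e, q (f e) i = π e) (τ : MulAut X) :
    ∃ j, (∀ e, τ (f e) ∈ factor q j) ∧ ∀ s, ∃ e, q (τ (f e)) j = s := by
  have := hπ.perfect
  have hrange : f.range.Normal := by
    rw [range_eq_commutator_factor hker hf fun s => by
      obtain ⟨e, he⟩ := hπ.surjective s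
      exact ⟨e, (hfπ e).trans he⟩]
    infer_instance
  let h : E →* X := τ.toMonoidHom.comp f
  have hh : h.range.Normal := by
    rw [MonoidHom.range_comp]
    exact hrange.map _ τ.surjective
  let c : ι → E →* S := fun j => (Pi.evalMonoidHom (fun _ : ι => S) j).comp (q.comp h)
  have hc : ∀ j, (c j).range.Normal := fun j => by
    have : (c j).range = (h.range.map q).map (Pi.evalMonoidHom (fun _ : ι => S) j) := by
      rw [← MonoidHom.range_comp, ← MonoidHom.range_comp]
    rw [this]
    exact (hh.map _ hq).map _ (Function.surjective_eval j)
  -- some projection of the image to a factor of `S ^ n` is nontrivial, hence onto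
  obtain ⟨j, hj⟩ : ∃ j, (c j).range ≠ ⊥ := by
    by_contra! hcon
    have h1 : ∀ e, π e = 1 := by
      intro e
      have h2 : τ (f e) ∈ q.ker := MonoidHom.mem_ker.mpr (funext fun j => by
        have : c j e ∈ (c j).range := ⟨e, rfl⟩
        rw [hcon j] at this
        exact this)
      rw [hker] at h2
      have h3 : f e ∈ q.ker := by
        rw [hker, Subgroup.mem_center_iff]
        intro g
        refine τ.injective ?_
        rw [map_mul, map_mul]
        exact Subgroup.mem_center_iff.mp h2 _
      rw [← hfπ, MonoidHom.mem_ker.mp h3]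
      rfl
    obtain ⟨s, hs⟩ := exists_ne (1 : S)
    obtain ⟨e, rfl⟩ := hπ.surjective s
    exact hs (h1 e)
  have hj' : (c j).range = ⊤ := ((hc j).eq_bot_or_eq_top).resolve_left hj
  have hsurj : Function.Surjective (c j) := MonoidHom.range_eq_top.mp hj'
  refine ⟨j, ?_, hsurj⟩
  -- the commutators of the image with the `j`-th factor still cover `S`
  let N : Subgroup E := (factor q j).comap h
  have hN : N.Normal := inferInstance
  have hNj : N.map (c j) = ⊤ := by
    refine top_unique ?_
    rw [← Group.IsPerfect.commutator_eq_top, commutator_def, Subgroup.commutator_le]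
    intro s _ t _
    obtain ⟨e, rfl⟩ := hsurj s
    obtain ⟨x, hx⟩ := hq (Pi.mulSingle j t)
    have h1 : h e * (x * (h e)⁻¹ * x⁻¹) ∈ h.range :=
      mul_mem ⟨e, rfl⟩ (hh.conj_mem _ (inv_mem ⟨e, rfl⟩) x)
    obtain ⟨e', he'⟩ := h1
    have h2 : ∀ k, q (h e') k = q (h e) k * (q x k * (q (h e) k)⁻¹ * (q x k)⁻¹) := fun k => by
      rw [he']
      simp only [map_mul, map_inv, Pi.mul_apply, Pi.inv_apply]
    refine ⟨e', fun k hk => ?_, ?_⟩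
    · rw [h2, hx, Pi.mulSingle_eq_of_ne hk, one_mul, inv_one, mul_one, mul_inv_cancel]
    · refine (h2 j).trans ?_
      rw [hx, Pi.mulSingle_eq_same, commutatorElement_def, ← mul_assoc, ← mul_assoc]
      rfl
  have hNπ : (N.map π).Normal := hN.map _ hπ.surjective
  rcases hNπ.eq_bot_or_eq_top with h0 | h0
  · exfalso
    refine not_forall_commute (S := S) fun a b => ?_
    have ha : a ∈ N.map (c j) := hNj ▸ trivial
    obtain ⟨a, haN, rfl⟩ := ha
    obtain ⟨b, rfl⟩ := hsurj b
    have h1 : π a ∈ N.map π := ⟨a, haN, rfl⟩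
    rw [h0] at h1
    exact Commute.map (f := c j) (Subgroup.mem_center_iff.mp (hπ.ker_le_center h1) b).symm
  -- `N` covers `S`, and a perfect group has no proper subgroup covering its central quotient
  · have hNtop : N = ⊤ := eq_top_of_forall_exists fun x => by
      have h1 : π x ∈ N.map π := h0 ▸ trivial
      obtain ⟨k, hk, hkx⟩ := h1
      exact ⟨k, hk, hπ.ker_le_center (by
        rw [MonoidHom.mem_ker, map_mul, map_inv, hkx, mul_inv_cancel])⟩
    intro e
    have : e ∈ N := hNtop ▸ trivial
    exact this

include hq hker in
/-- A finite group whose central quotient is a power of a nonabelian simple group `S` is a central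
product of its center and images of the universal covering of `S`. -/
theorem nonempty_cover [Fintype ι] [Finite X] [IsSimpleGroup S] [Group.IsPerfect S]
    (hπ : IsUniversalCovering π) : Nonempty (Cover ι E X) := by
  have := hπ.perfect
  choose θ hθ hθπ using exists_hom_factor (π := π) hq hker hπ
  have hrange : ∀ i, (θ i).range = ⁅factor q i, factor q i⁆ := fun i =>
    range_eq_commutator_factor hker (hθ i) fun s => by
      obtain ⟨e, he⟩ := hπ.surjective s
      exact ⟨e, (hθπ i e).trans he⟩
  have hcomm : Pairwise fun i j => ∀ x y, Commute (θ i x) (θ j y) := fun i j hij x y =>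
    commute_of_mem_factor hker hij (hrange i ▸ ⟨x, rfl⟩) (hθ j y)
  have hΘ : ∀ e j, q (MonoidHom.noncommPiCoprod θ hcomm e) j = π (e j) := by
    intro e j
    have : (Pi.evalMonoidHom (fun _ : ι => S) j).comp (q.comp (MonoidHom.noncommPiCoprod θ hcomm)) =
        π.comp (Pi.evalMonoidHom (fun _ : ι => E) j) := pi_hom_ext fun i m => by
      change q (MonoidHom.noncommPiCoprod θ hcomm (Pi.mulSingle i m)) j =
        π ((Pi.mulSingle i m : ι → E) j)
      rw [MonoidHom.noncommPiCoprod_mulSingle]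
      by_cases h : j = i
      · subst h
        rw [hθπ, Pi.mulSingle_eq_same]
      · rw [hθ i m j h, Pi.mulSingle_eq_of_ne h, map_one]
    exact DFunLike.congr_fun this e
  refine ⟨{ θ := θ, commute := hcomm, Z := Subgroup.center X, Z_le := le_rfl, Z_eq := rfl,
            gen := fun x => ?_, mem_center := fun e he i => ?_, exists_aut := fun τ => ?_ }⟩
  · choose e he using fun i => hπ.surjective (q x i)
    refine ⟨x * (MonoidHom.noncommPiCoprod θ hcomm e)⁻¹, ?_, e, (inv_mul_cancel_right _ _).symm⟩
    rw [← hker, MonoidHom.mem_ker, map_mul, map_inv, mul_inv_eq_one]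
    funext i
    rw [hΘ, he]
  · refine hπ.ker_le_center ?_
    rw [MonoidHom.mem_ker, ← hΘ, MonoidHom.mem_ker.mp (hker.symm ▸ he)]
    rfl
  · choose s hs hs' using fun i => exists_factor_of_aut hq hker hπ (hθ i) (hθπ i) τ
    have hinj : Function.Injective s := by
      intro i i' h
      by_contra hii
      refine not_forall_commute (S := S) fun a b => ?_
      obtain ⟨a, rfl⟩ := hs' i a
      obtain ⟨b, rfl⟩ := hs' i' b
      rw [h]
      exact (((hcomm hii a b).map τ).map q).map (Pi.evalMonoidHom (fun _ : ι => S) (s i'))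
    have hα : ∀ i, ∃ α : MulAut E, ∀ e, θ (s i) (α e) = τ (θ i e) := fun i => by
      refine hπ.exists_mulAut (f := τ.toMonoidHom.comp (θ i)) (h := θ (s i)) (fun e he => ?_) ?_
      · refine hπ.ker_le_center ?_
        rw [MonoidHom.mem_ker, ← hθπ (s i), MonoidHom.mem_ker.mp he, map_one]
        rfl
      · rw [hrange]
        exact range_eq_commutator_factor hker (hs i) (hs' i)
    choose α hα using hα
    exact ⟨Equiv.ofBijective s (Finite.injective_iff_bijective.mp hinj), α,
      fun i e => (hα i e).symm⟩

end

end CentralProduct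

/-! ### Constituents and central scalars -/

section Constituent

variable {F : Type*} [Field F] {G : Type*} [Group G] {V : Type*} [AddCommGroup V] [Module F V]
  {W : Type*} [AddCommGroup W] [Module F W]

/-- `σ` has a nonzero homomorphism to `τ`. For irreducible `σ` this means that `τ` has a
subrepresentation isomorphic to `σ`. -/
def IsConstituent (σ : Representation F G W) (τ : Representation F G V) : Prop :=
  ∃ f : W →ₗ[F] V, σ.IsIntertwiningMap τ f ∧ f ≠ 0

variable {V' : Type*} [AddCommGroup V'] [Module F V'] {W' : Type*} [AddCommGroup W'] [Module F W']
  {σ : Representation F G W} {σ' : Representation F G W'} {τ : Representation F G V}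
  {τ' : Representation F G V'}

theorem IsConstituent.of_equiv (h : IsConstituent σ τ) (e : σ.Equiv σ') (e' : τ.Equiv τ') :
    IsConstituent σ' τ' := by
  obtain ⟨f, hf, hf0⟩ := h
  refine ⟨e'.toLinearEquiv.toLinearMap ∘ₗ f ∘ₗ e.symm.toLinearEquiv.toLinearMap, ⟨fun g v => ?_⟩,
    fun h0 => hf0 (LinearMap.ext fun v => ?_)⟩
  · simp only [LinearMap.comp_apply, (isIntertwiningMap_equiv e.symm).isIntertwining,
      hf.isIntertwining, (isIntertwiningMap_equiv e').isIntertwining]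
  · have h1 := LinearMap.congr_fun h0 (e.toLinearEquiv v)
    refine e'.toLinearEquiv.injective (Eq.trans ?_ (h1.trans (map_zero e'.toLinearEquiv).symm))
    exact congrArg (fun x => e'.toLinearEquiv (f x)) (e.toLinearEquiv.symm_apply_apply v).symm

theorem resRep_equiv {H : Type*} [Group H] (f : H →* G) (e : τ.Equiv τ') :
    Nonempty ((resRep τ f).Equiv (resRep τ' f)) :=
  ⟨.mk e.toLinearEquiv fun h => e.isIntertwining' (f h)⟩

/-- A central element acts on an irreducible representation by a scalar. -/
theorem exists_smul_of_mem_center [IsAlgClosed F] [FiniteDimensional F V] (hτ : τ.IsIrreducible)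
    {z : G} (hz : ∀ g, g * z = z * g) : ∃ c : F, τ z = c • 1 :=
  exists_smul_of_isIntertwiningMap hτ ⟨fun g v => by
    rw [← Module.End.mul_apply, ← Module.End.mul_apply, ← map_mul, ← map_mul, hz]⟩

theorem smul_one_injective [Nontrivial V] {c c' : F} (h : c • (1 : Module.End F V) = c' • 1) :
    c = c' := by
  obtain ⟨v, hv⟩ := exists_ne (0 : V)
  have h1 := LinearMap.congr_fun h v
  simp only [LinearMap.smul_apply, Module.End.one_apply] at h1
  exact smul_left_injective F hv h1

theorem apply_eq_smul_of_equiv (e : τ.Equiv τ') {g : G} {c : F} (h : τ g = c • 1) :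
    τ' g = c • 1 := by
  refine LinearMap.ext fun v => ?_
  obtain ⟨v, rfl⟩ := e.toLinearEquiv.surjective v
  have h1 := (isIntertwiningMap_equiv e).isIntertwining g v
  refine h1.symm.trans ?_
  rw [h]
  exact e.toLinearEquiv.map_smul c v

/-- A scalar acting on a constituent of the restriction of an irreducible representation to a
central subgroup acts on the whole representation. -/
theorem apply_eq_smul_of_isConstituent [IsAlgClosed F] [FiniteDimensional F V]
    (hτ : τ.IsIrreducible) {H : Type*} [Group H] {j : H →* G} {ν : Representation F H W}
    (h : IsConstituent ν (resRep τ j)) {z : H} (hz : ∀ g, g * j z = j z * g) {c : F}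
    (hc : ν z = c • 1) : τ (j z) = c • 1 := by
  have := nontrivial_of_irreducible hτ
  obtain ⟨f, hf, hf0⟩ := h
  obtain ⟨c', hc'⟩ := exists_smul_of_mem_center hτ hz
  obtain ⟨w, hw⟩ := DFunLike.ne_iff.mp hf0
  have h1 := hf.isIntertwining z w
  rw [hc] at h1
  change f (c • w) = τ (j z) (f w) at h1
  rw [hc', map_smul] at h1
  rw [hc', smul_left_injective F hw h1]

end Constituent

/-! ### Representations of central products -/

section Slot

variable {F : Type*} [Field F] {ι : Type*} [Fintype ι] [DecidableEq ι] {d : ι → ℕ}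

/-- The factors of an outer tensor product are constituents of its restrictions. -/
theorem isConstituent_tensorRep [∀ i, NeZero (d i)] {M : ι → Type*} [∀ i, Group (M i)]
    (ρ : ∀ i, Representation F (M i) (Fin (d i) → F)) (i : ι) :
    IsConstituent (ρ i) (resRep (tensorRep ρ) (MonoidHom.mulSingle M i)) := by
  let L : (Fin (d i) → F) →ₗ[F] TensorSpace F d :=
    { toFun := fun v f => v (f i) * ∏ j ∈ Finset.univ.erase i, (Pi.single 0 1 : Fin (d j) → F) (f j)
      map_add' := fun v w => funext fun f => by simp only [Pi.add_apply, add_mul]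
      map_smul' := fun c v => funext fun f => by
        simp only [Pi.smul_apply, smul_eq_mul, mul_assoc, RingHom.id_apply] }
  have hL : ∀ k, L (Pi.single k 1) = Pi.single (Function.update (fun _ => 0) i k) 1 := by
    intro k
    funext f
    change (Pi.single k 1 : Fin (d i) → F) (f i) *
      ∏ j ∈ Finset.univ.erase i, (Pi.single 0 1 : Fin (d j) → F) (f j) = _
    by_cases hf : f = Function.update (fun _ => 0) i k
    · subst hf
      rw [Pi.single_eq_same, Function.update_self, Pi.single_eq_same, one_mul]
      refine Finset.prod_eq_one fun j hj => ?_
      rw [Function.update_of_ne (Finset.ne_of_mem_erase hj), Pi.single_eq_same]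
    · rw [Pi.single_eq_of_ne hf]
      obtain ⟨j, hj⟩ := Function.ne_iff.mp hf
      by_cases hji : j = i
      · subst hji
        rw [Function.update_self] at hj
        rw [Pi.single_eq_of_ne hj, zero_mul]
      · rw [Function.update_of_ne hji] at hj
        rw [Finset.prod_eq_zero (Finset.mem_erase.mpr ⟨hji, Finset.mem_univ j⟩), mul_zero]
        rw [Pi.single_eq_of_ne hj]
  refine ⟨L, ⟨fun m v => ?_⟩, fun h0 => ?_⟩
  · have : L ∘ₗ ρ i m = tensorRep ρ (Pi.mulSingle i m) ∘ₗ L := by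
      refine LinearMap.pi_ext' fun k => LinearMap.ext_ring (funext fun f => ?_)
      change L (ρ i m (Pi.single k 1)) f = tensorRep ρ (Pi.mulSingle i m) (L (Pi.single k 1)) f
      rw [hL, tensorRep_apply, tensorEnd_single, ← Finset.mul_prod_erase _ _ (Finset.mem_univ i),
        Function.update_self, Pi.mulSingle_eq_same]
      refine congrArg (ρ i m (Pi.single k 1) (f i) * ·) (Finset.prod_congr rfl fun j hj => ?_)
      rw [Function.update_of_ne (Finset.ne_of_mem_erase hj),
        Pi.mulSingle_eq_of_ne (Finset.ne_of_mem_erase hj), map_one]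
      rfl
    exact LinearMap.congr_fun this v
  · have h1 := congrFun ((hL 0).symm.trans (LinearMap.congr_fun h0 (Pi.single 0 1)))
      (Function.update (fun _ => 0) i 0)
    rw [Pi.single_eq_same] at h1
    exact one_ne_zero h1

end Slot

namespace CentralProduct

variable {F : Type*} [Field F] [IsAlgClosed F] {ι : Type*} [Fintype ι] [DecidableEq ι]
  {M : ι → Type*} [∀ i, Group (M i)] {X : Type*} [Group X] (𝒞 : CentralProduct M X)
  {V : Type*} [AddCommGroup V] [Module F V] [FiniteDimensional F V] {ρ : Representation F X V}

omit [DecidableEq ι] in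
theorem exists_eq_smul (hρ : ρ.IsIrreducible) (x : X) :
    ∃ e, ∃ c : F, c ≠ 0 ∧ ρ x = c • ρ (𝒞.Θ e) := by
  have := nontrivial_of_irreducible hρ
  obtain ⟨z, hz, e, rfl⟩ := 𝒞.exists_eq x
  obtain ⟨c, hc⟩ := exists_smul_of_mem_center hρ (𝒞.comm_Z hz)
  refine ⟨e, c, ?_, by rw [map_mul, hc, smul_mul_assoc, one_mul]⟩
  rintro rfl
  have h1 : ρ z * ρ z⁻¹ = 1 := by rw [← map_mul, mul_inv_cancel, map_one]
  rw [hc, zero_smul, zero_mul] at h1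
  exact zero_ne_one h1

omit [DecidableEq ι] in
theorem isIrreducible_resRep (hρ : ρ.IsIrreducible) : (resRep ρ 𝒞.Θ).IsIrreducible := by
  refine isIrreducible_iff.mpr ⟨nontrivial_of_irreducible hρ, fun U hU => ?_⟩
  refine (isIrreducible_iff.mp hρ).2 U fun g v hv => ?_
  obtain ⟨e, c, -, hc⟩ := 𝒞.exists_eq_smul hρ g
  rw [hc]
  exact U.smul_mem c (hU e v hv)

omit [IsAlgClosed F] [FiniteDimensional F V] in
theorem resRep_mulSingle (i : ι) :
    resRep (resRep ρ 𝒞.Θ) (MonoidHom.mulSingle M i) = resRep ρ (𝒞.θ i) :=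
  MonoidHom.ext fun m => congrArg ρ (𝒞.Θ_mulSingle i m)

variable {d : ι → ℕ} {σ : ∀ i, Representation F (M i) (Fin (d i) → F)} [∀ i, Finite (M i)]

/-- An irreducible representation of a central product restricts to the outer tensor product of its
constituents. -/
theorem nonempty_tensorRep_equiv (hρ : ρ.IsIrreducible) (hσ : ∀ i, (σ i).IsIrreducible)
    (h : ∀ i, IsConstituent (σ i) (resRep ρ (𝒞.θ i))) :
    Nonempty ((tensorRep σ).Equiv (resRep ρ 𝒞.Θ)) := by
  choose f hf hf0 using h
  refine AWC.nonempty_tensorRep_equiv (𝒞.isIrreducible_resRep hρ) hσ f (fun i => ?_) hf0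
  rw [resRep_mulSingle]
  exact hf i

omit [∀ i, Finite (M i)] in
/-- The irreducible constituent of the restriction to a factor is unique up to isomorphism. -/
theorem nonempty_equiv_of_isConstituent (hρ : ρ.IsIrreducible) {i : ι} {m n : ℕ}
    {σ : Representation F (M i) (Fin m → F)} {σ' : Representation F (M i) (Fin n → F)}
    (hσ : σ.IsIrreducible) (hσ' : σ'.IsIrreducible) (h : IsConstituent σ (resRep ρ (𝒞.θ i)))
    (h' : IsConstituent σ' (resRep ρ (𝒞.θ i))) : Nonempty (σ.Equiv σ') := by
  obtain ⟨f, hf, hf0⟩ := h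
  obtain ⟨f', hf', hf0'⟩ := h'
  have hinj := injective_of_isIntertwiningMap hσ' hf' hf0'
  refine nonempty_equiv_of_annihilator_le hσ' hσ fun r hr => ?_
  have h1 : (resRep ρ (𝒞.θ i)).asAlgebraHom r = 0 := by
    rw [← 𝒞.resRep_mulSingle] at hf ⊢
    exact asAlgebraHom_mulSingle_eq_zero (𝒞.isIrreducible_resRep hρ) hf hf0 hr
  refine LinearMap.ext fun v => hinj ?_
  rw [asAlgebraHom_map hf', h1, LinearMap.zero_apply, LinearMap.zero_apply, map_zero]

/-- An irreducible representation of a central product is determined by its constituents and by the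
action of the central subgroup. -/
theorem nonempty_equiv {V' : Type*} [AddCommGroup V'] [Module F V'] [FiniteDimensional F V']
    {ρ' : Representation F X V'} (hρ : ρ.IsIrreducible) (hρ' : ρ'.IsIrreducible)
    (hσ : ∀ i, (σ i).IsIrreducible) (h : ∀ i, IsConstituent (σ i) (resRep ρ (𝒞.θ i)))
    (h' : ∀ i, IsConstituent (σ i) (resRep ρ' (𝒞.θ i)))
    (hZ : ∀ z ∈ 𝒞.Z, ∀ c : F, ρ z = c • 1 → ρ' z = c • 1) : Nonempty (ρ.Equiv ρ') := by
  obtain ⟨e⟩ := 𝒞.nonempty_tensorRep_equiv hρ hσ h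
  obtain ⟨e'⟩ := 𝒞.nonempty_tensorRep_equiv hρ' hσ h'
  let a := e.symm.trans e'
  refine ⟨.mk a.toLinearEquiv fun x => LinearMap.ext fun v => ?_⟩
  obtain ⟨z, hz, y, rfl⟩ := 𝒞.exists_eq x
  obtain ⟨c, hc⟩ := exists_smul_of_mem_center hρ (𝒞.comm_Z hz)
  have h1 := (isIntertwiningMap_equiv a).isIntertwining y v
  change a.toLinearEquiv (ρ (z * 𝒞.Θ y) v) = ρ' (z * 𝒞.Θ y) (a.toLinearEquiv v)
  rw [map_mul, map_mul, hc, hZ z hz c hc]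
  refine (a.toLinearEquiv.map_smul c _).trans (congrArg (c • ·) h1)

/-- Irreducible representations of the factors and a character of the central subgroup define an
irreducible representation of the central product if they are compatible. -/
theorem exists_rep (hσ : ∀ i, (σ i).IsIrreducible) (lam : 𝒞.Z →* F)
    (h : ∀ (e : ∀ i, M i) (he : 𝒞.Θ e ∈ 𝒞.Z), tensorRep σ e = lam ⟨𝒞.Θ e, he⟩ • 1) :
    ∃ R : Representation F X (TensorSpace F d), R.IsIrreducible ∧
      (∀ e, R (𝒞.Θ e) = tensorRep σ e) ∧ (∀ z : 𝒞.Z, R z = lam z • 1) ∧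
      ∀ i, IsConstituent (σ i) (resRep R (𝒞.θ i)) := by
  have := fun i => neZero_of_irreducible (hσ i)
  obtain ⟨R, hR, hZ⟩ := exists_extension_of_central 𝒞.Θ 𝒞.Z 𝒞.Z_le 𝒞.gen (tensorRep σ) lam h
  have hR' : resRep R 𝒞.Θ = tensorRep σ := MonoidHom.ext hR
  refine ⟨R, ?_, hR, hZ, fun i => ?_⟩
  · have h1 := tensorRep_irreducible hσ
    refine isIrreducible_iff.mpr ⟨nontrivial_of_irreducible h1, fun U hU => ?_⟩
    refine (isIrreducible_iff.mp h1).2 U fun e v hv => ?_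
    rw [← hR]
    exact hU _ v hv
  · rw [← 𝒞.resRep_mulSingle, hR']
    exact isConstituent_tensorRep σ i

/-- An element acts by a scalar if and only if its components act by scalars. -/
theorem exists_smul_iff (hρ : ρ.IsIrreducible) (hσ : ∀ i, (σ i).IsIrreducible)
    (h : ∀ i, IsConstituent (σ i) (resRep ρ (𝒞.θ i))) {z : X} (hz : z ∈ 𝒞.Z) {e : ∀ i, M i} :
    (∃ c : F, ρ (z * 𝒞.Θ e) = c • 1) ↔ ∀ i, ∃ c : F, σ i (e i) = c • 1 := by
  obtain ⟨a⟩ := 𝒞.nonempty_tensorRep_equiv hρ hσ h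
  obtain ⟨c, hc⟩ := exists_smul_of_mem_center hρ (𝒞.comm_Z hz)
  constructor
  · rintro ⟨c', hc'⟩ i
    obtain ⟨c'', hc''⟩ := exists_smul_of_mem_center hρ (𝒞.comm_Z (inv_mem hz))
    refine exists_smul_of_tensorRep_eq_smul hσ (c := c'' * c') (apply_eq_smul_of_equiv a.symm ?_) i
    change ρ (𝒞.Θ e) = _
    rw [← inv_mul_cancel_left z (𝒞.Θ e), map_mul, hc', hc'', smul_mul_smul_comm, one_mul]
  · intro hi
    choose c' hc' using hi
    refine ⟨c * ∏ i, c' i, ?_⟩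
    have h1 : ρ (𝒞.Θ e) = (∏ i, c' i) • 1 := apply_eq_smul_of_equiv a (tensorRep_eq_smul hc')
    rw [map_mul, hc, h1, smul_mul_smul_comm, one_mul]

theorem isDefectZero_iff [Finite X] (hρ : ρ.IsIrreducible) (hσ : ∀ i, (σ i).IsIrreducible)
    (h : ∀ i, IsConstituent (σ i) (resRep ρ (𝒞.θ i))) :
    IsDefectZero ρ ↔ ∀ i, IsDefectZero (σ i) := by
  obtain ⟨a⟩ := 𝒞.nonempty_tensorRep_equiv hρ hσ h
  rw [← isDefectZero_tensorRep_iff hσ]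
  have h1 : IsDefectZero ρ ↔ IsDefectZero (resRep ρ 𝒞.Θ) := isDefectZero_congr
    (fun x => by
      obtain ⟨e, c, -, hc⟩ := 𝒞.exists_eq_smul hρ x
      exact ⟨e, c, hc⟩)
    (fun e => ⟨𝒞.Θ e, 1, (one_smul _ _).symm⟩)
  rw [h1]
  exact ⟨fun h => h.of_equiv a.symm, fun h => h.of_equiv a⟩

end CentralProduct

/-! ### Elements of `p`-power order -/

section PElements

variable {G : Type*} [Group G] {p : ℕ}

/-- The elements of `p`-power order. -/
def IsPElt (p : ℕ) (x : G) : Prop := ∃ k : ℕ, x ^ p ^ k = 1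

theorem IsPElt.one : IsPElt p (1 : G) := ⟨0, one_pow _⟩

theorem IsPElt.pow_eq_one {x : G} {k l : ℕ} (h : x ^ p ^ k = 1) (hkl : k ≤ l) : x ^ p ^ l = 1 := by
  rw [← Nat.add_sub_cancel' hkl, pow_add, pow_mul, h, one_pow]

theorem IsPElt.mul {x y : G} (hx : IsPElt p x) (hy : IsPElt p y) (h : Commute x y) :
    IsPElt p (x * y) := by
  obtain ⟨k, hk⟩ := hx
  obtain ⟨l, hl⟩ := hy
  exact ⟨max k l, by rw [h.mul_pow, pow_eq_one hk (le_max_left _ _),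
    pow_eq_one hl (le_max_right _ _), one_mul]⟩

theorem IsPElt.inv {x : G} (hx : IsPElt p x) : IsPElt p x⁻¹ := by
  obtain ⟨k, hk⟩ := hx
  exact ⟨k, by rw [inv_pow, hk, inv_one]⟩

theorem IsPElt.map {H : Type*} [Group H] (f : G →* H) {x : G} (hx : IsPElt p x) :
    IsPElt p (f x) := by
  obtain ⟨k, hk⟩ := hx
  exact ⟨k, by rw [← map_pow, hk, map_one]⟩

theorem IsPElt.of_map {H : Type*} [Group H] {f : G →* H} (hf : Function.Injective f) {x : G}
    (hx : IsPElt p (f x)) : IsPElt p x := by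
  obtain ⟨k, hk⟩ := hx
  exact ⟨k, hf (by rw [map_pow, hk, map_one])⟩

theorem IsPElt.zpow {x : G} (hx : IsPElt p x) (n : ℤ) : IsPElt p (x ^ n) := by
  obtain ⟨k, hk⟩ := hx
  exact ⟨k, by rw [← zpow_natCast, ← zpow_mul, mul_comm, zpow_mul, zpow_natCast, hk, one_zpow]⟩

theorem IsPElt.conj {x : G} (hx : IsPElt p x) (g : G) : IsPElt p (g * x * g⁻¹) :=
  hx.map (MulAut.conj g).toMonoidHom

theorem IsPElt.pi {ι : Type*} [Fintype ι] {M : ι → Type*} [∀ i, Group (M i)] {e : ∀ i, M i}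
    (h : ∀ i, IsPElt p (e i)) : IsPElt p e := by
  choose k hk using h
  exact ⟨∑ i, k i, funext fun i =>
    pow_eq_one (hk i) (Finset.single_le_sum (fun j _ => Nat.zero_le (k j)) (Finset.mem_univ i))⟩

theorem isPElt_of_isPGroup {Q : Subgroup G} (hQ : IsPGroup p Q) {x : G} (hx : x ∈ Q) :
    IsPElt p x :=
  (hQ ⟨x, hx⟩).imp fun _ hk => congrArg Subtype.val hk

theorem isPGroup_of_isPElt {Q : Subgroup G} (h : ∀ x ∈ Q, IsPElt p x) : IsPGroup p Q :=
  fun x => (h x x.2).imp fun _ hk => Subtype.ext hk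

/-- The decomposition of an element into a `p`-part and a `p'`-part, where the latter lies in a
subgroup that contains some `p`-power of the element. -/
theorem exists_isPElt_mul [Finite G] [hp : Fact p.Prime] {C : Subgroup G} {x : G} {k : ℕ}
    (hx : x ^ p ^ k ∈ C) :
    ∃ u ∈ Subgroup.zpowers x, ∃ w ∈ C, w ∈ Subgroup.zpowers x ∧ IsPElt p u ∧ x = u * w := by
  obtain ⟨a, m, hm, ham⟩ := Nat.exists_eq_pow_mul_and_not_dvd (orderOf_pos x).ne' p hp.out.ne_one
  have hcop : IsCoprime (m : ℤ) ((p ^ (a + k) : ℕ) : ℤ) :=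
    Nat.isCoprime_iff_coprime.mpr
      (((Nat.Prime.coprime_iff_not_dvd hp.out).mpr hm).symm.pow_right _)
  obtain ⟨r, s, hrs⟩ := hcop
  refine ⟨x ^ (r * m), ⟨_, rfl⟩, x ^ (s * (p ^ (a + k) : ℕ)), ?_, ⟨_, rfl⟩, ⟨a, ?_⟩, ?_⟩
  · rw [mul_comm, zpow_mul, zpow_natCast, pow_add, mul_comm, pow_mul]
    exact C.zpow_mem (C.pow_mem hx _) _
  · have : (r * m * (p ^ a : ℕ) : ℤ) = (orderOf x : ℤ) * r := by rw [ham]; push_cast; ring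
    rw [← zpow_natCast, ← zpow_mul, this, zpow_mul, zpow_natCast, pow_orderOf_eq_one, one_zpow]
  · rw [← zpow_add, hrs, zpow_one]

end PElements

/-! ### Products of `p`-subgroups of the factors and their normalizers -/

section IsProd

variable {ι : Type*} [Fintype ι] [DecidableEq ι] {E X : Type*} [Group E] [Group X]
  (𝒞 : Cover ι E X) (p : ℕ)

/-- The subgroup `Q` is the product of the images of the `p`-subgroups `R i` and of the `p`-part of
the center. -/
structure IsProd (Q : Subgroup X) (R : ι → Subgroup E) : Prop where
  mem_iff : ∀ x, x ∈ Q ↔ ∃ z ∈ Subgroup.center X, IsPElt p z ∧ ∃ e, (∀ i, e i ∈ R i) ∧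
    x = z * 𝒞.Θ e
  isPElt : ∀ i, ∀ e ∈ R i, IsPElt p e
  mem_of_center : ∀ i, ∀ e ∈ Subgroup.center E, IsPElt p e → e ∈ R i

variable {𝒞 p} {Q : Subgroup X} {R : ι → Subgroup E}

omit [DecidableEq ι] in
theorem Cover.mem_Z {z : X} : z ∈ 𝒞.Z ↔ z ∈ Subgroup.center X := by rw [𝒞.Z_eq]

omit [DecidableEq ι] in
theorem Cover.exists_eq (x : X) : ∃ z ∈ Subgroup.center X, ∃ e, x = z * 𝒞.Θ e := by
  obtain ⟨z, hz, e, rfl⟩ := 𝒞.toCentralProduct.exists_eq x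
  exact ⟨z, Cover.mem_Z.mp hz, e, rfl⟩

omit [DecidableEq ι] in
theorem Cover.mul_inv_mem_center {z z' : X} (hz : z ∈ Subgroup.center X)
    (hz' : z' ∈ Subgroup.center X) {e e' : ι → E} (h : z * 𝒞.Θ e = z' * 𝒞.Θ e') (i : ι) :
    e i * (e' i)⁻¹ ∈ Subgroup.center E := by
  refine 𝒞.mem_center (e * e'⁻¹) ?_ i
  change 𝒞.Θ (e * e'⁻¹) ∈ _
  have h1 : 𝒞.Θ (e * e'⁻¹) = z⁻¹ * z' := by
    rw [map_mul, map_inv, mul_inv_eq_iff_eq_mul, mul_assoc, ← h, inv_mul_cancel_left]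
  rw [h1]
  exact mul_mem (inv_mem hz) hz'

omit [DecidableEq ι] in
theorem Cover.Θ_mem_center {e : ι → E} (he : ∀ i, e i ∈ Subgroup.center E) :
    𝒞.Θ e ∈ Subgroup.center X := by
  refine Subgroup.mem_center_iff.mpr fun x => ?_
  obtain ⟨z, hz, y, rfl⟩ := 𝒞.exists_eq x
  have h1 : y * e = e * y := funext fun i => Subgroup.mem_center_iff.mp (he i) (y i)
  rw [mul_assoc, ← map_mul, h1, map_mul, ← mul_assoc, ← mul_assoc,
    Subgroup.mem_center_iff.mp hz (𝒞.Θ e)]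

omit [DecidableEq ι] in
/-- An element of `E` that agrees with an element of `R i` modulo the center. -/
theorem IsProd.mem_of_mul_inv (h : IsProd 𝒞 p Q R) {i : ι} {e e' : E} (he : IsPElt p e)
    (he' : e' ∈ R i) (hc : e * e'⁻¹ ∈ Subgroup.center E) : e ∈ R i := by
  have h1 : Commute e e'⁻¹ := by
    have := (Subgroup.mem_center_iff.mp hc e').symm
    rw [inv_mul_cancel_right, ← mul_assoc, eq_mul_inv_iff_mul_eq] at this
    exact (show Commute e e' from this).inv_right
  have h2 := h.mem_of_center i _ hc (he.mul (h.isPElt i e' he').inv h1)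
  simpa using mul_mem h2 he'

omit [DecidableEq ι] in
/-- A `p`-element whose components lie in the subgroups `R i` modulo the center lies in `Q`. -/
theorem IsProd.mem_of_forall_exists (h : IsProd 𝒞 p Q R) {z : X} (hz : z ∈ Subgroup.center X)
    {e : ι → E} (hx : IsPElt p (z * 𝒞.Θ e))
    (he : ∀ i, ∃ u ∈ R i, ∃ w ∈ Subgroup.center E, e i = u * w) : z * 𝒞.Θ e ∈ Q := by
  choose u hu w hw huw using he
  have h2 : e = w * u := funext fun i => by
    rw [huw]
    exact Subgroup.mem_center_iff.mp (hw i) _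
  have h3 : z * 𝒞.Θ w ∈ Subgroup.center X := mul_mem hz (𝒞.Θ_mem_center hw)
  have h4 : z * 𝒞.Θ w = z * 𝒞.Θ e * 𝒞.Θ u⁻¹ := by
    rw [h2, map_mul, map_inv]; group
  refine (h.mem_iff _).mpr ⟨z * 𝒞.Θ w, h3, ?_, u, hu, by rw [h2, map_mul, mul_assoc]⟩
  have h5 : Commute (z * 𝒞.Θ e) (𝒞.Θ u⁻¹) := by
    have h6 : z * 𝒞.Θ e = z * 𝒞.Θ w * 𝒞.Θ u := by rw [h2, map_mul, mul_assoc]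
    rw [h6, map_inv]
    exact (Commute.mul_left (Subgroup.mem_center_iff.mp h3 _).symm (Commute.refl _)).inv_right
  rw [h4]
  exact hx.mul ((IsPElt.pi fun i => (h.isPElt i _ (hu i)).inv).map 𝒞.Θ) h5

/-- The subgroups `R i` are determined by `Q`. -/
theorem IsProd.mem_iff_θ (h : IsProd 𝒞 p Q R) {i : ι} {e : E} :
    e ∈ R i ↔ IsPElt p e ∧ 𝒞.θ i e ∈ Q := by
  constructor
  · intro he
    refine ⟨h.isPElt i e he, (h.mem_iff _).mpr ⟨1, one_mem _, IsPElt.one, Pi.mulSingle i e, ?_, ?_⟩⟩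
    · intro j
      by_cases hj : j = i
      · subst hj
        rwa [Pi.mulSingle_eq_same]
      · rw [Pi.mulSingle_eq_of_ne hj]
        exact one_mem _
    · rw [one_mul]
      exact (𝒞.toCentralProduct.Θ_mulSingle i e).symm
  · rintro ⟨he, hQ⟩
    obtain ⟨z, hz, -, e', he', hx⟩ := (h.mem_iff _).mp hQ
    refine h.mem_of_mul_inv he (he' i) ?_
    have h1 : 1 * 𝒞.Θ (Pi.mulSingle i e) = z * 𝒞.Θ e' := by
      rw [one_mul, ← hx]
      exact 𝒞.toCentralProduct.Θ_mulSingle i e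
    have := 𝒞.mul_inv_mem_center (one_mem _) hz h1 i
    rwa [Pi.mulSingle_eq_same] at this

theorem IsProd.eq (h : IsProd 𝒞 p Q R) {R' : ι → Subgroup E} (h' : IsProd 𝒞 p Q R') (i : ι) :
    R i = R' i := by
  ext e
  rw [h.mem_iff_θ, h'.mem_iff_θ]

theorem IsProd.mem_normalizer_iff [Finite E] [Finite X] (h : IsProd 𝒞 p Q R) {z : X}
    (hz : z ∈ Subgroup.center X) {e : ι → E} :
    z * 𝒞.Θ e ∈ Subgroup.normalizer (Q : Set X) ↔
      ∀ i, e i ∈ Subgroup.normalizer (R i : Set E) := by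
  have hz' := Cover.mem_Z (𝒞 := 𝒞).mpr hz
  constructor
  · intro hN i
    refine Subgroup.mem_normalizer_fintype fun q hq => ?_
    have h1 := (h.mem_iff_θ.mp hq).2
    refine h.mem_iff_θ.mpr ⟨(h.isPElt i q hq).conj _, ?_⟩
    rw [← 𝒞.toCentralProduct.Θ_conj hz' i q]
    exact (Subgroup.mem_normalizer_iff.mp hN _).mp h1
  · intro hN
    refine Subgroup.mem_normalizer_fintype fun q hq => ?_
    obtain ⟨w, hw, hwp, r, hr, rfl⟩ := (h.mem_iff q).mp hq
    refine (h.mem_iff _).mpr ⟨w, hw, hwp, e * r * e⁻¹, fun i => ?_, ?_⟩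
    · exact (Subgroup.mem_normalizer_iff.mp (hN i) _).mp (hr i)
    · rw [map_mul, map_mul, map_inv, mul_inv_rev]
      have h1 := Subgroup.mem_center_iff.mp hz
      have h2 := Subgroup.mem_center_iff.mp hw
      calc z * 𝒞.Θ e * (w * 𝒞.Θ r) * ((𝒞.Θ e)⁻¹ * z⁻¹)
          = z * (𝒞.Θ e * w * 𝒞.Θ r * (𝒞.Θ e)⁻¹) * z⁻¹ := by group
        _ = 𝒞.Θ e * w * 𝒞.Θ r * (𝒞.Θ e)⁻¹ := by rw [← h1, mul_inv_cancel_right]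
        _ = _ := by rw [h2]; group

/-- The homomorphism between normalizers induced by the embedding of a factor. -/
def IsProd.normHom [Finite E] [Finite X] (h : IsProd 𝒞 p Q R) (i : ι) :
    Subgroup.normalizer (R i : Set E) →* Subgroup.normalizer (Q : Set X) :=
  ((𝒞.θ i).comp (Subgroup.normalizer (R i : Set E)).subtype).codRestrict _ fun e => by
    have h1 := (h.mem_normalizer_iff (one_mem _) (e := Pi.mulSingle i (e : E))).mpr fun j => by
      by_cases hj : j = i
      · subst hj
        rw [Pi.mulSingle_eq_same]
        exact e.2
      · rw [Pi.mulSingle_eq_of_ne hj]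
        exact one_mem _
    have h2 : (𝒞.θ i).comp (Subgroup.normalizer (R i : Set E)).subtype e =
        𝒞.Θ (Pi.mulSingle i (e : E)) := (𝒞.toCentralProduct.Θ_mulSingle i (e : E)).symm
    rwa [one_mul, ← h2] at h1

theorem IsProd.normHom_commute [Finite E] [Finite X] (h : IsProd 𝒞 p Q R) :
    Pairwise fun i j => ∀ x y, Commute (h.normHom i x) (h.normHom j y) :=
  fun _ _ hij x y => Subtype.ext (𝒞.commute hij (x : E) (y : E))

theorem IsProd.coe_noncommPiCoprod [Finite E] [Finite X] (h : IsProd 𝒞 p Q R)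
    (e : ∀ i, Subgroup.normalizer (R i : Set E)) :
    (MonoidHom.noncommPiCoprod h.normHom h.normHom_commute e : X) =
      𝒞.Θ fun i => (e i : E) := by
  have : (Subgroup.normalizer (Q : Set X)).subtype.comp
      (MonoidHom.noncommPiCoprod h.normHom h.normHom_commute) =
      𝒞.Θ.comp (MonoidHom.piMap fun i => (Subgroup.normalizer (R i : Set E)).subtype) := by
    refine pi_hom_ext fun i m => ?_
    have h1 : (MonoidHom.piMap fun i => (Subgroup.normalizer (R i : Set E)).subtype)
        (Pi.mulSingle i m) = Pi.mulSingle i (m : E) := by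
      funext j
      by_cases hj : j = i
      · subst hj; simp [MonoidHom.piMap]
      · simp [MonoidHom.piMap, Pi.mulSingle_eq_of_ne hj]
    rw [MonoidHom.comp_apply, MonoidHom.comp_apply, MonoidHom.noncommPiCoprod_mulSingle, h1]
    exact (𝒞.toCentralProduct.Θ_mulSingle i (m : E)).symm
  exact DFunLike.congr_fun this e

/-- The normalizer of a product of subgroups is the central product of the normalizers. -/
def IsProd.normProd [Finite E] [Finite X] (h : IsProd 𝒞 p Q R) :
    CentralProduct (fun i => Subgroup.normalizer (R i : Set E))
      (Subgroup.normalizer (Q : Set X)) where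
  θ := h.normHom
  commute := h.normHom_commute
  Z := (Subgroup.center X).subgroupOf _
  Z_le := fun z hz => Subgroup.mem_center_iff.mpr fun g =>
    Subtype.ext (Subgroup.mem_center_iff.mp hz g)
  gen := fun x => by
    obtain ⟨z, hz, e, he⟩ := 𝒞.exists_eq x
    have hx := x.2
    rw [he, h.mem_normalizer_iff hz] at hx
    refine ⟨⟨z, Subgroup.center_le_normalizer _ hz⟩, hz, fun i => ⟨e i, hx i⟩, Subtype.ext ?_⟩
    rw [Subgroup.coe_mul, h.coe_noncommPiCoprod]
    exact he

omit [DecidableEq ι] in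
variable (𝒞) in
theorem exists_isProd (hR : ∀ i, ∀ e ∈ R i, IsPElt p e)
    (hc : ∀ i, ∀ e ∈ Subgroup.center E, IsPElt p e → e ∈ R i) :
    ∃ Q : Subgroup X, IsPGroup p Q ∧ IsProd 𝒞 p Q R := by
  let Q : Subgroup X :=
    { carrier := {x | ∃ z ∈ Subgroup.center X, IsPElt p z ∧ ∃ e, (∀ i, e i ∈ R i) ∧ x = z * 𝒞.Θ e}
      mul_mem' := by
        rintro _ _ ⟨z, hz, hzp, e, he, rfl⟩ ⟨z', hz', hzp', e', he', rfl⟩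
        refine ⟨z * z', mul_mem hz hz', hzp.mul hzp' (Subgroup.mem_center_iff.mp hz' z), e * e',
          fun i => mul_mem (he i) (he' i), ?_⟩
        rw [map_mul, mul_assoc, ← mul_assoc (𝒞.Θ e), Subgroup.mem_center_iff.mp hz' (𝒞.Θ e)]
        simp only [mul_assoc]
      one_mem' := ⟨1, one_mem _, IsPElt.one, 1, fun i => one_mem _, by rw [map_one, one_mul]⟩
      inv_mem' := by
        rintro _ ⟨z, hz, hzp, e, he, rfl⟩
        refine ⟨z⁻¹, inv_mem hz, hzp.inv, e⁻¹, fun i => inv_mem (he i), ?_⟩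
        rw [map_inv, mul_inv_rev, Subgroup.mem_center_iff.mp (inv_mem hz)] }
  refine ⟨Q, isPGroup_of_isPElt ?_, ⟨fun x => Iff.rfl, hR, hc⟩⟩
  rintro _ ⟨z, hz, hzp, e, he, rfl⟩
  exact hzp.mul ((IsPElt.pi fun i => hR i _ (he i)).map 𝒞.Θ)
    (Subgroup.mem_center_iff.mp hz _).symm

theorem Cover.aut_Θ {τ : MulAut X} {s : Equiv.Perm ι} {α : ι → MulAut E}
    (hτ : ∀ i e, τ (𝒞.θ i e) = 𝒞.θ (s i) (α i e)) (e : ι → E) :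
    τ (𝒞.Θ e) = 𝒞.Θ fun j => α (s.symm j) (e (s.symm j)) := by
  let A : (ι → E) →* (ι → E) :=
    { toFun := fun e j => α (s.symm j) (e (s.symm j))
      map_one' := funext fun j => map_one _
      map_mul' := fun e e' => funext fun j => map_mul _ _ _ }
  have : τ.toMonoidHom.comp 𝒞.Θ = 𝒞.Θ.comp A := pi_hom_ext fun i m => by
    have h1 : A (Pi.mulSingle i m) = Pi.mulSingle (s i) (α i m) := by
      funext j
      obtain ⟨k, rfl⟩ := s.surjective j
      change α (s.symm (s k)) ((Pi.mulSingle i m : ι → E) (s.symm (s k))) = _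
      rw [s.symm_apply_apply]
      by_cases hk : k = i
      · subst hk
        rw [Pi.mulSingle_eq_same, Pi.mulSingle_eq_same]
      · rw [Pi.mulSingle_eq_of_ne hk, Pi.mulSingle_eq_of_ne (s.injective.ne hk), map_one]
    rw [MonoidHom.comp_apply, MonoidHom.comp_apply, h1]
    refine (congrArg τ (𝒞.toCentralProduct.Θ_mulSingle i m)).trans ((hτ i m).trans ?_)
    exact (𝒞.toCentralProduct.Θ_mulSingle (s i) (α i m)).symm
  exact DFunLike.congr_fun this e

theorem mem_center_map {G : Type*} [Group G] (τ : MulAut G) {z : G} :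
    τ z ∈ Subgroup.center G ↔ z ∈ Subgroup.center G := by
  rw [Subgroup.mem_center_iff, Subgroup.mem_center_iff]
  constructor
  · intro h g
    refine τ.injective ?_
    rw [map_mul, map_mul, h]
  · intro h g
    obtain ⟨g, rfl⟩ := τ.surjective g
    rw [← map_mul, ← map_mul, h]

theorem IsProd.map (h : IsProd 𝒞 p Q R) {τ : MulAut X} {s : Equiv.Perm ι} {α : ι → MulAut E}
    (hτ : ∀ i e, τ (𝒞.θ i e) = 𝒞.θ (s i) (α i e)) {R' : ι → Subgroup E}
    (hR : ∀ i, R' (s i) = (R i).map (α i).toMonoidHom) :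
    IsProd 𝒞 p (Q.map τ.toMonoidHom) R' := by
  refine ⟨fun x => ?_, fun j e he => ?_, fun j e he hep => ?_⟩
  · constructor
    · rintro ⟨y, hy, rfl⟩
      obtain ⟨z, hz, hzp, e, he, rfl⟩ := (h.mem_iff y).mp hy
      refine ⟨τ z, (mem_center_map τ).mpr hz, hzp.map τ.toMonoidHom,
        fun j => α (s.symm j) (e (s.symm j)), fun j => ?_, ?_⟩
      · obtain ⟨i, rfl⟩ := s.surjective j
        rw [hR]
        exact ⟨e i, he i, by simp⟩
      · rw [← 𝒞.aut_Θ hτ]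
        exact map_mul τ _ _
    · rintro ⟨z, hz, hzp, e, he, rfl⟩
      have h1 : ∀ i, ∃ r ∈ R i, α i r = e (s i) := fun i => by
        have := he (s i)
        rw [hR] at this
        exact this
      choose r hr hre using h1
      refine ⟨τ.symm z * 𝒞.Θ r, (h.mem_iff _).mpr ⟨_, ?_, hzp.map τ.symm.toMonoidHom, r, hr, rfl⟩, ?_⟩
      · refine (mem_center_map τ).mp ?_
        change τ (τ.symm z) ∈ _
        rwa [τ.apply_symm_apply]
      · change τ (τ.symm z * 𝒞.Θ r) = _
        rw [map_mul, τ.apply_symm_apply, 𝒞.aut_Θ hτ]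
        refine congrArg (fun e => z * 𝒞.Θ e) (funext fun j => ?_)
        rw [hre, s.apply_symm_apply]
  · obtain ⟨i, rfl⟩ := s.surjective j
    rw [hR] at he
    obtain ⟨r, hr, rfl⟩ := he
    exact (h.isPElt i r hr).map (α i).toMonoidHom
  · obtain ⟨i, rfl⟩ := s.surjective j
    rw [hR]
    have h2 : (α i) ((α i).symm e) = e := (α i).apply_symm_apply e
    exact ⟨(α i).symm e, h.mem_of_center i _ ((mem_center_map (α i)).mp (h2.symm ▸ he))
      (hep.map (α i).symm.toMonoidHom), h2⟩

/-- In a finite nilpotent group the `p`-elements form a subgroup. -/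
theorem IsPElt.mul_of_isNilpotent {H : Type*} [Group H] [Finite H] [Group.IsNilpotent H]
    [Fact p.Prime] {a b : H} (ha : IsPElt p a) (hb : IsPElt p b) : IsPElt p (a * b) := by
  obtain ⟨P⟩ : Nonempty (Sylow p H) := inferInstance
  have hP : (P : Subgroup H).Normal := inferInstance
  have := Sylow.unique_of_normal P hP
  have key : ∀ x : H, IsPElt p x → x ∈ (P : Subgroup H) := fun x hx => by
    have h1 : IsPGroup p (Subgroup.zpowers x) := isPGroup_of_isPElt fun y hy => by
      obtain ⟨n, rfl⟩ := hy
      exact hx.zpow n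
    obtain ⟨P', hP'⟩ := h1.exists_le_sylow
    rw [Subsingleton.elim P P']
    exact hP' (Subgroup.mem_zpowers x)
  exact isPElt_of_isPGroup P.isPGroup' (mul_mem (key a ha) (key b hb))

/-- A `p`-subgroup that contains all normal `p`-subgroups of its normalizer is a product of
subgroups of the factors. -/
theorem exists_isProd_of_radical [Finite E] [Finite X] [Fact p.Prime] (hQ : IsPGroup p Q)
    (hrad : ∀ P : Subgroup (Subgroup.normalizer (Q : Set X)), P.Normal → IsPGroup p P →
      ∀ x ∈ P, (x : X) ∈ Q) : ∃ R, IsProd 𝒞 p Q R := by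
  -- the projections of `Q`, which are `p`-groups modulo the center of `E`
  let T : ι → Subgroup E := fun i =>
    { carrier := {e | ∃ z ∈ Subgroup.center X, ∃ e', z * 𝒞.Θ e' ∈ Q ∧ e' i = e}
      mul_mem' := by
        rintro _ _ ⟨z, hz, e, he, rfl⟩ ⟨z', hz', e', he', rfl⟩
        refine ⟨z * z', mul_mem hz hz', e * e', ?_, rfl⟩
        have h1 : z * z' * 𝒞.Θ (e * e') = z * 𝒞.Θ e * (z' * 𝒞.Θ e') := by
          rw [map_mul, mul_assoc, mul_assoc, ← mul_assoc (𝒞.Θ e),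
            Subgroup.mem_center_iff.mp hz' (𝒞.Θ e), mul_assoc]
        rw [h1]
        exact mul_mem he he'
      one_mem' := ⟨1, one_mem _, 1, by rw [map_one, one_mul]; exact one_mem _, rfl⟩
      inv_mem' := by
        rintro _ ⟨z, hz, e, he, rfl⟩
        refine ⟨z⁻¹, inv_mem hz, e⁻¹, ?_, rfl⟩
        rw [map_inv, ← Subgroup.mem_center_iff.mp (inv_mem hz), ← mul_inv_rev]
        exact inv_mem he }
  have hTp : ∀ i, ∀ e ∈ T i, ∃ k, e ^ p ^ k ∈ Subgroup.center E := by
    rintro i _ ⟨z, hz, e, he, rfl⟩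
    obtain ⟨k, hk⟩ := isPElt_of_isPGroup hQ he
    refine ⟨k, ?_⟩
    rw [(show Commute z (𝒞.Θ e) from (Subgroup.mem_center_iff.mp hz _).symm).mul_pow,
      ← map_pow] at hk
    have := 𝒞.mul_inv_mem_center (pow_mem hz _) (one_mem _) (e' := 1)
      (hk.trans (by rw [map_one, one_mul])) i
    simpa using this
  have hTc : ∀ i, Subgroup.center E ≤ T i := fun i e he => by
    refine ⟨(𝒞.Θ (Pi.mulSingle i e))⁻¹, inv_mem (𝒞.Θ_mem_center fun j => ?_), Pi.mulSingle i e,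
      by rw [inv_mul_cancel]; exact one_mem _, Pi.mulSingle_eq_same _ _⟩
    by_cases hj : j = i
    · subst hj
      rwa [Pi.mulSingle_eq_same]
    · rw [Pi.mulSingle_eq_of_ne hj]
      exact one_mem _
  have hTn : ∀ i, Group.IsNilpotent (T i) := fun i => by
    let f : T i →* E ⧸ Subgroup.center E := (QuotientGroup.mk' _).comp (T i).subtype
    have h1 : IsPGroup p f.range := by
      rintro ⟨_, e, rfl⟩
      obtain ⟨k, hk⟩ := hTp i e e.2
      refine ⟨k, Subtype.ext ?_⟩
      change (((e : E) : E ⧸ Subgroup.center E)) ^ p ^ k = 1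
      rw [← QuotientGroup.mk_pow]
      exact (QuotientGroup.eq_one_iff _).mpr hk
    have := h1.isNilpotent
    refine Subgroup.isNilpotent_of_ker_le_center f.rangeRestrict fun e he => ?_
    have h2 : ((e : E) : E ⧸ Subgroup.center E) = 1 := congrArg Subtype.val he
    have h3 := (QuotientGroup.eq_one_iff _).mp h2
    exact Subgroup.mem_center_iff.mpr fun e' => Subtype.ext (Subgroup.mem_center_iff.mp h3 e')
  let R : ι → Subgroup E := fun i =>
    { carrier := {e | e ∈ T i ∧ IsPElt p e}
      mul_mem' := by
        rintro a b ⟨ha, hap⟩ ⟨hb, hbp⟩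
        have := hTn i
        have h1 := IsPElt.mul_of_isNilpotent
          (IsPElt.of_map (f := (T i).subtype) (Subgroup.subtype_injective _) (x := ⟨a, ha⟩) hap)
          (IsPElt.of_map (f := (T i).subtype) (Subgroup.subtype_injective _) (x := ⟨b, hb⟩) hbp)
        exact ⟨mul_mem ha hb, h1.map (T i).subtype⟩
      one_mem' := ⟨one_mem _, IsPElt.one⟩
      inv_mem' := fun ⟨ha, hap⟩ => ⟨inv_mem ha, hap.inv⟩ }
  obtain ⟨P, hPp, hP⟩ := exists_isProd 𝒞 (R := R) (p := p) (fun i e he => he.2)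
    (fun i e he hep => ⟨hTc i he, hep⟩)
  have hQP : Q ≤ P := by
    intro x hx
    obtain ⟨z, hz, e, rfl⟩ := 𝒞.exists_eq x
    have h1 : ∀ i, ∃ u ∈ R i, ∃ w ∈ Subgroup.center E, e i = u * w := fun i => by
      have hei : e i ∈ T i := ⟨z, hz, e, hx, rfl⟩
      obtain ⟨k, hk⟩ := hTp i _ hei
      obtain ⟨u, hu, w, hw, -, hup, huw⟩ := exists_isPElt_mul (p := p) hk
      exact ⟨u, ⟨(Subgroup.zpowers_le.mpr hei) hu, hup⟩, w, hw, huw⟩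
    exact hP.mem_of_forall_exists hz (isPElt_of_isPGroup hQ hx) h1
  -- the normalizer of `Q` normalizes `P`
  have hN : ∀ g ∈ Subgroup.normalizer (Q : Set X), ∀ x ∈ P, g * x * g⁻¹ ∈ P := by
    intro g hg x hx
    obtain ⟨z, hz, hzp, r, hr, rfl⟩ := (hP.mem_iff _).mp hx
    obtain ⟨y, hy, e, rfl⟩ := 𝒞.exists_eq g
    have hconj : ∀ (w : X) (f : ι → E), w ∈ Subgroup.center X →
        y * 𝒞.Θ e * (w * 𝒞.Θ f) * (y * 𝒞.Θ e)⁻¹ = w * 𝒞.Θ (e * f * e⁻¹) := by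
      intro w f hw
      have h1 := Subgroup.mem_center_iff.mp hw
      have h2 := Subgroup.mem_center_iff.mp hy
      rw [← mul_assoc, h1 (y * 𝒞.Θ e), mul_inv_rev, map_mul, map_mul, map_inv]
      calc w * (y * 𝒞.Θ e) * 𝒞.Θ f * ((𝒞.Θ e)⁻¹ * y⁻¹)
          = w * (y * (𝒞.Θ e * 𝒞.Θ f * (𝒞.Θ e)⁻¹)) * y⁻¹ := by group
        _ = _ := by rw [← h2]; group
    refine (hP.mem_iff _).mpr ⟨z, hz, hzp, e * r * e⁻¹, fun i => ⟨?_, ((hr i).2).conj _⟩, hconj z r hz⟩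
    obtain ⟨w, hw, f, hf, hfr⟩ := (hr i).1
    refine ⟨w, hw, e * f * e⁻¹, ?_, by simp [hfr]⟩
    rw [← hconj w f hw]
    exact (Subgroup.mem_normalizer_iff.mp hg _).mp hf
  have hPQ : ∀ x ∈ P, x ∈ Subgroup.normalizer (Q : Set X) → x ∈ Q := fun x hx hxN =>
    hrad (P.subgroupOf _) ⟨fun y hy g => hN g g.2 y hy⟩
      (isPGroup_of_isPElt fun y hy => IsPElt.of_map (f := Subgroup.subtype _)
        (Subgroup.subtype_injective _) (isPElt_of_isPGroup hPp hy)) ⟨x, hxN⟩ hx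
  have hnil : Group.IsNilpotent P := hPp.isNilpotent
  have hcond := Group.normalizerCondition_of_isNilpotent (G := P)
  have htop : Q.subgroupOf P = ⊤ := by
    by_contra hne
    refine (hcond _ (lt_top_iff_ne_top.mpr hne)).not_ge fun y hy => ?_
    refine hPQ y y.2 (Subgroup.mem_normalizer_fintype fun x hx => ?_)
    exact (Subgroup.mem_normalizer_iff.mp hy ⟨x, hQP hx⟩).mp hx
  have hPQ' : P = Q := le_antisymm (Subgroup.subgroupOf_eq_top.mp htop) hQP
  exact ⟨R, hPQ' ▸ hP⟩

end IsProd

/-! ### Restriction to the center -/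

section CentralCharacter

variable {F : Type u} [Field F] [IsAlgClosed F] {G : Type v} [Group G] {Z : Type v} [Group Z]

omit [IsAlgClosed F] in
theorem cls_mem_over_iff {j : Z →* G} {ρ : IrrRep F G} {ν : IrrRep F Z} :
    ρ.cls ∈ IBr.over j ν.cls ↔ IsConstituent ν.rep (resRep ρ.rep j) := by
  constructor
  · rintro ⟨ρ', ν', hρ, hν, i, hi⟩
    obtain ⟨e⟩ := IrrRep.cls_eq_iff.mp hρ
    obtain ⟨e'⟩ := IrrRep.cls_eq_iff.mp hν
    obtain ⟨e''⟩ := resRep_equiv j e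
    have := nontrivial_of_irreducible ν'.irreducible
    have h : IsConstituent ν'.rep (resRep ρ'.rep j) :=
      ⟨i.toLinearMap, ⟨fun z v => LinearMap.congr_fun (i.isIntertwining' z) v⟩, fun h0 => by
        obtain ⟨v, hv⟩ := exists_ne (0 : Fin ν'.dim → F)
        exact hv (hi ((LinearMap.congr_fun h0 v).trans (map_zero i).symm))⟩
    exact h.of_equiv e' e''
  · rintro ⟨f, hf, hf0⟩
    exact ⟨ρ, ν, rfl, rfl, ⟨f, fun z => LinearMap.ext fun v => hf.isIntertwining z v⟩,
      injective_of_isIntertwiningMap ν.irreducible hf hf0⟩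

/-- Lying over an irreducible representation of a central subgroup is equality of the scalars. -/
theorem cls_mem_over_iff_of_central {j : Z →* G} (hZ : ∀ a b : Z, a * b = b * a)
    (hj : ∀ z g, g * j z = j z * g) {ρ : IrrRep F G} {ν : IrrRep F Z} :
    ρ.cls ∈ IBr.over j ν.cls ↔ ∀ z, ∀ c : F, ν.rep z = c • 1 → ρ.rep (j z) = c • 1 := by
  rw [cls_mem_over_iff]
  constructor
  · intro h z c hc
    exact apply_eq_smul_of_isConstituent ρ.irreducible h (hj z) hc
  · intro h
    have := nontrivial_of_irreducible ρ.irreducible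
    have := neZero_of_irreducible ν.irreducible
    obtain ⟨v, hv⟩ := exists_ne (0 : Fin ρ.dim → F)
    refine ⟨(LinearMap.proj (0 : Fin ν.dim) : (Fin ν.dim → F) →ₗ[F] F).smulRight v,
      ⟨fun z w => ?_⟩, fun h0 => ?_⟩
    · obtain ⟨c, hc⟩ := exists_smul_of_mem_center ν.irreducible (z := z) (fun g => hZ g z)
      change _ = ρ.rep (j z) _
      rw [h z c hc, hc]
      simp [smul_smul, mul_comm]
    · have h1 := LinearMap.congr_fun h0 (Pi.single 0 1)
      simp only [LinearMap.smulRight_apply, LinearMap.proj_apply, Pi.single_eq_same, one_smul,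
        LinearMap.zero_apply] at h1
      exact hv h1

/-- The center acts by the same scalars on a representation of `G` and on one of `N_G(Q)`. -/
def CentralEq {V W : Type*} [AddCommGroup V] [Module F V] [AddCommGroup W] [Module F W]
    {Q : Subgroup G} (ρ : Representation F G V)
    (ρ' : Representation F (Subgroup.normalizer (Q : Set G)) W) : Prop :=
  ∀ z : Subgroup.normalizer (Q : Set G), (z : G) ∈ Subgroup.center G → ∀ c : F,
    ρ z = c • 1 → ρ' z = c • 1

/-- The scalars determine each other, since both representations are irreducible. -/
theorem CentralEq.symm {V W : Type*} [AddCommGroup V] [Module F V] [FiniteDimensional F V]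
    [AddCommGroup W] [Module F W]
    {Q : Subgroup G} {ρ : Representation F G V} (hρ : ρ.IsIrreducible)
    {ρ' : Representation F (Subgroup.normalizer (Q : Set G)) W} (hρ' : ρ'.IsIrreducible)
    (h : CentralEq ρ ρ') (z : Subgroup.normalizer (Q : Set G)) (hz : (z : G) ∈ Subgroup.center G)
    (c : F) (hc : ρ' z = c • 1) : ρ z = c • 1 := by
  have := nontrivial_of_irreducible hρ'
  obtain ⟨c', hc'⟩ := exists_smul_of_mem_center hρ (Subgroup.mem_center_iff.mp hz)
  rw [hc', smul_one_injective ((h z hz c' hc').symm.trans hc)]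

variable (p : ℕ)

theorem coe_normalizerMap_symm (τ : MulAut G) (Q : Subgroup G)
    (x : Subgroup.normalizer ((Q.map τ.toMonoidHom : Subgroup G) : Set G)) :
    (((normalizerMap τ Q).symm x : Subgroup.normalizer (Q : Set G)) : G) = τ.symm x := by
  obtain ⟨y, rfl⟩ := (normalizerMap τ Q).surjective x
  rw [MulEquiv.symm_apply_apply]
  exact (τ.symm_apply_apply (y : G)).symm

variable {p}

theorem cls_mem_Alp_over_iff {ν : IrrRep F (Subgroup.center G)} {a : Weight F G p}
    {ρ : IrrRep F (Subgroup.normalizer (a.Q : Set G))} (hρ : ρ.cls = a.ψ) :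
    a.cls ∈ Alp.over ν.cls ↔ ∀ z : Subgroup.center G, ∀ c : F, ν.rep z = c • 1 →
      ρ.rep ⟨z, Subgroup.center_le_normalizer _ z.2⟩ = c • 1 := by
  have hcomm : ∀ x y : Subgroup.center G, x * y = y * x := fun x y =>
    Subtype.ext (Subgroup.mem_center_iff.mp y.2 x)
  have hj : ∀ (a : Weight F G p) z (g : Subgroup.normalizer (a.Q : Set G)),
      g * Subgroup.inclusion (Subgroup.center_le_normalizer (a.Q : Set G)) z =
      Subgroup.inclusion (Subgroup.center_le_normalizer (a.Q : Set G)) z * g := fun a z g =>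
    Subtype.ext (Subgroup.mem_center_iff.mp z.2 g)
  constructor
  · rintro ⟨b, hb, hbν⟩
    obtain ⟨g, rfl⟩ := Quotient.exact hb
    obtain ⟨σ, hσ⟩ := IBr.exists_rep b.ψ
    rw [← hσ, cls_mem_over_iff_of_central hcomm (hj b)] at hbν
    have h1 : ρ.cls = (IrrRep.map (normalizerMap (MulAut.conj g) b.Q) σ).cls :=
      hρ.trans (congrArg (IBr.map (normalizerMap (MulAut.conj g) b.Q)) hσ.symm)
    obtain ⟨e⟩ := IrrRep.cls_eq_iff.mp h1
    intro z c hc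
    refine apply_eq_smul_of_equiv e.symm ?_
    refine Eq.trans (congrArg σ.rep (Subtype.ext ?_)) (hbν z c hc)
    refine (coe_normalizerMap_symm _ _ _).trans ?_
    change g⁻¹ * (z : G) * g = z
    rw [mul_assoc, ← Subgroup.mem_center_iff.mp z.2 g, inv_mul_cancel_left]
  · intro h
    refine ⟨a, rfl, ?_⟩
    rw [← hρ, cls_mem_over_iff_of_central hcomm (hj a)]
    exact h

theorem cls_mem_over_center_iff {ν : IrrRep F (Subgroup.center G)} {ρ : IrrRep F G} :
    ρ.cls ∈ IBr.over (Subgroup.center G).subtype ν.cls ↔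
      ∀ z : Subgroup.center G, ∀ c : F, ν.rep z = c • 1 → ρ.rep z = c • 1 :=
  cls_mem_over_iff_of_central (fun x y => Subtype.ext (Subgroup.mem_center_iff.mp y.2 x))
    (fun z g => Subgroup.mem_center_iff.mp z.2 g)

variable {Ω : IBr F G ≃ Alp F G p}

/-- A bijection compatible with the restriction to the center preserves the scalars. -/
theorem centralEq_of_over (hΩ : ∀ ν : IBr F (Subgroup.center G),
      Ω '' IBr.over (Subgroup.center G).subtype ν = Alp.over ν)
    {ρ : IrrRep F G} {a : Weight F G p} {ρ' : IrrRep F (Subgroup.normalizer (a.Q : Set G))}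
    (hρ' : ρ'.cls = a.ψ) (h : a.cls = Ω ρ.cls) : CentralEq ρ.rep ρ'.rep := by
  have := nontrivial_of_irreducible ρ.irreducible
  obtain ⟨ν, f, hf, hf0⟩ := exists_irreducible_sub (resRep ρ.rep (Subgroup.center G).subtype)
  have h1 : ρ.cls ∈ IBr.over (Subgroup.center G).subtype ν.cls :=
    cls_mem_over_iff.mpr ⟨f, hf, hf0⟩
  have h2 : a.cls ∈ Alp.over ν.cls := by
    rw [← hΩ, h]
    exact ⟨_, h1, rfl⟩
  rw [cls_mem_Alp_over_iff hρ'] at h2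
  rw [cls_mem_over_center_iff] at h1
  intro z hz c hc
  obtain ⟨c', hc'⟩ := exists_smul_of_mem_center ν.irreducible (z := (⟨z, hz⟩ : Subgroup.center G))
    (fun g => Subtype.ext (Subgroup.mem_center_iff.mp hz g))
  rw [smul_one_injective (hc.symm.trans (h1 _ c' hc'))]
  exact h2 _ c' hc'

end CentralCharacter

/-! ### Properties of weights -/

section WeightProperties

variable {F : Type u} [Field F] [IsAlgClosed F] {p : ℕ} [Fact p.Prime] [CharP F p] {G : Type v}
  [Group G] [Finite G]

theorem Weight.mem_of_smul {a : Weight F G p} {ρ : IrrRep F (Subgroup.normalizer (a.Q : Set G))}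
    (hρ : ρ.cls = a.ψ) {x : Subgroup.normalizer (a.Q : Set G)} (hx : IsPElt p x)
    (hc : ∃ c : F, ρ.rep x = c • 1) : (x : G) ∈ a.Q :=
  ((isWeightChar_iff a.isPGroup ρ).mp (hρ ▸ a.isWeightChar)).1 x hx hc

theorem Weight.isDefectZero {a : Weight F G p} {ρ : IrrRep F (Subgroup.normalizer (a.Q : Set G))}
    (hρ : ρ.cls = a.ψ) : IsDefectZero ρ.rep :=
  ((isWeightChar_iff a.isPGroup ρ).mp (hρ ▸ a.isWeightChar)).2

theorem Weight.mem_of_mem_center (a : Weight F G p) {z : G} (hz : z ∈ Subgroup.center G)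
    (hzp : IsPElt p z) : z ∈ a.Q := by
  obtain ⟨ρ, hρ⟩ := IBr.exists_rep a.ψ
  exact Weight.mem_of_smul hρ (x := ⟨z, Subgroup.center_le_normalizer _ hz⟩)
    (IsPElt.of_map (f := Subgroup.subtype _) (Subgroup.subtype_injective _) hzp)
    (exists_smul_of_mem_center ρ.irreducible fun g =>
      Subtype.ext (Subgroup.mem_center_iff.mp hz g))

/-- The first component of a weight contains all normal `p`-subgroups of its normalizer. -/
theorem Weight.mem_of_mem_normal (a : Weight F G p)
    {P : Subgroup (Subgroup.normalizer (a.Q : Set G))} (hP : P.Normal)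
    (hPp : IsPGroup p P) {x : Subgroup.normalizer (a.Q : Set G)} (hx : x ∈ P) : (x : G) ∈ a.Q := by
  obtain ⟨ρ, hρ⟩ := IBr.exists_rep a.ψ
  refine Weight.mem_of_smul hρ (isPElt_of_isPGroup hPp hx) ⟨1, ?_⟩
  rw [one_smul]
  exact eq_one_of_mem_normal_pgroup ρ.irreducible P hPp hx

omit [IsAlgClosed F] [Fact p.Prime] [CharP F p] [Finite G] in
/-- Equality of weights in terms of representatives. The identification of the normalizers along
`a.Q = b.Q` replaces an equality of dependent components. -/
theorem Weight.eq_of_rep {a b : Weight F G p} (hQ : a.Q = b.Q)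
    {σ : IrrRep F (Subgroup.normalizer (a.Q : Set G))} (hσ : σ.cls = a.ψ)
    {σ' : IrrRep F (Subgroup.normalizer (b.Q : Set G))} (hσ' : σ'.cls = b.ψ)
    (h : Nonempty (σ.rep.Equiv (IrrRep.map (MulEquiv.subgroupCongr
      (congrArg (fun R : Subgroup G => Subgroup.normalizer (R : Set G)) hQ.symm)) σ').rep)) :
    a = b := by
  obtain ⟨Q, hQp, ψ, hψ⟩ := a
  obtain ⟨Q', hQp', ψ', hψ'⟩ := b
  obtain rfl : Q = Q' := hQ
  refine Weight.ext_map rfl ?_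
  refine (IBr.map_refl _).trans (hσ.symm.trans ((IrrRep.cls_eq_iff.mpr h).trans ?_))
  refine Eq.trans ?_ hσ'
  exact IBr.map_refl σ'.cls

end WeightProperties

/-! ### Components of weights of a central product -/

section WType

variable {F : Type u} [Field F] {p : ℕ} {ι : Type*} [Fintype ι] [DecidableEq ι] {E : Type v}
  {X : Type w} [Group E] [Group X] (𝒞 : Cover ι E X)

/-- The representation of `N_E(R)` in the weight `b` of `E` is a constituent of the restriction of
the representation in the weight `a` of `X` along the `i`-th homomorphism `E →* X`. -/
def WConstituent (i : ι) (a : Weight F X p) (b : Weight F E p) : Prop :=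
  ∃ (ρ : IrrRep F (Subgroup.normalizer (a.Q : Set X)))
    (σ : IrrRep F (Subgroup.normalizer (b.Q : Set E))), ρ.cls = a.ψ ∧ σ.cls = b.ψ ∧
    ∃ f : (Fin σ.dim → F) →ₗ[F] (Fin ρ.dim → F), f ≠ 0 ∧
      ∀ (y : Subgroup.normalizer (b.Q : Set E)) (x : Subgroup.normalizer (a.Q : Set X)),
        (x : X) = 𝒞.θ i y → ∀ v, f (σ.rep y v) = ρ.rep x (f v)

/-- The weight `a` of `X` is composed of the weights `b i` of `E`. -/
structure WType (a : Weight F X p) (b : ι → Weight F E p) : Prop where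
  isProd : IsProd 𝒞 p a.Q fun i => (b i).Q
  constituent : ∀ i, WConstituent 𝒞 i a (b i)

variable {𝒞} {a : Weight F X p} {b : ι → Weight F E p} [Finite E] [Finite X]

theorem WType.isConstituent (h : WType 𝒞 a b)
    {ρ : IrrRep F (Subgroup.normalizer (a.Q : Set X))} (hρ : ρ.cls = a.ψ) {i : ι}
    {σ : IrrRep F (Subgroup.normalizer ((b i).Q : Set E))} (hσ : σ.cls = (b i).ψ) :
    IsConstituent σ.rep (resRep ρ.rep (h.isProd.normProd.θ i)) := by
  obtain ⟨ρ', σ', hρ', hσ', f, hf0, hf⟩ := h.constituent i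
  obtain ⟨e⟩ := IrrRep.cls_eq_iff.mp (hσ'.trans hσ.symm)
  obtain ⟨e'⟩ := IrrRep.cls_eq_iff.mp (hρ'.trans hρ.symm)
  obtain ⟨e''⟩ := resRep_equiv (h.isProd.normProd.θ i) e'
  exact IsConstituent.of_equiv ⟨f, ⟨fun y v => hf y (h.isProd.normProd.θ i y) rfl v⟩, hf0⟩ e e''

theorem wType_mk {isProd : IsProd 𝒞 p a.Q fun i => (b i).Q}
    {ρ : IrrRep F (Subgroup.normalizer (a.Q : Set X))} (hρ : ρ.cls = a.ψ)
    {σ : ∀ i, IrrRep F (Subgroup.normalizer ((b i).Q : Set E))} (hσ : ∀ i, (σ i).cls = (b i).ψ)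
    (h : ∀ i, IsConstituent (σ i).rep (resRep ρ.rep (isProd.normProd.θ i))) : WType 𝒞 a b := by
  refine ⟨isProd, fun i => ?_⟩
  obtain ⟨f, hf, hf0⟩ := h i
  refine ⟨ρ, σ i, hρ, hσ i, f, hf0, fun y x hx v => ?_⟩
  obtain rfl : x = isProd.normProd.θ i y := Subtype.ext hx
  exact hf.isIntertwining y v

omit [Finite E] [Finite X] in
/-- Automorphisms act on weights of `X` and on their components. -/
theorem WType.smul (h : WType 𝒞 a b) {τ : MulAut X} {s : Equiv.Perm ι} {α : ι → MulAut E}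
    (hτ : ∀ i e, τ (𝒞.θ i e) = 𝒞.θ (s i) (α i e)) {b' : ι → Weight F E p}
    (hb : ∀ i, b' (s i) = α i • b i) : WType 𝒞 (τ • a) b' := by
  refine ⟨h.isProd.map hτ fun i => by rw [hb]; rfl, fun j => ?_⟩
  obtain ⟨i, rfl⟩ := s.surjective j
  rw [hb]
  obtain ⟨ρ, σ, hρ, hσ, f, hf0, hf⟩ := h.constituent i
  refine ⟨IrrRep.map (normalizerMap τ a.Q) ρ, IrrRep.map (normalizerMap (α i) (b i).Q) σ,
    congrArg (IBr.map (normalizerMap τ a.Q)) hρ,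
    congrArg (IBr.map (normalizerMap (α i) (b i).Q)) hσ, f, hf0, fun y x hx v => ?_⟩
  refine hf ((normalizerMap (α i) (b i).Q).symm y) ((normalizerMap τ a.Q).symm x) ?_ v
  have h1 := coe_normalizerMap_symm (α i) (b i).Q y
  have h2 := coe_normalizerMap_symm τ a.Q x
  rw [h1, h2, hx]
  refine τ.injective ?_
  rw [hτ, τ.apply_symm_apply, (α i).apply_symm_apply]

variable [IsAlgClosed F]

/-- The components of a weight are unique. -/
theorem WType.eq (h : WType 𝒞 a b) {b' : ι → Weight F E p} (h' : WType 𝒞 a b') : b = b' := by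
  funext i
  obtain ⟨ρ, hρ⟩ := IBr.exists_rep a.ψ
  obtain ⟨σ, hσ⟩ := IBr.exists_rep (b i).ψ
  obtain ⟨σ', hσ'⟩ := IBr.exists_rep (b' i).ψ
  refine Weight.eq_of_rep (h.isProd.eq h'.isProd i) hσ hσ' ?_
  refine h.isProd.normProd.nonempty_equiv_of_isConstituent ρ.irreducible σ.irreducible
    (IrrRep.irreducible _) (h.isConstituent hρ hσ) ?_
  obtain ⟨f, hf, hf0⟩ := h'.isConstituent hρ hσ'
  exact ⟨f, ⟨fun y v => hf.isIntertwining _ v⟩, hf0⟩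

/-- A weight is determined by its components and the action of the center. -/
theorem WType.eq_left (h : WType 𝒞 a b) {a' : Weight F X p} (h' : WType 𝒞 a' b)
    {ρ : IrrRep F (Subgroup.normalizer (a.Q : Set X))} (hρ : ρ.cls = a.ψ)
    {ρ' : IrrRep F (Subgroup.normalizer (a'.Q : Set X))} (hρ' : ρ'.cls = a'.ψ)
    (hZ : ∀ z (hz : z ∈ Subgroup.center X), ∀ c : F,
      ρ.rep ⟨z, Subgroup.center_le_normalizer _ hz⟩ = c • 1 →
      ρ'.rep ⟨z, Subgroup.center_le_normalizer _ hz⟩ = c • 1) : a = a' := by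
  choose σ hσ using fun i => IBr.exists_rep (b i).ψ
  refine Weight.eq_of_rep (by ext x; rw [h.isProd.mem_iff, h'.isProd.mem_iff]) hρ hρ' ?_
  refine h.isProd.normProd.nonempty_equiv (σ := fun i => (σ i).rep) ρ.irreducible
    (IrrRep.irreducible _) (fun i => (σ i).irreducible) (fun i => h.isConstituent hρ (hσ i))
    (fun i => ?_) (fun z hz c hc => hZ z hz c hc)
  obtain ⟨f, hf, hf0⟩ := h'.isConstituent hρ' (hσ i)
  exact ⟨f, ⟨fun y v => hf.isIntertwining y v⟩, hf0⟩

variable [Fact p.Prime] [CharP F p]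

variable (𝒞) in
/-- Every weight of `X` is composed of weights of `E`. -/
theorem exists_wType (a : Weight F X p) : ∃ b : ι → Weight F E p, WType 𝒞 a b := by
  obtain ⟨R, hR⟩ := exists_isProd_of_radical (𝒞 := 𝒞) a.isPGroup fun P hP hPp x hx =>
    a.mem_of_mem_normal hP hPp hx
  obtain ⟨ρ, hρ⟩ := IBr.exists_rep a.ψ
  have := nontrivial_of_irreducible ρ.irreducible
  choose σ f hf hf0 using fun i => exists_irreducible_sub (resRep ρ.rep (hR.normProd.θ i))
  have hc : ∀ i, IsConstituent (σ i).rep (resRep ρ.rep (hR.normProd.θ i)) :=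
    fun i => ⟨f i, hf i, hf0 i⟩
  have hw : ∀ i, IsWeightChar (R i) (σ i).cls := fun i => by
    refine (isWeightChar_iff (isPGroup_of_isPElt (hR.isPElt i)) (σ i)).mpr
      ⟨fun y hy hyc => ?_, ?_⟩
    · have h1 : IsPElt p y := hy
      refine hR.mem_iff_θ.mpr ⟨h1.map (Subgroup.subtype _), ?_⟩
      refine Weight.mem_of_smul hρ (x := hR.normProd.θ i y) (h1.map _) ?_
      have h2 := (hR.normProd.exists_smul_iff ρ.irreducible (fun i => (σ i).irreducible) hc
        (one_mem _) (e := Pi.mulSingle i y)).mpr fun j => by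
          by_cases hj : j = i
          · subst hj
            rwa [Pi.mulSingle_eq_same]
          · exact ⟨1, by rw [Pi.mulSingle_eq_of_ne hj, map_one, one_smul]⟩
      rwa [one_mul, hR.normProd.Θ_mulSingle] at h2
    · exact (hR.normProd.isDefectZero_iff ρ.irreducible (fun i => (σ i).irreducible) hc).mp
        (Weight.isDefectZero hρ) i
  exact ⟨fun i => ⟨R i, isPGroup_of_isPElt (hR.isPElt i), (σ i).cls, hw i⟩,
    wType_mk (isProd := hR) hρ (fun i => rfl) hc⟩

end WType

section Scalars

variable {F : Type*} [Field F] [IsAlgClosed F] {G : Type*} [Group G] {V : Type*} [AddCommGroup V]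
  [Module F V] [FiniteDimensional F V] {ρ : Representation F G V}

theorem exists_centralCharacter (hρ : ρ.IsIrreducible) :
    ∃ lam : Subgroup.center G →* F, ∀ z : Subgroup.center G, ρ z = lam z • 1 := by
  have := nontrivial_of_irreducible hρ
  choose lam hlam using fun z : Subgroup.center G =>
    exists_smul_of_mem_center hρ (Subgroup.mem_center_iff.mp z.2)
  refine ⟨{ toFun := lam, map_one' := ?_, map_mul' := fun z w => ?_ }, hlam⟩
  · refine smul_one_injective (V := V) ?_
    rw [← hlam, one_smul, Subgroup.coe_one, map_one]
  · refine smul_one_injective (V := V) ?_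
    rw [← hlam, Subgroup.coe_mul, map_mul, hlam, hlam, smul_mul_smul_comm, one_mul]

end Scalars

/-! ### Construction of weights and representations from components -/

section Build

variable {F : Type u} [Field F] [IsAlgClosed F] {p : ℕ} [Fact p.Prime] [CharP F p] {ι : Type*}
  [Fintype ι] [DecidableEq ι] {E : Type v} {X : Type w} [Group E] [Group X] {𝒞 : Cover ι E X}
  [Finite E] [Finite X]

/-- Weights of `E` with the central characters of the constituents of an irreducible representation
of `X` are the components of a weight of `X`. -/
theorem exists_weight {ρ : IrrRep F X} {σ : ι → IrrRep F E}
    (hσ : ∀ i, IsConstituent (σ i).rep (resRep ρ.rep (𝒞.θ i))) (b : ι → Weight F E p)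
    {σ' : ∀ i, IrrRep F (Subgroup.normalizer ((b i).Q : Set E))}
    (hσ' : ∀ i, (σ' i).cls = (b i).ψ) (hc : ∀ i, CentralEq (σ i).rep (σ' i).rep) :
    ∃ (a : Weight F X p) (ρ' : IrrRep F (Subgroup.normalizer (a.Q : Set X))), ρ'.cls = a.ψ ∧
      WType 𝒞 a b ∧ CentralEq ρ.rep ρ'.rep := by
  obtain ⟨Q, hQ, hP⟩ := exists_isProd 𝒞 (R := fun i => (b i).Q) (p := p)
    (fun i e he => isPElt_of_isPGroup (b i).isPGroup he)
    (fun i e he hep => (b i).mem_of_mem_center he hep)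
  obtain ⟨lam, hlam⟩ := exists_centralCharacter ρ.irreducible
  let lam' : hP.normProd.Z →* F := lam.comp
    { toFun := fun z => ⟨(z : Subgroup.normalizer (Q : Set X)), z.2⟩
      map_one' := rfl
      map_mul' := fun _ _ => rfl }
  have := nontrivial_of_irreducible ρ.irreducible
  obtain ⟨ε⟩ := 𝒞.toCentralProduct.nonempty_tensorRep_equiv (σ := fun i => (σ i).rep)
    ρ.irreducible (fun i => (σ i).irreducible) hσ
  obtain ⟨R, hR, -, hRZ, hRc⟩ := hP.normProd.exists_rep (σ := fun i => (σ' i).rep)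
    (fun i => (σ' i).irreducible) lam' fun e he => by
      have h1 : 𝒞.Θ (fun i => (e i : E)) ∈ Subgroup.center X := by
        rw [← hP.coe_noncommPiCoprod]
        exact he
      have h2 := 𝒞.mem_center _ h1
      choose c hc' using fun i => exists_smul_of_mem_center (σ i).irreducible
        (Subgroup.mem_center_iff.mp (h2 i))
      have h3 : tensorRep (fun i => (σ' i).rep) e = (∏ i, c i) • 1 :=
        tensorRep_eq_smul fun i => hc i (e i) (h2 i) _ (hc' i)
      have h4 : ρ.rep (𝒞.Θ fun i => (e i : E)) = (∏ i, c i) • 1 :=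
        apply_eq_smul_of_equiv ε (g := fun i => (e i : E)) (tensorRep_eq_smul hc')
      rw [h3]
      congr 1
      refine smul_one_injective (V := Fin ρ.dim → F) (h4.symm.trans ?_)
      refine (hlam ⟨_, h1⟩).trans ?_
      refine congrArg (fun z => lam z • (1 : Module.End F (Fin ρ.dim → F))) (Subtype.ext ?_)
      exact (hP.coe_noncommPiCoprod e).symm
  obtain ⟨ε'⟩ := IrrRep.nonempty_equiv_ofRep R hR
  have hcons : ∀ i, IsConstituent (σ' i).rep (resRep (IrrRep.ofRep R hR).rep (hP.normProd.θ i)) :=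
    fun i => by
      obtain ⟨ε''⟩ := resRep_equiv (hP.normProd.θ i) ε'
      exact (hRc i).of_equiv (.refl _) ε''
  have hw : IsWeightChar Q (IrrRep.ofRep R hR).cls := by
    refine (isWeightChar_iff hQ _).mpr ⟨fun x hx hxc => ?_, ?_⟩
    · obtain ⟨z, hz, e, rfl⟩ := hP.normProd.exists_eq x
      have h1 := (hP.normProd.exists_smul_iff (IrrRep.irreducible _)
        (fun i => (σ' i).irreducible) hcons hz).mp hxc
      have h2 : IsPElt p ((z : X) * 𝒞.Θ fun i => (e i : E)) := by
        rw [← hP.coe_noncommPiCoprod]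
        exact IsPElt.map (Subgroup.subtype _) hx
      rw [Subgroup.coe_mul]
      change (z : X) * (MonoidHom.noncommPiCoprod hP.normHom hP.normHom_commute e : X) ∈ Q
      rw [hP.coe_noncommPiCoprod]
      refine hP.mem_of_forall_exists hz h2 fun i => ?_
      obtain ⟨k, hk⟩ := h2
      have h3 : (e i : E) ^ p ^ k ∈ Subgroup.center E := by
        rw [(show Commute (z : X) _ from (Subgroup.mem_center_iff.mp hz _).symm).mul_pow,
          ← map_pow] at hk
        have := 𝒞.mul_inv_mem_center (pow_mem hz _) (one_mem _) (e' := 1)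
          (hk.trans (by rw [map_one, one_mul])) i
        simpa using this
      obtain ⟨u, hu, w, hw, hw', hup, huw⟩ := exists_isPElt_mul (p := p) h3
      refine ⟨u, ?_, w, hw, huw⟩
      obtain ⟨n, rfl⟩ := hu
      have h4 : e i ^ n ∈ (Representation.linHom (σ' i).rep (σ' i).rep).ker :=
        Subgroup.zpow_mem _ ((linHom_eq_one_iff (σ' i).irreducible).mpr (h1 i)) n
      exact Weight.mem_of_smul (hσ' i) (x := e i ^ n)
        (IsPElt.of_map (f := Subgroup.subtype _) (Subgroup.subtype_injective _) (by
          rw [map_zpow]; exact hup))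
        ((linHom_eq_one_iff (σ' i).irreducible).mp h4)
    · exact (hP.normProd.isDefectZero_iff (IrrRep.irreducible _) (fun i => (σ' i).irreducible)
        hcons).mpr fun i => Weight.isDefectZero (hσ' i)
  refine ⟨⟨Q, hQ, _, hw⟩, IrrRep.ofRep R hR, rfl, wType_mk (isProd := hP) rfl hσ' hcons,
    fun z hz c hc => ?_⟩
  refine apply_eq_smul_of_equiv ε' ((hRZ ⟨z, hz⟩).trans ?_)
  congr 1
  exact smul_one_injective (V := Fin ρ.dim → F) ((hlam ⟨z, hz⟩).symm.trans hc)

omit [Fact p.Prime] [CharP F p] in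
/-- Irreducible representations of `E` with the central characters of the components of a weight
of `X` are the constituents of an irreducible representation of `X`. -/
theorem exists_irrRep {a : Weight F X p} {b : ι → Weight F E p} (h : WType 𝒞 a b)
    {ρ' : IrrRep F (Subgroup.normalizer (a.Q : Set X))} (hρ' : ρ'.cls = a.ψ)
    {σ' : ∀ i, IrrRep F (Subgroup.normalizer ((b i).Q : Set E))}
    (hσ' : ∀ i, (σ' i).cls = (b i).ψ) (σ : ι → IrrRep F E)
    (hc : ∀ i, CentralEq (σ i).rep (σ' i).rep) :
    ∃ ρ : IrrRep F X, (∀ i, IsConstituent (σ i).rep (resRep ρ.rep (𝒞.θ i))) ∧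
      CentralEq ρ.rep ρ'.rep := by
  have hP := h.isProd
  have hcons := fun i => h.isConstituent hρ' (hσ' i)
  have := nontrivial_of_irreducible ρ'.irreducible
  have hle := Subgroup.center_le_normalizer (a.Q : Set X)
  obtain ⟨lam, hlam⟩ := exists_centralCharacter ρ'.irreducible
  let lam' : 𝒞.Z →* F := lam.comp
    { toFun := fun z => ⟨⟨z, hle (Cover.mem_Z.mp z.2)⟩, Subgroup.mem_center_iff.mpr fun g =>
        Subtype.ext (Subgroup.mem_center_iff.mp (Cover.mem_Z.mp z.2) g)⟩
      map_one' := rfl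
      map_mul' := fun _ _ => rfl }
  obtain ⟨ε⟩ := hP.normProd.nonempty_tensorRep_equiv (σ := fun i => (σ' i).rep)
    ρ'.irreducible (fun i => (σ' i).irreducible) hcons
  obtain ⟨R, hR, -, hRZ, hRc⟩ := 𝒞.toCentralProduct.exists_rep (σ := fun i => (σ i).rep)
    (fun i => (σ i).irreducible) lam' fun e he => by
      have h1 : 𝒞.Θ e ∈ Subgroup.center X := Cover.mem_Z.mp he
      have h2 := 𝒞.mem_center _ h1
      have hle' := fun i => Subgroup.center_le_normalizer ((b i).Q : Set E)
      let y : ∀ i, Subgroup.normalizer ((b i).Q : Set E) := fun i => ⟨e i, hle' i (h2 i)⟩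
      choose c hc' using fun i => exists_smul_of_mem_center (σ i).irreducible
        (Subgroup.mem_center_iff.mp (h2 i))
      have h3 : tensorRep (fun i => (σ i).rep) e = (∏ i, c i) • 1 := tensorRep_eq_smul hc'
      have h4 : ρ'.rep (hP.normProd.Θ y) = (∏ i, c i) • 1 :=
        apply_eq_smul_of_equiv ε (g := y)
          (tensorRep_eq_smul fun i => hc i (y i) (h2 i) _ (hc' i))
      rw [h3]
      congr 1
      refine smul_one_injective (V := Fin ρ'.dim → F) (h4.symm.trans ?_)
      have h5 : hP.normProd.Θ y = ⟨𝒞.Θ e, hle h1⟩ := Subtype.ext (hP.coe_noncommPiCoprod y)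
      rw [h5]
      exact hlam ⟨⟨𝒞.Θ e, hle h1⟩, _⟩
  obtain ⟨ε'⟩ := IrrRep.nonempty_equiv_ofRep R hR
  refine ⟨IrrRep.ofRep R hR, fun i => ?_, fun z hz c hc => ?_⟩
  · obtain ⟨ε''⟩ := resRep_equiv (𝒞.θ i) ε'
    exact (hRc i).of_equiv (.refl _) ε''
  · have := nontrivial_of_irreducible hR
    have h1 := apply_eq_smul_of_equiv ε'.symm hc
    have h2 := hRZ ⟨z, Cover.mem_Z.mpr hz⟩
    rw [smul_one_injective (h1.symm.trans h2)]
    exact hlam ⟨z, _⟩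

end Build

/-! ### Inner automorphisms -/

section Inner

variable {F : Type u} [Field F] {G : Type v} [Group G]

/-- Inner automorphisms fix all isomorphism classes of representations. -/
theorem IBr.conj_smul (x : G) (χ : IBr F G) : MulAut.conj x • χ = χ := by
  obtain ⟨ρ, rfl⟩ := IBr.exists_rep χ
  have := nontrivial_of_irreducible ρ.irreducible
  refine IrrRep.cls_eq_iff.mpr (nonempty_equiv_of_isIntertwiningMap
    (ρ := (IrrRep.map (MulAut.conj x) ρ).rep) (σ := ρ.rep) (f := ρ.rep x)
    (IrrRep.irreducible _) ρ.irreducible ⟨fun g v => ?_⟩ fun h0 => ?_)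
  · have h : ρ.rep x * ρ.rep (x⁻¹ * g * x) = ρ.rep g * ρ.rep x := by
      rw [← map_mul, ← map_mul]
      group
    exact LinearMap.congr_fun h v
  · obtain ⟨v, hv⟩ := exists_ne (0 : Fin ρ.dim → F)
    have h : ρ.rep x v = 0 := LinearMap.congr_fun h0 v
    exact hv (by rw [← Representation.inv_self_apply ρ.rep x v, h, map_zero])

end Inner

/-! ### The bijection between representations and weights of a central product -/

section Correspondence

variable {F : Type u} [Field F] {p : ℕ} {ι : Type*} [Fintype ι] [DecidableEq ι] {E : Type v}
  {X : Type w} [Group E] [Group X] (𝒞 : Cover ι E X) (Ω : IBr F E ≃ Alp F E p)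

/-- The correspondence between `IBr(X)` and the weights of `X` induced by a bijection `Ω` for `E`:
the components of the weight correspond under `Ω` to the constituents of the representation, and
the center acts by the same scalars. -/
def Corr [IsAlgClosed F] (χ : IBr F X) (a : Weight F X p) : Prop :=
  ∃ (ρ : IrrRep F X) (ρ' : IrrRep F (Subgroup.normalizer (a.Q : Set X)))
    (b : ι → Weight F E p) (σ : ι → IrrRep F E), ρ.cls = χ ∧ ρ'.cls = a.ψ ∧
    CentralEq ρ.rep ρ'.rep ∧ WType 𝒞 a b ∧ (∀ i, (b i).cls = Ω (σ i).cls) ∧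
    ∀ i, IsConstituent (σ i).rep (resRep ρ.rep (𝒞.θ i))

variable {𝒞 Ω} [IsAlgClosed F]

theorem Corr.smul (hΩ : ∀ (τ : MulAut E) (χ : IBr F E), Ω (τ • χ) = τ • Ω χ) {χ : IBr F X}
    {a : Weight F X p} (h : Corr 𝒞 Ω χ a) (τ : MulAut X) : Corr 𝒞 Ω (τ • χ) (τ • a) := by
  obtain ⟨s, α, hτ⟩ := 𝒞.exists_aut τ
  obtain ⟨ρ, ρ', b, σ, rfl, hρ', hZ, hW, hb, hσ⟩ := h
  refine ⟨IrrRep.map τ ρ, IrrRep.map (normalizerMap τ a.Q) ρ',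
    fun j => α (s.symm j) • b (s.symm j), fun j => IrrRep.map (α (s.symm j)) (σ (s.symm j)), rfl,
    congrArg (IBr.map (normalizerMap τ a.Q)) hρ', fun z hz c hc => ?_,
    hW.smul hτ fun i => by rw [s.symm_apply_apply], fun j => ?_, fun j => ?_⟩
  · have h1 := coe_normalizerMap_symm τ a.Q z
    refine hZ ((normalizerMap τ a.Q).symm z) ?_ c ?_
    · rw [h1]
      exact (mem_center_map τ.symm).mpr hz
    · rw [h1]
      exact hc
  · exact (congrArg (α (s.symm j) • ·) (hb (s.symm j))).trans (hΩ _ _).symm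
  · obtain ⟨f, hf, hf0⟩ := hσ (s.symm j)
    refine ⟨f, ⟨fun e v => ?_⟩, hf0⟩
    have h1 : 𝒞.θ j e = τ (𝒞.θ (s.symm j) ((α (s.symm j)).symm e)) := by
      rw [hτ, (α (s.symm j)).apply_symm_apply, s.apply_symm_apply]
    refine (hf.isIntertwining ((α (s.symm j)).symm e) v).trans ?_
    change ρ.rep _ _ = ρ.rep (τ.symm (𝒞.θ j e)) _
    rw [h1, τ.symm_apply_apply]
    rfl

variable [Finite E] [Finite X]

/-- An irreducible representation corresponds to at most one class of weights: the components of two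
such weights are conjugate in `E`, and conjugation by the product of the conjugating elements
identifies the weights. -/
theorem Corr.cls_eq {χ : IBr F X} {a a' : Weight F X p} (h : Corr 𝒞 Ω χ a)
    (h' : Corr 𝒞 Ω χ a') : a.cls = a'.cls := by
  obtain ⟨ρ₁, ρ', b, σ, rfl, hρ', hZ, hW, hb, hσ⟩ := h
  obtain ⟨ρ, ρ₁', b', σ', h1, hρ₁', hZ', hW', hb', hσ'⟩ := h'
  obtain ⟨ε⟩ := IrrRep.cls_eq_iff.mp h1
  have h2 : ∀ i, ∃ e : E, MulAut.conj e • b i = b' i := fun i => by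
    refine Quotient.exact ((hb i).trans (Eq.trans ?_ (hb' i).symm))
    obtain ⟨ε'⟩ := resRep_equiv (𝒞.θ i) ε
    exact congrArg Ω (IrrRep.cls_eq_iff.mpr (𝒞.nonempty_equiv_of_isConstituent ρ₁.irreducible
      (σ i).irreducible (σ' i).irreducible (hσ i) ((hσ' i).of_equiv (.refl _) ε')))
  choose e he using h2
  have h3 : WType 𝒞 (MulAut.conj (𝒞.Θ e) • a) b' := by
    refine hW.smul (s := 1) (α := fun i => MulAut.conj (e i)) (fun i m => ?_)
      (fun i => (he i).symm)
    have := 𝒞.Θ_conj (e := e) (one_mem 𝒞.Z) i m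
    rw [one_mul] at this
    exact this
  have h4 := h3.eq_left hW'
    (ρ := IrrRep.map (normalizerMap (MulAut.conj (𝒞.Θ e)) a.Q) ρ')
    (congrArg (IBr.map (normalizerMap (MulAut.conj (𝒞.Θ e)) a.Q)) hρ') hρ₁' fun z hz c hc => by
      have h5 : (normalizerMap (MulAut.conj (𝒞.Θ e)) a.Q).symm
          ⟨z, Subgroup.center_le_normalizer _ hz⟩ = ⟨z, Subgroup.center_le_normalizer _ hz⟩ := by
        refine Subtype.ext ((coe_normalizerMap_symm _ _ _).trans ?_)
        change (𝒞.Θ e)⁻¹ * z * 𝒞.Θ e = z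
        rw [mul_assoc, ← Subgroup.mem_center_iff.mp hz, inv_mul_cancel_left]
      refine hZ' _ hz c (apply_eq_smul_of_equiv ε.symm ?_)
      refine hZ.symm ρ₁.irreducible ρ'.irreducible ⟨z, Subgroup.center_le_normalizer _ hz⟩ hz c ?_
      rw [← h5]
      exact hc
  exact Quotient.sound ⟨𝒞.Θ e, h4⟩

/-- A weight corresponds to at most one irreducible representation: its components are unique and
determine the constituents, and the center acts by the same scalars. -/
theorem Corr.eq {χ χ' : IBr F X} {a : Weight F X p} (h : Corr 𝒞 Ω χ a)
    (h' : Corr 𝒞 Ω χ' a) : χ = χ' := by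
  obtain ⟨ρ, ρ', b, σ, rfl, hρ', hZ, hW, hb, hσ⟩ := h
  obtain ⟨ρ₁, ρ₁', b', σ', rfl, hρ₁', hZ', hW', hb', hσ'⟩ := h'
  obtain rfl := hW.eq hW'
  obtain ⟨ε⟩ := IrrRep.cls_eq_iff.mp (hρ'.trans hρ₁'.symm)
  refine IrrRep.cls_eq_iff.mpr (𝒞.nonempty_equiv (σ := fun i => (σ i).rep) ρ.irreducible
    ρ₁.irreducible (fun i => (σ i).irreducible) hσ (fun i => ?_) fun z hz c hc => ?_)
  · obtain ⟨ε'⟩ := IrrRep.cls_eq_iff.mp (Ω.injective ((hb' i).symm.trans (hb i)))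
    exact (hσ' i).of_equiv ε' (.refl _)
  · have hz' := Cover.mem_Z.mp hz
    refine hZ'.symm ρ₁.irreducible ρ₁'.irreducible ⟨z, Subgroup.center_le_normalizer _ hz'⟩ hz' c ?_
    exact apply_eq_smul_of_equiv ε (hZ ⟨z, Subgroup.center_le_normalizer _ hz'⟩ hz' c hc)

variable [Fact p.Prime] [CharP F p]

theorem exists_corr (hΩ : ∀ ν : IBr F (Subgroup.center E),
      Ω '' IBr.over (Subgroup.center E).subtype ν = Alp.over ν) (χ : IBr F X) :
    ∃ a, Corr 𝒞 Ω χ a := by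
  obtain ⟨ρ, rfl⟩ := IBr.exists_rep χ
  have := nontrivial_of_irreducible ρ.irreducible
  choose σ f hf hf0 using fun i => exists_irreducible_sub (resRep ρ.rep (𝒞.θ i))
  choose b hb using fun i => Quotient.exists_rep (Ω (σ i).cls)
  choose σ' hσ' using fun i => IBr.exists_rep (b i).ψ
  obtain ⟨a, ρ', hρ', hW, hZ⟩ := exists_weight (fun i => ⟨f i, hf i, hf0 i⟩) b hσ'
    fun i => centralEq_of_over hΩ (hσ' i) (hb i)
  exact ⟨a, ρ, ρ', b, σ, rfl, hρ', hZ, hW, hb, fun i => ⟨f i, hf i, hf0 i⟩⟩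

theorem exists_corr' (hΩ : ∀ ν : IBr F (Subgroup.center E),
      Ω '' IBr.over (Subgroup.center E).subtype ν = Alp.over ν) (a : Weight F X p) :
    ∃ χ, Corr 𝒞 Ω χ a := by
  obtain ⟨b, hW⟩ := exists_wType 𝒞 a
  obtain ⟨ρ', hρ'⟩ := IBr.exists_rep a.ψ
  choose σ' hσ' using fun i => IBr.exists_rep (b i).ψ
  choose σ hσ using fun i => IBr.exists_rep (Ω.symm (b i).cls)
  have hb : ∀ i, (b i).cls = Ω (σ i).cls := fun i => by rw [hσ, Ω.apply_symm_apply]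
  obtain ⟨ρ, hc, hZ⟩ := exists_irrRep hW hρ' hσ' σ
    fun i => centralEq_of_over hΩ (hσ' i) (hb i)
  exact ⟨ρ.cls, ρ, ρ', b, σ, rfl, hρ', hZ, hW, hb, hc⟩

variable (𝒞) in
/-- The correspondence induces a bijection `IBr(X) → Alp(X)` with the properties of `Ω`. -/
theorem exists_equiv_corr (hΩ : ∀ (τ : MulAut E) (χ : IBr F E), Ω (τ • χ) = τ • Ω χ)
    (hΩ' : ∀ ν : IBr F (Subgroup.center E),
      Ω '' IBr.over (Subgroup.center E).subtype ν = Alp.over ν) :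
    ∃ Ω' : IBr F X ≃ Alp F X p, (∀ χ a, a.cls = Ω' χ ↔ Corr 𝒞 Ω χ a) ∧
      (∀ (τ : MulAut X) (χ : IBr F X), Ω' (τ • χ) = τ • Ω' χ) ∧
      ∀ ν : IBr F (Subgroup.center X),
        Ω' '' IBr.over (Subgroup.center X).subtype ν = Alp.over ν := by
  choose a ha using exists_corr (𝒞 := 𝒞) hΩ'
  have key : ∀ χ a', a'.cls = (a χ).cls ↔ Corr 𝒞 Ω χ a' := fun χ a' => by
    refine ⟨fun h => ?_, fun h => h.cls_eq (ha χ)⟩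
    obtain ⟨x, hx⟩ := Quotient.exact h.symm
    have h1 := (ha χ).smul hΩ (MulAut.conj x)
    rwa [IBr.conj_smul, hx] at h1
  have hbij : Function.Bijective fun χ => (a χ).cls := by
    refine ⟨fun χ χ' h => ((key χ' (a χ)).mp h).eq (ha χ) |>.symm, fun α => ?_⟩
    obtain ⟨a', rfl⟩ := Quotient.exists_rep α
    obtain ⟨χ, hχ⟩ := exists_corr' (𝒞 := 𝒞) hΩ' a'
    exact ⟨χ, ((key χ a').mpr hχ).symm⟩
  refine ⟨Equiv.ofBijective _ hbij, key, fun τ χ => ?_, fun ν => ?_⟩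
  · exact ((key (τ • χ) (τ • a χ)).mpr ((ha χ).smul hΩ τ)).symm
  · have key' : ∀ χ, χ ∈ IBr.over (Subgroup.center X).subtype ν ↔ (a χ).cls ∈ Alp.over ν := by
      intro χ
      obtain ⟨ν, rfl⟩ := IBr.exists_rep ν
      obtain ⟨ρ, ρ', b, σ, h, hρ', hZ, -, -, -⟩ := ha χ
      have h' := cls_mem_over_center_iff (ν := ν) (ρ := ρ)
      rw [h] at h'
      rw [cls_mem_Alp_over_iff hρ', h']
      refine forall_congr' fun z => forall_congr' fun c => imp_congr_right fun _ => ⟨fun h => ?_,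
        fun h => ?_⟩
      · exact hZ ⟨z, Subgroup.center_le_normalizer _ z.2⟩ z.2 c h
      · exact hZ.symm ρ.irreducible ρ'.irreducible ⟨z, Subgroup.center_le_normalizer _ z.2⟩ z.2 c h
    ext α
    obtain ⟨χ, rfl⟩ := hbij.surjective α
    rw [← key']
    exact ⟨fun ⟨χ', h, h'⟩ => by rwa [← hbij.injective h'], fun h => ⟨χ, h, rfl⟩⟩

end Correspondence

/-! ### Stabilizers of weights -/

section Stabilizer

variable {F : Type u} [Field F] {p : ℕ} {E : Type v} [Group E]

/-- The pair `(N_E(Q), ψ)` attached to a weight `(Q, ψ)`. -/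
def Weight.toSubPair (b : Weight F E p) : SubPair F E := ⟨Subgroup.normalizer (b.Q : Set E), b.ψ⟩

theorem Weight.smul_toSubPair (τ : MulAut E) (b : Weight F E p) :
    τ • b.toSubPair = (τ • b).toSubPair :=
  SubPair.ext_map (Subgroup.map_equiv_normalizer_eq b.Q τ) (IBr.map_map _ _ b.ψ)

theorem Weight.conj_smul_eq_iff {b : Weight F E p} {x : E} :
    MulAut.conj x • b = b ↔ x ∈ Subgroup.normalizer (b.Q : Set E) := by
  constructor
  · intro h
    have h1 : b.Q.map (MulAut.conj x).toMonoidHom = b.Q := congrArg Weight.Q h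
    refine Subgroup.mem_normalizer_iff.mpr fun y => ?_
    conv_rhs => rw [← h1]
    constructor
    · exact fun hy => ⟨y, hy, rfl⟩
    · rintro ⟨y', hy', h2⟩
      rwa [← (MulAut.conj x).injective h2]
  · intro hx
    have h1 : b.Q.map (MulAut.conj x).toMonoidHom = b.Q := by
      ext y
      constructor
      · rintro ⟨y', hy', rfl⟩
        exact (Subgroup.mem_normalizer_iff.mp hx y').mp hy'
      · intro hy
        refine ⟨x⁻¹ * y * x, (Subgroup.mem_normalizer_iff.mp hx _).mpr ?_, ?_⟩
        · convert hy using 1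
          group
        · change x * (x⁻¹ * y * x) * x⁻¹ = y
          group
    refine Weight.ext_map h1 ((IBr.map_map _ _ b.ψ).trans ?_)
    exact IBr.conj_smul (⟨x, hx⟩ : Subgroup.normalizer (b.Q : Set E)) b.ψ

end Stabilizer

/-! ### Intertwining maps from the cohomological condition -/

section StabData

variable {F : Type u} [Field F] {p : ℕ} {E : Type v} [Group E] (Ω : IBr F E ≃ Alp F E p)

/-- Representations `ρ` of `E` and `ρ'` of `N_E(Q)` attached to a weight `k = (Q, ψ)` together
with a group of triples `(τ, g, g')`, where `τ` stabilizes `k` and `g`, `g'` intertwine `ρ` and `ρ'`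
with their twists by `τ`. The group consists of the common scalar multiples of the values of two
projective representations with the same cocycle. -/
structure StabData (k : Weight F E p) where
  ρ : IrrRep F E
  ρ' : IrrRep F (Subgroup.normalizer (k.Q : Set E))
  cls : k.cls = Ω ρ.cls
  cls' : ρ'.cls = k.ψ
  rel : MulAut E → Module.End F (Fin ρ.dim → F) → Module.End F (Fin ρ'.dim → F) → Prop
  smul_eq : ∀ {τ g g'}, rel τ g g' → τ • k = k
  exists_rel : ∀ {τ : MulAut E}, τ • k = k → ∃ g g', rel τ g g'
  mul : ∀ {τ₁ τ₂ g₁ g₂ g₁' g₂'}, rel τ₁ g₁ g₁' → rel τ₂ g₂ g₂' → rel (τ₁ * τ₂) (g₁ * g₂) (g₁' * g₂')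
  exists_inv : ∀ {τ g g'}, rel τ g g' → ∃ h h', rel τ⁻¹ h h' ∧ h * g = 1 ∧ g * h = 1 ∧
    h' * g' = 1 ∧ g' * h' = 1
  intertwine : ∀ {τ g g'}, rel τ g g' → ∀ x, g * ρ.rep x = ρ.rep (τ x) * g
  intertwine' : ∀ {τ g g'}, rel τ g g' → ∀ x y : Subgroup.normalizer (k.Q : Set E),
    (y : E) = τ x → g' * ρ'.rep x = ρ'.rep y * g'
  inner : ∀ {x g g'}, rel (MulAut.conj x) g g' → ∃ c : F, g = c • ρ.rep x ∧
    ∀ y : Subgroup.normalizer (k.Q : Set E), (y : E) = x → g' = c • ρ'.rep y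

variable {Ω} [IsAlgClosed F] [Group.IsPerfect E]

/-- The cohomological condition provides projective representations `P` and `P'` that agree with `ρ`
and `ρ'` on inner automorphisms only up to scalars and only for the elements of a section. For `τ`
in the stabilizer, the operators `P τ * ρ x` and `ρ (τ x) * P τ` differ by a scalar that depends
multiplicatively on `x`, and is the same for `P'`. As `E` is perfect, it is `1`, so that `P τ` and
`P' τ` are genuine intertwining maps. -/
theorem nonempty_stabData (hΩ : ∀ (τ : MulAut E) (χ : IBr F E), Ω (τ • χ) = τ • Ω χ)
    (hΩ' : ∀ ν : IBr F (Subgroup.center E),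
      Ω '' IBr.over (Subgroup.center E).subtype ν = Alp.over ν)
    (hcc : ∀ (χ : IBr F E) (a : Weight F E p), a.cls = Ω χ →
      CohomologicalCondition (Subgroup.normalizer (a.Q : Set E))
        (Subgroup.center_le_normalizer _) χ a.ψ) (k : Weight F E p) :
    Nonempty (StabData Ω k) := by
  obtain ⟨χ, hχ⟩ := Ω.surjective k.cls
  obtain ⟨s, ρ, ρ', P, P', rfl, hρ', hP, hP', hα⟩ := hcc χ k hχ.symm
  have := nontrivial_of_irreducible ρ.irreducible
  have := nontrivial_of_irreducible ρ'.irreducible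
  have hZ := centralEq_of_over hΩ' hρ' hχ.symm
  have hst : ∀ {τ : MulAut E}, τ • k = k → τ ∈ MulAction.stabilizer (MulAut E) ρ.cls := by
    intro τ h
    refine Ω.injective ?_
    rw [hΩ, hχ]
    exact congrArg Weight.cls h
  have hst' : ∀ {τ : MulAut E}, τ • k = k → τ ∈ MulAction.stabilizer (MulAut E)
      (⟨Subgroup.normalizer (k.Q : Set E), k.ψ⟩ : SubPair F E) := fun {τ} h =>
    (k.smul_toSubPair τ).trans (congrArg Weight.toSubPair h)
  have hin : ∀ x : E, MulAut.conj x ∈ MulAction.stabilizer (MulAut E) ρ.cls :=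
    fun x => IBr.conj_smul x _
  -- The representations are scalar multiples of the projective representations.
  have hsc : ∀ x : E, ∃ c : F, c ≠ 0 ∧
      ρ.rep x = c • (P.toFun ⟨MulAut.conj x, hin x⟩ : Module.End F (Fin ρ.dim → F)) ∧
      ∀ (y : Subgroup.normalizer (k.Q : Set E)) (h : MulAut.conj x • k = k), (y : E) = x →
        ρ'.rep y = c • (P'.toFun ⟨MulAut.conj x, hst' h⟩ : Module.End F (Fin ρ'.dim → F)) := by
    intro x
    have hz := QuotientGroup.eq.mp (s.mk_toFun (x : E ⧸ Subgroup.center E))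
    obtain ⟨c, hc⟩ := exists_smul_of_mem_center ρ.irreducible (Subgroup.mem_center_iff.mp hz)
    have hx : s.toFun x * ((s.toFun x)⁻¹ * x) = x := mul_inv_cancel_left _ _
    refine ⟨c, ?_, ?_, fun y h hy => ?_⟩
    · rintro rfl
      rw [zero_smul] at hc
      obtain ⟨v, hv⟩ := exists_ne (0 : Fin ρ.dim → F)
      refine hv ?_
      rw [← Representation.inv_self_apply ρ.rep ((s.toFun x)⁻¹ * x) v, hc, LinearMap.zero_apply,
        map_zero]
    · rw [hP ⟨MulAut.conj x, hin x⟩ x rfl]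
      conv_lhs => rw [← hx, map_mul, hc, mul_smul_comm, mul_one]
    · subst hy
      rw [hP' ⟨MulAut.conj (y : E), hst' h⟩ y rfl]
      have h1 : y = ⟨s.toFun ((y : E) : E ⧸ Subgroup.center E),
          s.toFun_mem (Subgroup.center_le_normalizer _) y⟩ *
          ⟨_, Subgroup.center_le_normalizer (k.Q : Set E) hz⟩ := Subtype.ext hx.symm
      conv_lhs => rw [h1, map_mul, hZ ⟨_, Subgroup.center_le_normalizer _ hz⟩ hz c hc,
        mul_smul_comm, mul_one]
  have hPm : ∀ a b, (P.toFun a : Module.End F (Fin ρ.dim → F)) * P.toFun b =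
      (P.cocycle a b : F) • (P.toFun (a * b) : Module.End F (Fin ρ.dim → F)) := P.map_mul
  have hPm' : ∀ a b, (P'.toFun a : Module.End F (Fin ρ'.dim → F)) * P'.toFun b =
      (P'.cocycle a b : F) • (P'.toFun (a * b) : Module.End F (Fin ρ'.dim → F)) := P'.map_mul
  have hP0 : ∀ a (f : Module.End F (Fin ρ.dim → F)), f * P.toFun a = 0 → f = 0 := fun a f h => by
    have h1 := congrArg (fun g => g * (((P.toFun a)⁻¹ : (Module.End F (Fin ρ.dim → F))ˣ) :
      Module.End F (Fin ρ.dim → F))) h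
    simp only [zero_mul] at h1
    rw [mul_assoc] at h1
    erw [Units.mul_inv, mul_one] at h1
    exact h1
  -- The scalar `c` is the same for `P` and `P'`, as it is built from their common cocycle and from
  -- the scalars of `hsc`.
  have hcomm : ∀ (τ : MulAut E) (h : τ • k = k) (x : E), ∃ c : F, c ≠ 0 ∧
      (P.toFun ⟨τ, hst h⟩ : Module.End F (Fin ρ.dim → F)) * ρ.rep x =
        c • (ρ.rep (τ x) * P.toFun ⟨τ, hst h⟩) ∧
      ∀ y y' : Subgroup.normalizer (k.Q : Set E), (y : E) = x → (y' : E) = τ x →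
        (P'.toFun ⟨τ, hst' h⟩ : Module.End F (Fin ρ'.dim → F)) * ρ'.rep y =
          c • (ρ'.rep y' * P'.toFun ⟨τ, hst' h⟩) := by
    intro τ h x
    obtain ⟨c₁, hc₁, h₁, h₁'⟩ := hsc x
    obtain ⟨c₂, hc₂, h₂, h₂'⟩ := hsc (τ x)
    have hτx : τ * MulAut.conj x = MulAut.conj (τ x) * τ := by ext y; simp
    have e : (⟨τ, hst h⟩ : MulAction.stabilizer (MulAut E) ρ.cls) * ⟨MulAut.conj x, hin x⟩ =
        ⟨MulAut.conj (τ x), hin (τ x)⟩ * ⟨τ, hst h⟩ := Subtype.ext hτx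
    have hα0 := (P.cocycle ⟨MulAut.conj (τ x), hin (τ x)⟩ ⟨τ, hst h⟩).ne_zero
    refine ⟨c₁ * P.cocycle ⟨τ, hst h⟩ ⟨MulAut.conj x, hin x⟩ *
      (c₂ * P.cocycle ⟨MulAut.conj (τ x), hin (τ x)⟩ ⟨τ, hst h⟩)⁻¹,
      mul_ne_zero (mul_ne_zero hc₁ (Units.ne_zero _))
        (inv_ne_zero (mul_ne_zero hc₂ (Units.ne_zero _))), ?_, fun y y' hy hy' => ?_⟩
    · rw [h₁, h₂, mul_smul_comm, smul_mul_assoc, hPm, hPm, e, smul_smul, smul_smul, smul_smul]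
      congr 1
      field_simp
    · have hy1 : MulAut.conj x • k = k := Weight.conj_smul_eq_iff.mpr (hy ▸ y.2)
      have hy2 : MulAut.conj (τ x) • k = k := Weight.conj_smul_eq_iff.mpr (hy' ▸ y'.2)
      have e' : (⟨τ, hst' h⟩ : MulAction.stabilizer (MulAut E)
          (⟨Subgroup.normalizer (k.Q : Set E), k.ψ⟩ : SubPair F E)) *
            ⟨MulAut.conj x, hst' hy1⟩ =
          ⟨MulAut.conj (τ x), hst' hy2⟩ * ⟨τ, hst' h⟩ := Subtype.ext hτx
      rw [h₁' y hy1 hy, h₂' y' hy2 hy', mul_smul_comm, smul_mul_assoc, hPm', hPm', e', smul_smul,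
        smul_smul, smul_smul, hα _ _ (hst h) (hin x) (hst' h) (hst' hy1),
        hα _ _ (hin (τ x)) (hst h) (hst' hy2) (hst' h)]
      rw [hα _ _ (hin (τ x)) (hst h) (hst' hy2) (hst' h)] at hα0
      congr 1
      field_simp
  -- The scalars define a homomorphism from the perfect group `E`, which is trivial.
  have hone : ∀ (τ : MulAut E) (h : τ • k = k) (x : E),
      (P.toFun ⟨τ, hst h⟩ : Module.End F (Fin ρ.dim → F)) * ρ.rep x =
        ρ.rep (τ x) * P.toFun ⟨τ, hst h⟩ ∧
      ∀ y y' : Subgroup.normalizer (k.Q : Set E), (y : E) = x → (y' : E) = τ x →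
        (P'.toFun ⟨τ, hst' h⟩ : Module.End F (Fin ρ'.dim → F)) * ρ'.rep y =
          ρ'.rep y' * P'.toFun ⟨τ, hst' h⟩ := by
    intro τ h
    choose c hc hc1 hc2 using hcomm τ h
    have hmul : ∀ x y, c (x * y) = c x * c y := fun x y => by
      have h1 := hc1 (x * y)
      rw [map_mul, ← mul_assoc, hc1, smul_mul_assoc, mul_assoc, hc1, mul_smul_comm, smul_smul,
        ← mul_assoc, ← map_mul, ← map_mul, ← sub_eq_zero, ← sub_smul, ← smul_mul_assoc] at h1
      have h2 := hP0 _ _ h1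
      rw [sub_smul, sub_eq_zero] at h2
      have h3 := congrArg (fun f => f * ρ.rep (τ (x * y))⁻¹) h2
      simp only [smul_mul_assoc, ← map_mul, mul_inv_cancel, map_one] at h3
      exact (smul_one_injective h3).symm
    have h1 : ∀ x, c x = 1 := fun x => congrArg Units.val
      (hom_eq_one_of_isPerfect (MonoidHom.mk' (fun x => Units.mk0 (c x) (hc x))
        fun x y => Units.ext (hmul x y)) x)
    intro x
    refine ⟨by rw [hc1, h1, one_smul], fun y y' hy hy' => ?_⟩
    rw [hc2 x y y' hy hy', h1, one_smul]
  refine ⟨{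
    ρ := ρ
    ρ' := ρ'
    cls := hχ.symm
    cls' := hρ'
    rel := fun τ g g' => ∃ (h : τ • k = k) (c : F), c ≠ 0 ∧ g = c • P.toFun ⟨τ, hst h⟩ ∧
      g' = c • P'.toFun ⟨τ, hst' h⟩
    smul_eq := fun h => h.1
    exists_rel := fun {τ} h => ⟨_, _, h, 1, one_ne_zero, rfl, rfl⟩
    mul := ?_
    exists_inv := ?_
    intertwine := ?_
    intertwine' := ?_
    inner := ?_ }⟩
  · rintro τ₁ τ₂ _ _ _ _ ⟨h₁, c₁, hc₁, rfl, rfl⟩ ⟨h₂, c₂, hc₂, rfl, rfl⟩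
    refine ⟨by rw [mul_smul, h₂, h₁], c₁ * c₂ * P.cocycle ⟨τ₁, hst h₁⟩ ⟨τ₂, hst h₂⟩,
      mul_ne_zero (mul_ne_zero hc₁ hc₂) (Units.ne_zero _), ?_, ?_⟩
    · rw [smul_mul_smul_comm, hPm, smul_smul]
      rfl
    · rw [smul_mul_smul_comm, hPm', smul_smul, hα _ _ (hst h₁) (hst h₂) (hst' h₁) (hst' h₂)]
      rfl
  · rintro τ _ _ ⟨h, c, hc, rfl, rfl⟩
    have h' : τ⁻¹ • k = k := inv_smul_eq_iff.mpr h.symm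
    have hα' := hα _ _ (hst h') (hst h) (hst' h') (hst' h)
    have hα0 := (P.cocycle ⟨τ⁻¹, hst h'⟩ ⟨τ, hst h⟩).ne_zero
    have key : ((c⁻¹ * (P.cocycle ⟨τ⁻¹, hst h'⟩ ⟨τ, hst h⟩ : F)⁻¹) •
        (P.toFun ⟨τ⁻¹, hst h'⟩ : Module.End F (Fin ρ.dim → F))) *
        c • (P.toFun ⟨τ, hst h⟩ : Module.End F (Fin ρ.dim → F)) = 1 := by
      have e : (⟨τ⁻¹, hst h'⟩ : MulAction.stabilizer (MulAut E) ρ.cls) * ⟨τ, hst h⟩ = 1 :=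
        Subtype.ext (inv_mul_cancel τ)
      rw [smul_mul_smul_comm, hPm, e, P.map_one, smul_smul]
      refine Eq.trans (congrArg (· • _) (by field_simp : _ = (1 : F))) (one_smul _ _)
    have key' : ((c⁻¹ * (P.cocycle ⟨τ⁻¹, hst h'⟩ ⟨τ, hst h⟩ : F)⁻¹) •
        (P'.toFun ⟨τ⁻¹, hst' h'⟩ : Module.End F (Fin ρ'.dim → F))) *
        c • (P'.toFun ⟨τ, hst' h⟩ : Module.End F (Fin ρ'.dim → F)) = 1 := by
      have e : (⟨τ⁻¹, hst' h'⟩ : MulAction.stabilizer (MulAut E)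
          (⟨Subgroup.normalizer (k.Q : Set E), k.ψ⟩ : SubPair F E)) * ⟨τ, hst' h⟩ = 1 :=
        Subtype.ext (inv_mul_cancel τ)
      rw [smul_mul_smul_comm, hPm', e, P'.map_one, smul_smul, ← hα']
      refine Eq.trans (congrArg (· • _) (by field_simp : _ = (1 : F))) (one_smul _ _)
    exact ⟨_, _, ⟨h', _, mul_ne_zero (inv_ne_zero hc) (inv_ne_zero hα0), rfl, rfl⟩, key,
      mul_eq_one_comm.mp key, key', mul_eq_one_comm.mp key'⟩
  · rintro τ _ _ ⟨h, c, hc, rfl, rfl⟩ x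
    rw [smul_mul_assoc, mul_smul_comm, (hone τ h x).1]
  · rintro τ _ _ ⟨h, c, hc, rfl, rfl⟩ x y hy
    rw [smul_mul_assoc, mul_smul_comm, (hone τ h x).2 x y rfl hy]
  · rintro x _ _ ⟨h, c, hc, rfl, rfl⟩
    obtain ⟨d, hd, h1, h2⟩ := hsc x
    refine ⟨c * d⁻¹, ?_, fun y hy => ?_⟩
    · rw [h1, smul_smul, inv_mul_cancel_right₀ hd]
    · rw [h2 y h hy, smul_smul, inv_mul_cancel_right₀ hd]

end StabData

/-! ### Intertwining maps for whole orbits of weights -/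

section Matching

variable {F : Type u} [Field F] {p : ℕ} {E : Type v} [Group E] (Ω : IBr F E ≃ Alp F E p)

/-- A compatible choice of intertwining maps: representations `ρ b` of `E` and `ρ' b` of `N_E(Q)`
for each weight `b = (Q, ψ)`, and a groupoid of triples `(τ, g, g')`, where `τ` is an automorphism
that maps `b` to `b'` and `g : ρ b → ρ b'`, `g' : ρ' b → ρ' b'` are `τ`-semilinear. -/
structure Matching where
  ρ : Weight F E p → IrrRep F E
  ρ' : ∀ b : Weight F E p, IrrRep F (Subgroup.normalizer (b.Q : Set E))
  cls : ∀ b, b.cls = Ω (ρ b).cls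
  cls' : ∀ b, (ρ' b).cls = b.ψ
  rel : ∀ b b' : Weight F E p, MulAut E → ((Fin (ρ b).dim → F) →ₗ[F] (Fin (ρ b').dim → F)) →
    ((Fin (ρ' b).dim → F) →ₗ[F] (Fin (ρ' b').dim → F)) → Prop
  smul_eq : ∀ {b b' τ g g'}, rel b b' τ g g' → τ • b = b'
  exists_rel : ∀ {b b'} {τ : MulAut E}, τ • b = b' → ∃ g g', rel b b' τ g g'
  comp : ∀ {b b' b'' τ₁ τ₂ g₁ g₂ g₁' g₂'}, rel b' b'' τ₁ g₁ g₁' → rel b b' τ₂ g₂ g₂' →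
    rel b b'' (τ₁ * τ₂) (g₁ ∘ₗ g₂) (g₁' ∘ₗ g₂')
  exists_inv : ∀ {b b' τ g g'}, rel b b' τ g g' → ∃ h h', rel b' b τ⁻¹ h h' ∧
    h ∘ₗ g = .id ∧ g ∘ₗ h = .id ∧ h' ∘ₗ g' = .id ∧ g' ∘ₗ h' = .id
  intertwine : ∀ {b b' τ g g'}, rel b b' τ g g' → ∀ x,
    g ∘ₗ (ρ b).rep x = (ρ b').rep (τ x) ∘ₗ g
  intertwine' : ∀ {b b' τ g g'}, rel b b' τ g g' →
    ∀ (x : Subgroup.normalizer (b.Q : Set E)) (y : Subgroup.normalizer (b'.Q : Set E)),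
      (y : E) = τ x → g' ∘ₗ (ρ' b).rep x = (ρ' b').rep y ∘ₗ g'
  inner : ∀ {b x g g'}, rel b b (MulAut.conj x) g g' → ∃ c : F, g = c • (ρ b).rep x ∧
    ∀ y : Subgroup.normalizer (b.Q : Set E), (y : E) = x → g' = c • (ρ' b).rep y

variable {Ω}

/-- Representations attached to a weight `b`, identified with those of a weight `k` by means of an
automorphism that maps `k` to `b`. -/
structure Frame {k : Weight F E p} (S : StabData Ω k) (b : Weight F E p) where
  ρ : IrrRep F E
  ρ' : IrrRep F (Subgroup.normalizer (b.Q : Set E))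
  cls : b.cls = Ω ρ.cls
  cls' : ρ'.cls = b.ψ
  t : MulAut E
  smul_eq : t • k = b
  h : (Fin S.ρ.dim → F) ≃ₗ[F] (Fin ρ.dim → F)
  h' : (Fin S.ρ'.dim → F) ≃ₗ[F] (Fin ρ'.dim → F)
  intertwine : ∀ x v, h (S.ρ.rep x v) = ρ.rep (t x) (h v)
  intertwine' : ∀ (x : Subgroup.normalizer (k.Q : Set E))
    (y : Subgroup.normalizer (b.Q : Set E)), (y : E) = t x →
    ∀ v, h' (S.ρ'.rep x v) = ρ'.rep y (h' v)

theorem Frame.nonempty (hΩ : ∀ (τ : MulAut E) (χ : IBr F E), Ω (τ • χ) = τ • Ω χ)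
    {k : Weight F E p} (S : StabData Ω k) {b : Weight F E p} (t : MulAut E) (ht : t • k = b) :
    Nonempty (Frame S b) := by
  subst ht
  refine ⟨{
    ρ := IrrRep.map t S.ρ
    ρ' := IrrRep.map (normalizerMap t k.Q) S.ρ'
    cls := (congrArg (t • ·) S.cls).trans (hΩ t _).symm
    cls' := congrArg (IBr.map (normalizerMap t k.Q)) S.cls'
    t := t
    smul_eq := rfl
    h := .refl F _
    h' := .refl F _
    intertwine := fun x v => ?_
    intertwine' := fun x y hy v => ?_ }⟩
  · change S.ρ.rep x v = S.ρ.rep (t.symm (t x)) v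
    rw [t.symm_apply_apply]
  · change S.ρ'.rep x v = S.ρ'.rep ((normalizerMap t k.Q).symm y) v
    congr 2
    refine Subtype.ext ?_
    have h1 := coe_normalizerMap_symm t k.Q y
    rw [h1, hy, t.symm_apply_apply]

/-- The triples between two weights, transported from the base weight of their orbit. -/
def Frame.rel {k : Weight F E p} {S : StabData Ω k} {b b' : Weight F E p} (B : Frame S b)
    (B' : Frame S b') (τ : MulAut E) (g : (Fin B.ρ.dim → F) →ₗ[F] (Fin B'.ρ.dim → F))
    (g' : (Fin B.ρ'.dim → F) →ₗ[F] (Fin B'.ρ'.dim → F)) : Prop :=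
  S.rel (B'.t⁻¹ * τ * B.t) (B'.h.symm.toLinearMap ∘ₗ g ∘ₗ B.h.toLinearMap)
    (B'.h'.symm.toLinearMap ∘ₗ g' ∘ₗ B.h'.toLinearMap)

variable {k : Weight F E p} {S : StabData Ω k} {b b' b'' : Weight F E p} {B : Frame S b}
  {B' : Frame S b'} {B'' : Frame S b''}

theorem Frame.rel_smul_eq {τ g g'} (h : B.rel B' τ g g') : τ • b = b' := by
  have h1 := S.smul_eq h
  rw [mul_smul, mul_smul, B.smul_eq, inv_smul_eq_iff, B'.smul_eq] at h1
  exact h1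

theorem Frame.exists_rel {τ : MulAut E} (h : τ • b = b') : ∃ g g', B.rel B' τ g g' := by
  have h1 : (B'.t⁻¹ * τ * B.t) • k = k := by
    rw [mul_smul, mul_smul, B.smul_eq, inv_smul_eq_iff, B'.smul_eq, h]
  obtain ⟨g, g', hg⟩ := S.exists_rel h1
  refine ⟨B'.h.toLinearMap ∘ₗ g ∘ₗ B.h.symm.toLinearMap,
    B'.h'.toLinearMap ∘ₗ g' ∘ₗ B.h'.symm.toLinearMap, ?_⟩
  unfold Frame.rel
  convert hg using 1
  · refine LinearMap.ext fun v => ?_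
    simp
  · refine LinearMap.ext fun v => ?_
    simp

theorem Frame.rel_comp {τ₁ τ₂ g₁ g₂ g₁' g₂'} (h₁ : B'.rel B'' τ₁ g₁ g₁')
    (h₂ : B.rel B' τ₂ g₂ g₂') : B.rel B'' (τ₁ * τ₂) (g₁ ∘ₗ g₂) (g₁' ∘ₗ g₂') := by
  have h := S.mul h₁ h₂
  unfold Frame.rel
  convert h using 1
  · group
  · refine LinearMap.ext fun v => ?_
    simp
  · refine LinearMap.ext fun v => ?_
    simp

theorem Frame.exists_inv {τ g g'} (hr : B.rel B' τ g g') : ∃ h h', B'.rel B τ⁻¹ h h' ∧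
    h ∘ₗ g = .id ∧ g ∘ₗ h = .id ∧ h' ∘ₗ g' = .id ∧ g' ∘ₗ h' = .id := by
  obtain ⟨h, h', hh, h1, h2, h3, h4⟩ := S.exists_inv hr
  refine ⟨B.h.toLinearMap ∘ₗ h ∘ₗ B'.h.symm.toLinearMap,
    B.h'.toLinearMap ∘ₗ h' ∘ₗ B'.h'.symm.toLinearMap, ?_, ?_, ?_, ?_, ?_⟩
  · unfold Frame.rel
    convert hh using 1
    · group
    · refine LinearMap.ext fun v => ?_
      simp
    · refine LinearMap.ext fun v => ?_
      simp
  · refine LinearMap.ext fun v => ?_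
    simpa using congrArg B.h (LinearMap.congr_fun h1 (B.h.symm v))
  · refine LinearMap.ext fun v => ?_
    simpa using congrArg B'.h (LinearMap.congr_fun h2 (B'.h.symm v))
  · refine LinearMap.ext fun v => ?_
    simpa using congrArg B.h' (LinearMap.congr_fun h3 (B.h'.symm v))
  · refine LinearMap.ext fun v => ?_
    simpa using congrArg B'.h' (LinearMap.congr_fun h4 (B'.h'.symm v))

theorem Frame.rel_intertwine {τ g g'} (hr : B.rel B' τ g g') (x : E) :
    g ∘ₗ B.ρ.rep x = B'.ρ.rep (τ x) ∘ₗ g := by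
  refine LinearMap.ext fun v => ?_
  have h := congrArg B'.h (LinearMap.congr_fun (S.intertwine hr (B.t⁻¹ x)) (B.h.symm v))
  simpa [B.intertwine, B'.intertwine] using h

theorem Frame.rel_intertwine' {τ g g'} (hr : B.rel B' τ g g')
    (x : Subgroup.normalizer (b.Q : Set E)) (y : Subgroup.normalizer (b'.Q : Set E))
    (hy : (y : E) = τ x) : g' ∘ₗ B.ρ'.rep x = B'.ρ'.rep y ∘ₗ g' := by
  have hmem : ∀ {b : Weight F E p} (B : Frame S b) (x : Subgroup.normalizer (b.Q : Set E)),
      B.t⁻¹ (x : E) ∈ Subgroup.normalizer (k.Q : Set E) := fun {b} B x => by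
    obtain ⟨ρ, ρ', -, -, t, rfl, -⟩ := B
    have := coe_normalizerMap_symm t k.Q x
    exact this ▸ ((normalizerMap t k.Q).symm x).2
  refine LinearMap.ext fun v => ?_
  have h := congrArg B'.h' (LinearMap.congr_fun (S.intertwine' hr ⟨_, hmem B x⟩ ⟨_, hmem B' y⟩
    (by simp [hy])) (B.h'.symm v))
  simp only [Module.End.mul_apply, LinearMap.comp_apply, LinearEquiv.coe_coe] at h
  rw [B.intertwine' ⟨_, hmem B x⟩ x (by simp), B'.intertwine' ⟨_, hmem B' y⟩ y (by simp)] at h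
  simpa using h

theorem Frame.rel_inner {x g g'} (hr : B.rel B (MulAut.conj x) g g') :
    ∃ c : F, g = c • B.ρ.rep x ∧
      ∀ y : Subgroup.normalizer (b.Q : Set E), (y : E) = x → g' = c • B.ρ'.rep y := by
  have hmem : ∀ (x : Subgroup.normalizer (b.Q : Set E)),
      B.t⁻¹ (x : E) ∈ Subgroup.normalizer (k.Q : Set E) := fun x => by
    obtain ⟨ρ, ρ', -, -, t, rfl, -⟩ := B
    have := coe_normalizerMap_symm t k.Q x
    exact this ▸ ((normalizerMap t k.Q).symm x).2
  have e : B.t⁻¹ * MulAut.conj x * B.t = MulAut.conj (B.t⁻¹ x) := by ext y; simp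
  unfold Frame.rel at hr
  rw [e] at hr
  obtain ⟨c, h1, h2⟩ := S.inner hr
  refine ⟨c, ?_, fun y hy => ?_⟩
  · refine LinearMap.ext fun v => ?_
    simpa [B.intertwine] using congrArg B.h (LinearMap.congr_fun h1 (B.h.symm v))
  · refine LinearMap.ext fun v => ?_
    have h := congrArg B.h' (LinearMap.congr_fun (h2 ⟨_, hmem y⟩ (by rw [← hy])) (B.h'.symm v))
    rw [LinearMap.smul_apply, map_smul, B.intertwine' ⟨_, hmem y⟩ y (by simp)] at h
    simpa using h

/-- The triples between two framed weights of the same orbit. The base weights are bundled with the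
frames, so that two weights with propositionally equal base weights can be compared. -/
inductive FrameRel (S : ∀ k : Weight F E p, StabData Ω k) {b b' : Weight F E p} :
    ∀ (B : Σ k, Frame (S k) b) (B' : Σ k, Frame (S k) b') (_ : MulAut E)
      (_ : (Fin B.2.ρ.dim → F) →ₗ[F] (Fin B'.2.ρ.dim → F))
      (_ : (Fin B.2.ρ'.dim → F) →ₗ[F] (Fin B'.2.ρ'.dim → F)), Prop
  | mk {k : Weight F E p} {B : Frame (S k) b} {B' : Frame (S k) b'} {τ g g'} :
      B.rel B' τ g g' → FrameRel S ⟨k, B⟩ ⟨k, B'⟩ τ g g'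

variable [IsAlgClosed F] [Group.IsPerfect E]

/-- Choosing a base weight in each orbit of the automorphism group, and an automorphism from it to
every other weight of the orbit, extends the data for the stabilizers to all weights. -/
theorem nonempty_matching (hΩ : ∀ (τ : MulAut E) (χ : IBr F E), Ω (τ • χ) = τ • Ω χ)
    (hΩ' : ∀ ν : IBr F (Subgroup.center E),
      Ω '' IBr.over (Subgroup.center E).subtype ν = Alp.over ν)
    (hcc : ∀ (χ : IBr F E) (a : Weight F E p), a.cls = Ω χ →
      CohomologicalCondition (Subgroup.normalizer (a.Q : Set E))
        (Subgroup.center_le_normalizer _) χ a.ψ) : Nonempty (Matching Ω) := by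
  have S : ∀ k : Weight F E p, StabData Ω k := fun k => (nonempty_stabData hΩ hΩ' hcc k).some
  -- `base b` is a representative of the orbit of `b`.
  let base : Weight F E p → Weight F E p := fun b =>
    @Quotient.out _ (MulAction.orbitRel (MulAut E) (Weight F E p))
      (@Quotient.mk _ (MulAction.orbitRel (MulAut E) (Weight F E p)) b)
  have hbase : ∀ {b b' : Weight F E p} {τ : MulAut E}, τ • b = b' → base b = base b' :=
    fun {b b' τ} h => congrArg (@Quotient.out _ (MulAction.orbitRel (MulAut E) (Weight F E p)))
      (@Quotient.sound _ (MulAction.orbitRel (MulAut E) (Weight F E p)) _ _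
      (⟨τ⁻¹, inv_smul_eq_iff.mpr h.symm⟩ : b ∈ MulAction.orbit (MulAut E) b'))
  have hfr : ∀ b : Weight F E p, Nonempty (Frame (S (base b)) b) := fun b => by
    obtain ⟨t, ht⟩ : b ∈ MulAction.orbit (MulAut E) (base b) :=
      (MulAction.orbitRel (MulAut E) (Weight F E p)).symm
        (@Quotient.mk_out _ (MulAction.orbitRel (MulAut E) (Weight F E p)) b)
    exact Frame.nonempty hΩ _ t ht
  let fr : ∀ b : Weight F E p, Σ k, Frame (S k) b := fun b => ⟨base b, (hfr b).some⟩
  have key : ∀ {b b' : Weight F E p} (B : Σ k, Frame (S k) b) (B' : Σ k, Frame (S k) b'),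
      B.1 = B'.1 → ∀ {τ : MulAut E}, τ • b = b' → ∃ g g', FrameRel S B B' τ g g' := by
    rintro b b' ⟨k, B⟩ ⟨k', B'⟩ h τ hτ
    obtain rfl : k = k' := h
    obtain ⟨g, g', hg⟩ := Frame.exists_rel (B := B) (B' := B') hτ
    exact ⟨g, g', .mk hg⟩
  refine ⟨{
    ρ := fun b => (fr b).2.ρ
    ρ' := fun b => (fr b).2.ρ'
    cls := fun b => (fr b).2.cls
    cls' := fun b => (fr b).2.cls'
    rel := fun b b' => FrameRel S (fr b) (fr b')
    smul_eq := ?_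
    exists_rel := fun {b b' τ} h => key _ _ (hbase h) h
    comp := ?_
    exists_inv := ?_
    intertwine := ?_
    intertwine' := ?_
    inner := ?_ }⟩
  · intro b b'
    generalize fr b = B
    generalize fr b' = B'
    rintro τ g g' ⟨h⟩
    exact Frame.rel_smul_eq h
  · intro b b' b''
    generalize fr b = B
    generalize fr b' = B'
    generalize fr b'' = B''
    rintro τ₁ τ₂ g₁ g₂ g₁' g₂' ⟨h₁⟩ h₂
    cases h₂ with
    | mk h₂ => exact .mk (Frame.rel_comp h₁ h₂)
  · intro b b'
    generalize fr b = B
    generalize fr b' = B'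
    rintro τ g g' ⟨h⟩
    obtain ⟨h, h', h1, h2⟩ := Frame.exists_inv h
    exact ⟨h, h', .mk h1, h2⟩
  · intro b b'
    generalize fr b = B
    generalize fr b' = B'
    rintro τ g g' ⟨h⟩
    exact Frame.rel_intertwine h
  · intro b b'
    generalize fr b = B
    generalize fr b' = B'
    rintro τ g g' ⟨h⟩
    exact Frame.rel_intertwine' h
  · intro b x
    generalize fr b = B
    intro g g' h
    cases h with
    | mk h => exact Frame.rel_inner h

end Matching

/-! ### Kronecker products of intertwining maps -/

section KroneckerTwist

variable {F : Type*} [Field F] {ι : Type*} [Fintype ι] [DecidableEq ι] {d : ι → ℕ}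
  {s : Equiv.Perm ι} {g : ∀ i j, (Fin (d i) → F) →ₗ[F] (Fin (d j) → F)}

/-- Intertwining relations for the factors yield one for the Kronecker products. -/
theorem kron_comp_tensorEnd {a b : ∀ i, Module.End F (Fin (d i) → F)}
    (h : ∀ i, g i (s i) ∘ₗ a i = b (s i) ∘ₗ g i (s i)) :
    kron s g ∘ₗ tensorEnd a = tensorEnd b ∘ₗ kron s g := by
  rw [tensorEnd, tensorEnd, kron_comp, kron_comp]
  refine kron_congr (σ := s) fun i => ?_
  change g i (s i) ∘ₗ (if h : i = i then h ▸ a i else 0) =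
    (if h : s i = s i then h ▸ b (s i) else 0) ∘ₗ g i (s i)
  simpa using h i

theorem kron_inv_comp {h : ∀ i j, (Fin (d i) → F) →ₗ[F] (Fin (d j) → F)}
    (hh : ∀ i, h (s i) i ∘ₗ g i (s i) = .id) : kron s⁻¹ h * kron s g = 1 := by
  have h1 : kron s⁻¹ h ∘ₗ kron s g = kron (s⁻¹ * s) fun i k => h (s i) k ∘ₗ g i (s i) :=
    kron_comp s s⁻¹ g h
  rw [inv_mul_cancel, kron_one, funext hh] at h1
  exact h1.trans tensorEnd_one

omit [Fintype ι] in
/-- The components of a Kronecker product away from the graph of the permutation are irrelevant, so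
that a family on the graph suffices. -/
theorem exists_extend {W : ι → ι → Type*} [∀ i j, Zero (W i j)] (g : ∀ i, W i (s i)) :
    ∃ g' : ∀ i j, W i j, ∀ i, g' i (s i) = g i :=
  ⟨fun i j => if h : s i = j then h ▸ g i else 0, fun i => by simp⟩

omit [Fintype ι] in
theorem exists_extend' {W : ι → ι → Type*} [∀ i j, Zero (W i j)] (g : ∀ i, W (s i) i) :
    ∃ g' : ∀ i j, W i j, ∀ i, g' (s i) i = g i :=
  ⟨fun j i => if h : s i = j then h ▸ g i else 0, fun i => by simp⟩

end KroneckerTwist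

/-! ### Lifts of automorphisms to tensor products -/

section Lift

variable {F : Type u} [Field F] {p : ℕ} {ι : Type*} [Fintype ι] [DecidableEq ι] {E : Type v}
  {X : Type w} [Group E] [Group X] (𝒞 : Cover ι E X) {Ω : IBr F E ≃ Alp F E p} (ℳ : Matching Ω)
  (b : ι → Weight F E p)

/-- The tensor product of the representations of `E` chosen for the weights `b i`. -/
abbrev Matching.Space : Type _ := TensorSpace F fun i => (ℳ.ρ (b i)).dim

/-- The tensor product of the local representations chosen for the weights `b i`. -/
abbrev Matching.Space' : Type _ := TensorSpace F fun i => (ℳ.ρ' (b i)).dim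

/-- Endomorphisms of the two tensor products that lift an automorphism `τ` of `X` stabilizing the
weight `a`: `τ` permutes the factors of `X` and lifts to automorphisms of `E`, and the
endomorphisms are the corresponding Kronecker products of chosen intertwining maps. -/
def Lift (a : Weight F X p) (τ : MulAut X) (A : Module.End F (ℳ.Space b))
    (A' : Module.End F (ℳ.Space' b)) : Prop :=
  τ • a = a ∧ ∃ (s : Equiv.Perm ι) (α : ι → MulAut E)
    (g : ∀ i j, (Fin (ℳ.ρ (b i)).dim → F) →ₗ[F] (Fin (ℳ.ρ (b j)).dim → F))
    (g' : ∀ i j, (Fin (ℳ.ρ' (b i)).dim → F) →ₗ[F] (Fin (ℳ.ρ' (b j)).dim → F)),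
    (∀ i e, τ (𝒞.θ i e) = 𝒞.θ (s i) (α i e)) ∧
    (∀ i, ℳ.rel (b i) (b (s i)) (α i) (g i (s i)) (g' i (s i))) ∧ A = kron s g ∧ A' = kron s g'

variable {𝒞 ℳ b} {a : Weight F X p} {τ : MulAut X} {A : Module.End F (ℳ.Space b)}
  {A' : Module.End F (ℳ.Space' b)}

theorem Lift.mul (h : Lift 𝒞 ℳ b a τ A A') {τ₂ : MulAut X} {B B'}
    (h₂ : Lift 𝒞 ℳ b a τ₂ B B') : Lift 𝒞 ℳ b a (τ * τ₂) (A * B) (A' * B') := by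
  obtain ⟨ha, s, α, g, g', hs, hg, rfl, rfl⟩ := h
  obtain ⟨ha₂, s₂, α₂, g₂, g₂', hs₂, hg₂, rfl, rfl⟩ := h₂
  refine ⟨by rw [mul_smul, ha₂, ha], s * s₂, fun i => α (s₂ i) * α₂ i,
    fun i k => g (s₂ i) k ∘ₗ g₂ i (s₂ i), fun i k => g' (s₂ i) k ∘ₗ g₂' i (s₂ i), fun i e => ?_,
    fun i => ℳ.comp (hg (s₂ i)) (hg₂ i), kron_comp _ _ _ _, kron_comp _ _ _ _⟩
  rw [MulAut.mul_apply, hs₂, hs]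
  rfl

theorem Lift.exists_inv (h : Lift 𝒞 ℳ b a τ A A') :
    ∃ B B', Lift 𝒞 ℳ b a τ⁻¹ B B' ∧ B * A = 1 ∧ A * B = 1 ∧ B' * A' = 1 ∧ A' * B' = 1 := by
  obtain ⟨ha, s, α, g, g', hs, hg, rfl, rfl⟩ := h
  choose k k' hk h1 h2 h3 h4 using fun i => ℳ.exists_inv (hg i)
  obtain ⟨h, hh⟩ := exists_extend' (s := s)
    (W := fun i j => (Fin (ℳ.ρ (b i)).dim → F) →ₗ[F] (Fin (ℳ.ρ (b j)).dim → F)) k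
  obtain ⟨h', hh'⟩ := exists_extend' (s := s)
    (W := fun i j => (Fin (ℳ.ρ' (b i)).dim → F) →ₗ[F] (Fin (ℳ.ρ' (b j)).dim → F)) k'
  have e1 : kron s⁻¹ h * kron s g = 1 := kron_inv_comp fun i => by rw [hh, h1]
  have e2 : kron s⁻¹ h' * kron s g' = 1 := kron_inv_comp fun i => by rw [hh', h3]
  refine ⟨kron s⁻¹ h, kron s⁻¹ h', ⟨inv_smul_eq_iff.mpr ha.symm, s⁻¹,
    fun j => (α (s⁻¹ j))⁻¹, h, h', fun j e => ?_, fun j => ?_, rfl, rfl⟩, e1,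
    mul_eq_one_comm.mp e1, e2, mul_eq_one_comm.mp e2⟩
  · obtain ⟨i, rfl⟩ := s.surjective j
    rw [show s⁻¹ (s i) = i from s.symm_apply_apply i]
    refine (τ.symm_apply_eq).mpr ?_
    rw [hs]
    change _ = 𝒞.θ (s i) (α i ((α (s.symm (s i)))⁻¹ e))
    rw [s.symm_apply_apply, MulAut.apply_inv_self]
  · obtain ⟨i, rfl⟩ := s.surjective j
    rw [show s⁻¹ (s i) = i from s.symm_apply_apply i, hh, hh']
    change ℳ.rel _ _ (α (s.symm (s i)))⁻¹ _ _
    rw [s.symm_apply_apply]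
    exact hk i

/-- A lift of `τ` intertwines the representation of `X` with its twist by `τ`, provided that `τ`
fixes the center. -/
theorem Lift.mul_apply (h : Lift 𝒞 ℳ b a τ A A') {R : Representation F X (ℳ.Space b)}
    (hR : ∀ e, R (𝒞.Θ e) = tensorRep (fun i => (ℳ.ρ (b i)).rep) e)
    (hRZ : ∀ z ∈ Subgroup.center X, ∃ c : F, R z = c • 1) (hτ : ∀ z ∈ Subgroup.center X, τ z = z)
    (x : X) : A * R x = R (τ x) * A := by
  obtain ⟨-, s, α, g, g', hs, hg, rfl, -⟩ := h
  obtain ⟨z, hz, e, rfl⟩ := 𝒞.exists_eq x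
  obtain ⟨c, hc⟩ := hRZ z hz
  rw [map_mul τ, hτ z hz, map_mul, map_mul, hc, Cover.aut_Θ hs, hR, hR, smul_one_mul,
    smul_one_mul, mul_smul_comm, smul_mul_assoc]
  congr 1
  refine kron_comp_tensorEnd fun i => ?_
  change _ = (ℳ.ρ (b (s i))).rep (α (s.symm (s i)) (e (s.symm (s i)))) ∘ₗ _
  rw [s.symm_apply_apply]
  exact ℳ.intertwine (hg i) (e i)

theorem Weight.apply_mem_normalizer {b b' : Weight F E p} {α : MulAut E} (h : α • b = b') {x : E}
    (hx : x ∈ Subgroup.normalizer (b.Q : Set E)) : α x ∈ Subgroup.normalizer (b'.Q : Set E) := by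
  subst h
  exact (normalizerMap α b.Q ⟨x, hx⟩).2

variable [Finite E] [Finite X]

/-- The analogue of `Lift.mul_apply` for the normalizer of the first component of the weight. -/
theorem Lift.mul_apply' (h : Lift 𝒞 ℳ b a τ A A') (hW : WType 𝒞 a b)
    {R : Representation F (Subgroup.normalizer (a.Q : Set X)) (ℳ.Space' b)}
    (hR : ∀ e, R (hW.isProd.normProd.Θ e) = tensorRep (fun i => (ℳ.ρ' (b i)).rep) e)
    (hRZ : ∀ z : Subgroup.normalizer (a.Q : Set X), (z : X) ∈ Subgroup.center X →
      ∃ c : F, R z = c • 1)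
    (hτ : ∀ z ∈ Subgroup.center X, τ z = z) (x y : Subgroup.normalizer (a.Q : Set X))
    (hy : (y : X) = τ x) : A' * R x = R y * A' := by
  obtain ⟨-, s, α, g, g', hs, hg, -, rfl⟩ := h
  obtain ⟨z, hz, e, rfl⟩ := hW.isProd.normProd.exists_eq x
  obtain ⟨c, hc⟩ := hRZ z hz
  have hmem : ∀ i, α (s.symm i) (e (s.symm i) : E) ∈ Subgroup.normalizer ((b i).Q : Set E) :=
    fun i => Weight.apply_mem_normalizer
      ((ℳ.smul_eq (hg (s.symm i))).trans (by rw [s.apply_symm_apply])) (e (s.symm i)).2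
  have h1 : y = z * hW.isProd.normProd.Θ fun i => ⟨_, hmem i⟩ := by
    refine Subtype.ext ?_
    rw [hy, Subgroup.coe_mul, Subgroup.coe_mul]
    have h2 := hW.isProd.coe_noncommPiCoprod e
    have h3 := hW.isProd.coe_noncommPiCoprod fun i => ⟨_, hmem i⟩
    refine Eq.trans ?_ (congrArg ((z : X) * ·) h3.symm)
    refine (congrArg (fun t => τ ((z : X) * t)) h2).trans ?_
    rw [map_mul, hτ z hz, Cover.aut_Θ hs]
  rw [h1, map_mul, map_mul, hc, hR, hR, smul_one_mul, smul_one_mul, mul_smul_comm, smul_mul_assoc]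
  congr 1
  refine kron_comp_tensorEnd fun i => ℳ.intertwine' (hg i) _ _ ?_
  change α (s.symm (s i)) (e (s.symm (s i)) : E) = _
  rw [s.symm_apply_apply]

/-- Every automorphism stabilizing the weight lifts: by uniqueness of the components of a weight,
the automorphisms of `E` map the component at `i` to the component at `s i`. -/
theorem exists_lift [IsAlgClosed F] (hW : WType 𝒞 a b) (ha : τ • a = a) :
    ∃ A A', Lift 𝒞 ℳ b a τ A A' := by
  obtain ⟨s, α, hs⟩ := 𝒞.exists_aut τ
  have h1 : WType 𝒞 (τ • a) fun j => α (s.symm j) • b (s.symm j) :=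
    hW.smul hs fun i => by rw [s.symm_apply_apply]
  rw [ha] at h1
  have h2 : ∀ i, α i • b i = b (s i) := fun i => by
    rw [congrFun (hW.eq h1) (s i), s.symm_apply_apply]
  choose k k' hk using fun i => ℳ.exists_rel (h2 i)
  obtain ⟨g, hg⟩ := exists_extend (s := s)
    (W := fun i j => (Fin (ℳ.ρ (b i)).dim → F) →ₗ[F] (Fin (ℳ.ρ (b j)).dim → F)) k
  obtain ⟨g', hg'⟩ := exists_extend (s := s)
    (W := fun i j => (Fin (ℳ.ρ' (b i)).dim → F) →ₗ[F] (Fin (ℳ.ρ' (b j)).dim → F)) k'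
  exact ⟨_, _, ha, s, α, g, g', hs, fun i => by rw [hg, hg']; exact hk i, rfl, rfl⟩

omit [Finite E] [Finite X] in
/-- The action of an automorphism on the factors determines the lift to `E`. -/
theorem Cover.perm_eq [Group.IsPerfect E] (hE : ∃ e : E, e ∉ Subgroup.center E)
    {s : Equiv.Perm ι} {α β : ι → MulAut E}
    (h : ∀ i e, 𝒞.θ (s i) (α i e) = 𝒞.θ i (β i e)) : s = 1 ∧ α = β := by
  have h1 : ∀ i, s i = i := fun i => by
    by_contra hne
    obtain ⟨e, he⟩ := hE
    obtain ⟨e', rfl⟩ := (β i).surjective e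
    refine he ?_
    have h2 : 𝒞.Θ (Pi.mulSingle i (β i e') * (Pi.mulSingle (s i) (α i e'))⁻¹) = 1 := by
      rw [map_mul, map_inv, 𝒞.Θ_mulSingle, 𝒞.Θ_mulSingle, h, mul_inv_cancel]
    have h3 := 𝒞.mem_center _ (h2 ▸ one_mem (Subgroup.center X) :
      𝒞.Θ (Pi.mulSingle i (β i e') * (Pi.mulSingle (s i) (α i e'))⁻¹) ∈ Subgroup.center X) i
    rwa [Pi.mul_apply, Pi.inv_apply, Pi.mulSingle_eq_same,
      Pi.mulSingle_eq_of_ne (fun h => hne h.symm), inv_one, mul_one] at h3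
  refine ⟨Equiv.ext h1, funext fun i => MulEquiv.ext fun e => ?_⟩
  refine DFunLike.congr_fun (hom_eq_of_mul_inv_mem_center (f := (α i).toMonoidHom)
    (g := (β i).toMonoidHom) fun e => ?_) e
  have h2 := h i e
  rw [h1] at h2
  have h3 := 𝒞.mem_center (Pi.mulSingle i (α i e * (β i e)⁻¹)) (by
    have : 𝒞.Θ (Pi.mulSingle i (α i e * (β i e)⁻¹)) = 1 := by
      rw [𝒞.Θ_mulSingle, map_mul, map_inv, h2, mul_inv_cancel]
    exact this ▸ one_mem (Subgroup.center X)) i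
  rwa [Pi.mulSingle_eq_same] at h3

/-- The lifts of inner automorphisms are scalar multiples of the two representations, with the
same scalar. -/
theorem Lift.inner [Group.IsPerfect E] (hE : ∃ e : E, e ∉ Subgroup.center E) {x : X}
    (h : Lift 𝒞 ℳ b a (MulAut.conj x) A A') (hW : WType 𝒞 a b)
    {R : Representation F X (ℳ.Space b)}
    (hR : ∀ e, R (𝒞.Θ e) = tensorRep (fun i => (ℳ.ρ (b i)).rep) e)
    {R' : Representation F (Subgroup.normalizer (a.Q : Set X)) (ℳ.Space' b)}
    (hR' : ∀ e, R' (hW.isProd.normProd.Θ e) = tensorRep (fun i => (ℳ.ρ' (b i)).rep) e)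
    (hRZ : ∀ z : Subgroup.normalizer (a.Q : Set X), (z : X) ∈ Subgroup.center X →
      ∃ c : F, c ≠ 0 ∧ R z = c • 1 ∧ R' z = c • 1)
    (y : Subgroup.normalizer (a.Q : Set X)) (hy : (y : X) = x) :
    ∃ c : F, A = c • R x ∧ A' = c • R' y := by
  subst hy
  obtain ⟨-, s, α, g, g', hs, hg, rfl, rfl⟩ := h
  obtain ⟨z, hz, e, rfl⟩ := hW.isProd.normProd.exists_eq y
  obtain ⟨c, hc0, hc, hc'⟩ := hRZ z hz
  have hΘ : (hW.isProd.normProd.Θ e : X) = 𝒞.Θ fun i => (e i : E) :=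
    hW.isProd.coe_noncommPiCoprod e
  obtain ⟨rfl, rfl⟩ := 𝒞.perm_eq hE (s := s) (α := α) (β := fun i => MulAut.conj (e i : E))
    fun i m => by
      rw [← hs, Subgroup.coe_mul, hΘ]
      exact 𝒞.Θ_conj (Cover.mem_Z.mpr hz) i m
  choose d hd hd' using fun i => ℳ.inner (hg i)
  have e1 : kron 1 g = (∏ i, d i) • tensorRep (fun i => (ℳ.ρ (b i)).rep) fun i => (e i : E) := by
    rw [kron_one, tensorRep_apply, ← tensorEnd_smul]
    exact congrArg tensorEnd (funext hd)
  have e2 : kron 1 g' = (∏ i, d i) • tensorRep (fun i => (ℳ.ρ' (b i)).rep) e := by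
    rw [kron_one, tensorRep_apply, ← tensorEnd_smul]
    exact congrArg tensorEnd (funext fun i => hd' i (e i) rfl)
  refine ⟨(∏ i, d i) * c⁻¹, ?_, ?_⟩
  · rw [e1, Subgroup.coe_mul, hΘ, map_mul, hc, hR, smul_one_mul, smul_smul,
      inv_mul_cancel_right₀ hc0]
  · rw [e2, map_mul, hc', hR', smul_one_mul, smul_smul, inv_mul_cancel_right₀ hc0]

end Lift

/-! ### Transport of representations -/

section Transport

variable {F : Type*} [Field F] {X Y : Type*} [Group X] [Group Y] {V W : Type*} [AddCommGroup V]
  [Module F V] [AddCommGroup W] [Module F W]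

/-- A representation of `X` transported to a space that carries a given restriction. -/
theorem exists_rep_of_equiv {R : Representation F X W} {Θ : Y →* X} {T : Representation F Y V}
    (ε : T.Equiv (resRep R Θ)) :
    ∃ R' : Representation F X V, (∀ y, R' (Θ y) = T y) ∧ Nonempty (R'.Equiv R) := by
  let e := ε.toLinearEquiv
  let R' : Representation F X V :=
    { toFun := fun x => e.symm.toLinearMap ∘ₗ R x ∘ₗ e.toLinearMap
      map_one' := by
        refine LinearMap.ext fun v => ?_
        simp
      map_mul' := fun x y => by
        refine LinearMap.ext fun v => ?_
        simp }
  refine ⟨R', fun y => LinearMap.ext fun v => ?_, ⟨.mk e fun x => LinearMap.ext fun v => ?_⟩⟩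
  · have h : e (T y v) = R (Θ y) (e v) := LinearMap.congr_fun (ε.isIntertwining' y) v
    change e.symm (R (Θ y) (e v)) = _
    rw [← h, e.symm_apply_apply]
  · change e (e.symm (R x (e v))) = R x (e v)
    rw [e.apply_symm_apply]

/-- Conjugation on a normal subgroup that is given as the image of an injective homomorphism. -/
theorem exists_conj_mulAut {N : Type*} [Group N] {j : Y →* N} (hj : Function.Injective j)
    (hn : j.range.Normal) : ∃ c : N → MulAut Y, ∀ g y, j (c g y) = g * j y * g⁻¹ := by
  let e := MonoidHom.ofInjective hj
  refine ⟨fun g => e.trans ((MulAut.conjNormal g : MulAut j.range).trans e.symm), fun g y => ?_⟩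
  have h : ∀ r, j (e.symm r) = r := fun r => by
    obtain ⟨y, rfl⟩ := e.surjective r
    rw [e.symm_apply_apply]
    rfl
  refine (h _).trans ?_
  exact MulAut.conjNormal_apply g (e y)

theorem smul_apply_injective [Nontrivial V] (R : Representation F X V) (x : X) {c c' : F}
    (h : c • R x = c' • R x) : c = c' := by
  refine smul_one_injective (V := V) ?_
  have h' := congrArg (fun f => f * R x⁻¹) h
  simpa only [smul_mul_assoc, ← map_mul, mul_inv_cancel, map_one] using h'

end Transport

/-! ### Counting over corresponding representations -/

section Count

variable {F : Type u} [Field F] [IsAlgClosed F] {p : ℕ} {ι : Type*} [Fintype ι] [DecidableEq ι]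
  {E : Type v} {G : Type w} [Group E] [Finite E] [Group.IsPerfect E] [Group G] [Finite G]
  {X : Subgroup G} [X.Normal] {𝒞 : Cover ι E X} {Ω : IBr F E ≃ Alp F E p}

variable (𝒞) in
/-- The group of triples of an element of `G` and lifts of the automorphism of `X` it induces. It is
a central extension of the stabilizer of the weight in `G` on which both tensor products become
linear representations. -/
def liftGroup (ℳ : Matching Ω) {a : Weight F X p} {b : ι → Weight F E p} (hW : WType 𝒞 a b) :
    Subgroup (G × (Module.End F (ℳ.Space b))ˣ × (Module.End F (ℳ.Space' b))ˣ) where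
  carrier := {d | Lift 𝒞 ℳ b a (MulAut.conjNormal d.1) d.2.1 d.2.2}
  mul_mem' := fun {d d'} h h' => by
    have h1 := Lift.mul h h'
    rw [← map_mul] at h1
    exact h1
  one_mem' := by
    obtain ⟨A, A', h⟩ := exists_lift (ℳ := ℳ) hW (one_smul _ a)
    obtain ⟨B, B', h', h1, -, h2, -⟩ := h.exists_inv
    have h3 := h'.mul h
    rw [h1, h2, inv_one, one_mul] at h3
    change Lift 𝒞 ℳ b a (MulAut.conjNormal (1 : G)) _ _
    rw [map_one]
    exact h3
  inv_mem' := fun {d} h => by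
    obtain ⟨B, B', h', h1, h2, h3, h4⟩ := Lift.exists_inv h
    change Lift 𝒞 ℳ b a (MulAut.conjNormal d.1⁻¹) (d.2.1⁻¹ : _) (d.2.2⁻¹ : _)
    rw [map_inv]
    rwa [Units.inv_eq_of_mul_eq_one_left h1, Units.inv_eq_of_mul_eq_one_left h3]

omit [IsAlgClosed F] [Finite G] in
theorem mem_normalizer_map_of_conjNormal_smul {a : Weight F X p} {t : G}
    (h : (MulAut.conjNormal t : MulAut X) • a = a) :
    t ∈ Subgroup.normalizer ((a.Q.map X.subtype : Subgroup G) : Set G) := by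
  have h1 : a.Q.map (MulAut.conjNormal t : MulAut X).toMonoidHom = a.Q := congrArg Weight.Q h
  refine Subgroup.mem_normalizer_iff.mpr fun g => ⟨?_, ?_⟩
  · rintro ⟨x, hx, rfl⟩
    refine ⟨(MulAut.conjNormal t : MulAut X) x, ?_, MulAut.conjNormal_apply t x⟩
    rw [SetLike.mem_coe, ← h1]
    exact ⟨x, hx, rfl⟩
  · rintro ⟨x, hx, hg⟩
    rw [SetLike.mem_coe, ← h1] at hx
    obtain ⟨y, hy, rfl⟩ := hx
    refine ⟨y, hy, ?_⟩
    have h2 := (MulAut.conjNormal_apply t y).symm.trans hg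
    exact mul_left_cancel (mul_right_cancel h2)

omit [Finite G] [X.Normal] in
theorem mem_range_normalizerInclusion {Q : Subgroup X}
    {t : Subgroup.normalizer ((Q.map X.subtype : Subgroup G) : Set G)} :
    t ∈ (normalizerInclusion X Q).range ↔ (t : G) ∈ X := by
  constructor
  · rintro ⟨y, rfl⟩
    exact (y : X).2
  · intro ht
    have h1 : ∀ x : X, x ∈ Q ↔ (x : G) ∈ Q.map X.subtype := fun x =>
      ⟨fun hx => ⟨x, hx, rfl⟩, fun ⟨y, hy, hyx⟩ => by rwa [← Subtype.ext hyx]⟩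
    refine ⟨⟨⟨t, ht⟩, Subgroup.mem_normalizer_iff.mpr fun x => ?_⟩, rfl⟩
    exact (h1 x).trans ((Subgroup.mem_normalizer_iff.mp t.2 x).trans
      (h1 (⟨t, ht⟩ * x * ⟨t, ht⟩⁻¹)).symm)

omit [IsAlgClosed F] [Finite G] in
/-- An element of the normalizer that fixes the class of the second component fixes the weight. -/
theorem conjNormal_smul_eq {a : Weight F X p}
    {ρ : IrrRep F (Subgroup.normalizer (a.Q : Set X))} (hρ : ρ.cls = a.ψ)
    {t : Subgroup.normalizer ((a.Q.map X.subtype : Subgroup G) : Set G)}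
    {c : MulAut (Subgroup.normalizer (a.Q : Set X))}
    (hc : ∀ y, normalizerInclusion X a.Q (c y) = t⁻¹ * normalizerInclusion X a.Q y * t)
    (h : Nonempty (ρ.rep.Equiv (resRep ρ.rep c.toMonoidHom))) :
    (MulAut.conjNormal (t : G) : MulAut X) • a = a := by
  obtain ⟨e⟩ := h
  have h1 : ∀ x : X, x ∈ a.Q ↔ (x : G) ∈ a.Q.map X.subtype := fun x =>
    ⟨fun hx => ⟨x, hx, rfl⟩, fun ⟨y, hy, hyx⟩ => by rwa [← Subtype.ext hyx]⟩
  have h2 : ∀ x, (MulAut.conjNormal (t : G) : MulAut X) x ∈ a.Q ↔ x ∈ a.Q := fun x => by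
    rw [h1, h1, MulAut.conjNormal_apply]
    exact (Subgroup.mem_normalizer_iff.mp t.2 x).symm
  have hQ : a.Q.map (MulAut.conjNormal (t : G) : MulAut X).toMonoidHom = a.Q := by
    ext x
    constructor
    · rintro ⟨y, hy, rfl⟩
      exact (h2 y).mpr hy
    · intro hx
      obtain ⟨y, rfl⟩ := (MulAut.conjNormal (t : G) : MulAut X).surjective x
      exact ⟨y, (h2 y).mp hx, rfl⟩
  have hm : ∀ y : Subgroup.normalizer ((((MulAut.conjNormal (t : G) : MulAut X) • a).Q :
      Subgroup X) : Set X), (y : X) ∈ Subgroup.normalizer (a.Q : Set X) := fun y => by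
    have hy := y.2
    change _ ∈ Subgroup.normalizer ((a.Q.map _ : Subgroup X) : Set X) at hy
    rwa [hQ] at hy
  refine Weight.eq_of_rep (a := (MulAut.conjNormal (t : G) : MulAut X) • a) hQ
    (σ := IrrRep.map (normalizerMap (MulAut.conjNormal (t : G) : MulAut X) a.Q) ρ)
    (congrArg (IBr.map (normalizerMap _ a.Q)) hρ) hρ
    ⟨.mk e.symm.toLinearEquiv fun y => LinearMap.ext fun v => ?_⟩
  have key : (normalizerMap (MulAut.conjNormal (t : G) : MulAut X) a.Q).symm y =
      c ⟨y, hm y⟩ := by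
    refine Subtype.ext ((coe_normalizerMap_symm _ a.Q y).trans (Subtype.ext ?_))
    have h3 : ((c ⟨y, hm y⟩ : X) : G) = (t : G)⁻¹ * ((y : X) : G) * t :=
      congrArg Subtype.val (hc ⟨y, hm y⟩)
    rw [h3]
    change (((MulAut.conjNormal (t : G) : MulAut X)⁻¹ (y : X) : X) : G) = _
    rw [← map_inv, MulAut.conjNormal_apply, inv_inv]
  change e.symm.toLinearEquiv (ρ.rep ((normalizerMap _ a.Q).symm y) v) = _
  rw [key]
  exact LinearMap.congr_fun (e.symm.isIntertwining' ⟨y, hm y⟩) v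

/-- Corresponding representations have equally many irreducible representations above them: by the
Clifford correspondence both sets are in bijection with the irreducible representations of
`liftGroup` with prescribed scalars on the preimage of an image of `X`, respectively `N_X(Q)`. These
preimages and scalars agree. -/
theorem encard_over_eq (hE : ∃ e : E, e ∉ Subgroup.center E) (ℳ : Matching Ω)
    (hXZ : ∀ (g : G) (z : X), z ∈ Subgroup.center X → g * (z : G) = (z : G) * g)
    {χ : IBr F X} {a : Weight F X p} (h : Corr 𝒞 Ω χ a)
    (hst : ∀ τ : MulAut X, τ • χ = χ → ∃ x : X, MulAut.conj x • τ • a = a) :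
    (IBr.over X.subtype χ).encard = (IBr.over (normalizerInclusion X a.Q) a.ψ).encard := by
  obtain ⟨ρ, ρ', b, σ, rfl, hρ', hZ, hW, hb, hσ⟩ := h
  have hσ' : ∀ i, IsConstituent (ℳ.ρ (b i)).rep (resRep ρ.rep (𝒞.θ i)) := fun i => by
    obtain ⟨e⟩ := IrrRep.cls_eq_iff.mp (Ω.injective ((hb i).symm.trans (ℳ.cls (b i))))
    exact (hσ i).of_equiv e (.refl _)
  obtain ⟨ε⟩ := 𝒞.toCentralProduct.nonempty_tensorRep_equiv (σ := fun i => (ℳ.ρ (b i)).rep)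
    ρ.irreducible (fun i => IrrRep.irreducible _) hσ'
  obtain ⟨ε'⟩ := hW.isProd.normProd.nonempty_tensorRep_equiv (σ := fun i => (ℳ.ρ' (b i)).rep)
    ρ'.irreducible (fun i => IrrRep.irreducible _)
    (fun i => hW.isConstituent hρ' (ℳ.cls' (b i)))
  obtain ⟨R, hR, ⟨η⟩⟩ := exists_rep_of_equiv ε
  obtain ⟨R', hR', ⟨η'⟩⟩ := exists_rep_of_equiv ε'
  have := nontrivial_of_irreducible ρ.irreducible
  have := nontrivial_of_irreducible ρ'.irreducible
  have hRi := isIrreducible_of_equiv η.symm ρ.irreducible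
  have hRi' := isIrreducible_of_equiv η'.symm ρ'.irreducible
  have := nontrivial_of_irreducible hRi
  have := nontrivial_of_irreducible hRi'
  have hRZ : ∀ z : Subgroup.normalizer (a.Q : Set X), (z : X) ∈ Subgroup.center X →
      ∃ c : F, c ≠ 0 ∧ R z = c • 1 ∧ R' z = c • 1 := fun z hz => by
    obtain ⟨c, hc⟩ := exists_smul_of_mem_center hRi (Subgroup.mem_center_iff.mp hz)
    refine ⟨c, ?_, hc, apply_eq_smul_of_equiv η'.symm (hZ z hz c (apply_eq_smul_of_equiv η hc))⟩
    rintro rfl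
    rw [zero_smul] at hc
    obtain ⟨v, hv⟩ := exists_ne (0 : ℳ.Space b)
    refine hv ?_
    rw [← Representation.inv_self_apply R (z : X) v, hc, LinearMap.zero_apply, map_zero]
  have hτ : ∀ (t : G), ∀ z ∈ Subgroup.center X, (MulAut.conjNormal t : MulAut X) z = z :=
    fun t z hz => Subtype.ext (by rw [MulAut.conjNormal_apply, hXZ t z hz, mul_inv_cancel_right])
  let D := liftGroup 𝒞 ℳ hW
  let pr : D →* G := (MonoidHom.fst _ _).comp D.subtype
  have hD : ∀ t : G, (MulAut.conjNormal t : MulAut X) • a = a → ∃ d : D, pr d = t :=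
    fun t ht => by
      obtain ⟨A, A', h⟩ := exists_lift (ℳ := ℳ) hW ht
      obtain ⟨B, B', -, h1, h2, h3, h4⟩ := h.exists_inv
      exact ⟨⟨(t, ⟨A, B, h2, h1⟩, ⟨A', B', h4, h3⟩), h⟩, rfl⟩
  have hmemN : ∀ d : D, pr d ∈
      Subgroup.normalizer ((a.Q.map X.subtype : Subgroup G) : Set G) :=
    fun d => mem_normalizer_map_of_conjNormal_smul d.2.1
  have hjinj : Function.Injective (normalizerInclusion X a.Q) := fun y y' h => by
    have h1 : ((y : X) : G) = ((y' : X) : G) := congrArg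
      (fun n : Subgroup.normalizer ((a.Q.map X.subtype : Subgroup G) : Set G) => (n : G)) h
    exact Subtype.ext (Subtype.ext h1)
  have hn : (normalizerInclusion X a.Q).range.Normal := ⟨fun t ht g =>
    mem_range_normalizerInclusion.mpr
      (‹X.Normal›.conj_mem _ (mem_range_normalizerInclusion.mp ht) g)⟩
  obtain ⟨c', hc'⟩ := exists_conj_mulAut hjinj hn
  -- An element of `G` stabilizing `χ` fixes the class of `a`, hence lies in `X` times the
  -- stabilizer of `a`, onto which `D` maps.
  let 𝒟 : CliffordDatum R X.subtype D :=
    { c := fun g => MulAut.conjNormal g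
      j_c := fun g x => MulAut.conjNormal_apply g x
      q := pr
      γ := (Units.coeHom (Module.End F (ℳ.Space b))).comp
        ((MonoidHom.fst _ _).comp ((MonoidHom.snd _ _).comp D.subtype))
      γ_ρ := fun d x v => LinearMap.congr_fun (Lift.mul_apply d.2 hR (fun z hz => by
        obtain ⟨c, -, hc, -⟩ := hRZ ⟨z, Subgroup.center_le_normalizer _ hz⟩ hz
        exact ⟨c, hc⟩) (hτ _) x) v
      stab := fun g ⟨e⟩ => by
        have h1 : (MulAut.conjNormal g : MulAut X) • ρ.cls = ρ.cls := by
          obtain ⟨e'⟩ := resRep_equiv ((MulAut.conjNormal g⁻¹ : MulAut X)).toMonoidHom η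
          have e2 := (η.symm.trans (e.trans e')).symm
          rw [map_inv] at e2
          exact IrrRep.cls_eq_iff.mpr ⟨e2⟩
        obtain ⟨x, hx⟩ := hst _ h1
        rw [← mul_smul, ← MulAut.conjNormal_val, ← map_mul] at hx
        obtain ⟨d, hd⟩ := hD _ hx
        refine ⟨d, ⟨g⁻¹ * (x : G)⁻¹ * g⁻¹⁻¹,
          ‹X.Normal›.conj_mem _ (X.inv_mem x.2) g⁻¹⟩, ?_⟩
        change g = pr d * (g⁻¹ * (x : G)⁻¹ * g⁻¹⁻¹)
        rw [hd]
        group }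
  let 𝒟' : CliffordDatum R' (normalizerInclusion X a.Q) D :=
    { c := c'
      j_c := hc'
      q := pr.codRestrict _ hmemN
      γ := (Units.coeHom (Module.End F (ℳ.Space' b))).comp
        ((MonoidHom.snd _ _).comp ((MonoidHom.snd _ _).comp D.subtype))
      γ_ρ := fun d x v => LinearMap.congr_fun (Lift.mul_apply' d.2 hW hR' (fun z hz => by
        obtain ⟨c, -, -, hc⟩ := hRZ z hz
        exact ⟨c, hc⟩) (hτ _) x (c' ⟨_, hmemN d⟩ x)
          (Subtype.ext (congrArg (fun n : Subgroup.normalizer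
            ((a.Q.map X.subtype : Subgroup G) : Set G) => (n : G)) (hc' ⟨_, hmemN d⟩ x)))) v
      stab := fun g ⟨e⟩ => by
        obtain ⟨e'⟩ := resRep_equiv (c' g⁻¹).toMonoidHom η'
        obtain ⟨d, hd⟩ := hD _ (conjNormal_smul_eq hρ' (t := g) (c := c' g⁻¹)
          (fun y => by rw [hc', inv_inv]) ⟨η'.symm.trans (e.trans e')⟩)
        refine ⟨d, 1, ?_⟩
        rw [map_one, mul_one]
        exact Subtype.ext hd.symm }
  rw [𝒟.encard_over hRi X.subtype_injective η, ← hρ', 𝒟'.encard_over hRi' hjinj η']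
  -- `D` acts on the two tensor products by the same scalars over `N_X(Q)`.
  have hker : ∀ (d : D) (y : Subgroup.normalizer (a.Q : Set X)), pr d = ((y : X) : G) →
      ∀ c : F, 𝒟.γ d = c • R y ↔ 𝒟'.γ d = c • R' y := by
    intro d y hy c
    have h1 : Lift 𝒞 ℳ b a (MulAut.conj (y : X)) (𝒟.γ d) (𝒟'.γ d) := by
      rw [← MulAut.conjNormal_val, ← hy]
      exact d.2
    obtain ⟨c₀, h2, h3⟩ := h1.inner hE hW hR hR' hRZ y rfl
    constructor
    · intro h6
      rw [← smul_apply_injective R (y : X) (h2.symm.trans h6)]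
      exact h3
    · intro h6
      rw [← smul_apply_injective R' y (h3.symm.trans h6)]
      exact h2
  congr 1
  ext φ
  refine exists_congr fun U => and_congr_right fun _ => forall_congr' fun d => forall_congr' fun c =>
    imp_congr_left ?_
  constructor
  -- An element of `X` in the image of `D` fixes `a` and hence lies in `N_X(Q)`.
  · rintro ⟨x, hx, hx'⟩
    have hx1 : pr d = x := hx
    have hxN : x ∈ Subgroup.normalizer (a.Q : Set X) := by
      have := d.2.1
      change (MulAut.conjNormal (pr d) : MulAut X) • a = a at this
      rw [hx1, MulAut.conjNormal_val] at this
      exact Weight.conj_smul_eq_iff.mp this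
    exact ⟨⟨x, hxN⟩, Subtype.ext hx, (hker d ⟨x, hxN⟩ hx1 c).mp hx'⟩
  · rintro ⟨y, hy, hy'⟩
    have hy1 : pr d = ((y : X) : G) := congrArg Subtype.val hy
    exact ⟨y, hy1, (hker d y hy1 c).mpr hy'⟩

end Count

/-! ### Transport of representations over a given one -/

section OverTransport

variable {F : Type u} [Field F] {X G Y N : Type v} [Group X] [Group G] [Group Y] [Group N]

theorem IBr.map_mem_over {j : X →* G} {j' : Y →* N} {e : X ≃* Y} {e' : G ≃* N}
    (h : ∀ x, j' (e x) = e' (j x)) {χ : IBr F X} {φ : IBr F G} (hφ : φ ∈ IBr.over j χ) :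
    IBr.map e' φ ∈ IBr.over j' (IBr.map e χ) := by
  obtain ⟨ρ, σ, rfl, rfl, i, hi⟩ := hφ
  refine ⟨IrrRep.map e' ρ, IrrRep.map e σ, rfl, rfl, ⟨i.toLinearMap, fun y => ?_⟩, hi⟩
  have h1 := i.isIntertwining' (e.symm y)
  refine h1.trans ?_
  have h2 : e'.symm (j' y) = j (e.symm y) := by
    rw [MulEquiv.symm_apply_eq, ← h, e.apply_symm_apply]
  change ρ.rep (j (e.symm y)) ∘ₗ _ = ρ.rep (e'.symm (j' y)) ∘ₗ _
  rw [h2]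

theorem IBr.map_symm_map (e : X ≃* Y) (χ : IBr F X) : IBr.map e.symm (IBr.map e χ) = χ := by
  rw [IBr.map_map, MulEquiv.self_trans_symm, IBr.map_refl]

theorem IBr.map_map_symm (e : X ≃* Y) (χ : IBr F Y) : IBr.map e (IBr.map e.symm χ) = χ :=
  IBr.map_symm_map e.symm χ

theorem IBr.encard_over_map {j : X →* G} {j' : Y →* N} {e : X ≃* Y} {e' : G ≃* N}
    (h : ∀ x, j' (e x) = e' (j x)) (χ : IBr F X) :
    (IBr.over j χ).encard = (IBr.over j' (IBr.map e χ)).encard := by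
  have h' : ∀ y, j (e.symm y) = e'.symm (j' y) := fun y => by
    rw [MulEquiv.eq_symm_apply, ← h, e.apply_symm_apply]
  refine Set.encard_eq_of_rel (fun φ φ' => φ' = IBr.map e' φ)
    (fun φ hφ => ⟨_, IBr.map_mem_over h hφ, rfl⟩) (fun φ hφ => ⟨IBr.map e'.symm φ, ?_, ?_⟩)
    (fun φ _ φ' _ ψ h1 h2 => ?_) fun φ ψ _ ψ' _ h1 h2 => h1.trans h2.symm
  · have := IBr.map_mem_over h' hφ
    rwa [IBr.map_symm_map] at this
  · rw [IBr.map_map_symm]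
  · rw [← IBr.map_symm_map e' φ, ← h1, h2, IBr.map_symm_map]

end OverTransport

/-! ### Defect zero for `p`-power elements acting trivially -/

section DefectZero

variable {F : Type*} [Field F] {N : Type*} [Group N] [Finite N] {V : Type*} [AddCommGroup V]
  [Module F V] {p : ℕ} [Fact p.Prime] [CharP F p]

/-- If the `p`-elements act trivially, then the projective image is a `p'`-group. -/
theorem isDefectZero_of_isPElt {ρ : Representation F N V}
    (h : ∀ x, IsPElt p x → Representation.linHom ρ ρ x = 1) : IsDefectZero ρ := by
  let φ : N →* (Module.End F (V →ₗ[F] V))ˣ := MonoidHom.toHomUnits (Representation.linHom ρ ρ)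
  have hφ : Set.range (Representation.linHom ρ ρ) = Units.val '' (φ.range : Set _) := by
    ext c
    constructor
    · rintro ⟨x, rfl⟩
      exact ⟨φ x, ⟨x, rfl⟩, rfl⟩
    · rintro ⟨_, ⟨x, rfl⟩, rfl⟩
      exact ⟨x, rfl⟩
  have : Finite φ.range := Finite.of_surjective _ φ.rangeRestrict_surjective
  have hp : ¬ p ∣ Nat.card φ.range := by
    intro hdvd
    obtain ⟨⟨_, x, rfl⟩, hy⟩ := exists_prime_orderOf_dvd_card' p hdvd
    have h1 : x ^ p ^ 1 ∈ φ.ker := by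
      rw [pow_one, MonoidHom.mem_ker, map_pow]
      exact congrArg Subtype.val (orderOf_dvd_iff_pow_eq_one.mp (dvd_of_eq hy))
    obtain ⟨u, -, w, hw, -, hu, rfl⟩ := exists_isPElt_mul h1
    have h2 : φ (u * w) = 1 := by
      rw [map_mul, MonoidHom.mem_ker.mp hw, mul_one]
      exact Units.ext (h u hu)
    have h3 : (⟨φ (u * w), u * w, rfl⟩ : φ.range) = 1 := Subtype.ext h2
    rw [h3, orderOf_one] at hy
    exact (Fact.out : p.Prime).one_lt.ne hy
  have hF : (Nat.card φ.range : F) ≠ 0 := fun h0 => hp ((CharP.cast_eq_zero_iff F p _).mp h0)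
  refine ⟨(Nat.card φ.range : F)⁻¹ • 1, ?_⟩
  have hfix : ∀ u ∈ (φ.range : Set (Module.End F (V →ₗ[F] V))ˣ),
      (u : Module.End F (V →ₗ[F] V)) ((Nat.card φ.range : F)⁻¹ • 1) =
      (Nat.card φ.range : F)⁻¹ • 1 := by
    rintro _ ⟨x, rfl⟩
    rw [map_smul]
    congr 1
    refine LinearMap.ext fun v => ?_
    exact Representation.self_inv_apply ρ x v
  rw [hφ, finsum_mem_image Units.val_injective.injOn, finsum_mem_congr rfl hfix,
    finsum_mem_eq_finite_toFinset_sum _ (Set.toFinite _), Finset.sum_const,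
    ← Nat.cast_smul_eq_nsmul F, smul_smul, ← Set.ncard_eq_toFinset_card _ (Set.toFinite _),
    ← Nat.card_coe_set_eq]
  exact (congrArg (· • _) (mul_inv_cancel₀ hF)).trans (one_smul _ _)

end DefectZero

/-! ### Weights of nilpotent groups of class two -/

section Nilpotent

variable (p : ℕ) [Fact p.Prime] (X : Type v) [Group X] [Finite X] [Group.IsNilpotent X]

/-- The subgroup of the `p`-elements of a finite nilpotent group. -/
def pPart : Subgroup X where
  carrier := {x | IsPElt p x}
  one_mem' := IsPElt.one
  mul_mem' := IsPElt.mul_of_isNilpotent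
  inv_mem' := IsPElt.inv

variable {p X}

instance : (pPart p X).Normal := ⟨fun _ hx g => IsPElt.conj hx g⟩

theorem normalizer_pPart : Subgroup.normalizer (pPart p X : Set X) = ⊤ :=
  Subgroup.normalizer_eq_top _

variable (p X) in
/-- The isomorphism of `X` with the normalizer of its `p`-part. -/
def pPartEquiv : X ≃* Subgroup.normalizer (pPart p X : Set X) :=
  Subgroup.topEquiv.symm.trans (MulEquiv.subgroupCongr normalizer_pPart.symm)

variable {F : Type u} [Field F] [IsAlgClosed F] [CharP F p]

/-- Every irreducible representation defines a weight with the `p`-part as first component: the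
latter acts trivially, so that the group acts through a quotient of order prime to `p`. -/
theorem isWeightChar_pPart (ψ : IBr F (Subgroup.normalizer (pPart p X : Set X))) :
    IsWeightChar (pPart p X) ψ := by
  obtain ⟨ρ, rfl⟩ := IBr.exists_rep ψ
  have hP : IsPGroup p (pPart p X) := isPGroup_of_isPElt fun _ h => h
  refine (isWeightChar_iff hP ρ).mpr ⟨fun x hx _ => IsPElt.map (Subgroup.subtype _) hx,
    isDefectZero_of_isPElt (p := p) fun x hx => ?_⟩
  refine (linHom_eq_one_iff ρ.irreducible).mpr ⟨1, ?_⟩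
  rw [one_smul]
  refine eq_one_of_mem_normal_pgroup ρ.irreducible
    ((pPart p X).subgroupOf (Subgroup.normalizer (pPart p X : Set X)))
    (hP.comap_of_injective _ (Subgroup.subtype_injective _)) ?_
  exact IsPElt.map (Subgroup.subtype _) hx

/-- The weight of a finite nilpotent group that corresponds to an irreducible representation. -/
def IBr.weight (χ : IBr F X) : Weight F X p where
  Q := pPart p X
  isPGroup := isPGroup_of_isPElt fun _ h => h
  ψ := IBr.map (pPartEquiv p X) χ
  isWeightChar := isWeightChar_pPart _

theorem smul_weight (τ : MulAut X) (χ : IBr F X) :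
    τ • (χ.weight : Weight F X p) = (τ • χ).weight := by
  have hQ : (pPart p X).map τ.toMonoidHom = pPart p X := by
    ext x
    constructor
    · rintro ⟨y, hy, rfl⟩
      exact IsPElt.map τ.toMonoidHom hy
    · intro hx
      exact ⟨τ.symm x, IsPElt.map τ.symm.toMonoidHom hx, τ.apply_symm_apply x⟩
  refine Weight.ext_map hQ ?_
  refine (IBr.map_map _ _ _).trans ((IBr.map_map _ _ _).trans ?_)
  exact (IBr.map_map τ (pPartEquiv p X) χ).symm

theorem conj_smul_weight (x : X) (χ : IBr F X) :
    MulAut.conj x • (χ.weight : Weight F X p) = χ.weight := by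
  rw [smul_weight, IBr.conj_smul]

theorem weight_injective : Function.Injective (IBr.weight : IBr F X → Weight F X p) := by
  intro χ χ' h
  have h1 := eq_of_heq (Weight.mk.inj h).2
  rw [← IBr.map_symm_map (pPartEquiv p X) χ, h1, IBr.map_symm_map]

/-- In a group of class at most two, the first component of a weight consists of all
`p`-elements. -/
theorem exists_weight_eq (hX : ∀ x y : X, x * y * x⁻¹ * y⁻¹ ∈ Subgroup.center X)
    (a : Weight F X p) : ∃ χ : IBr F X, χ.weight = a := by
  have hQ : a.Q = pPart p X := by
    have hle : a.Q ≤ pPart p X := fun x hx => isPElt_of_isPGroup a.isPGroup hx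
    refine le_antisymm hle fun x hx => ?_
    -- `p`-elements normalize `a.Q`, as their commutators are central `p`-elements
    have h1 : ∀ z ∈ pPart p X, ∀ q ∈ a.Q, z * q * z⁻¹ ∈ a.Q := fun z hz q hq => by
      have h2 : z * q * z⁻¹ * q⁻¹ ∈ a.Q := a.mem_of_mem_center (hX z q)
        ((pPart p X).mul_mem (IsPElt.conj (hle hq) z) ((pPart p X).inv_mem (hle hq)))
      have h3 := a.Q.mul_mem h2 hq
      rwa [inv_mul_cancel_right] at h3
    have hN : pPart p X ≤ Subgroup.normalizer (a.Q : Set X) := fun z hz =>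
      Subgroup.mem_normalizer_iff.mpr fun q => ⟨h1 z hz q, fun h => by
        have := h1 z⁻¹ ((pPart p X).inv_mem hz) _ h
        have e : z⁻¹ * (z * q * z⁻¹) * z⁻¹⁻¹ = q := by group
        rwa [e] at this⟩
    exact a.mem_of_mem_normal (P := (pPart p X).subgroupOf (Subgroup.normalizer (a.Q : Set X)))
      inferInstance ((isPGroup_of_isPElt fun _ h => h : IsPGroup p (pPart p X)).comap_of_injective
        _ (Subgroup.subtype_injective _)) (x := ⟨x, hN hx⟩) hx
  obtain ⟨Q, hQp, ψ, hψ⟩ := a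
  obtain rfl : Q = pPart p X := hQ
  refine ⟨IBr.map (pPartEquiv p X).symm ψ, ?_⟩
  refine Weight.ext_map rfl ?_
  exact (IBr.map_refl _).trans (IBr.map_map_symm _ ψ)

theorem weight_cls_eq_iff {χ : IBr F X} {a : Weight F X p} :
    a.cls = χ.weight.cls ↔ a = χ.weight := by
  refine ⟨fun h => ?_, fun h => h ▸ rfl⟩
  obtain ⟨x, hx⟩ := Quotient.exact h.symm
  rw [← hx, conj_smul_weight]

theorem weight_cls_mem_over_iff {χ : IBr F X} {ν : IBr F (Subgroup.center X)} :
    (χ.weight : Weight F X p).cls ∈ Alp.over ν ↔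
      χ ∈ IBr.over (Subgroup.center X).subtype ν := by
  obtain ⟨ρ, rfl⟩ := IBr.exists_rep χ
  obtain ⟨ν, rfl⟩ := IBr.exists_rep ν
  rw [cls_mem_Alp_over_iff (a := ρ.cls.weight) (ρ := IrrRep.map (pPartEquiv p X) ρ) rfl,
    cls_mem_over_center_iff]
  rfl

end Nilpotent

/-! ### Counting over representations of nilpotent normal subgroups -/

section Abelian

variable {F : Type u} [Field F] [IsAlgClosed F] {p : ℕ} [Fact p.Prime] [CharP F p] {G : Type v}
  [Group G] [Finite G] {X : Subgroup G} [X.Normal] [Group.IsNilpotent X]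

theorem normalizer_map_pPart :
    Subgroup.normalizer (((pPart p X).map X.subtype : Subgroup G) : Set G) = ⊤ := by
  have : ((pPart p X).map X.subtype : Subgroup G).Normal := ⟨fun x hx g => by
    obtain ⟨y, hy, rfl⟩ := hx
    exact ⟨⟨g * y * g⁻¹, ‹X.Normal›.conj_mem _ y.2 g⟩,
      IsPElt.of_map (f := X.subtype) X.subtype_injective
        (IsPElt.conj (IsPElt.map X.subtype hy) g), rfl⟩⟩
  exact Subgroup.normalizer_eq_top _

theorem encard_over_weight (χ : IBr F X) :
    (IBr.over X.subtype χ).encard =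
      (IBr.over (normalizerInclusion X (χ.weight : Weight F X p).Q) χ.weight.ψ).encard :=
  IBr.encard_over_map (e := pPartEquiv p X)
    (e' := Subgroup.topEquiv.symm.trans (MulEquiv.subgroupCongr normalizer_map_pPart.symm))
    (fun _ => rfl) χ

end Abelian

end AWC

theorem mainTheorem2 {F : Type*} [Field F] [IsAlgClosed F] (p : ℕ) [Fact p.Prime] [CharP F p]
    {G : Type*} [Group G] [Finite G] (X : Subgroup G) [X.Normal]
    (hXZ : ∀ (g : G) (z : X), z ∈ Subgroup.center X → g * (z : G) = (z : G) * g)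
    {S : Type*} [Group S] [Finite S] [IsSimpleGroup S] (hS : AWC.SatisfiesIAwHat F p S)
    (n : ℕ) (hn : 1 ≤ n) (hX : Nonempty ((X ⧸ Subgroup.center X) ≃* (Fin n → S))) :
    ∃ Ω : AWC.IBr F X ≃ AWC.Alp F X p,
      (∀ (g : G) (χ : AWC.IBr F X),
        Ω ((MulAut.conjNormal g : MulAut X) • χ) = (MulAut.conjNormal g : MulAut X) • Ω χ) ∧
      (∀ ν : AWC.IBr F (Subgroup.center X),
        Ω '' AWC.IBr.over (Subgroup.center X).subtype ν = AWC.Alp.over ν) ∧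
      ∀ (χ : AWC.IBr F X) (a : AWC.Weight F X p), a.cls = Ω χ →
        (AWC.IBr.over X.subtype χ).encard =
          (AWC.IBr.over (AWC.normalizerInclusion X a.Q) a.ψ).encard := by
  obtain ⟨e⟩ := hX
  let q : X →* (Fin n → S) := e.toMonoidHom.comp (QuotientGroup.mk' (Subgroup.center X))
  have hq : Function.Surjective q := e.surjective.comp (QuotientGroup.mk'_surjective _)
  have hker : q.ker = Subgroup.center X := by
    ext x
    rw [MonoidHom.mem_ker, ← QuotientGroup.eq_one_iff]
    exact e.map_eq_one_iff
  rcases hS with ⟨-, hcomm, -⟩ | ⟨hperf, E, _, _, π, hπ, Ω, hΩ, hΩ', hcc⟩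
  -- `S` is abelian: the weights of `X` are the pairs `(O_p(X), ψ)`.
  · have hqc : ∀ x y, q x * q y = q y * q x := fun x y =>
      funext fun i => hcomm.is_comm.comm (q x i) (q y i)
    have hXc : ∀ x y : X, x * y * x⁻¹ * y⁻¹ ∈ Subgroup.center X := fun x y => by
      rw [← hker, MonoidHom.mem_ker, map_mul, map_mul, map_mul, hqc, map_inv, map_inv,
        mul_inv_cancel_right, mul_inv_cancel]
    have hnil : Group.IsNilpotent X := by
      let _ : CommGroup S := { ‹Group S› with mul_comm := hcomm.is_comm.comm }
      exact Subgroup.isNilpotent_of_ker_le_center q hker.le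
    have hbij : Function.Bijective fun χ : AWC.IBr F X => (χ.weight : AWC.Weight F X p).cls :=
      ⟨fun χ χ' h => AWC.weight_injective (p := p) (AWC.weight_cls_eq_iff.mp h), fun α => by
        obtain ⟨a, rfl⟩ := Quotient.exists_rep α
        obtain ⟨χ, rfl⟩ := AWC.exists_weight_eq hXc a
        exact ⟨χ, rfl⟩⟩
    refine ⟨Equiv.ofBijective _ hbij, fun g χ => ?_, fun ν => ?_, fun χ a h => ?_⟩
    · exact (congrArg AWC.Weight.cls (AWC.smul_weight _ χ)).symm
    · ext α
      obtain ⟨χ, rfl⟩ := hbij.surjective α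
      rw [AWC.weight_cls_mem_over_iff]
      exact ⟨fun ⟨χ', h, h'⟩ => by rwa [← hbij.injective h'], fun h => ⟨χ, h, rfl⟩⟩
    · obtain rfl := AWC.weight_cls_eq_iff.mp h
      exact AWC.encard_over_weight χ
  -- `S` is perfect: the bijection for the universal covering is applied to each factor of `X`.
  · have := hπ.perfect
    have hE : ∃ e : E, e ∉ Subgroup.center E := by
      by_contra! h
      refine AWC.not_forall_commute (S := S) fun s t => ?_
      obtain ⟨x, rfl⟩ := hπ.surjective s
      obtain ⟨y, rfl⟩ := hπ.surjective t
      exact Commute.map (Subgroup.mem_center_iff.mp (h y) x) π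
    obtain ⟨𝒞⟩ := AWC.nonempty_cover hq hker hπ
    obtain ⟨ℳ⟩ := AWC.nonempty_matching hΩ hΩ' hcc
    obtain ⟨Ω', h1, h2, h3⟩ := AWC.exists_equiv_corr 𝒞 hΩ hΩ'
    refine ⟨Ω', fun g χ => h2 _ χ, h3, fun χ a h => ?_⟩
    refine AWC.encard_over_eq hE ℳ hXZ ((h1 χ a).mp h) fun τ hτ => ?_
    have h4 : (τ • a).cls = a.cls := by
      change τ • a.cls = a.cls
      rw [h, ← h2, hτ]
    exact Quotient.exact h4
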